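/- Let $R_0$ be a commutative ring, $V$ a free $R_0$-module with basis $v_1,\dots,v_n$, $E=\Lambda V$ with its increasing filtration $F^pE=E^{\le p}$ and its $\mathbb{Z}/2$-grading, and $R=R_0[[V]]=R_0[[x_1,\dots,x_n]]$ with $x_i$ the coordinates dual to $v_i$. For homogeneous $a_1,a_2,\dots$ put $\maltese_i=|a_1|+\dots+|a_i|-i$. A *superfiltered $A_\infty$-deformation* $\mathcal{A}$ of $E$ consists of $R_0$-multilinear operations $\mu^k(a_k,\dots,a_1)$ on $E$ ($k\ge 2$; $\mu^0=\mu^1=0$) which satisfy the $A_\infty$-equations $\sum(-1)^{\maltese_i}\mu(a_k,\dots,\mu(a_{i+j},\dots,a_{i+1}),a_i,\dots,a_1)=0$, have degree $2-k$ mod $2$, map $F^{p_k}\otimes\dots\otimes F^{p_1}$ into $F^{p_1+\dots+p_k+2-k}$, induce on the associated graded module $\mu^2(a_2,a_1)=(-1)^{|a_1|}a_2\wedge a_1$ and $\mu^k=0$ for $k\ge3$, and are strictly unital with unit $1\in E$ (that is, $\mu^2(a,1)=a=(-1)^{|a|}\mu^2(1,a)$, and $\mu^k$ vanishes for $k\geq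 3$ if some entry is $1$). Let $\mathbf{v}=\sum_i x_iv_i$, extend all operations $R$-multilinearly to $E_R=R\otimes_{R_0}E$, and let $\mathfrak{P}=\sum_{k\ge2}\mu^k(\mathbf{v},\dots,\mathbf{v})\in R$ be the *disc potential* of $\mathcal{A}$. *Hochschild cohomology.* $HH^*(\mathcal{A})$ is the cohomology of the $\mathbb{Z}/2$-graded reduced Hochschild complex: a cochain of degree $t$ is a sequence $\phi=(\phi^k)_{k\ge0}$ of $R_0$-multilinear maps $\phi^k:E^{\otimes k}\to E$ of degree $t-k$ mod $2$ vanishing whenever an entry is a scalar multiple of $1$, with differential $$(d\phi)(a_k,\dots,a_1)=\sum(-1)^{(t-1)\maltese_i}\mu(a_k,\dots,\phi(a_{i+j},\dots,a_{i+1}),a_i,\dots,a_1)-(-1)^{t-1}\sum(-1)^{\maltese_i}\phi(a_k,\dots,\mu(a_{i+j},\dots,a_{i+1}),a_i,\dots,a_1).$$ Its product is induced by the cup product, for $\phi$ of degree $p$ and $\psi$ of degree $q$, $$(\phi\smile\psi)(a_k,\dots,a_1)=(-1)^q\sum(-1)^{(p-1)\maltese_l+(q-1)\maltese_i}\mu(a_k,\dots,\phi(a_{l+m},\dots,a_{l+1}),a_l,\dots,\psi(a_{i+j},\dots,a_{i+1}),a_i,\dots,a_1),$$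 and its unit by the cochain $\phi^0=1$, $\phi^k=0$ for $k>0$. *The algebra $\mathcal{A}_{\mathbf{v}}$.* On $E_R$ let $\mu^1_{\mathbf v}(a)=\sum\mu(\mathbf v,\dots,\mathbf v,a,\mathbf v,\dots,\mathbf v)$ and $\mu^2_{\mathbf v}(a_2,a_1)=\sum\mu(\mathbf v,\dots,\mathbf v,a_2,\mathbf v,\dots,\mathbf v,a_1,\mathbf v,\dots,\mathbf v)$, the sums being over all numbers of inserted $\mathbf v$'s, and put $d_{\mathbf v}a=(-1)^{|a|}\mu^1_{\mathbf v}(a)$ and $a_2\cdot a_1=(-1)^{|a_1|}\mu^2_{\mathbf v}(a_2,a_1)$. $H^*(\mathcal{A}_{\mathbf v})$ is the cohomology of $(E_R,d_{\mathbf v})$ with the product induced by $\cdot$ and unit $1$. *The Clifford dg-algebra.* Let $\tfrac12\mathrm{Hess}(\mathfrak P)$ be the quadratic form $\sum a_iv_i\mapsto\sum_i a_i^2\,\tfrac12\partial_i^2\mathfrak P+\sum_{i<j}a_ia_j\,\partial_i\partial_j\mathfrak P$ on $R\otimes V$, where $\tfrac12\partial_i^2$ multiplies $x_i^{m}$ by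 $\binom m2$ and lowers its exponent by $2$. Let $\mathrm{Cl}(-\tfrac12\mathrm{Hess}(\mathfrak P))$ be the quotient of the tensor algebra of the $R$-module $R\otimes V$ by the relations $u\otimes u=-\tfrac12\mathrm{Hess}(\mathfrak P)(u)$, with differential the contraction $-d\mathfrak P\lrcorner\,\bullet$, i.e. the $R$-linear odd derivation with $v_i\mapsto-\partial_i\mathfrak P$. **Theorem.** $HH^*(\mathcal A)$ and $H^*(\mathcal A_{\mathbf v})$ are well-defined unital associative algebras over $R_0$ and $R$ respectively, and there is an isomorphism of unital $R_0$-algebras $$HH^*(\mathcal A)\;\cong\;H^*\big(\mathrm{Cl}(-\tfrac12\mathrm{Hess}(\mathfrak P)),\,-d\mathfrak P\lrcorner\,\bullet\big),$$ respecting the $\mathbb Z/2$-gradings, which is canonical in that it is the composite $\Psi\circ\Phi$ of 1. the isomorphism of unital $R_0$-algebras $\Phi:HH^*(\mathcal A)\to H^*(\mathcal A_{\mathbf v})$, $[\phi]\mapsto\big[\sum_{k\ge0}\phi^k(\mathbf v,\dots,\mathbf v)\big]$; and 2. the isomorphism of unital $R$-algebras $\Psi:H^*(\mathcal A_{\mathbf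 v})\to H^*\big(\mathrm{Cl}(-\tfrac12\mathrm{Hess}(\mathfrak P)),-d\mathfrak P\lrcorner\,\bullet\big)$ which, for every ordered basis $w_1,\dots,w_n$ of $V$ and all $c_I\in R$, sends the class of a cocycle $\sum_I c_I\,((w_{i_1}\cdot w_{i_2})\cdots)\cdot w_{i_r}$ to the class of $\sum_I c_I\,w_{i_1}\cdots w_{i_r}$ (the sums being over all $I=\{i_1<\dots<i_r\}\subset\{1,\dots,n\}$). -/

import Mathlib

open scoped TensorProduct

noncomputable section

namespace SuperDef

/-! ### Cohomology algebras -/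

section Cohomology

variable {S M : Type*} [CommRing S] [AddCommGroup M] [Module S M]

/-- The cocycles of a differential `d` on the submodule `C` of `M`. -/
def cocycles (C : Submodule S M) (d : M →ₗ[S] M) : Submodule S M := C ⊓ LinearMap.ker d

/-- The coboundaries of a differential `d` on the submodule `C` of `M`. -/
def coboundaries (C : Submodule S M) (d : M →ₗ[S] M) : Submodule S M := C.map d

/-- The cohomology module: cocycles modulo coboundaries. -/
abbrev Cohomology (C : Submodule S M) (d : M →ₗ[S] M) : Type _ :=
  cocycles C d ⧸ (coboundaries C d).comap (cocycles C d).subtype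

/-- `(C, d)` is a complex, and the product `m` and the element `e` of `C` induce on its cohomology
the structure of a unital associative algebra. -/
structure IsCohomologyAlgebra (C : Submodule S M) (d : M →ₗ[S] M) (m : M →ₗ[S] M →ₗ[S] M)
    (e : M) : Prop where
  d_mem : ∀ x ∈ C, d x ∈ C
  d_d : ∀ x ∈ C, d (d x) = 0
  mul_mem : ∀ x ∈ C, ∀ y ∈ C, m x y ∈ C
  one_cocycle : e ∈ cocycles C d
  mul_cocycle : ∀ x ∈ cocycles C d, ∀ y ∈ cocycles C d, m x y ∈ cocycles C d
  coboundary_mul : ∀ x ∈ coboundaries C d, ∀ y ∈ cocycles C d, m x y ∈ coboundaries C d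
  mul_coboundary : ∀ x ∈ cocycles C d, ∀ y ∈ coboundaries C d, m x y ∈ coboundaries C d
  one_mul : ∀ x ∈ cocycles C d, m e x - x ∈ coboundaries C d
  mul_one : ∀ x ∈ cocycles C d, m x e - x ∈ coboundaries C d
  mul_assoc : ∀ x ∈ cocycles C d, ∀ y ∈ cocycles C d, ∀ z ∈ cocycles C d,
    m (m x y) z - m x (m y z) ∈ coboundaries C d

variable {C : Submodule S M} {d : M →ₗ[S] M} {m : M →ₗ[S] M →ₗ[S] M} {e : M}

/-- The cohomology module, regarded as an algebra under the induced product. -/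
def CohomologyAlgebra (_h : IsCohomologyAlgebra C d m e) : Type _ := Cohomology C d

namespace CohomologyAlgebra

variable (h : IsCohomologyAlgebra C d m e)

instance : AddCommGroup (CohomologyAlgebra h) := inferInstanceAs (AddCommGroup (Cohomology C d))

instance : Module S (CohomologyAlgebra h) := inferInstanceAs (Module S (Cohomology C d))

/-- The class of a cocycle. -/
def cls (x : M) (hx : x ∈ cocycles C d) : CohomologyAlgebra h :=
  Submodule.Quotient.mk (p := (coboundaries C d).comap (cocycles C d).subtype) ⟨x, hx⟩

theorem cls_eq {x y : M} (hx : x ∈ cocycles C d) (hy : y ∈ cocycles C d)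
    (hxy : x - y ∈ coboundaries C d) : cls h x hx = cls h y hy :=
  (Submodule.Quotient.eq _).2 hxy

theorem ind {p : CohomologyAlgebra h → Prop} (hp : ∀ x hx, p (cls h x hx)) (a) : p a :=
  Submodule.Quotient.induction_on _ a fun x => hp x.1 x.2

theorem cls_add {x y : M} (hx : x ∈ cocycles C d) (hy : y ∈ cocycles C d) :
    cls h x hx + cls h y hy = cls h (x + y) (add_mem hx hy) := rfl

theorem cls_smul (r : S) {x : M} (hx : x ∈ cocycles C d) :
    r • cls h x hx = cls h (r • x) (Submodule.smul_mem _ r hx) := rfl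

/-- The product on cohomology: the product of the classes of `x` and `y` is the class of
`m x y`. -/
def mul (a b : CohomologyAlgebra h) : CohomologyAlgebra h :=
  Quotient.liftOn₂ a b
    (fun x y => cls h (m x.1 y.1) (h.mul_cocycle _ x.2 _ y.2))
    (fun x y x' y' hx hy => by
      have hx' : x.1 - x'.1 ∈ coboundaries C d := (Submodule.quotientRel_def ((coboundaries C d).comap (cocycles C d).subtype)).1 hx
      have hy' : y.1 - y'.1 ∈ coboundaries C d := (Submodule.quotientRel_def ((coboundaries C d).comap (cocycles C d).subtype)).1 hy
      refine cls_eq h _ _ ?_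
      have := add_mem (h.coboundary_mul _ hx' _ y.2) (h.mul_coboundary _ x'.2 _ hy')
      simpa using this)

instance : Mul (CohomologyAlgebra h) := ⟨mul h⟩

instance : One (CohomologyAlgebra h) := ⟨cls h e h.one_cocycle⟩

theorem cls_mul {x y : M} (hx : x ∈ cocycles C d) (hy : y ∈ cocycles C d) :
    cls h x hx * cls h y hy = cls h (m x y) (h.mul_cocycle _ hx _ hy) := rfl

theorem one_def : (1 : CohomologyAlgebra h) = cls h e h.one_cocycle := rfl

theorem left_distrib' (a b c : CohomologyAlgebra h) : a * (b + c) = a * b + a * c := by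
  induction a using ind with | hp x hx =>
  induction b using ind with | hp y hy =>
  induction c using ind with | hp z hz =>
  simp only [cls_add, cls_mul, map_add]

theorem right_distrib' (a b c : CohomologyAlgebra h) : (a + b) * c = a * c + b * c := by
  induction a using ind with | hp x hx =>
  induction b using ind with | hp y hy =>
  induction c using ind with | hp z hz =>
  simp only [cls_add, cls_mul, map_add, LinearMap.add_apply]

instance : Ring (CohomologyAlgebra h) :=
  { (inferInstance : AddCommGroup (CohomologyAlgebra h)) with
    mul := (· * ·)
    one := 1
    left_distrib := left_distrib' h
    right_distrib := right_distrib' h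
    zero_mul := fun a => by
      have := right_distrib' h 0 0 a
      simpa using this
    mul_zero := fun a => by
      have := left_distrib' h a 0 0
      simpa using this
    mul_assoc := fun a b c => by
      induction a using ind with | hp x hx =>
      induction b using ind with | hp y hy =>
      induction c using ind with | hp z hz =>
      exact cls_eq h _ _ (h.mul_assoc _ hx _ hy _ hz)
    one_mul := fun a => by
      induction a using ind with | hp x hx =>
      exact cls_eq h _ _ (h.one_mul _ hx)
    mul_one := fun a => by
      induction a using ind with | hp x hx =>
      exact cls_eq h _ _ (h.mul_one _ hx) }

instance : Algebra S (CohomologyAlgebra h) :=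
  Algebra.ofModule
    (fun r a b => by
      induction a using ind with | hp x hx =>
      induction b using ind with | hp y hy =>
      simp only [cls_smul, cls_mul, map_smul, LinearMap.smul_apply])
    (fun r a b => by
      induction a using ind with | hp x hx =>
      induction b using ind with | hp y hy =>
      simp only [cls_smul, cls_mul, map_smul])

end CohomologyAlgebra

/-- An algebra over a power series ring is an algebra over the ring of coefficients. -/
instance {σ S₀ M : Type*} [CommRing S₀] [AddCommGroup M] [Module (MvPowerSeries σ S₀) M]
    {C : Submodule (MvPowerSeries σ S₀) M} {d : M →ₗ[MvPowerSeries σ S₀] M}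
    {m : M →ₗ[MvPowerSeries σ S₀] M →ₗ[MvPowerSeries σ S₀] M} {e : M}
    (h : IsCohomologyAlgebra C d m e) : Algebra S₀ (CohomologyAlgebra h) :=
  Algebra.compHom (CohomologyAlgebra h) (algebraMap S₀ (MvPowerSeries σ S₀))

instance {σ S₀ M : Type*} [CommRing S₀] [AddCommGroup M] [Module (MvPowerSeries σ S₀) M]
    {C : Submodule (MvPowerSeries σ S₀) M} {d : M →ₗ[MvPowerSeries σ S₀] M}
    {m : M →ₗ[MvPowerSeries σ S₀] M →ₗ[MvPowerSeries σ S₀] M} {e : M}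
    (h : IsCohomologyAlgebra C d m e) :
    IsScalarTower S₀ (MvPowerSeries σ S₀) (CohomologyAlgebra h) :=
  IsScalarTower.of_algebraMap_eq' rfl

end Cohomology

/-! ### The exterior algebra with its grading, filtration and parity -/

section Exterior

variable (R₀ V : Type*) [CommRing R₀] [AddCommGroup V] [Module R₀ V]

/-- The exterior algebra `E = ΛV` over the ground ring. -/
abbrev ExtAlg : Type _ := ExteriorAlgebra R₀ V

/-- The `ℤ/2`-graded pieces of `E`. -/
abbrev parityPart (t : ZMod 2) : Submodule R₀ (ExtAlg R₀ V) :=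
  CliffordAlgebra.evenOdd (0 : QuadraticForm R₀ V) t

/-- The increasing filtration `F^p E = E^{≤ p}`, for `p ∈ ℤ`. -/
def filt (p : ℤ) : Submodule R₀ (ExtAlg R₀ V) := ⨆ (i : ℕ) (_ : (i : ℤ) ≤ p), ⋀[R₀]^i V

variable {R₀ V}

/-- The linear map `a ↦ (-1)^{|a|} a`. -/
def eps : ExtAlg R₀ V →ₗ[R₀] ExtAlg R₀ V :=
  (CliffordAlgebra.involute (Q := (0 : QuadraticForm R₀ V))).toLinearMap

/-- The linear map `a ↦ (-1)^{(t - 1)(|a| - 1)} a`, for `t ∈ ℤ/2`. -/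
def tw (t : ZMod 2) : ExtAlg R₀ V →ₗ[R₀] ExtAlg R₀ V := if t = 0 then -eps else LinearMap.id

end Exterior

/-! ### Operations with arbitrarily many inputs

A sequence of `R₀`-multilinear operations `φ^k : E^{⊗k} → E`, `k ≥ 0`, is encoded by one function
on lists: `φ [a_k, …, a_1]` is `φ^k(a_k, …, a_1)`. -/

section Ops

variable {R₀ V : Type*} [CommRing R₀] [AddCommGroup V] [Module R₀ V]

/-- `f` is linear in each entry of the list. -/
structure IsMultilinear (f : List (ExtAlg R₀ V) → ExtAlg R₀ V) : Prop where
  map_add : ∀ x z a b, f (x ++ (a + b) :: z) = f (x ++ a :: z) + f (x ++ b :: z)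
  map_smul : ∀ x z (c : R₀) a, f (x ++ (c • a) :: z) = c • f (x ++ a :: z)

/-- The operations `f^k` have degree `t - k` modulo 2, i.e. they have degree `t` as maps
`E[1]^{⊗k} → E`. -/
def HasParity (t : ZMod 2) (f : List (ExtAlg R₀ V) → ExtAlg R₀ V) : Prop :=
  ∀ l : List (ZMod 2 × ExtAlg R₀ V), (∀ a ∈ l, a.2 ∈ parityPart R₀ V a.1) →
    f (l.map Prod.snd) ∈ parityPart R₀ V (t - l.length + (l.map Prod.fst).sum)

/-- The sum of `F x y z` over all ways of writing the list `l` as `x ++ y ++ z`. -/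
def sumSplit {A M : Type*} [AddCommMonoid M] (F : List A → List A → List A → M) (l : List A) : M :=
  ∑ p ∈ Finset.range (l.length + 1), ∑ q ∈ Finset.range (l.length - p + 1),
    F (l.take p) ((l.drop p).take q) (l.drop (p + q))

/-- A superfiltered (strictly unital) `A_∞`-deformation of `E = ΛV`:
operations `μ^k(a_k, …, a_1)`, `k ≥ 0`, with `μ^0 = 0 = μ^1`, satisfying the `A_∞`-equations, which
have degree `1` as maps `E[1]^{⊗k} → E[1]` with respect to both the `ℤ/2`-grading and the
filtration, and which induce on the associated graded module the product
`(a_2, a_1) ↦ (-1)^{|a_1|} a_2 ∧ a_1` and zero higher operations. -/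
structure SuperfilteredDeformation (R₀ V : Type*) [CommRing R₀] [AddCommGroup V]
    [Module R₀ V] where
  /-- the operations -/
  μ : List (ExtAlg R₀ V) → ExtAlg R₀ V
  multilinear : IsMultilinear μ
  zero : μ [] = 0
  one : ∀ a, μ [a] = 0
  parity : HasParity 2 μ
  filtered : ∀ l : List (ℤ × ExtAlg R₀ V), (∀ a ∈ l, a.2 ∈ filt R₀ V a.1) →
    μ (l.map Prod.snd) ∈ filt R₀ V ((l.map Prod.fst).sum + 2 - l.length)
  leading_two : ∀ (p₂ p₁ : ℤ), ∀ a₂ ∈ filt R₀ V p₂, ∀ a₁ ∈ filt R₀ V p₁,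
    μ [a₂, a₁] - a₂ * eps a₁ ∈ filt R₀ V (p₂ + p₁ - 1)
  leading_higher : ∀ l : List (ℤ × ExtAlg R₀ V), 3 ≤ l.length →
    (∀ a ∈ l, a.2 ∈ filt R₀ V a.1) →
    μ (l.map Prod.snd) ∈ filt R₀ V ((l.map Prod.fst).sum + 2 - l.length - 1)
  unit_right : ∀ a, μ [a, 1] = a
  unit_left : ∀ a, μ [1, a] = eps a
  unit_higher : ∀ x z, 2 ≤ x.length + z.length → μ (x ++ 1 :: z) = 0
  /-- The `A_∞`-equations
  `∑ (-1)^{|a_1| + … + |a_i| - i} μ(a_k, …, μ(a_{i+j}, …, a_{i+1}), a_i, …, a_1) = 0`. -/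
  ainfinity : ∀ l, sumSplit (fun x y z => μ (x ++ μ y :: z.map (tw 0))) l = 0

variable (A : SuperfilteredDeformation R₀ V)

/-! ### The reduced Hochschild complex

A Hochschild cochain is a pair `(φ_0, φ_1)` of an even and an odd one, i.e. a function
on `ℤ/2`. -/

variable (R₀ V) in
/-- The direct sum of the even and the odd sequences of operations. -/
abbrev Ops : Type _ := ZMod 2 → List (ExtAlg R₀ V) → ExtAlg R₀ V

variable (R₀ V) in
/-- The reduced Hochschild cochains: in degree `t ∈ ℤ/2`, sequences of multilinear maps
`φ^k : E[1]^{⊗k} → E` of degree `t` that vanish if some entry is a scalar multiple of the unit. -/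
def redCochains : Submodule R₀ (Ops R₀ V) where
  carrier := {φ | ∀ t, IsMultilinear (φ t) ∧ HasParity t (φ t) ∧
    ∀ x (c : R₀) z, φ t (x ++ algebraMap R₀ (ExtAlg R₀ V) c :: z) = 0}
  add_mem' := fun {φ ψ} hφ hψ t => by
    refine ⟨⟨fun x z a b => ?_, fun x z c a => ?_⟩, fun l hl => ?_, fun x c z => ?_⟩
    · simp only [Pi.add_apply, (hφ t).1.map_add, (hψ t).1.map_add]; abel
    · simp only [Pi.add_apply, (hφ t).1.map_smul, (hψ t).1.map_smul, smul_add]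
    · exact add_mem ((hφ t).2.1 l hl) ((hψ t).2.1 l hl)
    · simp only [Pi.add_apply, (hφ t).2.2, (hψ t).2.2, add_zero]
  zero_mem' := fun t => ⟨⟨fun _ _ _ _ => (add_zero 0).symm, fun _ _ _ _ => (smul_zero _).symm⟩,
    fun _ _ => zero_mem _, fun _ _ _ => rfl⟩
  smul_mem' := fun c φ hφ t => by
    refine ⟨⟨fun x z a b => ?_, fun x z c a => ?_⟩, fun l hl => ?_, fun x c z => ?_⟩
    · simp only [Pi.smul_apply, (hφ t).1.map_add, smul_add]
    · simp only [Pi.smul_apply, (hφ t).1.map_smul]; rw [smul_comm]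
    · exact Submodule.smul_mem _ c ((hφ t).2.1 l hl)
    · simp only [Pi.smul_apply, (hφ t).2.2, smul_zero]

/-- The scalar `(-1)^t`. -/
def sgn (R₀ : Type*) [CommRing R₀] (t : ZMod 2) : R₀ := if t = 0 then 1 else -1

/-- The Hochschild differential of a cochain `φ` of degree `t`:
`∑ (-1)^{(t-1)✠_i} μ(a_k, …, φ(a_{i+j}, …, a_{i+1}), a_i, …, a_1)
  - (-1)^{t-1} ∑ (-1)^{✠_i} φ(a_k, …, μ(a_{i+j}, …, a_{i+1}), a_i, …, a_1)`,
where `✠_i = |a_1| + … + |a_i| - i`. -/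
def hochAux (t : ZMod 2) (φ : List (ExtAlg R₀ V) → ExtAlg R₀ V) (l : List (ExtAlg R₀ V)) : ExtAlg R₀ V :=
  sumSplit (fun x y z => A.μ (x ++ φ y :: z.map (tw t))) l
    - sgn R₀ (t - 1) • sumSplit (fun x y z => φ (x ++ A.μ y :: z.map (tw 0))) l

/-- The Hochschild differential, of degree one. -/
def hochD : Ops R₀ V →ₗ[R₀] Ops R₀ V where
  toFun φ t := hochAux A (t - 1) (φ (t - 1))
  map_add' φ ψ := by
    funext t l
    simp only [hochAux, sumSplit, Pi.add_apply, A.multilinear.map_add, Finset.sum_add_distrib,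
      smul_add]
    abel
  map_smul' c φ := by
    funext t l
    simp only [hochAux, sumSplit, Pi.smul_apply, A.multilinear.map_smul, ← Finset.smul_sum,
      smul_sub, RingHom.id_apply]
    rw [smul_comm]

/-- The cup product of cochains `φ`, `ψ` of degrees `p`, `q`:
`(-1)^q ∑ ± μ(a_k, …, φ(…), a_l, …, a_{i+j+1}, ψ(a_{i+j}, …, a_{i+1}), a_i, …, a_1)`
with the sign `(-1)^{(p-1)✠_l + (q-1)✠_i}`. -/
def cupAux (p q : ZMod 2) (φ ψ : List (ExtAlg R₀ V) → ExtAlg R₀ V) (l : List (ExtAlg R₀ V)) : ExtAlg R₀ V :=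
  sgn R₀ q • sumSplit (fun x y r => sumSplit (fun z w u =>
    A.μ (x ++ φ y :: (z.map (tw p) ++ ψ (w.map (tw p)) :: (u.map (tw p)).map (tw q)))) r) l

/-- The cup product of Hochschild cochains. -/
def cup : Ops R₀ V →ₗ[R₀] Ops R₀ V →ₗ[R₀] Ops R₀ V :=
  have key : ∀ (x y w : List (ExtAlg R₀ V)) (a : ExtAlg R₀ V), x ++ a :: (y ++ w) = (x ++ a :: y) ++ w :=
    fun x y w a => by simp
  LinearMap.mk₂ R₀ (fun φ ψ t => ∑ p, cupAux A p (t - p) (φ p) (ψ (t - p)))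
    (fun φ φ' ψ => by
      funext t l
      simp only [cupAux, sumSplit, Pi.add_apply, Finset.sum_apply, A.multilinear.map_add,
        Finset.sum_add_distrib, smul_add])
    (fun c φ ψ => by
      funext t l
      simp only [cupAux, sumSplit, Pi.smul_apply, Finset.sum_apply, A.multilinear.map_smul,
        ← Finset.smul_sum]
      rw [Finset.smul_sum]
      exact Finset.sum_congr rfl fun p _ => smul_comm _ _ _)
    (fun φ ψ ψ' => by
      funext t l
      simp only [cupAux, sumSplit, Pi.add_apply, Finset.sum_apply, key, A.multilinear.map_add,
        Finset.sum_add_distrib, smul_add])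
    (fun c φ ψ => by
      funext t l
      simp only [cupAux, sumSplit, Pi.smul_apply, Finset.sum_apply, key, A.multilinear.map_smul,
        ← Finset.smul_sum]
      rw [Finset.smul_sum]
      exact Finset.sum_congr rfl fun p _ => smul_comm _ _ _)

variable (R₀ V) in
/-- The unit of the Hochschild cochains: the even cochain `φ` with `φ^0 = 1` and `φ^k = 0` for
`k > 0`. -/
def hochOne : Ops R₀ V := fun t l => if t = 0 ∧ l = [] then 1 else 0

/-! ### Inserting the tautological element -/

variable (R₀ V) in
/-- `E_R = R ⊗ E` for `R = R₀⟦x_1, …, x_n⟧`: power series with coefficients in `E`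
(here `V`, and hence `E`, is free of finite rank). -/
def ExtSeries (n : ℕ) : Type _ := MvPowerSeries (Fin n) (ExtAlg R₀ V)

variable {n : ℕ}

instance : AddCommGroup (ExtSeries R₀ V n) :=
  inferInstanceAs (AddCommGroup (MvPowerSeries (Fin n) (ExtAlg R₀ V)))

/-- `E_R` is a module over `R`: multiplication of power series. -/
instance : Module (MvPowerSeries (Fin n) R₀) (ExtSeries R₀ V n) :=
  Module.compHom (MvPowerSeries (Fin n) (ExtAlg R₀ V))
    (MvPowerSeries.map (σ := Fin n) (algebraMap R₀ (ExtAlg R₀ V)))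

/-- The inclusion of `E` in `E_R` as the constant power series. -/
def const (n : ℕ) (a : ExtAlg R₀ V) : ExtSeries R₀ V n := MvPowerSeries.C (σ := Fin n) a

/-- The coefficient of a monomial. -/
def coeffE (m : Fin n →₀ ℕ) (a : ExtSeries R₀ V n) : ExtAlg R₀ V := MvPowerSeries.coeff m a

/-- The power series with given coefficients. -/
def series (f : (Fin n →₀ ℕ) → ExtAlg R₀ V) : ExtSeries R₀ V n := f

/-- The tautological element `v = ∑ x_i v_i` of `R ⊗ V`, where the `v_i` form a basis of `V` and
the `x_i` are the dual coordinates. -/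
def tautological (b : Module.Basis (Fin n) R₀ V) : ExtSeries R₀ V n :=
  (∑ i, MvPowerSeries.X i * MvPowerSeries.C (ExteriorAlgebra.ι R₀ (b i)) :
    MvPowerSeries (Fin n) (ExtAlg R₀ V))

/-- The coefficients of the `R`-multilinear extension of the operations `f` to `E_R`:
the coefficient of `x^m` in `f(a_k, …, a_1)` is the sum of
`f(coeff_{m_k} a_k, …, coeff_{m_1} a_1)` over all `m_k + … + m_1 = m`. -/
def extend : (List (ExtAlg R₀ V) → ExtAlg R₀ V) → List (ExtSeries R₀ V n) → (Fin n →₀ ℕ) → ExtAlg R₀ V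
  | f, [], m => if m = 0 then f [] else 0
  | f, a :: L, m => ∑ p ∈ Finset.HasAntidiagonal.antidiagonal m, extend (fun l => f (coeffE p.1 a :: l)) L p.2

/-- The sum `∑_k φ^k(v, …, v)` in `E_R`. Since `φ^k(v, …, v)` is homogeneous of degree `k` in the
variables, only finitely many terms contribute to each coefficient. -/
def evalTaut (b : Module.Basis (Fin n) R₀ V) (φ : List (ExtAlg R₀ V) → ExtAlg R₀ V) :
    ExtSeries R₀ V n :=
  series fun m => ∑ k ∈ Finset.range (m.degree + 1), extend φ (List.replicate k (tautological b)) m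

/-- The coefficients of
`∑_{i_0, i_1} f(v, …, v, a, v, …, v)`, with `i_1` copies of `v` before `a` and `i_0` after it.
Terms with `i_0 + i_1 > |m|` do not contribute to the coefficient of `x^m`. -/
def insert₁ (b : Module.Basis (Fin n) R₀ V) (f : List (ExtAlg R₀ V) → ExtAlg R₀ V)
    (a : ExtSeries R₀ V n) : ExtSeries R₀ V n :=
  series fun m => ∑ i₁ ∈ Finset.range (m.degree + 1), ∑ i₀ ∈ Finset.range (m.degree + 1),
    extend f (List.replicate i₁ (tautological b) ++ a :: List.replicate i₀ (tautological b)) m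

/-- The coefficients of
`∑_{i_0, i_1, i_2} f(v, …, v, a_2, v, …, v, a_1, v, …, v)`, with `i_2`, `i_1`, `i_0` copies
of `v`. -/
def insert₂ (b : Module.Basis (Fin n) R₀ V) (f : List (ExtAlg R₀ V) → ExtAlg R₀ V)
    (a₂ a₁ : ExtSeries R₀ V n) : ExtSeries R₀ V n :=
  series fun m => ∑ i₂ ∈ Finset.range (m.degree + 1), ∑ i₁ ∈ Finset.range (m.degree + 1),
    ∑ i₀ ∈ Finset.range (m.degree + 1),
    extend f (List.replicate i₂ (tautological b) ++ a₂ :: (List.replicate i₁ (tautological b) ++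
      a₁ :: List.replicate i₀ (tautological b))) m

/-- The disc potential `𝔓 = ∑_k μ^k(v, …, v)`, an element of `R` (the components of this sum in
positive exterior degree vanish). -/
def discPotential (b : Module.Basis (Fin n) R₀ V) : MvPowerSeries (Fin n) R₀ :=
  fun m => ExteriorAlgebra.algebraMapInv (coeffE m (evalTaut b A.μ))

/-! The next lemmas show that inserting `v` is linear over `R`. -/

theorem coeffE_add (m : Fin n →₀ ℕ) (a a' : ExtSeries R₀ V n) :
    coeffE m (a + a') = coeffE m a + coeffE m a' := rfl

theorem coeffE_smul (m : Fin n →₀ ℕ) (r : MvPowerSeries (Fin n) R₀) (a : ExtSeries R₀ V n) :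
    coeffE m (r • a) =
      ∑ p ∈ Finset.HasAntidiagonal.antidiagonal m, MvPowerSeries.coeff p.1 r • coeffE p.2 a := by
  refine (MvPowerSeries.coeff_mul m
    (MvPowerSeries.map (σ := Fin n) (algebraMap R₀ (ExtAlg R₀ V)) r) a).trans ?_
  refine Finset.sum_congr rfl fun p _ => ?_
  rw [MvPowerSeries.coeff_map, ← Algebra.smul_def]
  rfl

theorem IsMultilinear.cons {f : List (ExtAlg R₀ V) → ExtAlg R₀ V} (hf : IsMultilinear f)
    (a : ExtAlg R₀ V) : IsMultilinear fun l => f (a :: l) :=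
  ⟨fun x z => hf.map_add (a :: x) z, fun x z => hf.map_smul (a :: x) z⟩

theorem IsMultilinear.zero {f : List (ExtAlg R₀ V) → ExtAlg R₀ V} (hf : IsMultilinear f)
    (z : List (ExtAlg R₀ V)) : f (0 :: z) = 0 := by
  simpa using hf.map_smul [] z 0 0

theorem extend_zero (L : List (ExtSeries R₀ V n)) (m : Fin n →₀ ℕ) :
    extend (fun _ => (0 : ExtAlg R₀ V)) L m = 0 := by
  induction L generalizing m with
  | nil => simp [extend]
  | cons a L ih => simp [extend, ih]

theorem extend_add (f g : List (ExtAlg R₀ V) → ExtAlg R₀ V) (L : List (ExtSeries R₀ V n))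
    (m : Fin n →₀ ℕ) : extend (fun l => f l + g l) L m = extend f L m + extend g L m := by
  induction L generalizing m f g with
  | nil => simp only [extend]; split_ifs <;> simp
  | cons a L ih => simp only [extend, ih, Finset.sum_add_distrib]

theorem extend_smul (c : R₀) (f : List (ExtAlg R₀ V) → ExtAlg R₀ V) (L : List (ExtSeries R₀ V n))
    (m : Fin n →₀ ℕ) : extend (fun l => c • f l) L m = c • extend f L m := by
  induction L generalizing m f with
  | nil => simp only [extend]; split_ifs <;> simp
  | cons a L ih => simp only [extend, ih, Finset.smul_sum]

theorem extend_sum {f : List (ExtAlg R₀ V) → ExtAlg R₀ V} (hf : IsMultilinear f) {ι : Type*}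
    (s : Finset ι) (c : ι → R₀) (a : ι → ExtAlg R₀ V) (L : List (ExtSeries R₀ V n))
    (m : Fin n →₀ ℕ) : extend (fun l => f ((∑ i ∈ s, c i • a i) :: l)) L m =
      ∑ i ∈ s, c i • extend (fun l => f (a i :: l)) L m := by
  classical
  induction s using Finset.induction_on with
  | empty => simp only [Finset.sum_empty, hf.zero, extend_zero]
  | insert i s hi ih =>
    simp only [Finset.sum_insert hi]
    rw [← ih, ← extend_smul, ← extend_add]
    congr 1
    funext l
    have h1 := hf.map_add [] l (c i • a i) (∑ i ∈ s, c i • a i)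
    have h2 := hf.map_smul [] l (c i) (a i)
    simp only [List.nil_append] at h1 h2
    rw [h1, h2]

theorem extend_add_slot {f : List (ExtAlg R₀ V) → ExtAlg R₀ V} (hf : IsMultilinear f)
    (x z : List (ExtSeries R₀ V n)) (a a' : ExtSeries R₀ V n) (m : Fin n →₀ ℕ) :
    extend f (x ++ (a + a') :: z) m = extend f (x ++ a :: z) m + extend f (x ++ a' :: z) m := by
  induction x generalizing f m with
  | nil =>
    simp only [List.nil_append, extend, coeffE_add, ← Finset.sum_add_distrib, ← extend_add]
    refine Finset.sum_congr rfl fun p _ => ?_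
    congr 1
    funext l
    exact hf.map_add [] l _ _
  | cons u x ih =>
    simp only [List.cons_append, extend, ih (hf.cons _), Finset.sum_add_distrib]

theorem sum_assoc {N : Type*} [AddCommMonoid N] (m : Fin n →₀ ℕ)
    (F : (Fin n →₀ ℕ) → (Fin n →₀ ℕ) → (Fin n →₀ ℕ) → N) :
    ∑ p ∈ Finset.HasAntidiagonal.antidiagonal m, ∑ q ∈ Finset.HasAntidiagonal.antidiagonal p.1, F q.1 q.2 p.2 =
      ∑ p ∈ Finset.HasAntidiagonal.antidiagonal m, ∑ q ∈ Finset.HasAntidiagonal.antidiagonal p.2, F p.1 q.1 q.2 := by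
  simp only [Finset.sum_sigma']
  apply Finset.sum_nbij' (fun ⟨⟨_i, j⟩, ⟨k, l⟩⟩ ↦ ⟨(k, l + j), (l, j)⟩)
    (fun ⟨⟨i, _j⟩, ⟨k, l⟩⟩ ↦ ⟨(i + k, l), (i, k)⟩)
  · rintro ⟨⟨i, j⟩, ⟨k, l⟩⟩ h
    simp only [Finset.mem_sigma, Finset.HasAntidiagonal.mem_antidiagonal] at h ⊢
    exact ⟨by rw [← add_assoc, h.2, h.1], trivial⟩
  · rintro ⟨⟨i, j⟩, ⟨k, l⟩⟩ h
    simp only [Finset.mem_sigma, Finset.HasAntidiagonal.mem_antidiagonal] at h ⊢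
    exact ⟨by rw [add_assoc, h.2, h.1], trivial⟩
  · rintro ⟨⟨i, j⟩, ⟨k, l⟩⟩ h
    simp only [Finset.mem_sigma, Finset.HasAntidiagonal.mem_antidiagonal] at h
    obtain ⟨-, rfl⟩ := h
    rfl
  · rintro ⟨⟨i, j⟩, ⟨k, l⟩⟩ h
    simp only [Finset.mem_sigma, Finset.HasAntidiagonal.mem_antidiagonal] at h
    obtain ⟨-, rfl⟩ := h
    rfl
  · rintro ⟨⟨i, j⟩, ⟨k, l⟩⟩ h
    rfl

theorem sum_swap {N : Type*} [AddCommMonoid N] (m : Fin n →₀ ℕ)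
    (F : (Fin n →₀ ℕ) → (Fin n →₀ ℕ) → (Fin n →₀ ℕ) → N) :
    ∑ p ∈ Finset.HasAntidiagonal.antidiagonal m, ∑ q ∈ Finset.HasAntidiagonal.antidiagonal p.2, F p.1 q.1 q.2 =
      ∑ p ∈ Finset.HasAntidiagonal.antidiagonal m, ∑ q ∈ Finset.HasAntidiagonal.antidiagonal p.2, F q.1 p.1 q.2 := by
  rw [← sum_assoc, ← sum_assoc m fun u v w => F v u w]
  refine Finset.sum_congr rfl fun p _ => ?_
  refine Finset.sum_nbij' Prod.swap Prod.swap ?_ ?_ (fun _ _ => rfl) (fun _ _ => rfl)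
    (fun _ _ => rfl) <;>
  · intro q hq
    rw [Finset.HasAntidiagonal.mem_antidiagonal] at hq ⊢
    rw [← hq, add_comm]
    rfl

theorem extend_smul_slot {f : List (ExtAlg R₀ V) → ExtAlg R₀ V} (hf : IsMultilinear f)
    (x z : List (ExtSeries R₀ V n)) (r : MvPowerSeries (Fin n) R₀) (a : ExtSeries R₀ V n)
    (m : Fin n →₀ ℕ) :
    extend f (x ++ (r • a) :: z) m =
      ∑ p ∈ Finset.HasAntidiagonal.antidiagonal m, MvPowerSeries.coeff p.1 r • extend f (x ++ a :: z) p.2 := by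
  induction x generalizing f m with
  | nil =>
    simp only [List.nil_append, extend, coeffE_smul, extend_sum hf, Finset.smul_sum]
    exact sum_assoc m fun u v w =>
      MvPowerSeries.coeff u r • extend (fun l => f (coeffE v a :: l)) z w
  | cons y x ih =>
    simp only [List.cons_append, extend, ih (hf.cons _), Finset.smul_sum]
    exact sum_swap m fun u v w => MvPowerSeries.coeff v r •
      extend (fun l => f (coeffE u y :: l)) (x ++ a :: z) w

/-- The extension of multilinear operations to the entries `L` vanishes to order `N`. -/
def VanishesBelow (N : ℕ) (L : List (ExtSeries R₀ V n)) : Prop :=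
  ∀ f : List (ExtAlg R₀ V) → ExtAlg R₀ V, IsMultilinear f → ∀ m : Fin n →₀ ℕ, m.degree < N →
    extend f L m = 0

theorem vanishesBelow_zero (L : List (ExtSeries R₀ V n)) : VanishesBelow 0 L :=
  fun _ _ _ h => absurd h (Nat.not_lt_zero _)

theorem degree_snd_le {m : Fin n →₀ ℕ} {p : (Fin n →₀ ℕ) × (Fin n →₀ ℕ)}
    (hp : p ∈ Finset.HasAntidiagonal.antidiagonal m) : p.2.degree ≤ m.degree := by
  rw [← Finset.HasAntidiagonal.mem_antidiagonal.1 hp, map_add]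
  exact Nat.le_add_left _ _

theorem VanishesBelow.cons {N : ℕ} {L : List (ExtSeries R₀ V n)} (h : VanishesBelow N L)
    (a : ExtSeries R₀ V n) : VanishesBelow N (a :: L) := fun _ hf _ hm =>
  Finset.sum_eq_zero fun _ hp => h _ (hf.cons _) _ ((degree_snd_le hp).trans_lt hm)

theorem coeffE_zero_tautological (b : Module.Basis (Fin n) R₀ V) :
    coeffE 0 (tautological b) = 0 := by
  change MvPowerSeries.coeff 0 (∑ i, MvPowerSeries.X i *
    MvPowerSeries.C (ExteriorAlgebra.ι R₀ (b i)) : MvPowerSeries (Fin n) (ExtAlg R₀ V)) = 0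
  rw [map_sum]
  refine Finset.sum_eq_zero fun i _ => ?_
  simp

theorem VanishesBelow.tautological {N : ℕ} {L : List (ExtSeries R₀ V n)} (h : VanishesBelow N L)
    (b : Module.Basis (Fin n) R₀ V) : VanishesBelow (N + 1) (tautological b :: L) :=
  fun f hf m hm => Finset.sum_eq_zero fun p hp => by
    by_cases h0 : p.1 = 0
    · simp only [h0, coeffE_zero_tautological, hf.zero, extend_zero]
    · refine h _ (hf.cons _) _ ?_
      have h1 : p.1.degree ≠ 0 := fun h => h0 ((Finsupp.degree_eq_zero_iff _).1 h)
      have h2 : p.1.degree + p.2.degree = m.degree := by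
        rw [← Finset.HasAntidiagonal.mem_antidiagonal.1 hp, map_add]
      omega

theorem VanishesBelow.replicate {N : ℕ} {L : List (ExtSeries R₀ V n)} (h : VanishesBelow N L)
    (b : Module.Basis (Fin n) R₀ V) (i : ℕ) :
    VanishesBelow (N + i) (List.replicate i (SuperDef.tautological b) ++ L) := by
  induction i with
  | zero => exact h
  | succ i ih => exact ih.tautological b

theorem vanishesBelow_replicate (b : Module.Basis (Fin n) R₀ V) (i : ℕ) :
    VanishesBelow i (List.replicate i (tautological b)) := by
  have := (vanishesBelow_zero ([] : List (ExtSeries R₀ V n))).replicate b i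
  simpa using this

theorem sum_range_eq {N : Type*} [AddCommMonoid N] {k K : ℕ} (hk : k ≤ K) {F : ℕ → N}
    (hF : ∀ i, k < i → F i = 0) :
    ∑ i ∈ Finset.range (K + 1), F i = ∑ i ∈ Finset.range (k + 1), F i := by
  symm
  refine Finset.sum_subset (Finset.range_subset_range.2 (by omega)) fun i _ hi => hF i ?_
  simpa using hi

theorem insert₁_add (b : Module.Basis (Fin n) R₀ V) {f : List (ExtAlg R₀ V) → ExtAlg R₀ V}
    (hf : IsMultilinear f) (a a' : ExtSeries R₀ V n) :
    insert₁ b f (a + a') = insert₁ b f a + insert₁ b f a' := by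
  funext m
  refine Eq.trans ?_ (coeffE_add m _ _).symm
  simp only [insert₁, series, coeffE, extend_add_slot hf, Finset.sum_add_distrib]
  rfl

theorem insert₁_coeff (b : Module.Basis (Fin n) R₀ V) {f : List (ExtAlg R₀ V) → ExtAlg R₀ V}
    (hf : IsMultilinear f) (a : ExtSeries R₀ V n) (m : Fin n →₀ ℕ) (K : ℕ) (hK : m.degree ≤ K) :
    coeffE m (insert₁ b f a) =
      ∑ i₁ ∈ Finset.range (K + 1), ∑ i₀ ∈ Finset.range (K + 1),
        extend f (List.replicate i₁ (tautological b) ++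
          a :: List.replicate i₀ (tautological b)) m := by
  have hv : ∀ i₁ i₀, m.degree < i₁ + i₀ → extend f (List.replicate i₁ (tautological b) ++
      a :: List.replicate i₀ (tautological b)) m = 0 := fun i₁ i₀ h =>
    (((vanishesBelow_replicate b i₀).cons a).replicate b i₁) f hf m (by omega)
  rw [sum_range_eq hK fun i h => Finset.sum_eq_zero fun j _ => hv i j (by omega)]
  refine Eq.symm (Finset.sum_congr rfl fun i _ => ?_)
  exact sum_range_eq hK fun j h => hv i j (by omega)

theorem insert₁_smul (b : Module.Basis (Fin n) R₀ V) {f : List (ExtAlg R₀ V) → ExtAlg R₀ V}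
    (hf : IsMultilinear f) (r : MvPowerSeries (Fin n) R₀) (a : ExtSeries R₀ V n) :
    insert₁ b f (r • a) = r • insert₁ b f a := by
  funext m
  refine Eq.trans ?_ (coeffE_smul m r _).symm
  rw [Finset.sum_congr rfl fun p hp => by
    rw [insert₁_coeff b hf a p.2 m.degree (degree_snd_le hp)]]
  simp only [insert₁, series, extend_smul_slot hf, Finset.smul_sum]
  rw [Finset.sum_comm (s := Finset.HasAntidiagonal.antidiagonal m)]
  refine Finset.sum_congr rfl fun i _ => ?_
  exact Finset.sum_comm

theorem insert₂_coeff (b : Module.Basis (Fin n) R₀ V) {f : List (ExtAlg R₀ V) → ExtAlg R₀ V}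
    (hf : IsMultilinear f) (a₂ a₁ : ExtSeries R₀ V n) (m : Fin n →₀ ℕ) (K : ℕ)
    (hK : m.degree ≤ K) :
    coeffE m (insert₂ b f a₂ a₁) =
      ∑ i₂ ∈ Finset.range (K + 1), ∑ i₁ ∈ Finset.range (K + 1), ∑ i₀ ∈ Finset.range (K + 1),
        extend f (List.replicate i₂ (tautological b) ++ a₂ ::
          (List.replicate i₁ (tautological b) ++ a₁ :: List.replicate i₀ (tautological b))) m := by
  have hv : ∀ i₂ i₁ i₀, m.degree < i₂ + i₁ + i₀ →
      extend f (List.replicate i₂ (tautological b) ++ a₂ ::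
        (List.replicate i₁ (tautological b) ++ a₁ :: List.replicate i₀ (tautological b))) m = 0 :=
    fun i₂ i₁ i₀ h => (((((vanishesBelow_replicate b i₀).cons a₁).replicate b i₁).cons
      a₂).replicate b i₂) f hf m (by omega)
  rw [sum_range_eq hK fun i h => Finset.sum_eq_zero fun j _ =>
    Finset.sum_eq_zero fun k _ => hv i j k (by omega)]
  refine Eq.symm (Finset.sum_congr rfl fun i _ => ?_)
  rw [sum_range_eq hK fun j h => Finset.sum_eq_zero fun k _ => hv i j k (by omega)]
  exact Finset.sum_congr rfl fun j _ => sum_range_eq hK fun k h => hv i j k (by omega)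

theorem insert₂_add_left (b : Module.Basis (Fin n) R₀ V)
    {f : List (ExtAlg R₀ V) → ExtAlg R₀ V} (hf : IsMultilinear f) (a a' c : ExtSeries R₀ V n) :
    insert₂ b f (a + a') c = insert₂ b f a c + insert₂ b f a' c := by
  funext m
  refine Eq.trans ?_ (coeffE_add m _ _).symm
  simp only [insert₂, series, coeffE, extend_add_slot hf, Finset.sum_add_distrib]
  rfl

theorem insert₂_add_right (b : Module.Basis (Fin n) R₀ V)
    {f : List (ExtAlg R₀ V) → ExtAlg R₀ V} (hf : IsMultilinear f) (c a a' : ExtSeries R₀ V n) :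
    insert₂ b f c (a + a') = insert₂ b f c a + insert₂ b f c a' := by
  have key : ∀ (x y w : List (ExtSeries R₀ V n)) (a : ExtSeries R₀ V n),
    x ++ a :: (y ++ w) = (x ++ a :: y) ++ w := fun x y w a => by simp
  funext m
  refine Eq.trans ?_ (coeffE_add m _ _).symm
  simp only [insert₂, series, coeffE, key, extend_add_slot hf, Finset.sum_add_distrib]
  rfl

theorem insert₂_smul_left (b : Module.Basis (Fin n) R₀ V)
    {f : List (ExtAlg R₀ V) → ExtAlg R₀ V} (hf : IsMultilinear f)
    (r : MvPowerSeries (Fin n) R₀) (a c : ExtSeries R₀ V n) :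
    insert₂ b f (r • a) c = r • insert₂ b f a c := by
  funext m
  refine Eq.trans ?_ (coeffE_smul m r _).symm
  rw [Finset.sum_congr rfl fun p hp => by
    rw [insert₂_coeff b hf a c p.2 m.degree (degree_snd_le hp)]]
  simp only [insert₂, series, extend_smul_slot hf, Finset.smul_sum]
  rw [Finset.sum_comm (s := Finset.HasAntidiagonal.antidiagonal m)]
  refine Finset.sum_congr rfl fun i _ => ?_
  rw [Finset.sum_comm (s := Finset.HasAntidiagonal.antidiagonal m)]
  refine Finset.sum_congr rfl fun j _ => ?_
  exact Finset.sum_comm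

theorem insert₂_smul_right (b : Module.Basis (Fin n) R₀ V)
    {f : List (ExtAlg R₀ V) → ExtAlg R₀ V} (hf : IsMultilinear f)
    (r : MvPowerSeries (Fin n) R₀) (c a : ExtSeries R₀ V n) :
    insert₂ b f c (r • a) = r • insert₂ b f c a := by
  have key : ∀ (x y w : List (ExtSeries R₀ V n)) (a : ExtSeries R₀ V n),
    x ++ a :: (y ++ w) = (x ++ a :: y) ++ w := fun x y w a => by simp
  funext m
  refine Eq.trans ?_ (coeffE_smul m r _).symm
  rw [Finset.sum_congr rfl fun p hp => by
    rw [insert₂_coeff b hf c a p.2 m.degree (degree_snd_le hp)]]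
  simp only [insert₂, series, key, extend_smul_slot hf, Finset.smul_sum]
  rw [Finset.sum_comm (s := Finset.HasAntidiagonal.antidiagonal m)]
  refine Finset.sum_congr rfl fun i _ => ?_
  rw [Finset.sum_comm (s := Finset.HasAntidiagonal.antidiagonal m)]
  refine Finset.sum_congr rfl fun j _ => ?_
  exact Finset.sum_comm

/-! ### The algebra `A_v` -/

theorem series_eps_add (a a' : ExtSeries R₀ V n) (m : Fin n →₀ ℕ) :
    eps (coeffE m (a + a')) = eps (coeffE m a) + eps (coeffE m a') :=
  LinearMap.map_add eps _ _

theorem series_eps_smul (r : MvPowerSeries (Fin n) R₀) (a : ExtSeries R₀ V n) (m : Fin n →₀ ℕ) :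
    eps (coeffE m (r • a)) = ∑ p ∈ Finset.HasAntidiagonal.antidiagonal m,
      MvPowerSeries.coeff p.1 r • eps (coeffE p.2 a) := by
  rw [coeffE_smul, map_sum]
  exact Finset.sum_congr rfl fun p _ => LinearMap.map_smul eps _ _

/-- The `R`-linear extension of `a ↦ (-1)^{|a|} a` to `E_R`. -/
def epsR : ExtSeries R₀ V n →ₗ[MvPowerSeries (Fin n) R₀] ExtSeries R₀ V n where
  toFun a := series fun m => eps (coeffE m a)
  map_add' a a' := funext fun m => series_eps_add a a' m
  map_smul' r a := funext fun m => (series_eps_smul r a m).trans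
    (coeffE_smul m r (series fun m => eps (coeffE m a))).symm

/-- `insert₁` as an `R`-linear map. -/
def insert₁Lin (b : Module.Basis (Fin n) R₀ V) {f : List (ExtAlg R₀ V) → ExtAlg R₀ V}
    (hf : IsMultilinear f) :
    ExtSeries R₀ V n →ₗ[MvPowerSeries (Fin n) R₀] ExtSeries R₀ V n where
  toFun := insert₁ b f
  map_add' := insert₁_add b hf
  map_smul' := fun r a => insert₁_smul b hf r a

/-- `insert₂` as an `R`-bilinear map. -/
def insert₂Lin (b : Module.Basis (Fin n) R₀ V) {f : List (ExtAlg R₀ V) → ExtAlg R₀ V}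
    (hf : IsMultilinear f) :
    ExtSeries R₀ V n →ₗ[MvPowerSeries (Fin n) R₀] ExtSeries R₀ V n
      →ₗ[MvPowerSeries (Fin n) R₀] ExtSeries R₀ V n :=
  LinearMap.mk₂ (MvPowerSeries (Fin n) R₀) (insert₂ b f)
    (insert₂_add_left b hf) (insert₂_smul_left b hf)
    (insert₂_add_right b hf) (insert₂_smul_right b hf)

/-- The differential `d_v a = (-1)^{|a|} μ_v^1(a)` of `A_v`, where
`μ_v^1(a) = ∑ μ(v, …, v, a, v, …, v)`. -/
def dTaut (b : Module.Basis (Fin n) R₀ V) :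
    ExtSeries R₀ V n →ₗ[MvPowerSeries (Fin n) R₀] ExtSeries R₀ V n :=
  (insert₁Lin b A.multilinear).comp epsR

/-- The product `a_2 · a_1 = (-1)^{|a_1|} μ_v^2(a_2, a_1)` of `A_v`, where
`μ_v^2(a_2, a_1) = ∑ μ(v, …, v, a_2, v, …, v, a_1, v, …, v)`. -/
def mulTaut (b : Module.Basis (Fin n) R₀ V) :
    ExtSeries R₀ V n →ₗ[MvPowerSeries (Fin n) R₀] ExtSeries R₀ V n
      →ₗ[MvPowerSeries (Fin n) R₀] ExtSeries R₀ V n :=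
  (insert₂Lin b A.multilinear).compl₂ epsR

/-- The map `P_v : φ ↦ ∑_k φ^k(v, …, v)` from Hochschild cochains to `A_v`. -/
def hochToTaut (b : Module.Basis (Fin n) R₀ V) (φ : Ops R₀ V) : ExtSeries R₀ V n :=
  ∑ t, evalTaut b (φ t)

/-- The left-bracketed product `((v_{i_1} · v_{i_2}) ⋯ ) · v_{i_r}` in `A_v`, for a family `v_i` in
`V` and `I = {i_1 < ⋯ < i_r}`. -/
def tautMonomial (b : Module.Basis (Fin n) R₀ V) (v : Fin n → V) (I : Finset (Fin n)) :
    ExtSeries R₀ V n :=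
  ((I.sort (· ≤ ·)).map fun i => const n (ExteriorAlgebra.ι R₀ (v i))).foldl
    (fun x y => mulTaut A b x y) (const n 1)

end Ops

/-! ### The Clifford algebra of half the Hessian -/

section Clifford

variable {R₀ V : Type*} [CommRing R₀] [AddCommGroup V] [Module R₀ V] {n : ℕ}

/-- The operator `½ ∂_i²` on power series: it sends `x_i^k` to `(k (k - 1) / 2) x_i^{k - 2}`. -/
def halfPderivSq (i : Fin n) (P : MvPowerSeries (Fin n) R₀) : MvPowerSeries (Fin n) R₀ :=
  fun m => ((m i + 2).choose 2 : R₀) * MvPowerSeries.coeff (m + Finsupp.single i 2) P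

/-- The coordinates on `R ⊗ V` dual to a basis of `V`. -/
def coord (b : Module.Basis (Fin n) R₀ V) (i : Fin n) :
    MvPowerSeries (Fin n) R₀ ⊗[R₀] V →ₗ[MvPowerSeries (Fin n) R₀] MvPowerSeries (Fin n) R₀ :=
  (Algebra.TensorProduct.basis (MvPowerSeries (Fin n) R₀) b).coord i

/-- The quadratic form `½ Hess(P)` on `R ⊗ V`:
`∑ a_i v_i ↦ ∑_i a_i² ½∂_i²P + ∑_{i<j} a_i a_j ∂_i∂_jP`. -/
def halfHess (b : Module.Basis (Fin n) R₀ V) (P : MvPowerSeries (Fin n) R₀) :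
    QuadraticForm (MvPowerSeries (Fin n) R₀) (MvPowerSeries (Fin n) R₀ ⊗[R₀] V) :=
  ∑ i, halfPderivSq i P • QuadraticMap.linMulLin (coord b i) (coord b i) +
    ∑ i, ∑ j ∈ Finset.Ioi i,
      MvPowerSeries.pderiv R₀ i (MvPowerSeries.pderiv R₀ j P) •
        QuadraticMap.linMulLin (coord b i) (coord b j)

/-- The `R`-linear form `dP` on `R ⊗ V`, sending `v_i` to `∂_i P`. -/
def dForm (b : Module.Basis (Fin n) R₀ V) (P : MvPowerSeries (Fin n) R₀) :
    Module.Dual (MvPowerSeries (Fin n) R₀) (MvPowerSeries (Fin n) R₀ ⊗[R₀] V) :=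
  ∑ i, MvPowerSeries.pderiv R₀ i P • coord b i

/-- The Clifford algebra `Cl(-½ Hess(P))` over `R`. -/
abbrev Cl (b : Module.Basis (Fin n) R₀ V) (P : MvPowerSeries (Fin n) R₀) : Type _ :=
  CliffordAlgebra (-halfHess b P)

/-- The differential `-dP ⌟ •` on `Cl(-½ Hess(P))`. -/
def dCl (b : Module.Basis (Fin n) R₀ V) (P : MvPowerSeries (Fin n) R₀) :
    Cl b P →ₗ[MvPowerSeries (Fin n) R₀] Cl b P :=
  CliffordAlgebra.contractLeft (-dForm b P)

/-- The product `v_{i_1} ⋯ v_{i_r}` in `Cl(-½ Hess(P))`, for a family `v_i` in `V` and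
`I = {i_1 < ⋯ < i_r}`. -/
def clMonomial (b : Module.Basis (Fin n) R₀ V) (P : MvPowerSeries (Fin n) R₀) (v : Fin n → V)
    (I : Finset (Fin n)) : Cl b P :=
  ((I.sort (· ≤ ·)).map fun i => CliffordAlgebra.ι (-halfHess b P) (1 ⊗ₜ[R₀] v i)).prod

theorem contractLeft_mul {R N : Type*} [CommRing R] [AddCommGroup N] [Module R N]
    {Q : QuadraticForm R N} (f : Module.Dual R N) (x y : CliffordAlgebra Q) :
    CliffordAlgebra.contractLeft f (x * y) =
      CliffordAlgebra.contractLeft f x * y +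
        CliffordAlgebra.involute x * CliffordAlgebra.contractLeft f y := by
  induction x using CliffordAlgebra.left_induction generalizing y with
  | algebraMap r =>
    simp [CliffordAlgebra.contractLeft_algebraMap_mul, CliffordAlgebra.contractLeft_algebraMap]
  | add x x' hx hx' => simp only [add_mul, map_add, hx, hx']; abel
  | ι_mul x v hx =>
    rw [mul_assoc, CliffordAlgebra.contractLeft_ι_mul, hx, CliffordAlgebra.contractLeft_ι_mul,
      map_mul, CliffordAlgebra.involute_ι]
    simp only [sub_mul, mul_add, smul_mul_assoc, neg_mul, mul_assoc]
    abel

theorem contractLeft_involute {R N : Type*} [CommRing R] [AddCommGroup N] [Module R N]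
    {Q : QuadraticForm R N} (f : Module.Dual R N) (x : CliffordAlgebra Q) :
    CliffordAlgebra.contractLeft f (CliffordAlgebra.involute x) =
      -CliffordAlgebra.involute (CliffordAlgebra.contractLeft f x) := by
  induction x using CliffordAlgebra.left_induction with
  | algebraMap r => simp [CliffordAlgebra.contractLeft_algebraMap]
  | add x x' hx hx' => simp only [map_add, hx, hx', neg_add]
  | ι_mul x v hx =>
    simp only [map_mul, CliffordAlgebra.involute_ι, neg_mul, map_neg, map_sub, map_smul,
      CliffordAlgebra.contractLeft_ι_mul, hx]
    simp

/-- The cohomology of `(Cl(-½ Hess(P)), -dP ⌟ •)` is a unital algebra over `R`. -/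
theorem isCohomologyAlgebra_dCl (b : Module.Basis (Fin n) R₀ V) (P : MvPowerSeries (Fin n) R₀) :
    IsCohomologyAlgebra ⊤ (dCl b P) (LinearMap.mul (MvPowerSeries (Fin n) R₀) (Cl b P)) 1 where
  d_mem _ _ := trivial
  d_d x _ := CliffordAlgebra.contractLeft_contractLeft _ x
  mul_mem _ _ _ _ := trivial
  one_cocycle := ⟨trivial, CliffordAlgebra.contractLeft_one (Q := -halfHess b P) (-dForm b P)⟩
  mul_cocycle x hx y hy := by
    have hx' : CliffordAlgebra.contractLeft (-dForm b P) x = 0 := hx.2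
    have hy' : CliffordAlgebra.contractLeft (-dForm b P) y = 0 := hy.2
    refine ⟨trivial, ?_⟩
    change CliffordAlgebra.contractLeft (-dForm b P) (x * y) = 0
    rw [contractLeft_mul, hx', hy', zero_mul, mul_zero, add_zero]
  coboundary_mul := by
    rintro _ ⟨x, -, rfl⟩ y hy
    have hy' : CliffordAlgebra.contractLeft (-dForm b P) y = 0 := hy.2
    refine ⟨x * y, trivial, ?_⟩
    change CliffordAlgebra.contractLeft (-dForm b P) (x * y) =
      CliffordAlgebra.contractLeft (-dForm b P) x * y
    rw [contractLeft_mul, hy', mul_zero, add_zero]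
  mul_coboundary := by
    rintro x hx _ ⟨y, -, rfl⟩
    have hx' : CliffordAlgebra.contractLeft (-dForm b P) x = 0 := hx.2
    refine ⟨CliffordAlgebra.involute x * y, trivial, ?_⟩
    change CliffordAlgebra.contractLeft (-dForm b P) (CliffordAlgebra.involute x * y) =
      x * CliffordAlgebra.contractLeft (-dForm b P) y
    rw [contractLeft_mul, contractLeft_involute, hx', CliffordAlgebra.involute_involute]
    simp
  one_mul x _ := by simp
  mul_one x _ := by simp
  mul_assoc x _ y _ z _ := by simp [_root_.mul_assoc]

end Clifford

end SuperDef

end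

/-!
The reduced Hochschild cochains act on everything in sight through *braces*: `brace [φ, …, ψ] f`
inserts `φ, …, ψ` into the entries of `f`. The Hochschild differential and the cup product are
braces into `μ`, and all identities between them (`d² = 0`, the Leibniz rule, associativity of the
cup product up to homotopy) are instances of the relations between iterated braces together with
the `A_∞`-equation. Evaluating on the tautological element `v = ∑ x_i v_i` turns braces into
insertions into power series, so the same relations, applied to constant cochains, give the
corresponding identities for `A_v`, and `φ ↦ ∑ φ^k(v, …, v)` is a chain map which is strictly
multiplicative for the cup product (`hochToTaut_cup`).

*Why `Φ` is an isomorphism.* Evaluation is surjective on cochains (`exists_hochToTaut_eq`): the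
values of a cochain on weakly decreasing words in the basis of `V` are arbitrary, and already
produce all power series. It remains to see that its kernel is acyclic (`exists_hochD_eq`). A
reduced cochain is a function on words in the nonempty subsets of `{1, …, n}`. Besides the weakly
decreasing words of singletons there are words of type `merged` and of type `split`, matched to
each other by splitting off the smallest element of a letter (`splitLetter`). To leading order for
the filtration the differential is that of the exterior algebra, hence with respect to a suitable
well-founded order it maps the cochains supported on `merged` words triangularly, with units on the
diagonal, to the values on `split` words (`exists_hochAux_splitLetter`). Consequently every cochain
becomes zero on `split` words after subtraction of the coboundary of a cochain in the kernel, and a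
cocycle in the kernel that vanishes on `split` words is zero.

*Why `Ψ` is an isomorphism.* Differentiating the identity `∑ μ^k(v, …, v) = 𝔓 · 1` (`evalTaut_μ`)
twice and once shows that the Clifford relations for `-½ Hess(𝔓)` hold in `A_v` for products of
vectors, strictly, and that `d_v v_i = -∂_i 𝔓`. Both in `A_v` and in the Clifford algebra the
increasing monomials form a basis over `R`, in `A_v` because the product is the exterior one up to
lower filtration. Matching these bases for one basis of `V` gives an `R`-linear isomorphism of
complexes `clToTaut`. The product of `A_v` is not associative, but the obstruction to `(a · c) · v
= a · (c · v)` for `v ∈ V` is the boundary of the homotopy `vecHtpy`; by induction over words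
`clToTaut` is compatible with right multiplication by words in `V`, up to explicit homotopies
(`clToTaut_mul_linW`). This gives the multiplicativity in cohomology. Applied to `1` and the
increasing words in another basis of `V`, it shows that the induced map does not depend on the
basis.
-/

noncomputable section

namespace SuperDef

/-! ### Sums over the deconcatenations of a list -/

section SplitSum

variable {α β N N' : Type*} [AddCommMonoid N] [AddCommMonoid N']

/-- The sum of `G x y` over all ways of writing a list as `x ++ y`. -/
def splitSum : (List α → List α → N) → List α → N
  | G, [] => G [] []
  | G, a :: l => G [] (a :: l) + splitSum (fun x y => G (a :: x) y) l

theorem splitSum_nil (G : List α → List α → N) : splitSum G [] = G [] [] := rfl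

theorem splitSum_cons (G : List α → List α → N) (a : α) (l : List α) :
    splitSum G (a :: l) = G [] (a :: l) + splitSum (fun x y => G (a :: x) y) l := rfl

theorem splitSum_congr {G G' : List α → List α → N} {l : List α}
    (h : ∀ x y, x ++ y = l → G x y = G' x y) : splitSum G l = splitSum G' l := by
  induction l generalizing G G' with
  | nil => exact h _ _ rfl
  | cons a l ih =>
    rw [splitSum_cons, splitSum_cons, h _ _ rfl,
      ih fun x y hxy => h _ _ (by rw [List.cons_append, hxy])]

theorem splitSum_add (G G' : List α → List α → N) (l : List α) :
    splitSum (fun x y => G x y + G' x y) l = splitSum G l + splitSum G' l := by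
  induction l generalizing G G' with
  | nil => rfl
  | cons a l ih => simp only [splitSum_cons, ih]; exact add_add_add_comm _ _ _ _

theorem map_splitSum {F : Type*} [FunLike F N N'] [AddMonoidHomClass F N N'] (f : F)
    (G : List α → List α → N) (l : List α) :
    f (splitSum G l) = splitSum (fun x y => f (G x y)) l := by
  induction l generalizing G with
  | nil => rfl
  | cons a l ih => simp only [splitSum_cons, map_add, ih]

theorem splitSum_zero (l : List α) : splitSum (fun _ _ => (0 : N)) l = 0 := by
  induction l with
  | nil => rfl
  | cons a l ih => rw [splitSum_cons, ih, add_zero]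

theorem splitSum_eq_zero {G : List α → List α → N} {l : List α}
    (h : ∀ x y, x ++ y = l → G x y = 0) : splitSum G l = 0 :=
  (splitSum_congr h).trans (splitSum_zero l)

theorem smul_splitSum {R : Type*} [Monoid R] [DistribMulAction R N] (c : R)
    (G : List α → List α → N) (l : List α) :
    c • splitSum G l = splitSum (fun x y => c • G x y) l :=
  map_splitSum (DistribSMul.toAddMonoidHom N c) G l

theorem splitSum_map (f : α → β) (G : List β → List β → N) (l : List α) :
    splitSum G (l.map f) = splitSum (fun x y => G (x.map f) (y.map f)) l := by
  induction l generalizing G with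
  | nil => rfl
  | cons a l ih => simp only [List.map_cons, splitSum_cons, ih]; rfl

/-- Coassociativity of deconcatenation. -/
theorem splitSum_assoc (H : List α → List α → List α → N) (l : List α) :
    splitSum (fun s z => splitSum (fun x y => H x y z) s) l =
      splitSum (fun x r => splitSum (fun y z => H x y z) r) l := by
  induction l generalizing H with
  | nil => rfl
  | cons a l ih => simp only [splitSum_cons, splitSum_nil, splitSum_add, ih, add_assoc]

theorem splitSum_comm (H : List α → List α → List β → List β → N) (l : List α) (k : List β) :
    splitSum (fun x y => splitSum (fun u v => H x y u v) k) l =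
      splitSum (fun u v => splitSum (fun x y => H x y u v) l) k := by
  induction l generalizing H with
  | nil => rfl
  | cons a l ih => simp only [splitSum_cons, splitSum_add, ih]

theorem splitSum_append_cons (G : List α → List α → N) (x : List α) (a : α) (z : List α) :
    splitSum G (x ++ a :: z) =
      splitSum (fun p q => G p (q ++ a :: z)) x + splitSum (fun p q => G (x ++ a :: p) q) z := by
  induction x generalizing G with
  | nil => rfl
  | cons c x ih => simp only [List.cons_append, splitSum_cons, ih, add_assoc]

theorem splitSum_mem {S : Type*} [SetLike S N] [AddSubmonoidClass S N] {s : S}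
    {G : List α → List α → N} {l : List α} (h : ∀ x y, x ++ y = l → G x y ∈ s) :
    splitSum G l ∈ s := by
  induction l generalizing G with
  | nil => exact h _ _ rfl
  | cons a l ih =>
    exact add_mem (h _ _ rfl) (ih fun x y hxy => h _ _ (by rw [List.cons_append, hxy]))

theorem splitSum_eq_sum (G : List α → List α → N) (l : List α) :
    splitSum G l = ∑ p ∈ Finset.range (l.length + 1), G (l.take p) (l.drop p) := by
  induction l generalizing G with
  | nil => simp [splitSum]
  | cons a l ih =>
    rw [splitSum_cons, ih, List.length_cons, Finset.sum_range_succ' _ (l.length + 1), add_comm]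
    rfl

theorem sumSplit_eq_splitSum (F : List α → List α → List α → N) (l : List α) :
    sumSplit F l = splitSum (fun x r => splitSum (fun y z => F x y z) r) l := by
  simp only [splitSum_eq_sum, sumSplit, List.length_drop, List.drop_drop]

/-- Only the last term of a sum over deconcatenations is nonzero. -/
theorem splitSum_eq_right {G : List α → List α → N} {l : List α}
    (h : ∀ x y, y ≠ [] → x ++ y = l → G x y = 0) : splitSum G l = G l [] := by
  induction l generalizing G with
  | nil => rfl
  | cons a l ih =>
    rw [splitSum_cons, h _ _ (by simp) rfl, zero_add]
    exact ih fun x y hy hxy => h _ _ hy (by rw [List.cons_append, hxy])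

/-- Only the first term of a sum over deconcatenations is nonzero. -/
theorem splitSum_eq_left {G : List α → List α → N} {l : List α}
    (h : ∀ x y, x ≠ [] → x ++ y = l → G x y = 0) : splitSum G l = G [] l := by
  cases l with
  | nil => rfl
  | cons a l =>
    rw [splitSum_cons, splitSum_eq_zero, add_zero]
    exact fun x y hxy => h _ _ (by simp) (by rw [List.cons_append, hxy])

end SplitSum

/-! ### Multilinear operations on the exterior algebra -/

section Multilinear

variable {R₀ V : Type*} [CommRing R₀] [AddCommGroup V] [Module R₀ V]

/-- The operations obtained by fixing the first entry. -/
def sh (e : ExtAlg R₀ V) (f : List (ExtAlg R₀ V) → ExtAlg R₀ V) :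
    List (ExtAlg R₀ V) → ExtAlg R₀ V := fun l => f (e :: l)

namespace IsMultilinear

variable {f g : List (ExtAlg R₀ V) → ExtAlg R₀ V}

theorem sh (hf : IsMultilinear f) (e : ExtAlg R₀ V) : IsMultilinear (sh e f) := hf.cons e

theorem map_add_head (hf : IsMultilinear f) (a b : ExtAlg R₀ V) (l : List (ExtAlg R₀ V)) :
    f ((a + b) :: l) = f (a :: l) + f (b :: l) := hf.map_add [] l a b

theorem map_smul_head (hf : IsMultilinear f) (c : R₀) (a : ExtAlg R₀ V)
    (l : List (ExtAlg R₀ V)) : f ((c • a) :: l) = c • f (a :: l) := hf.map_smul [] l c a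

theorem append_left (hf : IsMultilinear f) (x : List (ExtAlg R₀ V)) :
    IsMultilinear fun l => f (x ++ l) :=
  ⟨fun y z a b => by simpa using hf.map_add (x ++ y) z a b,
    fun y z c a => by simpa using hf.map_smul (x ++ y) z c a⟩

theorem map_zero (hf : IsMultilinear f) (x z : List (ExtAlg R₀ V)) : f (x ++ 0 :: z) = 0 := by
  simpa using hf.map_smul x z 0 0

/-- The operations as a linear map in one entry. -/
def slot (hf : IsMultilinear f) (x z : List (ExtAlg R₀ V)) : ExtAlg R₀ V →ₗ[R₀] ExtAlg R₀ V where
  toFun a := f (x ++ a :: z)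
  map_add' := hf.map_add x z
  map_smul' := hf.map_smul x z

theorem map_neg (hf : IsMultilinear f) (x z : List (ExtAlg R₀ V)) (a : ExtAlg R₀ V) :
    f (x ++ (-a) :: z) = -f (x ++ a :: z) := (hf.slot x z).map_neg a

theorem add (hf : IsMultilinear f) (hg : IsMultilinear g) : IsMultilinear fun l => f l + g l :=
  ⟨fun y w a b => by rw [hf.map_add, hg.map_add, add_add_add_comm],
    fun y w c a => by rw [hf.map_smul, hg.map_smul, smul_add]⟩

theorem smul (hf : IsMultilinear f) (c : R₀) : IsMultilinear fun l => c • f l :=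
  ⟨fun y w a b => by rw [hf.map_add, smul_add],
    fun y w c a => by rw [hf.map_smul, smul_comm]⟩

theorem comp_linear (hf : IsMultilinear f) (T : ExtAlg R₀ V →ₗ[R₀] ExtAlg R₀ V) :
    IsMultilinear fun l => T (f l) :=
  ⟨fun y w a b => by rw [hf.map_add, T.map_add], fun y w c a => by rw [hf.map_smul, T.map_smul]⟩

theorem comp_map (hf : IsMultilinear f) (T : ExtAlg R₀ V →ₗ[R₀] ExtAlg R₀ V) :
    IsMultilinear fun l => f (l.map T) :=
  ⟨fun y w a b => by simp [hf.map_add], fun y w c a => by simp [hf.map_smul]⟩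

theorem splitSum {G : List (ExtAlg R₀ V) → List (ExtAlg R₀ V) → ExtAlg R₀ V}
    (h₁ : ∀ y, IsMultilinear fun x => G x y) (h₂ : ∀ x, IsMultilinear (G x)) :
    IsMultilinear (splitSum G) :=
  ⟨fun x z a b => by
    simp only [splitSum_append_cons, fun y => (h₁ y).map_add, fun y => (h₂ y).map_add,
      splitSum_add]
    exact add_add_add_comm _ _ _ _,
  fun x z c a => by
    simp only [splitSum_append_cons, fun y => (h₁ y).map_smul, fun y => (h₂ y).map_smul,
      smul_add, smul_splitSum]⟩

/-- Multilinear operations are determined by their values on lists of elements of a spanning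
set. -/
theorem ext_span {S : Set (ExtAlg R₀ V)} (hS : Submodule.span R₀ S = ⊤)
    (hf : IsMultilinear f) (hg : IsMultilinear g)
    (h : ∀ l : List (ExtAlg R₀ V), (∀ a ∈ l, a ∈ S) → f l = g l) : f = g := by
  funext l
  induction l generalizing f g with
  | nil => exact h [] (by simp)
  | cons a l ih =>
    have ha : a ∈ Submodule.span R₀ S := hS ▸ Submodule.mem_top
    induction ha using Submodule.span_induction with
    | mem a ha =>
      refine ih (hf.sh a) (hg.sh a) fun l hl => h _ ?_
      simpa using ⟨ha, hl⟩
    | zero => rw [hf.zero, hg.zero]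
    | add a b _ _ iha ihb => rw [hf.map_add_head, hg.map_add_head, iha, ihb]
    | smul c a _ iha => rw [hf.map_smul_head, hg.map_smul_head, iha]

end IsMultilinear

end Multilinear

/-! ### Signs and twists -/

section Signs

variable {R₀ V : Type*} [CommRing R₀] [AddCommGroup V] [Module R₀ V]

theorem zmod_two_cases (t : ZMod 2) : t = 0 ∨ t = 1 := by
  revert t; decide

theorem sgn_zero : sgn R₀ 0 = 1 := if_pos rfl

theorem sgn_one : sgn R₀ 1 = -1 := if_neg (by decide)

theorem sgn_add (s t : ZMod 2) : sgn R₀ (s + t) = sgn R₀ s * sgn R₀ t := by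
  rcases zmod_two_cases s with rfl | rfl <;> rcases zmod_two_cases t with rfl | rfl <;>
    simp [sgn_zero, sgn_one, show (1 + 1 : ZMod 2) = 0 from by decide]

theorem sgn_mul_self (t : ZMod 2) : sgn R₀ t * sgn R₀ t = 1 := by
  rcases zmod_two_cases t with rfl | rfl <;> simp [sgn_zero, sgn_one]

theorem tw_zero : (tw 0 : ExtAlg R₀ V →ₗ[R₀] _) = -eps := if_pos rfl

theorem tw_one : (tw 1 : ExtAlg R₀ V →ₗ[R₀] _) = LinearMap.id := if_neg (by decide)

theorem eps_eps (a : ExtAlg R₀ V) : eps (eps a) = a :=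
  CliffordAlgebra.involute_involute (Q := (0 : QuadraticForm R₀ V)) a

theorem eps_one : eps (1 : ExtAlg R₀ V) = 1 :=
  map_one (CliffordAlgebra.involute (Q := (0 : QuadraticForm R₀ V)))

theorem eps_of_mem {t : ZMod 2} {a : ExtAlg R₀ V} (ha : a ∈ parityPart R₀ V t) :
    eps a = sgn R₀ t • a := by
  rcases zmod_two_cases t with rfl | rfl
  · rw [sgn_zero, one_smul]
    exact CliffordAlgebra.involute_eq_of_mem_even ha
  · rw [sgn_one, neg_smul, one_smul]
    exact CliffordAlgebra.involute_eq_of_mem_odd ha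

theorem tw_of_mem (p : ZMod 2) {t : ZMod 2} {a : ExtAlg R₀ V} (ha : a ∈ parityPart R₀ V t) :
    tw p a = sgn R₀ ((p - 1) * (t - 1)) • a := by
  rcases zmod_two_cases p with rfl | rfl
  · rw [tw_zero, LinearMap.neg_apply, eps_of_mem ha]
    rcases zmod_two_cases t with rfl | rfl <;> simp [sgn]
  · simp [tw_one, sgn_zero]

theorem tw_tw (s t : ZMod 2) (a : ExtAlg R₀ V) :
    tw (s + 1) (tw (t + 1) a) = tw (s + t + 1) a := by
  have h : (1 + 1 : ZMod 2) = 0 := by decide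
  rcases zmod_two_cases s with rfl | rfl <;> rcases zmod_two_cases t with rfl | rfl <;>
    simp [tw_zero, tw_one, h, eps_eps]

theorem tw_comm (s t : ZMod 2) (a : ExtAlg R₀ V) : tw s (tw t a) = tw t (tw s a) := by
  rcases zmod_two_cases s with rfl | rfl <;> rcases zmod_two_cases t with rfl | rfl <;>
    simp [tw_zero, tw_one]

variable (R₀ V) in
/-- The homogeneous elements. -/
def homog : Set (ExtAlg R₀ V) := {a | ∃ t, a ∈ parityPart R₀ V t}

theorem span_homog : Submodule.span R₀ (homog R₀ V) = ⊤ := by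
  have h := (DirectSum.Decomposition.isInternal (parityPart R₀ V)).submodule_iSup_eq_top
  rw [eq_top_iff, ← h]
  exact iSup_le fun t a ha => Submodule.subset_span ⟨t, ha⟩

theorem exists_homog_list (l : List (ExtAlg R₀ V)) (h : ∀ a ∈ l, a ∈ homog R₀ V) :
    ∃ k : List (ZMod 2 × ExtAlg R₀ V), (∀ a ∈ k, a.2 ∈ parityPart R₀ V a.1) ∧
      k.map Prod.snd = l := by
  induction l with
  | nil => exact ⟨[], by simp, rfl⟩
  | cons a l ih =>
    obtain ⟨t, ht⟩ := h a (by simp)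
    obtain ⟨k, hk, rfl⟩ := ih fun a ha => h a (by simp [ha])
    exact ⟨(t, a) :: k, List.forall_mem_cons.2 ⟨ht, hk⟩, rfl⟩

theorem map_tw_homog (f : List (ExtAlg R₀ V) → ExtAlg R₀ V) (hf : IsMultilinear f) (p : ZMod 2)
    (k : List (ZMod 2 × ExtAlg R₀ V)) (hk : ∀ a ∈ k, a.2 ∈ parityPart R₀ V a.1) :
    f ((k.map Prod.snd).map (tw p)) =
      sgn R₀ ((p - 1) * ((k.map Prod.fst).sum - k.length)) • f (k.map Prod.snd) := by
  induction k generalizing f with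
  | nil => simp [sgn_zero]
  | cons a k ih =>
    have h1 : f (((a :: k).map Prod.snd).map (tw p)) =
        sgn R₀ ((p - 1) * (a.1 - 1)) • sh a.2 f ((k.map Prod.snd).map (tw p)) := by
      simp only [List.map_cons, tw_of_mem p (hk a (by simp)), hf.map_smul_head]
      rfl
    rw [h1, ih _ (hf.sh _) fun c hc => hk c (by simp [hc]), smul_smul, ← sgn_add]
    congr 2
    simp only [List.map_cons, List.sum_cons, List.length_cons, Nat.cast_add, Nat.cast_one]
    ring

/-- Multilinear operations of degree `t` commute with the twists up to sign. -/
theorem HasParity.tw_apply {t : ZMod 2} {f : List (ExtAlg R₀ V) → ExtAlg R₀ V}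
    (hp : HasParity t f) (hf : IsMultilinear f) (p : ZMod 2) (l : List (ExtAlg R₀ V)) :
    tw p (f l) = sgn R₀ ((p - 1) * (t - 1)) • f (l.map (tw p)) := by
  refine congrFun (IsMultilinear.ext_span span_homog (hf.comp_linear _)
    ((hf.comp_map _).smul _) fun l hl => ?_) l
  obtain ⟨k, hk, rfl⟩ := exists_homog_list l hl
  rw [tw_of_mem p (hp k hk), map_tw_homog f hf p k hk, smul_smul, ← sgn_add]
  congr 2
  ring

end Signs

/-! ### Braces -/

section Brace

theorem splitSum_assoc₃ {α N : Type*} [AddCommMonoid N] (K : List α → List α → List α → List α → N)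
    (l : List α) :
    splitSum (fun s q => splitSum (fun x r => splitSum (fun y p => K x y p q) r) s) l =
      splitSum (fun x r => splitSum (fun y z => splitSum (fun p q => K x y p q) z) r) l :=
  (splitSum_assoc (fun x r q => splitSum (fun y p => K x y p q) r) l).trans
    (splitSum_congr fun x t _ => splitSum_assoc (K x) t)

variable {R₀ V : Type*} [CommRing R₀] [AddCommGroup V] [Module R₀ V]

/-- The brace `f{φ_r, …, φ_1}` of Hochschild cochains, evaluated on a list: the signed sum of
`f(…, φ_r(…), …, φ_1(…), …)` over all ways of inserting the `φ_i`, in the given order, into the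
list. A cochain comes with its degree `p`, and the entries after it, including the values of the
later cochains, are twisted by `tw p`. -/
def brace : List (ZMod 2 × (List (ExtAlg R₀ V) → ExtAlg R₀ V)) →
    (List (ExtAlg R₀ V) → ExtAlg R₀ V) → List (ExtAlg R₀ V) → ExtAlg R₀ V
  | [], f => f
  | c :: Φ, f => splitSum fun x r => splitSum (fun y z =>
      brace Φ (fun u => f (x ++ c.2 y :: u.map (tw c.1))) z) r

/-- The degree of `f{φ_r, …, φ_1}`, for an operation `f` of degree zero. -/
def braceDeg {R₀ V : Type*} [CommRing R₀] [AddCommGroup V] [Module R₀ V]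
    (Φ : List (ZMod 2 × (List (ExtAlg R₀ V) → ExtAlg R₀ V))) : ZMod 2 :=
  (Φ.map fun c => c.1 - 1).sum

variable (c : ZMod 2 × (List (ExtAlg R₀ V) → ExtAlg R₀ V))
  (Φ : List (ZMod 2 × (List (ExtAlg R₀ V) → ExtAlg R₀ V)))
  (f g : List (ExtAlg R₀ V) → ExtAlg R₀ V) (l : List (ExtAlg R₀ V))

theorem brace_nil : brace [] f = f := rfl

theorem brace_cons : brace (c :: Φ) f l = splitSum (fun x r => splitSum (fun y z =>
      brace Φ (fun u => f (x ++ c.2 y :: u.map (tw c.1))) z) r) l := rfl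

theorem braceDeg_nil : braceDeg ([] : List (ZMod 2 × (List (ExtAlg R₀ V) → ExtAlg R₀ V))) = 0 :=
  rfl

theorem braceDeg_cons : braceDeg (c :: Φ) = c.1 - 1 + braceDeg Φ := by
  simp [braceDeg]

theorem brace_add : brace Φ (fun u => f u + g u) = fun l => brace Φ f l + brace Φ g l := by
  induction Φ generalizing f g with
  | nil => rfl
  | cons c Φ ih => funext l; simp only [brace_cons, ih, splitSum_add]

theorem brace_smul (a : R₀) : brace Φ (fun u => a • f u) = fun l => a • brace Φ f l := by
  induction Φ generalizing f with
  | nil => rfl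
  | cons c Φ ih => funext l; simp only [brace_cons, ih, smul_splitSum]

theorem brace_zero : brace Φ (fun _ => (0 : ExtAlg R₀ V)) = fun _ => 0 := by
  simpa using brace_smul Φ (fun _ => (0 : ExtAlg R₀ V)) 0

theorem brace_splitSum {α : Type*}
    (F : List α → List α → List (ExtAlg R₀ V) → ExtAlg R₀ V) (k : List α) :
    brace Φ (fun u => splitSum (fun x y => F x y u) k) =
      fun l => splitSum (fun x y => brace Φ (F x y) l) k := by
  induction k generalizing F with
  | nil => rfl
  | cons a k ih => simp only [splitSum_cons, brace_add, ih]

theorem tw_map_map (s t : ZMod 2) (l : List (ExtAlg R₀ V)) :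
    (l.map (tw (s + 1))).map (tw (t + 1)) = l.map (tw (t + s + 1)) := by
  simp [Function.comp_def, tw_tw]

theorem tw_map_comm (s t : ZMod 2) (l : List (ExtAlg R₀ V)) :
    (l.map (tw s)).map (tw t) = (l.map (tw t)).map (tw s) := by
  simp only [List.map_map, List.map_inj_left]
  exact fun a _ => tw_comm _ _ _

/-- The braces are compatible with the coproduct of deconcatenation. -/
theorem brace_deconcat (G : List (ExtAlg R₀ V) → List (ExtAlg R₀ V) → ExtAlg R₀ V) :
    brace Φ (splitSum G) l = splitSum (fun Φ' Φ'' => splitSum (fun x y =>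
      brace Φ' (fun u => brace Φ'' (fun w => G u (w.map (tw (braceDeg Φ' + 1)))) y) x) l) Φ := by
  induction Φ generalizing G l with
  | nil =>
    simp only [splitSum_nil, brace_nil, braceDeg_nil, zero_add, tw_one]
    simp
  | cons c Φ ih =>
    rw [splitSum_cons, brace_cons]
    simp only [splitSum_append_cons, brace_add, splitSum_add]
    congr 1
    · simp only [brace_splitSum, brace_nil, braceDeg_nil, zero_add, tw_one, LinearMap.id_coe,
        List.map_id, brace_cons]
      refine (splitSum_congr fun x r _ => splitSum_comm (N := ExtAlg R₀ V) _ r x).trans ?_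
      exact splitSum_assoc _ l
    · have h : ∀ x y, brace Φ (fun u => splitSum (fun p q => G (x ++ c.2 y :: p) q)
          (u.map (tw c.1))) = fun z => splitSum (fun Φ' Φ'' => splitSum (fun p q =>
            brace Φ' (fun u => brace Φ'' (fun w => G (x ++ c.2 y :: u.map (tw c.1))
              (w.map (tw (braceDeg (c :: Φ') + 1)))) q) p) z) Φ := fun x y => by
        funext z
        simp only [splitSum_map]
        refine (ih z fun p q => G (x ++ c.2 y :: p.map (tw c.1)) (q.map (tw c.1))).trans ?_
        refine splitSum_congr fun Φ' Φ'' _ => ?_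
        have h1 : ∀ w : List (ExtAlg R₀ V), (w.map (tw (braceDeg Φ' + 1))).map (tw c.1) =
            w.map (tw (braceDeg (c :: Φ') + 1)) := fun w => by
          have := tw_map_map (braceDeg Φ') (c.1 - 1) w
          rwa [sub_add_cancel, ← braceDeg_cons] at this
        simp only [h1]
      simp only [h, brace_cons]
      refine (splitSum_congr fun x r _ => splitSum_comm (N := ExtAlg R₀ V) _ r Φ).trans ?_
      refine (splitSum_comm (N := ExtAlg R₀ V) _ l Φ).trans (splitSum_congr fun Φ' Φ'' _ => ?_)
      exact (splitSum_assoc₃ _ l).symm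

end Brace

/-! #### The bar differential of a brace -/

section BraceIdentities

variable {R₀ V : Type*} [CommRing R₀] [AddCommGroup V] [Module R₀ V]

/-- An operation `c.2` which is multilinear of degree `c.1`. -/
structure IsCochain (c : ZMod 2 × (List (ExtAlg R₀ V) → ExtAlg R₀ V)) : Prop where
  multilinear : IsMultilinear c.2
  parity : HasParity c.1 c.2

variable {f : List (ExtAlg R₀ V) → ExtAlg R₀ V}
  {c : ZMod 2 × (List (ExtAlg R₀ V) → ExtAlg R₀ V)}
  {Φ : List (ZMod 2 × (List (ExtAlg R₀ V) → ExtAlg R₀ V))}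

theorem IsMultilinear.splitSum_param {α : Type*}
    {G : List (ExtAlg R₀ V) → List α → List α → ExtAlg R₀ V}
    (h : ∀ y z, IsMultilinear fun x => G x y z) (k : List α) :
    IsMultilinear fun x => SuperDef.splitSum (G x) k :=
  ⟨fun x z a b => (splitSum_congr fun y w _ => (h y w).map_add x z a b).trans (splitSum_add _ _ _),
    fun x z r a => (splitSum_congr fun y w _ => (h y w).map_smul x z r a).trans
      (smul_splitSum _ _ _).symm⟩

theorem IsMultilinear.twist (hf : IsMultilinear f) (x : List (ExtAlg R₀ V)) (a : ExtAlg R₀ V)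
    (p : ZMod 2) : IsMultilinear fun u => f (x ++ a :: u.map (tw p)) :=
  ((hf.append_left x).cons a).comp_map (tw p)

/-- The brace with prescribed first entries, as a linear map in one of these entries. -/
def braceSlot (hf : IsMultilinear f)
    (Φ : List (ZMod 2 × (List (ExtAlg R₀ V) → ExtAlg R₀ V))) (x : List (ExtAlg R₀ V))
    (p : ZMod 2) (z : List (ExtAlg R₀ V)) : ExtAlg R₀ V →ₗ[R₀] ExtAlg R₀ V where
  toFun a := brace Φ (fun u => f (x ++ a :: u.map (tw p))) z
  map_add' a a' := by simp only [hf.map_add, brace_add]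
  map_smul' r a := by simp only [hf.map_smul, brace_smul, RingHom.id_apply]

theorem map_brace (T : ExtAlg R₀ V →ₗ[R₀] ExtAlg R₀ V)
    (Φ : List (ZMod 2 × (List (ExtAlg R₀ V) → ExtAlg R₀ V)))
    (h : List (ExtAlg R₀ V) → ExtAlg R₀ V) (l : List (ExtAlg R₀ V)) :
    T (brace Φ h l) = brace Φ (fun u => T (h u)) l := by
  induction Φ generalizing h l with
  | nil => rfl
  | cons c Φ ih => simp only [brace_cons, map_splitSum, ih]

theorem IsMultilinear.brace (hf : IsMultilinear f) (hΦ : ∀ c ∈ Φ, IsMultilinear c.2) :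
    IsMultilinear (brace Φ f) := by
  induction Φ generalizing f with
  | nil => exact hf
  | cons c Φ ih =>
    have hc := hΦ c (by simp)
    refine IsMultilinear.splitSum (fun r => IsMultilinear.splitSum_param (fun y z => ?_) r)
      fun x => IsMultilinear.splitSum (fun z => ?_) fun y => ?_
    · exact ⟨fun x w a b => by
        simp only [List.append_assoc, List.cons_append, hf.map_add, brace_add],
        fun x w r a => by
        simp only [List.append_assoc, List.cons_append, hf.map_smul, brace_smul]⟩
    · exact hc.comp_linear (braceSlot hf Φ x c.1 z)
    · exact ih (hf.twist x (c.2 y) c.1) fun c hc => hΦ c (by simp [hc])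

theorem HasParity.brace {s : ZMod 2} (hp : HasParity s f) (hΦ : ∀ c ∈ Φ, IsCochain c) :
    HasParity (s + braceDeg Φ) (brace Φ f) := by
  induction Φ generalizing f s with
  | nil => simpa [braceDeg_nil, brace_nil] using hp
  | cons c Φ ih =>
    have hc := hΦ c (by simp)
    intro k hk
    refine splitSum_mem fun x r hxr => splitSum_mem fun y z hyz => ?_
    obtain ⟨kx, kr, rfl, rfl, rfl⟩ := List.map_eq_append_iff.1 hxr.symm
    obtain ⟨ky, kz, rfl, rfl, rfl⟩ := List.map_eq_append_iff.1 hyz.symm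
    simp only [List.mem_append] at hk
    have h1 : HasParity (s - kx.length + (kx.map Prod.fst).sum - 1 +
        (c.1 - ky.length + (ky.map Prod.fst).sum))
        (fun u => f (kx.map Prod.snd ++ c.2 (ky.map Prod.snd) :: u.map (tw c.1))) := by
      intro ku hku
      have h2 := hp (kx ++ (c.1 - ky.length + (ky.map Prod.fst).sum, c.2 (ky.map Prod.snd)) ::
        ku.map fun a => (a.1, tw c.1 a.2)) (by
          intro a ha
          simp only [List.mem_append, List.mem_cons, List.mem_map] at ha
          rcases ha with ha | rfl | ⟨a, ha, rfl⟩
          · exact hk a (Or.inl ha)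
          · exact hc.parity ky fun a ha => hk a (Or.inr (Or.inl ha))
          · simp only [tw_of_mem c.1 (hku a ha)]
            exact Submodule.smul_mem _ _ (hku a ha))
      have h3 : (List.map Prod.snd (ku.map fun a => (a.1, tw c.1 a.2))) =
          (ku.map Prod.snd).map (tw c.1) := by simp [Function.comp_def]
      have h4 : (List.map Prod.fst (ku.map fun a => (a.1, tw c.1 a.2))) = ku.map Prod.fst := by
        simp [Function.comp_def]
      simp only [List.map_append, List.map_cons, h3, h4, List.sum_append, List.sum_cons,
        List.length_append, List.length_cons, List.length_map, Nat.cast_add, Nat.cast_one] at h2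
      convert h2 using 2
      ring
    have h5 := ih h1 (fun c hc => hΦ c (by simp [hc])) kz fun a ha => hk a (Or.inr (Or.inr ha))
    convert h5 using 2
    simp only [braceDeg_cons, List.map_append, List.sum_append, List.length_append, Nat.cast_add]
    ring

theorem IsCochain.brace {s : ZMod 2} (hf : IsMultilinear f) (hp : HasParity s f)
    (hΦ : ∀ c ∈ Φ, IsCochain c) : IsCochain (s + braceDeg Φ, brace Φ f) :=
  ⟨hf.brace fun c hc => (hΦ c hc).multilinear, hp.brace hΦ⟩

/-- Braces commute with twisting all entries, up to sign. -/
theorem brace_map_tw_zero (hf : IsMultilinear f) (hΦ : ∀ c ∈ Φ, IsCochain c)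
    (z : List (ExtAlg R₀ V)) :
    brace Φ f (z.map (tw 0)) = sgn R₀ (braceDeg Φ) • brace Φ (fun u => f (u.map (tw 0))) z := by
  induction Φ generalizing f z with
  | nil => simp [braceDeg_nil, brace_nil, sgn_zero]
  | cons c Φ ih =>
    have hc := hΦ c (by simp)
    simp only [brace_cons, splitSum_map, smul_splitSum]
    refine splitSum_congr fun x r _ => splitSum_congr fun y w _ => ?_
    rw [ih (hf.twist _ _ _) fun c hc => hΦ c (by simp [hc]), braceDeg_cons, add_comm, sgn_add,
      mul_smul]
    congr 1
    have h1 : c.2 (y.map (tw 0)) = sgn R₀ (c.1 - 1) • tw 0 (c.2 y) := by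
      rw [hc.parity.tw_apply hc.multilinear, smul_smul, ← sgn_add]
      rcases zmod_two_cases c.1 with h | h <;>
        simp [h, sgn_zero, show (1 + 1 : ZMod 2) = 0 from by decide]
    simp only [h1, List.map_append, List.map_cons, hf.map_smul, brace_smul, tw_map_comm c.1 0]

variable (A : SuperfilteredDeformation R₀ V)

/-- The operation `l ↦ ∑ ± f(…, μ(…), …)`. -/
def barD (f : List (ExtAlg R₀ V) → ExtAlg R₀ V) : List (ExtAlg R₀ V) → ExtAlg R₀ V :=
  brace [(0, A.μ)] f

theorem barD_apply (f : List (ExtAlg R₀ V) → ExtAlg R₀ V) (l : List (ExtAlg R₀ V)) :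
    barD A f l =
      splitSum (fun x r => splitSum (fun y z => f (x ++ A.μ y :: z.map (tw 0))) r) l := rfl

theorem isCochain_μ : IsCochain ((0 : ZMod 2), A.μ) := ⟨A.multilinear, A.parity⟩

theorem barD_μ : barD A A.μ = fun _ => 0 := by
  funext l
  rw [barD_apply, ← sumSplit_eq_splitSum fun x y z => A.μ (x ++ A.μ y :: z.map (tw 0))]
  exact A.ainfinity l

/-- The inner operation `μ` ends before the entry `a`, has `a` among its entries, or begins
after `a`. -/
theorem barD_append_cons (f : List (ExtAlg R₀ V) → ExtAlg R₀ V) (x : List (ExtAlg R₀ V))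
    (a : ExtAlg R₀ V) (w : List (ExtAlg R₀ V)) :
    barD A f (x ++ a :: w) =
      splitSum (fun x₁ q => splitSum (fun x₂ x₃ =>
        f (x₁ ++ A.μ x₂ :: (x₃ ++ a :: w).map (tw 0))) q) x +
      splitSum (fun x₁ x₂ => splitSum (fun w₁ w₂ =>
        f (x₁ ++ A.μ (x₂ ++ a :: w₁) :: w₂.map (tw 0))) w) x +
      splitSum (fun w₁ q => splitSum (fun w₂ w₃ =>
        f (x ++ a :: (w₁ ++ A.μ w₂ :: w₃.map (tw 0)))) q) w := by
  simp only [barD_apply, splitSum_append_cons, splitSum_add, List.append_assoc, List.cons_append]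

theorem barD_twist (hf : IsMultilinear f) (x : List (ExtAlg R₀ V)) (a : ExtAlg R₀ V)
    (p : ZMod 2) (u : List (ExtAlg R₀ V)) :
    barD A f (x ++ a :: u.map (tw p)) =
      splitSum (fun x₁ q => splitSum (fun x₂ x₃ =>
        f (x₁ ++ A.μ x₂ :: (x₃ ++ a :: u.map (tw p)).map (tw 0))) q) x +
      splitSum (fun x₁ x₂ => splitSum (fun w₁ w₂ =>
        f (x₁ ++ A.μ (x₂ ++ a :: w₁.map (tw p)) :: (w₂.map (tw p)).map (tw 0))) u) x +
      sgn R₀ (p - 1) • barD A (fun w => f (x ++ a :: w.map (tw p))) u := by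
  have h1 : ∀ y : List (ExtAlg R₀ V), A.μ (y.map (tw p)) = sgn R₀ (p - 1) • tw p (A.μ y) :=
    fun y => by
      rw [A.parity.tw_apply A.multilinear, smul_smul, ← sgn_add]
      rcases zmod_two_cases p with h | h <;>
        simp [h, sgn_zero, show (1 + 1 : ZMod 2) = 0 from by decide,
          show (2 : ZMod 2) = 0 from by decide]
  rw [barD_append_cons]
  simp only [splitSum_map]
  congr 1
  rw [barD_apply]
  simp only [smul_splitSum]
  refine splitSum_congr fun w₁ q _ => splitSum_congr fun w₂ w₃ _ => ?_
  have h2 := hf.map_smul (x ++ a :: w₁.map (tw p)) ((w₃.map (tw p)).map (tw 0))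
    (sgn R₀ (p - 1)) (tw p (A.μ w₂))
  simp only [List.append_assoc, List.cons_append] at h2
  rw [h1, h2, List.map_append, List.map_cons, tw_map_comm p 0]

/-- Expansion of the brace of `∑ ± f(…, μ(…), …)`: each `μ` takes a block of cochains as entries. -/
theorem brace_barD (hf : IsMultilinear f) (hΦ : ∀ c ∈ Φ, IsCochain c) (l : List (ExtAlg R₀ V)) :
    brace Φ (barD A f) l = splitSum (fun Φ' Ψ => splitSum (fun Φ'' Φ''' =>
      sgn R₀ (braceDeg Φ') • brace (Φ' ++ (braceDeg Φ'', brace Φ'' A.μ) :: Φ''') f l) Ψ) Φ := by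
  induction Φ generalizing f l with
  | nil => simp [splitSum_nil, braceDeg_nil, sgn_zero, brace_nil, barD]
  | cons c Φ ih =>
    rw [splitSum_cons, splitSum_cons, brace_cons]
    simp only [barD_twist A hf, brace_add, splitSum_add, brace_smul,
      fun x y z => ih (hf.twist x (c.2 y) c.1) (fun c hc => hΦ c (by simp [hc])) z]
    congr 1
    · congr 1
      · simp only [braceDeg_nil, sgn_zero, one_smul, brace_nil, List.nil_append, brace_splitSum]
        refine (splitSum_congr fun x r _ => (splitSum_comm (N := ExtAlg R₀ V) _ r x).trans
          (splitSum_congr fun x₁ q _ => splitSum_comm (N := ExtAlg R₀ V) _ r q)).trans ?_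
        refine (splitSum_assoc _ l).trans (splitSum_congr fun x₁ t _ => ?_)
        exact splitSum_assoc _ t
      · simp only [braceDeg_nil, sgn_zero, one_smul, List.nil_append, brace_splitSum]
        have h1 : ∀ (x₁ x₂ y z : List (ExtAlg R₀ V)),
            brace Φ (fun u => splitSum (fun w₁ w₂ => f (x₁ ++ A.μ (x₂ ++ c.2 y ::
              w₁.map (tw c.1)) :: (w₂.map (tw c.1)).map (tw 0))) u) z =
            splitSum (fun Φ' Φ'' => splitSum (fun z₁ z₂ =>
              braceSlot hf Φ'' x₁ (braceDeg (c :: Φ')) z₂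
                (brace Φ' (fun u => A.μ (x₂ ++ c.2 y :: u.map (tw c.1))) z₁)) z) Φ :=
          fun x₁ x₂ y z => by
            refine (brace_deconcat Φ z _).trans (splitSum_congr fun Φ' Φ'' _ =>
              splitSum_congr fun z₁ z₂ _ => ?_)
            rw [map_brace]
            have h2 : ∀ w : List (ExtAlg R₀ V), ((w.map (tw (braceDeg Φ' + 1))).map
                (tw c.1)).map (tw 0) = w.map (tw (braceDeg (c :: Φ'))) := fun w => by
              have e1 := tw_map_map (braceDeg Φ') (c.1 - 1) w
              have e2 := tw_map_map (braceDeg (c :: Φ')) (-1) w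
              rw [sub_add_cancel, ← braceDeg_cons] at e1
              rw [e1]
              rwa [neg_add_cancel, add_comm (-1) _, neg_add_cancel_right] at e2
            simp only [h2]
            rfl
        simp only [h1]
        have h3 : ∀ Φ' Φ'', brace ((braceDeg (c :: Φ'), brace (c :: Φ') A.μ) :: Φ'') f l =
            splitSum (fun x r => splitSum (fun y z => splitSum (fun x₁ x₂ => splitSum
              (fun z₁ z₂ => braceSlot hf Φ'' x₁ (braceDeg (c :: Φ')) z₂
                (brace Φ' (fun u => A.μ (x₂ ++ c.2 y :: u.map (tw c.1))) z₁)) z) x) r) l :=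
          fun Φ' Φ'' => by
            have h4 : ∀ x₁ y' z₂, brace Φ'' (fun w => f (x₁ ++ brace (c :: Φ') A.μ y' ::
                w.map (tw (braceDeg (c :: Φ'))))) z₂ = splitSum (fun x₂ t => splitSum
                  (fun y z₁ => braceSlot hf Φ'' x₁ (braceDeg (c :: Φ')) z₂
                    (brace Φ' (fun u => A.μ (x₂ ++ c.2 y :: u.map (tw c.1))) z₁)) t) y' :=
              fun x₁ y' z₂ => by
                change braceSlot hf Φ'' x₁ (braceDeg (c :: Φ')) z₂ (brace (c :: Φ') A.μ y') = _
                rw [brace_cons, map_splitSum]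
                exact splitSum_congr fun x₂ t _ => map_splitSum _ _ _
            rw [brace_cons]
            refine (splitSum_congr fun x₁ r _ => (splitSum_congr fun y' z₂ _ =>
              h4 x₁ y' z₂).trans (splitSum_assoc₃ _ r)).trans ?_
            refine (splitSum_assoc _ l).symm.trans (splitSum_congr fun x r _ => ?_)
            exact splitSum_comm (N := ExtAlg R₀ V) _ x r
        rw [splitSum_congr fun Φ' Φ'' _ => h3 Φ' Φ'']
        refine Eq.trans ?_ (splitSum_comm (N := ExtAlg R₀ V) _ l Φ)
        refine splitSum_congr fun x r _ => Eq.trans ?_ (splitSum_comm (N := ExtAlg R₀ V) _ r Φ)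
        refine splitSum_congr fun y z _ => ?_
        refine (splitSum_congr fun x₁ x₂ _ => ?_).trans (splitSum_comm (N := ExtAlg R₀ V) _ x Φ)
        rfl
    · simp only [List.cons_append, brace_cons, braceDeg_cons, sgn_add, mul_smul, smul_splitSum]
      refine Eq.trans ?_ (splitSum_congr fun Φ' Ψ _ =>
        ((splitSum_comm (N := ExtAlg R₀ V) _ Ψ l).trans
          (splitSum_congr fun x r _ => splitSum_comm (N := ExtAlg R₀ V) _ Ψ r)).symm)
      refine Eq.trans ?_ (splitSum_comm (N := ExtAlg R₀ V) _ l Φ)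
      exact splitSum_congr fun x r _ => splitSum_comm (N := ExtAlg R₀ V) _ r Φ

/-- Expansion of `∑ ± (f{Φ})(…, μ(…), …)`: each `μ` is either inserted between the cochains, or it
is inserted in one of them. -/
theorem barD_brace (hf : IsMultilinear f) (hΦ : ∀ c ∈ Φ, IsCochain c) (l : List (ExtAlg R₀ V)) :
    barD A (brace Φ f) l =
      splitSum (fun Φ' Φ'' => sgn R₀ (braceDeg Φ'') • brace (Φ' ++ (0, A.μ) :: Φ'') f l) Φ +
      splitSum (fun Φ' Ψ => match Ψ with
        | [] => 0
        | c :: Φ'' =>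
          sgn R₀ (braceDeg Φ'') • brace (Φ' ++ (c.1 + 1, barD A c.2) :: Φ'') f l) Φ := by
  induction Φ generalizing f l with
  | nil => simp [splitSum_nil, braceDeg_nil, sgn_zero, brace_nil, barD]
  | cons c Φ ih =>
    have hc := hΦ c (by simp)
    have hΦ' : ∀ c ∈ Φ, IsCochain c := fun c hc => hΦ c (by simp [hc])
    have h1 : ∀ x y z : List (ExtAlg R₀ V), brace Φ (fun u => f (x ++ c.2 y :: u.map (tw c.1)))
        (z.map (tw 0)) = sgn R₀ (braceDeg Φ) •
          brace Φ (fun u => f (x ++ c.2 y :: u.map (tw (c.1 + 1)))) z := fun x y z => by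
      rw [brace_map_tw_zero (hf.twist _ _ _) hΦ']
      have e : ∀ u : List (ExtAlg R₀ V), (u.map (tw 0)).map (tw c.1) = u.map (tw (c.1 + 1)) :=
        fun u => by
          have := tw_map_map 1 (c.1 - 1) u
          rwa [sub_add_cancel, show (1 + 1 : ZMod 2) = 0 from by decide] at this
      simp only [e]
    have h2 : ∀ y : List (ExtAlg R₀ V), c.2 (y.map (tw 0)) = sgn R₀ (c.1 - 1) • tw 0 (c.2 y) :=
      fun y => by
        rw [hc.parity.tw_apply hc.multilinear, smul_smul, ← sgn_add]
        rcases zmod_two_cases c.1 with h | h <;>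
          simp [h, sgn_zero, show (1 + 1 : ZMod 2) = 0 from by decide]
    have h3 : ∀ (x a w : _), brace (c :: Φ) f (x ++ a :: w.map (tw 0)) =
        sgn R₀ (braceDeg Φ) • splitSum (fun p q => splitSum (fun y z => brace Φ (fun u =>
          f (x ++ a :: p.map (tw 0) ++ c.2 (y.map (tw 0)) :: u.map (tw (c.1 + 1)))) z) q) w +
        (sgn R₀ (braceDeg Φ) • splitSum (fun p q => splitSum (fun y z => brace Φ (fun u =>
          f (p ++ c.2 (q ++ a :: y.map (tw 0)) :: u.map (tw (c.1 + 1)))) z) w) x +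
        splitSum (fun p q => splitSum (fun y₁ y₂ => brace Φ (fun u =>
          f (p ++ c.2 y₁ :: u.map (tw c.1))) (y₂ ++ a :: w.map (tw 0))) q) x) := by
      intro x a w
      simp only [brace_cons, splitSum_append_cons, splitSum_add, splitSum_map, h1, smul_splitSum]
      rw [add_comm _ (splitSum _ w), add_comm (splitSum _ x) (splitSum _ x)]
    have e1 : splitSum (fun x r => splitSum (fun y' w => sgn R₀ (braceDeg Φ) • splitSum
        (fun p q => splitSum (fun y z => brace Φ (fun u => f (x ++ A.μ y' :: p.map (tw 0) ++
          c.2 (y.map (tw 0)) :: u.map (tw (c.1 + 1)))) z) q) w) r) l =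
        sgn R₀ (braceDeg (c :: Φ)) • brace ((0, A.μ) :: c :: Φ) f l := by
      simp only [brace_cons, smul_splitSum]
      refine splitSum_congr fun x r _ => splitSum_congr fun y' w _ => splitSum_congr fun p q _ =>
        splitSum_congr fun y z _ => ?_
      have e : ∀ u : List (ExtAlg R₀ V), (u.map (tw c.1)).map (tw 0) = u.map (tw (c.1 + 1)) :=
        fun u => by
          have := tw_map_map (c.1 - 1) 1 u
          rwa [sub_add_cancel, show (1 + 1 : ZMod 2) = 0 from by decide, add_comm 1,
            sub_add_cancel] at this
      have h5 : ∀ u, f (x ++ A.μ y' :: (p.map (tw 0) ++ sgn R₀ (c.1 - 1) • tw 0 (c.2 y) :: u)) =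
          sgn R₀ (c.1 - 1) • f (x ++ A.μ y' :: (p.map (tw 0) ++ tw 0 (c.2 y) :: u)) := fun u => by
        simpa using hf.map_smul (x ++ A.μ y' :: p.map (tw 0)) u (sgn R₀ (c.1 - 1)) (tw 0 (c.2 y))
      rw [braceDeg_cons, sgn_add, mul_comm, mul_smul]
      simp only [h2, h5, brace_smul, List.map_append, List.map_cons, e,
        List.append_assoc, List.cons_append]
    have e2 : splitSum (fun x r => splitSum (fun y' w => sgn R₀ (braceDeg Φ) • splitSum
        (fun p q => splitSum (fun y z => brace Φ (fun u => f (p ++ c.2 (q ++ A.μ y' ::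
          y.map (tw 0)) :: u.map (tw (c.1 + 1)))) z) w) x) r) l =
        sgn R₀ (braceDeg Φ) • brace ((c.1 + 1, barD A c.2) :: Φ) f l := by
      have h4 : ∀ p Y z, brace Φ (fun u => f (p ++ barD A c.2 Y :: u.map (tw (c.1 + 1)))) z =
          splitSum (fun q s => splitSum (fun y' y => brace Φ (fun u => f (p ++ c.2 (q ++ A.μ y' ::
            y.map (tw 0)) :: u.map (tw (c.1 + 1)))) z) s) Y := fun p Y z => by
        change braceSlot hf Φ p (c.1 + 1) z (barD A c.2 Y) = _
        rw [barD_apply, map_splitSum]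
        exact splitSum_congr fun q s _ => map_splitSum _ _ _
      rw [brace_cons]
      simp only [← smul_splitSum]
      congr 1
      refine Eq.trans ?_ (splitSum_congr fun p r _ => ((splitSum_congr fun Y z _ =>
        h4 p Y z).trans (splitSum_assoc₃ _ r)).symm)
      refine Eq.trans ?_ (splitSum_assoc _ l)
      exact splitSum_congr fun x r _ => splitSum_comm (N := ExtAlg R₀ V) _ r x
    have e3 : splitSum (fun x r => splitSum (fun y' w => splitSum (fun p q => splitSum
        (fun y₁ y₂ => brace Φ (fun u => f (p ++ c.2 y₁ :: u.map (tw c.1)))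
          (y₂ ++ A.μ y' :: w.map (tw 0))) q) x) r) l =
        splitSum (fun p r => splitSum (fun y z =>
          barD A (brace Φ (fun u => f (p ++ c.2 y :: u.map (tw c.1)))) z) r) l := by
      simp only [barD_apply]
      refine Eq.trans ?_ (splitSum_congr fun p r _ => splitSum_assoc _ r)
      refine Eq.trans ?_ (splitSum_assoc _ l)
      refine splitSum_congr fun x r _ => ?_
      refine (splitSum_comm (N := ExtAlg R₀ V) _ r x).trans (splitSum_congr fun p q _ => ?_)
      exact splitSum_comm (N := ExtAlg R₀ V) _ r q
    rw [barD_apply]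
    simp only [h3, splitSum_add]
    rw [e1, e2, e3]
    simp only [fun x y z => ih (hf.twist x (c.2 y) c.1) hΦ' z, splitSum_add]
    rw [splitSum_cons, splitSum_cons]
    have e4 : splitSum (fun x r => splitSum (fun y z => splitSum (fun Φ' Φ'' =>
        sgn R₀ (braceDeg Φ'') • brace (Φ' ++ (0, A.μ) :: Φ'')
          (fun u => f (x ++ c.2 y :: u.map (tw c.1))) z) Φ) r) l =
        splitSum (fun Φ' Φ'' =>
          sgn R₀ (braceDeg Φ'') • brace (c :: Φ' ++ (0, A.μ) :: Φ'') f l) Φ := by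
      simp only [List.cons_append, brace_cons, smul_splitSum]
      refine Eq.trans ?_ (splitSum_comm (N := ExtAlg R₀ V) _ l Φ)
      exact splitSum_congr fun x r _ => splitSum_comm (N := ExtAlg R₀ V) _ r Φ
    have e5 : splitSum (fun x r => splitSum (fun y z => splitSum (fun Φ' Ψ => match Ψ with
        | [] => 0
        | c' :: Φ'' => sgn R₀ (braceDeg Φ'') • brace (Φ' ++ (c'.1 + 1, barD A c'.2) :: Φ'')
          (fun u => f (x ++ c.2 y :: u.map (tw c.1))) z) Φ) r) l =
        splitSum (fun Φ' Ψ => match Ψ with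
        | [] => 0
        | c' :: Φ'' => sgn R₀ (braceDeg Φ'') •
          brace (c :: Φ' ++ (c'.1 + 1, barD A c'.2) :: Φ'') f l) Φ := by
      refine Eq.trans (splitSum_congr fun x r _ => splitSum_comm (N := ExtAlg R₀ V) _ r Φ) ?_
      refine (splitSum_comm (N := ExtAlg R₀ V) _ l Φ).trans (splitSum_congr fun Φ' Ψ _ => ?_)
      cases Ψ with
      | nil => simp only [splitSum_zero]
      | cons c' Φ'' => simp only [List.cons_append, brace_cons, smul_splitSum]
    rw [e4, e5]
    simp only [List.nil_append]
    abel

end BraceIdentities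

/-! #### The Hochschild differential -/

section Hochschild

variable {R₀ V : Type*} [CommRing R₀] [AddCommGroup V] [Module R₀ V]
  {f : List (ExtAlg R₀ V) → ExtAlg R₀ V}

theorem brace_add_cochain (hf : IsMultilinear f)
    (Φ Ψ : List (ZMod 2 × (List (ExtAlg R₀ V) → ExtAlg R₀ V))) (p : ZMod 2)
    (φ ψ : List (ExtAlg R₀ V) → ExtAlg R₀ V) (l : List (ExtAlg R₀ V)) :
    brace (Φ ++ (p, fun l => φ l + ψ l) :: Ψ) f l =
      brace (Φ ++ (p, φ) :: Ψ) f l + brace (Φ ++ (p, ψ) :: Ψ) f l := by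
  induction Φ generalizing f l with
  | nil =>
    simp only [List.nil_append, brace_cons, ← splitSum_add]
    exact splitSum_congr fun x r _ => splitSum_congr fun y z _ =>
      (braceSlot hf Ψ x p z).map_add _ _
  | cons c Φ ih =>
    simp only [List.cons_append, brace_cons, ← splitSum_add]
    exact splitSum_congr fun x r _ => splitSum_congr fun y z _ => ih (hf.twist _ _ _) z

theorem brace_smul_cochain (hf : IsMultilinear f)
    (Φ Ψ : List (ZMod 2 × (List (ExtAlg R₀ V) → ExtAlg R₀ V))) (p : ZMod 2) (a : R₀)
    (φ : List (ExtAlg R₀ V) → ExtAlg R₀ V) (l : List (ExtAlg R₀ V)) :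
    brace (Φ ++ (p, fun l => a • φ l) :: Ψ) f l = a • brace (Φ ++ (p, φ) :: Ψ) f l := by
  induction Φ generalizing f l with
  | nil =>
    simp only [List.nil_append, brace_cons, smul_splitSum]
    exact splitSum_congr fun x r _ => splitSum_congr fun y z _ =>
      (braceSlot hf Ψ x p z).map_smul _ _
  | cons c Φ ih =>
    simp only [List.cons_append, brace_cons, smul_splitSum]
    exact splitSum_congr fun x r _ => splitSum_congr fun y z _ => ih (hf.twist _ _ _) z

theorem brace_zero_cochain (hf : IsMultilinear f)
    (Φ Ψ : List (ZMod 2 × (List (ExtAlg R₀ V) → ExtAlg R₀ V))) (p : ZMod 2)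
    (l : List (ExtAlg R₀ V)) : brace (Φ ++ (p, fun _ => 0) :: Ψ) f l = 0 := by
  simpa using brace_smul_cochain hf Φ Ψ p 0 (fun _ => 0) l

variable (A : SuperfilteredDeformation R₀ V)

theorem hochAux_eq (t : ZMod 2) (φ : List (ExtAlg R₀ V) → ExtAlg R₀ V) :
    hochAux A t φ =
      fun l => brace [(t, φ)] A.μ l + (-sgn R₀ (t - 1)) • barD A φ l := by
  funext l
  rw [hochAux, sumSplit_eq_splitSum, sumSplit_eq_splitSum, neg_smul, ← sub_eq_add_neg]
  rfl

theorem hochAux_apply (t : ZMod 2) (φ : List (ExtAlg R₀ V) → ExtAlg R₀ V)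
    (l : List (ExtAlg R₀ V)) :
    hochAux A t φ l = brace [(t, φ)] A.μ l + (-sgn R₀ (t - 1)) • barD A φ l := by
  rw [hochAux_eq]

theorem sgn_eq (R₀ : Type*) [CommRing R₀] (t : ZMod 2) : sgn R₀ t = 1 ∨ sgn R₀ t = -1 := by
  rcases zmod_two_cases t with rfl | rfl
  · exact Or.inl sgn_zero
  · exact Or.inr sgn_one

theorem zmod_two_sub_one (t : ZMod 2) : t - 1 = t + 1 := by revert t; decide

theorem sgn_add_one (t : ZMod 2) : sgn R₀ (t + 1) = -sgn R₀ t := by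
  rw [sgn_add, sgn_one, mul_neg_one]

theorem brace_hochAux (hf : IsMultilinear f)
    (Φ Ψ : List (ZMod 2 × (List (ExtAlg R₀ V) → ExtAlg R₀ V))) (p t : ZMod 2)
    (φ : List (ExtAlg R₀ V) → ExtAlg R₀ V) (l : List (ExtAlg R₀ V)) :
    brace (Φ ++ (p, hochAux A t φ) :: Ψ) f l =
      brace (Φ ++ (p, brace [(t, φ)] A.μ) :: Ψ) f l +
        sgn R₀ t • brace (Φ ++ (p, barD A φ) :: Ψ) f l := by
  rw [hochAux_eq, brace_add_cochain hf, brace_smul_cochain hf, zmod_two_sub_one, sgn_add_one,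
    neg_neg]

theorem isCochain_hochAux {t : ZMod 2} {φ : List (ExtAlg R₀ V) → ExtAlg R₀ V}
    (hφ : IsCochain (t, φ)) : IsCochain (t + 1, hochAux A t φ) := by
  have h1 := IsCochain.brace (Φ := [(t, φ)]) A.multilinear A.parity (by simpa using hφ)
  have h2 := IsCochain.brace (Φ := [((0 : ZMod 2), A.μ)]) hφ.multilinear hφ.parity
    (by simpa using isCochain_μ A)
  simp only [braceDeg_cons, braceDeg_nil, add_zero] at h1 h2
  rw [show (2 : ZMod 2) + (t - 1) = t + 1 from
    (by decide : ∀ t : ZMod 2, (2 : ZMod 2) + (t - 1) = t + 1) t] at h1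
  rw [zero_sub, ← sub_eq_add_neg, zmod_two_sub_one] at h2
  rw [hochAux_eq]
  exact ⟨h1.multilinear.add (h2.multilinear.smul _),
    fun l hl => add_mem (h1.parity l hl) (Submodule.smul_mem _ _ (h2.parity l hl))⟩

/-- The bar differential squares to zero: this is the `A_∞`-equation, read as an identity for
the brace of `μ` with itself. -/
theorem barD_barD (hf : IsMultilinear f) (l : List (ExtAlg R₀ V)) :
    barD A (barD A f) l = 0 := by
  have h := barD_brace A (Φ := [((0 : ZMod 2), A.μ)]) hf (by simpa using isCochain_μ A) l
  change barD A (barD A f) l = _ at h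
  rw [h]
  simp only [splitSum_cons, splitSum_nil, List.nil_append, List.cons_append, braceDeg_cons,
    braceDeg_nil, barD_μ]
  have h0 := brace_zero_cochain hf [] [] 1 l
  rw [List.nil_append] at h0
  simp [h0, sgn_zero, sgn_one]

theorem barD_add_smul (φ ψ : List (ExtAlg R₀ V) → ExtAlg R₀ V) (a : R₀) (l : List (ExtAlg R₀ V)) :
    barD A (fun l => φ l + a • ψ l) l = barD A φ l + a • barD A ψ l := by
  simp only [barD, brace_add, brace_smul]

/-- The Hochschild differential squares to zero. -/
theorem hochAux_hochAux {t : ZMod 2} {φ : List (ExtAlg R₀ V) → ExtAlg R₀ V}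
    (hφ : IsCochain (t, φ)) (l : List (ExtAlg R₀ V)) :
    hochAux A (t + 1) (hochAux A t φ) l = 0 := by
  have hΦ : ∀ c ∈ [(t, φ)], IsCochain c := by simpa using hφ
  have h1 := brace_barD A A.multilinear hΦ l
  have h2 := barD_brace A A.multilinear hΦ l
  have h3 := brace_hochAux A A.multilinear [] [] (t + 1) t φ l
  rw [barD_μ, brace_zero] at h1
  simp only [splitSum_cons, splitSum_nil, List.nil_append, List.cons_append, braceDeg_cons,
    braceDeg_nil, add_zero, zmod_two_sub_one, sgn_add_one, sgn_zero, one_smul, brace_nil]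
    at h1 h2 h3
  have h4 : barD A (hochAux A t φ) l = barD A (brace [(t, φ)] A.μ) l := by
    rw [hochAux_eq, barD_add_smul, barD_barD A hφ.multilinear, smul_zero, add_zero]
  rw [hochAux_apply, h4, h3, h2, zmod_two_sub_one, sgn_add_one, sgn_add_one]
  rcases sgn_eq R₀ t with h | h <;> simp only [h] at h1 ⊢ <;>
    linear_combination (norm := module) -h1

/-- The Hochschild differential is a derivation for the brace `μ{φ, ψ}`. -/
theorem hochAux_brace_two {p q : ZMod 2} {φ ψ : List (ExtAlg R₀ V) → ExtAlg R₀ V}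
    (hφ : IsCochain (p, φ)) (hψ : IsCochain (q, ψ)) (l : List (ExtAlg R₀ V)) :
    hochAux A (p + q) (brace [(p, φ), (q, ψ)] A.μ) l =
      -brace [(p + 1, hochAux A p φ), (q, ψ)] A.μ l +
        sgn R₀ p • brace [(p, φ), (q + 1, hochAux A q ψ)] A.μ l := by
  have hΦ : ∀ c ∈ [(p, φ), (q, ψ)], IsCochain c := by simpa using ⟨hφ, hψ⟩
  have h1 := brace_barD A A.multilinear hΦ l
  have h2 := barD_brace A A.multilinear hΦ l
  have h3 := brace_hochAux A A.multilinear [] [(q, ψ)] (p + 1) p φ l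
  have h4 := brace_hochAux A A.multilinear [(p, φ)] [] (q + 1) q ψ l
  rw [barD_μ, brace_zero] at h1
  have e : p + 1 + (q + 1) = p + q := by
    rw [add_add_add_comm, show (1 + 1 : ZMod 2) = 0 from by decide, add_zero]
  simp only [splitSum_cons, splitSum_nil, List.nil_append, List.cons_append, braceDeg_cons,
    braceDeg_nil, add_zero, zmod_two_sub_one, e, sgn_add, sgn_zero, sgn_one, mul_one, one_smul,
    brace_nil] at h1 h2 h3 h4
  rw [hochAux_apply, h2, h3, h4, zmod_two_sub_one, sgn_add_one, sgn_add]
  rcases sgn_eq R₀ p with h | h <;> rcases sgn_eq R₀ q with h' | h' <;>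
    simp only [h, h'] at h1 ⊢ <;> linear_combination (norm := module) -h1

/-- The brace `μ{φ, ψ, χ}` is a homotopy for the associativity of the product `μ{φ, ψ}`. -/
theorem hochAux_brace_three {p q r : ZMod 2} {φ ψ χ : List (ExtAlg R₀ V) → ExtAlg R₀ V}
    (hφ : IsCochain (p, φ)) (hψ : IsCochain (q, ψ)) (hχ : IsCochain (r, χ))
    (l : List (ExtAlg R₀ V)) :
    hochAux A (p + q + r + 1) (brace [(p, φ), (q, ψ), (r, χ)] A.μ) l +
      brace [(p + 1, hochAux A p φ), (q, ψ), (r, χ)] A.μ l -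
      sgn R₀ p • brace [(p, φ), (q + 1, hochAux A q ψ), (r, χ)] A.μ l +
      (sgn R₀ p * sgn R₀ q) • brace [(p, φ), (q, ψ), (r + 1, hochAux A r χ)] A.μ l +
      brace [(p + q, brace [(p, φ), (q, ψ)] A.μ), (r, χ)] A.μ l -
      sgn R₀ p • brace [(p, φ), (q + r, brace [(q, ψ), (r, χ)] A.μ)] A.μ l = 0 := by
  have hΦ : ∀ c ∈ [(p, φ), (q, ψ), (r, χ)], IsCochain c := by simpa using ⟨hφ, hψ, hχ⟩
  have h1 := brace_barD A A.multilinear hΦ l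
  have h2 := barD_brace A A.multilinear hΦ l
  have h3 := brace_hochAux A A.multilinear [] [(q, ψ), (r, χ)] (p + 1) p φ l
  have h4 := brace_hochAux A A.multilinear [(p, φ)] [(r, χ)] (q + 1) q ψ l
  have h5 := brace_hochAux A A.multilinear [(p, φ), (q, ψ)] [] (r + 1) r χ l
  rw [barD_μ, brace_zero] at h1
  have e : ∀ p q : ZMod 2, p + 1 + (q + 1) = p + q := by decide
  have e' : p + 1 + (q + r) = p + q + r + 1 := by ring
  simp only [splitSum_cons, splitSum_nil, List.nil_append, List.cons_append, braceDeg_cons,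
    braceDeg_nil, add_zero, zmod_two_sub_one, e, e', sgn_add, sgn_zero, sgn_one, mul_one, one_smul,
    brace_nil] at h1 h2 h3 h4 h5
  rw [hochAux_apply, h2, h3, h4, h5, zmod_two_sub_one, sgn_add_one, sgn_add_one, sgn_add, sgn_add]
  rcases sgn_eq R₀ p with h | h <;> rcases sgn_eq R₀ q with h' | h' <;>
    rcases sgn_eq R₀ r with h'' | h'' <;>
    simp only [h, h', h''] at h1 ⊢ <;> linear_combination (norm := module) -h1

end Hochschild

/-! ### The reduced Hochschild complex -/

section Reduced

variable {R₀ V : Type*} [CommRing R₀] [AddCommGroup V] [Module R₀ V]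

/-- The operation vanishes if some entry is the unit. -/
def IsReduced (f : List (ExtAlg R₀ V) → ExtAlg R₀ V) : Prop := ∀ x z, f (x ++ 1 :: z) = 0

theorem one_mem_parityPart : (1 : ExtAlg R₀ V) ∈ parityPart R₀ V 0 :=
  SetLike.one_mem_graded (parityPart R₀ V)

theorem tw_one_eq (t : ZMod 2) : tw t (1 : ExtAlg R₀ V) = sgn R₀ (t - 1) • 1 := by
  rw [tw_of_mem t one_mem_parityPart]
  congr 2
  revert t; decide

theorem IsReduced.algebraMap {f : List (ExtAlg R₀ V) → ExtAlg R₀ V} (hr : IsReduced f)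
    (hf : IsMultilinear f) (x : List (ExtAlg R₀ V)) (c : R₀) (z : List (ExtAlg R₀ V)) :
    f (x ++ algebraMap R₀ (ExtAlg R₀ V) c :: z) = 0 := by
  rw [Algebra.algebraMap_eq_smul_one, hf.map_smul, hr, smul_zero]

theorem mem_redCochains {φ : Ops R₀ V} :
    φ ∈ redCochains R₀ V ↔ ∀ t, IsCochain (t, φ t) ∧ IsReduced (φ t) := by
  constructor
  · intro h t
    obtain ⟨h1, h2, h3⟩ := h t
    exact ⟨⟨h1, h2⟩, fun x z => by simpa using h3 x 1 z⟩
  · intro h t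
    obtain ⟨h1, h2⟩ := h t
    exact ⟨h1.multilinear, h1.parity, fun x c z => h2.algebraMap h1.multilinear x c z⟩

theorem brace_congr {f g : List (ExtAlg R₀ V) → ExtAlg R₀ V}
    {Φ : List (ZMod 2 × (List (ExtAlg R₀ V) → ExtAlg R₀ V))}
    (h : ∀ u, Φ.length ≤ u.length → f u = g u) (l : List (ExtAlg R₀ V)) :
    brace Φ f l = brace Φ g l := by
  induction Φ generalizing f g l with
  | nil => exact h l (Nat.zero_le _)
  | cons c Φ ih =>
    rw [brace_cons, brace_cons]
    refine splitSum_congr fun x r _ => splitSum_congr fun y z _ => ih (fun u hu => h _ ?_) z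
    simp only [List.length_append, List.length_cons, List.length_map]
    omega

/-- A brace of reduced operations is reduced as soon as its outer operation vanishes on lists of
length at least `N` with an entry `1`: when the unit is an entry of the outer operation, the
inserted operations provide at least `Φ.length` further entries. -/
theorem brace_unit {f : List (ExtAlg R₀ V) → ExtAlg R₀ V}
    {Φ : List (ZMod 2 × (List (ExtAlg R₀ V) → ExtAlg R₀ V))} (hf : IsMultilinear f) (N : ℕ)
    (hN : N ≤ Φ.length + 1) (h : ∀ a b, N ≤ a.length + b.length + 1 → f (a ++ 1 :: b) = 0)
    (hΦ : ∀ c ∈ Φ, IsReduced c.2) : IsReduced (brace Φ f) := by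
  induction Φ generalizing f N with
  | nil => exact fun x z => h x z (by simp at hN; omega)
  | cons c Φ ih =>
    intro x z
    rw [List.length_cons] at hN
    simp only [brace_cons, splitSum_append_cons]
    rw [splitSum_eq_zero, splitSum_eq_zero, add_zero]
    · intro p q _
      refine splitSum_eq_zero fun y w _ => ?_
      rw [brace_congr (g := fun _ => 0), brace_zero]
      intro u hu
      have := h x (p ++ c.2 y :: u.map (tw c.1)) (by
        simp only [List.length_append, List.length_cons, List.length_map]; omega)
      simpa using this
    · intro p q _
      rw [splitSum_eq_zero, splitSum_eq_zero, add_zero]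
      · intro y w _
        rw [hΦ c (by simp)]
        simp only [hf.map_zero, brace_zero]
      · intro y w _
        refine ih (hf.twist _ _ _) (N - 1) (by omega) (fun a b hab => ?_)
          (fun c hc => hΦ c (by simp [hc])) w z
        rw [List.map_append, List.map_cons, tw_one_eq]
        have h1 := hf.map_smul (p ++ c.2 y :: a.map (tw c.1)) (b.map (tw c.1))
          (sgn R₀ (c.1 - 1)) 1
        rw [h _ _ (by simp only [List.length_append, List.length_cons, List.length_map]; omega),
          smul_zero] at h1
        simpa using h1

theorem splitSum_append_singleton {α N : Type*} [AddCommMonoid N] (G : List α → List α → N)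
    (h : ∀ x y, 2 ≤ y.length → G x y = 0) (x : List α) (a : α) :
    splitSum G (x ++ [a]) = G x [a] + G (x ++ [a]) [] := by
  rw [splitSum_append_cons, splitSum_nil, splitSum_eq_right]
  · rfl
  · intro p q hq _
    refine h _ _ ?_
    have := List.length_pos_of_ne_nil hq
    simp only [List.length_append, List.length_cons, List.length_nil]
    omega

variable (A : SuperfilteredDeformation R₀ V) {t : ZMod 2}
  {φ : List (ExtAlg R₀ V) → ExtAlg R₀ V}

/-- By strict unitality the only surviving terms multiply the unit with a neighbouring entry. An
entry between two neighbours contributes twice with opposite signs, so only the ends of the list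
remain. -/
theorem barD_unit (hφ : IsCochain (t, φ)) (hr : IsReduced φ) (x z : List (ExtAlg R₀ V)) :
    barD A φ (x ++ 1 :: z) =
      (if x = [] then 0 else φ (x ++ z.map (tw 0))) -
        (if z = [] then 0 else φ (x ++ z.map (tw 0))) := by
  have hm : IsMultilinear φ := hφ.multilinear
  have h1 : ∀ x₁ x₂ : List (ExtAlg R₀ V), splitSum (fun w₁ w₂ =>
      φ (x₁ ++ A.μ (x₂ ++ 1 :: w₁) :: w₂.map (tw 0))) z =
      if x₂ = [] then (if z = [] then 0 else -φ (x₁ ++ z.map (tw 0))) else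
        if x₂.length = 1 then φ (x₁ ++ x₂ ++ z.map (tw 0)) else 0 := by
    intro x₁ x₂
    rcases x₂ with _ | ⟨a, _ | ⟨b, x₂⟩⟩
    · rcases z with _ | ⟨c, z⟩
      · simp [splitSum_nil, A.one, hm.map_zero]
      · rw [splitSum_cons, splitSum_eq_left]
        · have h2 := hm.map_neg x₁ (z.map (tw 0)) (eps c)
          have h3 : tw 0 c = -eps c := by rw [tw_zero, LinearMap.neg_apply]
          simp [A.one, hm.map_zero, A.unit_left, h2, h3]
        · intro p q hp _
          have := A.unit_higher [] (c :: p) (by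
            have := List.length_pos_of_ne_nil hp
            simp only [List.length_cons, List.length_nil]; omega)
          rw [this, hm.map_zero]
    · rw [splitSum_eq_left]
      · simp [A.unit_right]
      · intro p q hp _
        rw [A.unit_higher, hm.map_zero]
        have := List.length_pos_of_ne_nil hp
        simp only [List.length_cons, List.length_nil]; omega
    · rw [splitSum_eq_zero]
      · simp
      · intro p q _
        rw [A.unit_higher, hm.map_zero]
        simp only [List.length_cons]; omega
  have h3 : ∀ x₁ (a : ExtAlg R₀ V) x₃ w,
      φ (x₁ ++ a :: (x₃ ++ (1 : ExtAlg R₀ V) :: w).map (tw 0)) = 0 := by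
    intro x₁ a x₃ w
    rw [List.map_append, List.map_cons, tw_one_eq]
    have h1 := hm.map_smul (x₁ ++ a :: x₃.map (tw 0)) (w.map (tw 0)) (sgn R₀ (0 - 1)) 1
    rw [hr, smul_zero] at h1
    simpa using h1
  have h4 : ∀ w₁ a w₃, φ (x ++ (1 : ExtAlg R₀ V) :: (w₁ ++ a :: w₃)) = 0 :=
    fun w₁ a w₃ => hr x _
  rw [barD_append_cons]
  simp only [h3, h4, splitSum_zero, zero_add, add_zero, h1]
  rcases List.eq_nil_or_concat' x with rfl | ⟨x, a, rfl⟩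
  · by_cases hz : z = [] <;> simp [splitSum_nil, hz]
  · rw [splitSum_append_singleton]
    · by_cases hz : z = [] <;> simp [hz]
    · intro p q hq
      have : q ≠ [] := by rintro rfl; simp at hq
      rw [if_neg this, if_neg (by omega)]

/-- The boundary terms of `barD_unit` reappear here, which makes the Hochschild differential of a
reduced cochain reduced. -/
theorem brace_one_unit (hφ : IsCochain (t, φ)) (hr : IsReduced φ) (x z : List (ExtAlg R₀ V)) :
    brace [(t, φ)] A.μ (x ++ 1 :: z) =
      (if z = [] then sgn R₀ (t - 1) • φ (x ++ z.map (tw 0)) else 0) -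
        (if x = [] then sgn R₀ (t - 1) • φ (x ++ z.map (tw 0)) else 0) := by
  have h1 : ∀ p y : List (ExtAlg R₀ V), ∀ a, A.μ (p ++ a :: (y ++ 1 :: z).map (tw t)) =
      if p = [] ∧ y = [] ∧ z = [] then sgn R₀ (t - 1) • a else 0 := by
    intro p y a
    rw [List.map_append, List.map_cons, tw_one_eq]
    have h2 := A.multilinear.map_smul (p ++ a :: y.map (tw t)) (z.map (tw t))
      (sgn R₀ (t - 1)) 1
    simp only [List.append_assoc, List.cons_append] at h2
    rw [h2]
    split_ifs with h
    · obtain ⟨rfl, rfl, rfl⟩ := h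
      simp [A.unit_right]
    · have h3 := A.unit_higher (p ++ a :: y.map (tw t)) (z.map (tw t)) (by
        simp only [← List.length_eq_zero_iff] at h
        simp only [List.length_append, List.length_cons, List.length_map]
        omega)
      simp only [List.append_assoc, List.cons_append] at h3
      rw [h3, smul_zero]
  have h2 : ∀ p y w : List (ExtAlg R₀ V), ∀ a, A.μ (x ++ 1 :: (p ++ a :: w)) =
      if x = [] ∧ p = [] ∧ w = [] then eps a else 0 := by
    intro p y w a
    split_ifs with h
    · obtain ⟨rfl, rfl, rfl⟩ := h
      simp [A.unit_left]
    · refine A.unit_higher _ _ ?_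
      simp only [← List.length_eq_zero_iff] at h
      simp only [List.length_append, List.length_cons]
      omega
  have h3 : ∀ p q y, brace ([] : List (ZMod 2 × (List (ExtAlg R₀ V) → ExtAlg R₀ V)))
      (fun u => A.μ (p ++ φ (q ++ 1 :: y) :: u.map (tw t))) = fun _ => 0 := fun p q y => by
    simp only [hr q y, A.multilinear.map_zero, brace_zero]
  simp only [brace_cons, splitSum_append_cons, h3, splitSum_zero, add_zero]
  simp only [brace_nil, h1, List.append_assoc, List.cons_append, h2 _ []]
  refine Eq.trans (congrArg₂ (fun a c : ExtAlg R₀ V => a + c) ?_ ?_) (sub_eq_add_neg _ _).symm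
  · rw [splitSum_eq_left, splitSum_eq_right]
    · by_cases hz : z = [] <;> simp [hz]
    · exact fun p q hq _ => if_neg fun h => hq h.2.1
    · exact fun p q hp _ => splitSum_eq_zero fun y w _ => if_neg fun h => hp h.1
  · rw [splitSum_eq_left, splitSum_eq_right]
    · by_cases hx : x = []
      · have h4 := hφ.parity.tw_apply hφ.multilinear 0 z
        have h5 : (0 - 1) * (t - 1) = t - 1 := by
          rcases zmod_two_cases t with rfl | rfl <;> decide
        have h6 : eps (φ z) = -tw 0 (φ z) := by rw [tw_zero, LinearMap.neg_apply, neg_neg]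
        rw [h5] at h4
        rw [if_pos hx, if_pos ⟨hx, rfl, rfl⟩, h6, h4, hx]
        rfl
      · rw [if_neg hx, if_neg fun h => hx h.1, neg_zero]
    · exact fun p q hq _ => if_neg fun h => hq (by simpa using h.2.2)
    · exact fun p q hp _ => splitSum_eq_zero fun y w _ => if_neg fun h => hp h.2.1

theorem isReduced_hochAux (hφ : IsCochain (t, φ)) (hr : IsReduced φ) :
    IsReduced (hochAux A t φ) := by
  intro x z
  rw [hochAux_apply, barD_unit A hφ hr, brace_one_unit A hφ hr]
  by_cases hx : x = [] <;> by_cases hz : z = [] <;> simp [hx, hz]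

end Reduced

/-! #### Differential, cup product and unit -/

section Reduced

variable {R₀ V : Type*} [CommRing R₀] [AddCommGroup V] [Module R₀ V]
  (A : SuperfilteredDeformation R₀ V) {p q t : ZMod 2}
  {φ ψ : List (ExtAlg R₀ V) → ExtAlg R₀ V}

theorem hochD_apply (φ : Ops R₀ V) (t : ZMod 2) :
    hochD A φ t = hochAux A (t - 1) (φ (t - 1)) := rfl

theorem hochD_apply_add_one (φ : Ops R₀ V) (t : ZMod 2) :
    hochD A φ (t + 1) = hochAux A t (φ t) := by
  rw [hochD_apply, add_sub_cancel_right]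

theorem hochAux_add_smul (a : R₀) :
    hochAux A t (fun l => φ l + a • ψ l) = fun l => hochAux A t φ l + a • hochAux A t ψ l := by
  funext l
  have h1 := brace_add_cochain A.multilinear [] [] t φ (fun l => a • ψ l) l
  have h2 := brace_smul_cochain A.multilinear [] [] t a ψ l
  rw [List.nil_append] at h1 h2
  simp only [List.nil_append] at h1 h2
  simp only [hochAux_apply, barD_add_smul, h1, h2]
  module

theorem hochAux_smul (a : R₀) : hochAux A t (fun l => a • φ l) = fun l => a • hochAux A t φ l := by
  funext l
  have h2 := brace_smul_cochain A.multilinear [] [] t a φ l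
  simp only [List.nil_append] at h2
  simp only [hochAux_apply, h2, barD, brace_smul]
  module

theorem hochAux_zero : hochAux A t (fun _ => 0) = fun _ => 0 := by
  simpa using hochAux_smul A (t := t) (φ := fun _ => 0) 0

/-- The cup product is a brace, up to sign. -/
theorem cupAux_eq (hψ : IsCochain (q, ψ)) (φ : List (ExtAlg R₀ V) → ExtAlg R₀ V) :
    cupAux A p q φ ψ =
      fun l => (sgn R₀ q * sgn R₀ ((p - 1) * (q - 1))) • brace [(p, φ), (q, ψ)] A.μ l := by
  funext l
  rw [cupAux, mul_smul]
  congr 1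
  simp only [sumSplit_eq_splitSum, brace_cons, brace_nil, smul_splitSum]
  refine splitSum_congr fun x r _ => splitSum_congr fun y s _ => splitSum_congr fun z s _ =>
    splitSum_congr fun w u _ => ?_
  have h1 := hψ.parity.tw_apply hψ.multilinear p w
  have h2 := A.multilinear.map_smul (x ++ φ y :: z.map (tw p)) ((u.map (tw q)).map (tw p))
    (sgn R₀ ((p - 1) * (q - 1))) (ψ (w.map (tw p)))
  simp only at h1
  rw [List.map_append, List.map_cons, h1, tw_map_comm p q u]
  simp only [List.append_assoc, List.cons_append] at h2
  rw [h2, smul_smul, sgn_mul_self, one_smul]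

theorem cup_apply (φ ψ : Ops R₀ V) (t : ZMod 2) :
    cup A φ ψ t = ∑ p, cupAux A p (t - p) (φ p) (ψ (t - p)) := rfl

theorem isCochain_brace_two (hφ : IsCochain (p, φ)) (hψ : IsCochain (q, ψ)) :
    IsCochain (p + q, brace [(p, φ), (q, ψ)] A.μ) := by
  have h := IsCochain.brace (Φ := [(p, φ), (q, ψ)]) A.multilinear A.parity
    (by simpa using ⟨hφ, hψ⟩)
  have h1 : (2 : ZMod 2) + (p - 1 + (q - 1 + 0)) = p + q :=
    (by decide : ∀ p q : ZMod 2, (2 : ZMod 2) + (p - 1 + (q - 1 + 0)) = p + q) p q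
  rwa [braceDeg_cons, braceDeg_cons, braceDeg_nil, h1] at h

theorem isReduced_brace_two (hφ : IsReduced φ) (hψ : IsReduced ψ) :
    IsReduced (brace [(p, φ), (q, ψ)] A.μ) :=
  brace_unit A.multilinear 3 (by simp) (fun a b h => A.unit_higher a b (by omega))
    (by simpa using ⟨hφ, hψ⟩)

theorem isReduced_brace_three {r : ZMod 2} {χ : List (ExtAlg R₀ V) → ExtAlg R₀ V}
    (hφ : IsReduced φ) (hψ : IsReduced ψ) (hχ : IsReduced χ) :
    IsReduced (brace [(p, φ), (q, ψ), (r, χ)] A.μ) :=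
  brace_unit A.multilinear 3 (by simp) (fun a b h => A.unit_higher a b (by omega))
    (by simpa using ⟨hφ, hψ, hχ⟩)

theorem hochD_mem {φ : Ops R₀ V} (h : φ ∈ redCochains R₀ V) : hochD A φ ∈ redCochains R₀ V := by
  rw [mem_redCochains] at h ⊢
  intro t
  have h1 := isCochain_hochAux A (h (t - 1)).1
  rw [sub_add_cancel] at h1
  exact ⟨h1, isReduced_hochAux A (h (t - 1)).1 (h (t - 1)).2⟩

theorem hochD_hochD {φ : Ops R₀ V} (h : φ ∈ redCochains R₀ V) : hochD A (hochD A φ) = 0 := by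
  rw [mem_redCochains] at h
  funext t l
  have := hochAux_hochAux A (h (t - 1 - 1)).1 l
  rw [sub_add_cancel] at this
  exact this

theorem cup_mem {φ ψ : Ops R₀ V} (hφ : φ ∈ redCochains R₀ V) (hψ : ψ ∈ redCochains R₀ V) :
    cup A φ ψ ∈ redCochains R₀ V := by
  have key : ∀ t p, ∃ χ : Ops R₀ V, χ ∈ redCochains R₀ V ∧
      χ t = cupAux A p (t - p) (φ p) (ψ (t - p)) := by
    intro t p
    rw [mem_redCochains] at hφ hψ
    refine ⟨Pi.single t (cupAux A p (t - p) (φ p) (ψ (t - p))), ?_, Pi.single_eq_same _ _⟩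
    have h0 := mem_redCochains.1 (zero_mem (redCochains R₀ V))
    rw [mem_redCochains]
    intro s
    by_cases hs : s = t
    · subst hs
      rw [Pi.single_eq_same, cupAux_eq A (hψ _).1]
      have h1 := isCochain_brace_two A (hφ p).1 (hψ (s - p)).1
      have h2 := isReduced_brace_two (p := p) (q := s - p) A (hφ p).2 (hψ (s - p)).2
      rw [add_sub_cancel] at h1
      exact ⟨⟨h1.multilinear.smul _, fun l hl => Submodule.smul_mem _ _ (h1.parity l hl)⟩,
        fun x z => by simp only [h2 x z, smul_zero]⟩
    · rw [Pi.single_eq_of_ne hs]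
      exact h0 s
  intro t
  choose χ hχ h using key t
  have := sum_mem fun p (_ : p ∈ Finset.univ) => hχ p
  have h1 := this t
  rw [Finset.sum_apply] at h1
  simp only [h] at h1
  exact h1

theorem hochOne_zero : hochOne R₀ V 0 = fun l => if l = [] then 1 else 0 := by
  funext l; simp [hochOne]

theorem hochOne_one : hochOne R₀ V 1 = fun _ => 0 := by
  funext l; simp [hochOne]

theorem hochOne_mem : hochOne R₀ V ∈ redCochains R₀ V := by
  intro t
  rcases zmod_two_cases t with rfl | rfl
  · rw [hochOne_zero]
    refine ⟨⟨by simp, by simp⟩, fun l hl => ?_, by simp⟩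
    rcases l with _ | ⟨a, l⟩
    · simpa using one_mem_parityPart
    · simp
  · exact (hochOne_one (R₀ := R₀) (V := V)).symm ▸ (zero_mem (redCochains R₀ V)) 1

theorem hochD_hochOne : hochD A (hochOne R₀ V) = 0 := by
  funext t l
  obtain ⟨s, rfl⟩ : ∃ s, t = s + 1 := ⟨t - 1, by simp⟩
  rw [hochD_apply_add_one]
  rcases zmod_two_cases s with rfl | rfl
  · rw [hochOne_zero, hochAux_apply]
    have h1 : barD A (fun l : List (ExtAlg R₀ V) =>
        if l = [] then (1 : ExtAlg R₀ V) else 0) l = 0 := by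
      rw [barD_apply]
      simp [splitSum_zero]
    have h2 : ∀ x r, splitSum (fun y z =>
        A.μ (x ++ (if y = [] then 1 else 0) :: z.map (tw 0))) r = A.μ (x ++ 1 :: r.map (tw 0)) := by
      intro x r
      rw [splitSum_eq_left]
      · simp
      · intro y z hy _
        rw [if_neg hy, A.multilinear.map_zero]
    rw [h1, smul_zero, add_zero]
    simp only [brace_cons, brace_nil, h2]
    rcases l with _ | ⟨a, _ | ⟨c, l⟩⟩
    · simp [splitSum_nil, A.one]
    · have := A.multilinear.map_neg [1] [] (eps a)
      have h3 : tw 0 a = -eps a := by rw [tw_zero, LinearMap.neg_apply]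
      simp only [List.cons_append, List.nil_append] at this
      simp [splitSum_cons, splitSum_nil, h3, this, A.unit_left, A.unit_right, eps_eps]
    · refine splitSum_eq_zero fun x r h => A.unit_higher _ _ ?_
      have := congrArg List.length h
      simp only [List.length_append, List.length_cons, List.length_map] at this ⊢
      omega
  · rw [hochOne_one, hochAux_zero]
    rfl

theorem mem_hochCocycles {φ : Ops R₀ V} : φ ∈ cocycles (redCochains R₀ V) (hochD A) ↔
    φ ∈ redCochains R₀ V ∧ ∀ t, hochAux A t (φ t) = fun _ => 0 := by
  constructor
  · rintro ⟨h1, h2⟩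
    refine ⟨h1, fun t => ?_⟩
    rw [← hochD_apply_add_one]
    exact congrFun h2 (t + 1)
  · rintro ⟨h1, h2⟩
    exact ⟨h1, funext fun t => h2 (t - 1)⟩

/-- The cup product of two cocycles is a cocycle. -/
theorem hochAux_cupAux {p q : ZMod 2} {φ ψ : List (ExtAlg R₀ V) → ExtAlg R₀ V}
    (hφ : IsCochain (p, φ)) (hψ : IsCochain (q, ψ)) (h1 : hochAux A p φ = fun _ => 0)
    (h2 : hochAux A q ψ = fun _ => 0) : hochAux A (p + q) (cupAux A p q φ ψ) = fun _ => 0 := by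
  rw [cupAux_eq A hψ, hochAux_smul]
  funext l
  have h3 := hochAux_brace_two A hφ hψ l
  have h4 := brace_zero_cochain A.multilinear [] [(q, ψ)] (p + 1) l
  have h5 := brace_zero_cochain A.multilinear [(p, φ)] [] (q + 1) l
  simp only [List.nil_append, List.cons_append] at h4 h5
  rw [h1, h2, h4, h5] at h3
  rw [h3]
  simp

theorem cup_mem_cocycles {φ ψ : Ops R₀ V} (hφ : φ ∈ cocycles (redCochains R₀ V) (hochD A))
    (hψ : ψ ∈ cocycles (redCochains R₀ V) (hochD A)) :
    cup A φ ψ ∈ cocycles (redCochains R₀ V) (hochD A) := by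
  rw [mem_hochCocycles] at hφ hψ ⊢
  refine ⟨cup_mem A hφ.1 hψ.1, fun t => ?_⟩
  have h1 := mem_redCochains.1 hφ.1
  have h2 := mem_redCochains.1 hψ.1
  have h3 : ∀ p, hochAux A t (cupAux A p (t - p) (φ p) (ψ (t - p))) = fun _ => 0 := fun p => by
    have := hochAux_cupAux A (h1 p).1 (h2 (t - p)).1 (hφ.2 p) (hψ.2 (t - p))
    rwa [add_sub_cancel] at this
  have h5 : cup A φ ψ t = fun l => cupAux A 0 (t - 0) (φ 0) (ψ (t - 0)) l +
      (1 : R₀) • cupAux A 1 (t - 1) (φ 1) (ψ (t - 1)) l := by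
    funext l
    rw [cup_apply, one_smul]
    exact congrFun (Fin.sum_univ_two (fun p : ZMod 2 => cupAux A p (t - p) (φ p) (ψ (t - p)))) l
  rw [h5, hochAux_add_smul A, h3, h3]
  simp

end Reduced

/-! ### Sums over words in the coordinates -/

section Series

variable {R₀ V : Type*} [CommRing R₀] [AddCommGroup V] [Module R₀ V] {n : ℕ}

theorem coeffE_ext {a c : ExtSeries R₀ V n} (h : ∀ m, coeffE m a = coeffE m c) : a = c :=
  funext h

theorem coeffE_series (f : (Fin n →₀ ℕ) → ExtAlg R₀ V) (m : Fin n →₀ ℕ) :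
    coeffE m (series f) = f m := rfl

/-- The coefficient of a monomial, as an additive map. -/
def coeffHom (m : Fin n →₀ ℕ) : ExtSeries R₀ V n →+ ExtAlg R₀ V :=
  AddMonoidHom.mk' (coeffE m) (coeffE_add m)

theorem coeffE_sum {ι : Type*} (m : Fin n →₀ ℕ) (s : Finset ι) (F : ι → ExtSeries R₀ V n) :
    coeffE m (∑ i ∈ s, F i) = ∑ i ∈ s, coeffE m (F i) := map_sum (coeffHom m) F s

theorem coeffE_zero (m : Fin n →₀ ℕ) : coeffE m (0 : ExtSeries R₀ V n) = 0 :=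
  map_zero (coeffHom m)

theorem coeffE_sub (m : Fin n →₀ ℕ) (a c : ExtSeries R₀ V n) :
    coeffE m (a - c) = coeffE m a - coeffE m c := map_sub (coeffHom m) a c

theorem coeffE_const (m : Fin n →₀ ℕ) (e : ExtAlg R₀ V) :
    coeffE m (const n e) = if m = 0 then e else 0 := MvPowerSeries.coeff_C m e

/-- An element of `E_R` as a power series over the ring `E`. -/
def toSeries (a : ExtSeries R₀ V n) : MvPowerSeries (Fin n) (ExtAlg R₀ V) := a

theorem toSeries_smul (r : MvPowerSeries (Fin n) R₀) (a : ExtSeries R₀ V n) :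
    toSeries (r • a) = MvPowerSeries.map (σ := Fin n) (algebraMap R₀ (ExtAlg R₀ V)) r *
      toSeries a := rfl

theorem coeffE_X_smul (m : Fin n →₀ ℕ) (j : Fin n) (a : ExtSeries R₀ V n) :
    coeffE m ((MvPowerSeries.X j : MvPowerSeries (Fin n) R₀) • a) =
      if Finsupp.single j 1 ≤ m then coeffE (m - Finsupp.single j 1) a else 0 := by
  have h := MvPowerSeries.coeff_monomial_mul (σ := Fin n) m (Finsupp.single j 1)
    (toSeries a) 1
  rw [one_mul] at h
  refine Eq.trans (congrArg (MvPowerSeries.coeff m) ?_) h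
  refine (toSeries_smul _ _).trans ?_
  rw [MvPowerSeries.map_X]
  rfl

variable (R₀ V n) in
/-- The constant power series, as an additive map. -/
def constHom : ExtAlg R₀ V →+ ExtSeries R₀ V n :=
  AddMonoidHom.mk' (const n) (map_add (MvPowerSeries.C (σ := Fin n) (R := ExtAlg R₀ V)))

theorem const_add (a c : ExtAlg R₀ V) : const n (a + c) = const n a + const n c :=
  map_add (constHom R₀ V n) a c

theorem const_zero : const n (0 : ExtAlg R₀ V) = 0 := map_zero (constHom R₀ V n)

theorem const_neg (a : ExtAlg R₀ V) : const n (-a) = -const n a := map_neg (constHom R₀ V n) a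

theorem const_smul (r : R₀) (a : ExtAlg R₀ V) :
    const n (r • a) = (MvPowerSeries.C r : MvPowerSeries (Fin n) R₀) • const n a := by
  refine Eq.trans ?_ (toSeries_smul _ _).symm
  rw [MvPowerSeries.map_C, Algebra.smul_def]
  exact map_mul (MvPowerSeries.C (σ := Fin n) (R := ExtAlg R₀ V)) _ _

/-- Two power series agree in degrees less than `N`. -/
def AgreeBelow (N : ℕ) (a c : ExtSeries R₀ V n) : Prop :=
  ∀ m : Fin n →₀ ℕ, m.degree < N → coeffE m a = coeffE m c

theorem AgreeBelow.X_smul {N : ℕ} {a c : ExtSeries R₀ V n} (h : AgreeBelow N a c) (j : Fin n) :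
    AgreeBelow (N + 1) ((MvPowerSeries.X j : MvPowerSeries (Fin n) R₀) • a)
      ((MvPowerSeries.X j : MvPowerSeries (Fin n) R₀) • c) := by
  intro m hm
  rw [coeffE_X_smul, coeffE_X_smul]
  split_ifs with hj
  · refine h _ ?_
    have h1 := congrArg Finsupp.degree (tsub_add_cancel_of_le hj)
    rw [map_add, Finsupp.degree_single] at h1
    omega
  · rfl

theorem AgreeBelow.add {N : ℕ} {a c a' c' : ExtSeries R₀ V n} (h : AgreeBelow N a c)
    (h' : AgreeBelow N a' c') : AgreeBelow N (a + a') (c + c') := fun m hm => by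
  rw [coeffE_add, coeffE_add, h m hm, h' m hm]

theorem AgreeBelow.sum {N : ℕ} {ι : Type*} {s : Finset ι} {F G : ι → ExtSeries R₀ V n}
    (h : ∀ i ∈ s, AgreeBelow N (F i) (G i)) : AgreeBelow N (∑ i ∈ s, F i) (∑ i ∈ s, G i) :=
  fun m hm => by
    rw [coeffE_sum, coeffE_sum]
    exact Finset.sum_congr rfl fun i hi => h i hi m hm

theorem AgreeBelow.mono {N N' : ℕ} {a c : ExtSeries R₀ V n} (h : AgreeBelow N a c)
    (hN : N' ≤ N) : AgreeBelow N' a c := fun m hm => h m (hm.trans_le hN)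

theorem AgreeBelow.refl (N : ℕ) (a : ExtSeries R₀ V n) : AgreeBelow N a a := fun _ _ => rfl

/-- Two families of series satisfying the same recursion
`T a = c a + ∑ x_j T (s_j a)` are equal, since `T a` is determined up to terms of order `N` after
applying the recursion `N` times. -/
theorem eq_of_recursion {α : Type*} {T T' : α → ExtSeries R₀ V n} (c : α → ExtSeries R₀ V n)
    (s : Fin n → α → α)
    (h : ∀ a, T a = c a + ∑ j, (MvPowerSeries.X j : MvPowerSeries (Fin n) R₀) • T (s j a))
    (h' : ∀ a, T' a = c a + ∑ j, (MvPowerSeries.X j : MvPowerSeries (Fin n) R₀) • T' (s j a))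
    (a : α) : T a = T' a := by
  have key : ∀ N a, AgreeBelow N (T a) (T' a) := by
    intro N
    induction N with
    | zero => exact fun a m hm => absurd hm (Nat.not_lt_zero _)
    | succ N ih =>
      intro a
      rw [h, h']
      exact (AgreeBelow.refl _ _).add (AgreeBelow.sum fun j _ => (ih _).X_smul j)
  exact coeffE_ext fun m => key _ a m (Nat.lt_succ_self _)

/-- The sum of `x_w F(w)` over all words `w` of length `k`, where `x_w` is the product of the
corresponding coordinates. -/
def wordSumDeg : ℕ → (List (Fin n) → ExtSeries R₀ V n) → ExtSeries R₀ V n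
  | 0, F => F []
  | k + 1, F => ∑ j, (MvPowerSeries.X j : MvPowerSeries (Fin n) R₀) •
      wordSumDeg k fun w => F (j :: w)

/-- The sum of `x_w F(w)` over all words `w` in the coordinates. -/
def wordSum (F : List (Fin n) → ExtSeries R₀ V n) : ExtSeries R₀ V n :=
  series fun m => ∑ k ∈ Finset.range (m.degree + 1), coeffE m (wordSumDeg k F)

theorem wordSumDeg_zero (k : ℕ) :
    wordSumDeg k (fun _ => (0 : ExtSeries R₀ V n)) = 0 := by
  induction k with
  | zero => rfl
  | succ k ih => simp [wordSumDeg, ih]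

theorem agreeBelow_wordSumDeg_zero (k : ℕ) (F : List (Fin n) → ExtSeries R₀ V n) :
    AgreeBelow k (wordSumDeg k F) 0 := by
  induction k generalizing F with
  | zero => exact fun _ h => absurd h (Nat.not_lt_zero _)
  | succ k ih =>
    have h := AgreeBelow.sum fun j (_ : j ∈ Finset.univ) => (ih fun w => F (j :: w)).X_smul j
    simp only [smul_zero, Finset.sum_const_zero] at h
    exact h

theorem AgreeBelow.wordSumDeg {N : ℕ} {F G : List (Fin n) → ExtSeries R₀ V n}
    (h : ∀ w, AgreeBelow N (F w) (G w)) (k : ℕ) :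
    AgreeBelow N (wordSumDeg k F) (SuperDef.wordSumDeg k G) := by
  induction k generalizing F G with
  | zero => exact h []
  | succ k ih =>
    exact AgreeBelow.sum fun j _ => ((ih fun w => h (j :: w)).X_smul j).mono (Nat.le_succ N)

theorem coeffE_wordSum {m : Fin n →₀ ℕ} {K : ℕ} (hK : m.degree ≤ K)
    (F : List (Fin n) → ExtSeries R₀ V n) :
    coeffE m (wordSum F) = ∑ k ∈ Finset.range (K + 1), coeffE m (wordSumDeg k F) := by
  refine (sum_range_eq hK fun k hk => ?_).symm
  rw [agreeBelow_wordSumDeg_zero k F m hk, coeffE_zero]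

theorem agreeBelow_wordSum (K : ℕ) (F : List (Fin n) → ExtSeries R₀ V n) :
    AgreeBelow (K + 1) (wordSum F) (∑ k ∈ Finset.range (K + 1), wordSumDeg k F) := fun m hm => by
  rw [coeffE_wordSum (Nat.le_of_lt_succ hm), coeffE_sum]

/-- A sum over words is computed recursively, by separating the empty word from the words with a
given first letter. -/
theorem wordSum_eq (F : List (Fin n) → ExtSeries R₀ V n) :
    wordSum F = F [] + ∑ j, (MvPowerSeries.X j : MvPowerSeries (Fin n) R₀) •
      wordSum fun w => F (j :: w) := by
  refine coeffE_ext fun m => ?_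
  have h1 : ∑ k ∈ Finset.range (m.degree + 1 + 1), wordSumDeg k F =
      F [] + ∑ j, (MvPowerSeries.X j : MvPowerSeries (Fin n) R₀) •
        ∑ k ∈ Finset.range (m.degree + 1), wordSumDeg k fun w => F (j :: w) := by
    rw [Finset.sum_range_succ' _ (m.degree + 1), add_comm]
    simp only [Finset.smul_sum]
    rw [Finset.sum_comm]
    rfl
  rw [agreeBelow_wordSum (m.degree + 1) F m (by omega), h1]
  exact (AgreeBelow.refl _ _).add (AgreeBelow.sum fun j _ =>
    ((agreeBelow_wordSum m.degree fun w => F (j :: w)).X_smul j)) m (by omega) |>.symm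

theorem wordSum_map (T : ExtSeries R₀ V n →ₗ[MvPowerSeries (Fin n) R₀] ExtSeries R₀ V n)
    (F : List (Fin n) → ExtSeries R₀ V n) : T (wordSum F) = wordSum fun w => T (F w) := by
  refine eq_of_recursion (T := fun F => T (wordSum F)) (T' := fun F => wordSum fun w => T (F w))
    (fun F => T (F [])) (fun j F w => F (j :: w)) (fun F => ?_) (fun F => ?_) F
  · simp only [wordSum_eq F, map_add, map_sum, map_smul]
  · exact wordSum_eq _

theorem wordSum_add (F G : List (Fin n) → ExtSeries R₀ V n) :
    wordSum (fun w => F w + G w) = wordSum F + wordSum G := by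
  refine eq_of_recursion
    (α := (List (Fin n) → ExtSeries R₀ V n) × (List (Fin n) → ExtSeries R₀ V n))
    (T := fun F => wordSum fun w => F.1 w + F.2 w)
    (T' := fun F => wordSum F.1 + wordSum F.2) (fun F => F.1 [] + F.2 [])
    (fun j F => (fun w => F.1 (j :: w), fun w => F.2 (j :: w))) (fun F => ?_) (fun F => ?_) (F, G)
  · exact wordSum_eq _
  · simp only [wordSum_eq F.1, wordSum_eq F.2, smul_add, Finset.sum_add_distrib]
    abel

theorem wordSum_smul (r : MvPowerSeries (Fin n) R₀) (F : List (Fin n) → ExtSeries R₀ V n) :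
    wordSum (fun w => r • F w) = r • wordSum F :=
  (wordSum_map (LinearMap.lsmul (MvPowerSeries (Fin n) R₀) (ExtSeries R₀ V n) r) F).symm

theorem wordSum_zero : wordSum (fun _ => (0 : ExtSeries R₀ V n)) = 0 := by
  simpa using wordSum_smul 0 fun _ : List (Fin n) => (0 : ExtSeries R₀ V n)

variable (R₀ V n) in
/-- The sum over all words, as a linear map. -/
def wordSumLin :
    (List (Fin n) → ExtSeries R₀ V n) →ₗ[MvPowerSeries (Fin n) R₀] ExtSeries R₀ V n where
  toFun := wordSum
  map_add' := wordSum_add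
  map_smul' := wordSum_smul

theorem wordSum_sum {ι : Type*} (s : Finset ι) (F : ι → List (Fin n) → ExtSeries R₀ V n) :
    wordSum (fun w => ∑ i ∈ s, F i w) = ∑ i ∈ s, wordSum (F i) := by
  exact (congrArg wordSum (funext fun w => (Finset.sum_apply w s F).symm)).trans
    (map_sum (wordSumLin R₀ V n) F s)

theorem wordSum_swap_eq (G : List (Fin n) → List (Fin n) → ExtSeries R₀ V n) :
    (wordSum fun y => wordSum fun x => G x y) = (wordSum fun y => G [] y) +
      ∑ j, (MvPowerSeries.X j : MvPowerSeries (Fin n) R₀) •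
        wordSum fun y => wordSum fun x => G (j :: x) y := by
  have h : (fun y => wordSum fun x => G x y) = fun y => G [] y + ∑ j,
      (MvPowerSeries.X j : MvPowerSeries (Fin n) R₀) • wordSum fun x => G (j :: x) y :=
    funext fun y => wordSum_eq _
  rw [h, wordSum_add, wordSum_sum]
  simp only [wordSum_smul]

theorem wordSum_swap (G : List (Fin n) → List (Fin n) → ExtSeries R₀ V n) :
    (wordSum fun x => wordSum fun y => G x y) = wordSum fun y => wordSum fun x => G x y :=
  eq_of_recursion (T := fun G : List (Fin n) → List (Fin n) → ExtSeries R₀ V n =>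
      wordSum fun x => wordSum fun y => G x y)
    (T' := fun G => wordSum fun y => wordSum fun x => G x y)
    (fun G => wordSum fun y => G [] y) (fun j G x y => G (j :: x) y)
    (fun G => wordSum_eq fun x => wordSum fun y => G x y) wordSum_swap_eq G

/-- Summing over words and their deconcatenations is summing over pairs of words. -/
theorem wordSum_splitSum (G : List (Fin n) → List (Fin n) → ExtSeries R₀ V n) :
    wordSum (fun w => splitSum G w) = wordSum fun x => wordSum fun y => G x y := by
  refine eq_of_recursion (T := fun G => wordSum fun w => splitSum G w)
    (T' := fun G => wordSum fun x => wordSum fun y => G x y)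
    (fun G => wordSum fun y => G [] y) (fun j G x y => G (j :: x) y)
    (fun G => ?_) (fun G => wordSum_eq fun x => wordSum fun y => G x y) G
  have h1 := wordSum_eq fun w => splitSum G w
  have h2 := wordSum_eq fun y => G [] y
  simp only [splitSum_nil, splitSum_cons, wordSum_add, smul_add, Finset.sum_add_distrib] at h1
  rw [h1, h2, add_assoc]

end Series

/-! #### Insertion into words in the tautological element -/

section Insert

variable {R₀ V : Type*} [CommRing R₀] [AddCommGroup V] [Module R₀ V] {n : ℕ}
  (b : Module.Basis (Fin n) R₀ V) {f φ ψ χ : List (ExtAlg R₀ V) → ExtAlg R₀ V}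

/-- The list of basis vectors of `V` spelled by a word. -/
def basisWord (w : List (Fin n)) : List (ExtAlg R₀ V) :=
  w.map fun i => ExteriorAlgebra.ι R₀ (b i)

theorem eps_ι (v : V) : eps (ExteriorAlgebra.ι R₀ v) = -ExteriorAlgebra.ι R₀ v :=
  CliffordAlgebra.involute_ι (Q := (0 : QuadraticForm R₀ V)) v

theorem tw_ι (p : ZMod 2) (v : V) : tw p (ExteriorAlgebra.ι R₀ v) = ExteriorAlgebra.ι R₀ v := by
  rcases zmod_two_cases p with rfl | rfl
  · rw [tw_zero, LinearMap.neg_apply, eps_ι, neg_neg]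
  · rw [tw_one, LinearMap.id_apply]

theorem basisWord_map_tw (p : ZMod 2) (w : List (Fin n)) :
    (basisWord b w).map (tw p) = basisWord b w := by
  simp only [basisWord, List.map_map]
  exact List.map_congr_left fun i _ => tw_ι p (b i)

/-- The `R`-multilinear extension of operations to `E_R`. -/
def extendSeries (f : List (ExtAlg R₀ V) → ExtAlg R₀ V) (L : List (ExtSeries R₀ V n)) :
    ExtSeries R₀ V n := series (extend f L)

theorem extendSeries_nil (f : List (ExtAlg R₀ V) → ExtAlg R₀ V) :
    extendSeries (n := n) f [] = const n (f []) :=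
  coeffE_ext fun m => (coeffE_const m (f [])).symm

theorem extendSeries_const (hf : IsMultilinear f) (e : ExtAlg R₀ V) (L : List (ExtSeries R₀ V n)) :
    extendSeries f (const n e :: L) = extendSeries (sh e f) L := by
  refine coeffE_ext fun m => ?_
  rw [extendSeries, coeffE_series, extend, Finset.sum_eq_single (0, m)]
  · rw [coeffE_const, if_pos rfl]; rfl
  · intro p hp hne
    rw [coeffE_const, if_neg]
    · simp only [hf.zero, extend_zero]
    · intro h0
      have := Finset.HasAntidiagonal.mem_antidiagonal.1 hp
      rw [h0, zero_add] at this
      exact hne (Prod.ext h0 this)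
  · intro h
    exact absurd (Finset.HasAntidiagonal.mem_antidiagonal.2 (zero_add m)) h

theorem extendSeries_add (hf : IsMultilinear f) (a a' : ExtSeries R₀ V n)
    (L : List (ExtSeries R₀ V n)) :
    extendSeries f ((a + a') :: L) = extendSeries f (a :: L) + extendSeries f (a' :: L) :=
  coeffE_ext fun m => extend_add_slot hf [] L a a' m

theorem extendSeries_smul (hf : IsMultilinear f) (r : MvPowerSeries (Fin n) R₀)
    (a : ExtSeries R₀ V n) (L : List (ExtSeries R₀ V n)) :
    extendSeries f ((r • a) :: L) = r • extendSeries f (a :: L) :=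
  coeffE_ext fun m => (extend_smul_slot hf [] L r a m).trans
    (coeffE_smul m r (extendSeries f (a :: L))).symm

theorem tautological_eq : tautological b =
    ∑ j, (MvPowerSeries.X j : MvPowerSeries (Fin n) R₀) •
      const n (ExteriorAlgebra.ι R₀ (b j)) := by
  refine coeffE_ext fun m => ?_
  rw [coeffE_sum]
  refine (map_sum (MvPowerSeries.coeff m) _ _).trans (Finset.sum_congr rfl fun j _ => ?_)
  refine congrArg (MvPowerSeries.coeff m) ?_
  refine Eq.trans ?_ (toSeries_smul _ _).symm
  rw [MvPowerSeries.map_X]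
  rfl

theorem extendSeries_tautological (hf : IsMultilinear f) (L : List (ExtSeries R₀ V n)) :
    extendSeries f (tautological b :: L) = ∑ j, (MvPowerSeries.X j : MvPowerSeries (Fin n) R₀) •
      extendSeries (sh (ExteriorAlgebra.ι R₀ (b j)) f) L := by
  let T : ExtSeries R₀ V n →ₗ[MvPowerSeries (Fin n) R₀] ExtSeries R₀ V n :=
    { toFun := fun a => extendSeries f (a :: L)
      map_add' := fun a a' => extendSeries_add hf a a' L
      map_smul' := fun r a => extendSeries_smul hf r a L }
  change T (tautological b) = _
  rw [tautological_eq, map_sum]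
  refine Finset.sum_congr rfl fun j _ => ?_
  rw [map_smul]
  exact congrArg _ (extendSeries_const hf _ L)

theorem extendSeries_replicate (hf : IsMultilinear f) (k : ℕ) (L : List (ExtSeries R₀ V n)) :
    extendSeries f (List.replicate k (tautological b) ++ L) =
      wordSumDeg k fun w => extendSeries (fun l => f (basisWord b w ++ l)) L := by
  induction k generalizing f with
  | zero => rfl
  | succ k ih =>
    rw [List.replicate_succ, List.cons_append, extendSeries_tautological b hf]
    simp only [wordSumDeg, ih (hf.sh _)]
    rfl

theorem evalTaut_eq (hf : IsMultilinear f) :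
    evalTaut b f = wordSum fun w => const n (f (basisWord b w)) := by
  refine coeffE_ext fun m => ?_
  rw [evalTaut, wordSum, coeffE_series, coeffE_series]
  refine Finset.sum_congr rfl fun k _ => ?_
  have h := extendSeries_replicate b hf k []
  simp only [List.append_nil, extendSeries_nil] at h
  exact congrArg (coeffE m) h

theorem wordSumDeg_add (k : ℕ) (F G : List (Fin n) → ExtSeries R₀ V n) :
    wordSumDeg k (fun w => F w + G w) = wordSumDeg k F + wordSumDeg k G := by
  induction k generalizing F G with
  | zero => rfl
  | succ k ih => simp only [wordSumDeg, ih, smul_add, Finset.sum_add_distrib]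

theorem wordSumDeg_sum {ι : Type*} (k : ℕ) (s : Finset ι)
    (F : ι → List (Fin n) → ExtSeries R₀ V n) :
    wordSumDeg k (fun w => ∑ i ∈ s, F i w) = ∑ i ∈ s, wordSumDeg k (F i) := by
  classical
  induction s using Finset.induction_on with
  | empty => simp only [Finset.sum_empty, wordSumDeg_zero]
  | insert i s hi ih => simp only [Finset.sum_insert hi, wordSumDeg_add, ih]

theorem insert₁_const (hf : IsMultilinear f) (e : ExtAlg R₀ V) :
    insert₁ b f (const n e) =
      wordSum fun x => wordSum fun z => const n (f (basisWord b x ++ e :: basisWord b z)) := by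
  refine coeffE_ext fun m => ?_
  rw [insert₁, wordSum, coeffE_series, coeffE_series]
  refine Finset.sum_congr rfl fun i _ => ?_
  have h1 : ∀ i₀, extendSeries f (List.replicate i (tautological b) ++
      const n e :: List.replicate i₀ (tautological b)) = wordSumDeg i fun x =>
        wordSumDeg i₀ fun z => const n (f (basisWord b x ++ e :: basisWord b z)) := by
    intro i₀
    rw [extendSeries_replicate b hf]
    congr 1
    funext x
    have h := extendSeries_replicate b ((hf.append_left (basisWord b x)).cons e) i₀ []
    rw [extendSeries_const (hf.append_left _)]
    simp only [List.append_nil, extendSeries_nil] at h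
    exact h
  have h2 := (AgreeBelow.wordSumDeg (fun x => agreeBelow_wordSum m.degree fun z =>
    const n (f (basisWord b x ++ e :: basisWord b z))) i) m (Nat.lt_succ_self _)
  rw [h2, wordSumDeg_sum, coeffE_sum]
  exact Finset.sum_congr rfl fun i₀ _ => congrArg (coeffE m) (h1 i₀)

theorem insert₂_const (hf : IsMultilinear f) (e e' : ExtAlg R₀ V) :
    insert₂ b f (const n e) (const n e') =
      wordSum fun x => wordSum fun y => wordSum fun z =>
        const n (f (basisWord b x ++ e :: (basisWord b y ++ e' :: basisWord b z))) := by
  refine coeffE_ext fun m => ?_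
  rw [insert₂, wordSum, coeffE_series, coeffE_series]
  refine Finset.sum_congr rfl fun i _ => ?_
  have h1 : ∀ i₁ i₀, extendSeries f (List.replicate i (tautological b) ++
      const n e :: (List.replicate i₁ (tautological b) ++
        const n e' :: List.replicate i₀ (tautological b))) = wordSumDeg i fun x =>
        wordSumDeg i₁ fun y => wordSumDeg i₀ fun z =>
        const n (f (basisWord b x ++ e :: (basisWord b y ++ e' :: basisWord b z))) := by
    intro i₁ i₀
    rw [extendSeries_replicate b hf]
    congr 1
    funext x
    have hx := (hf.append_left (basisWord b x)).cons e
    rw [extendSeries_const (hf.append_left _)]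
    refine (extendSeries_replicate b hx i₁ _).trans ?_
    congr 1
    funext y
    have h := extendSeries_replicate b ((hx.append_left (basisWord b y)).cons e') i₀ []
    rw [extendSeries_const (hx.append_left _)]
    simp only [List.append_nil, extendSeries_nil] at h
    exact h
  have h2 := (AgreeBelow.wordSumDeg (fun x => agreeBelow_wordSum m.degree fun y => wordSum fun z =>
    const n (f (basisWord b x ++ e :: (basisWord b y ++ e' :: basisWord b z)))) i) m
      (Nat.lt_succ_self _)
  rw [h2, wordSumDeg_sum, coeffE_sum]
  refine Finset.sum_congr rfl fun i₁ _ => ?_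
  have h3 := (AgreeBelow.wordSumDeg (fun x => AgreeBelow.wordSumDeg
    (fun y => agreeBelow_wordSum m.degree fun z =>
    const n (f (basisWord b x ++ e :: (basisWord b y ++ e' :: basisWord b z)))) i₁) i) m
      (Nat.lt_succ_self _)
  rw [h3]
  simp only [wordSumDeg_sum]
  rw [coeffE_sum]
  exact Finset.sum_congr rfl fun i₀ _ => congrArg (coeffE m) (h1 i₁ i₀)

/-- The `R`-linear extension of an endomorphism of `E` to `E_R`. -/
def mapE (T : ExtAlg R₀ V →ₗ[R₀] ExtAlg R₀ V) :
    ExtSeries R₀ V n →ₗ[MvPowerSeries (Fin n) R₀] ExtSeries R₀ V n where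
  toFun a := series fun m => T (coeffE m a)
  map_add' a c := coeffE_ext fun m => by
    simp only [coeffE_add, coeffE_series, map_add]
  map_smul' r a := coeffE_ext fun m => by
    simp only [coeffE_smul, coeffE_series, map_sum, map_smul, RingHom.id_apply]

theorem mapE_const (T : ExtAlg R₀ V →ₗ[R₀] ExtAlg R₀ V) (e : ExtAlg R₀ V) :
    mapE T (const n e) = const n (T e) := coeffE_ext fun m => by
  simp only [mapE, LinearMap.coe_mk, AddHom.coe_mk, coeffE_series, coeffE_const]
  split_ifs <;> simp

theorem mapE_evalTaut (T : ExtAlg R₀ V →ₗ[R₀] ExtAlg R₀ V) (hf : IsMultilinear f) :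
    mapE T (evalTaut b f) = evalTaut b fun l => T (f l) := by
  rw [evalTaut_eq b hf, evalTaut_eq b (hf.comp_linear T), wordSum_map]
  simp only [mapE_const]

/-- The coordinates of an element of `E_R` with respect to the monomial basis of `E`. -/
def coordE (I : Finset (Fin n)) :
    ExtSeries R₀ V n →ₗ[MvPowerSeries (Fin n) R₀] MvPowerSeries (Fin n) R₀ where
  toFun a := fun m => b.ExteriorAlgebra.repr (coeffE m a) I
  map_add' a c := by
    funext m
    rw [coeffE_add, map_add]
    rfl
  map_smul' r a := by
    refine MvPowerSeries.ext fun m => ?_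
    rw [RingHom.id_apply]
    refine Eq.trans ?_ (MvPowerSeries.coeff_mul m r _).symm
    change b.ExteriorAlgebra.repr (coeffE m (r • a)) I = _
    rw [coeffE_smul, map_sum, Finsupp.finsetSum_apply]
    simp only [map_smul]
    rfl

theorem coeff_coordE (I : Finset (Fin n)) (a : ExtSeries R₀ V n) (m : Fin n →₀ ℕ) :
    MvPowerSeries.coeff m (coordE b I a) = b.ExteriorAlgebra.repr (coeffE m a) I := rfl

theorem coeffE_smul_const (r : MvPowerSeries (Fin n) R₀) (e : ExtAlg R₀ V) (m : Fin n →₀ ℕ) :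
    coeffE m (r • const n e) = MvPowerSeries.coeff m r • e := by
  rw [coeffE_smul, Finset.sum_eq_single (m, 0)]
  · rw [coeffE_const, if_pos rfl]
  · intro p hp hne
    rw [coeffE_const, if_neg, smul_zero]
    intro h0
    have := Finset.HasAntidiagonal.mem_antidiagonal.1 hp
    rw [h0, add_zero] at this
    exact hne (Prod.ext this h0)
  · intro h
    exact absurd (Finset.HasAntidiagonal.mem_antidiagonal.2 (add_zero m)) h

/-- The monomials `v_{i_1} ∧ … ∧ v_{i_r}` form a basis of `E_R` over `R`. -/
def constBasis :
    Module.Basis (Finset (Fin n)) (MvPowerSeries (Fin n) R₀) (ExtSeries R₀ V n) :=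
  Module.Basis.ofEquivFun
    { toFun := fun a I => coordE b I a
      map_add' := fun a c => funext fun I => map_add _ _ _
      map_smul' := fun r a => funext fun I => map_smul _ _ _
      invFun := fun c => ∑ I, c I • const n (b.ExteriorAlgebra I)
      left_inv := fun a => coeffE_ext fun m => by
        rw [coeffE_sum]
        simp only [coeffE_smul_const, coeff_coordE]
        exact b.ExteriorAlgebra.sum_repr (coeffE m a)
      right_inv := fun c => funext fun I => MvPowerSeries.ext fun m => by
        rw [coeff_coordE, coeffE_sum]
        simp only [coeffE_smul_const]
        rw [b.ExteriorAlgebra.repr_sum_self] }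

theorem constBasis_apply (I : Finset (Fin n)) :
    constBasis b I = const n (b.ExteriorAlgebra I) := by
  classical
  rw [constBasis, Module.Basis.coe_ofEquivFun]
  change ∑ J, (Pi.single I 1 : Finset (Fin n) → MvPowerSeries (Fin n) R₀) J •
    const n (b.ExteriorAlgebra J) = _
  rw [Finset.sum_eq_single I]
  · rw [Pi.single_eq_same, one_smul]
  · intro J _ hJ
    rw [Pi.single_eq_of_ne hJ, zero_smul]
  · simp

theorem const_eq_sum (e : ExtAlg R₀ V) : const n e = ∑ I,
    (MvPowerSeries.C (b.ExteriorAlgebra.repr e I) : MvPowerSeries (Fin n) R₀) •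
      const n (b.ExteriorAlgebra I) := by
  conv_lhs => rw [← b.ExteriorAlgebra.sum_repr e]
  refine (map_sum (constHom R₀ V n) _ _).trans (Finset.sum_congr rfl fun I _ => ?_)
  exact const_smul _ _

section

variable {M : Type*} [AddCommGroup M] [Module (MvPowerSeries (Fin n) R₀) M]

/-- A linear map on `E_R` is determined by its values on constants. -/
theorem extSeries_hom_ext (b : Module.Basis (Fin n) R₀ V)
    {T T' : ExtSeries R₀ V n →ₗ[MvPowerSeries (Fin n) R₀] M}
    (h : ∀ e, T (const n e) = T' (const n e)) : T = T' :=
  (constBasis b).ext fun I => by rw [constBasis_apply, h]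

/-- The `R`-linear extension to `E_R` of an `R₀`-linear map from `E` to an `R`-module. -/
def extendR (T : ExtAlg R₀ V → M) : ExtSeries R₀ V n →ₗ[MvPowerSeries (Fin n) R₀] M :=
  (constBasis b).constr (MvPowerSeries (Fin n) R₀) fun I => T (b.ExteriorAlgebra I)

theorem extendR_const {T : ExtAlg R₀ V → M} (hadd : ∀ e e', T (e + e') = T e + T e')
    (hsmul : ∀ (r : R₀) e, T (r • e) = (MvPowerSeries.C r : MvPowerSeries (Fin n) R₀) • T e)
    (e : ExtAlg R₀ V) : extendR b T (const n e) = T e := by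
  have h1 : T e = ∑ I, (MvPowerSeries.C (b.ExteriorAlgebra.repr e I) :
      MvPowerSeries (Fin n) R₀) • T (b.ExteriorAlgebra I) := by
    conv_lhs => rw [← b.ExteriorAlgebra.sum_repr e]
    refine (map_sum (AddMonoidHom.mk' T hadd) _ _).trans (Finset.sum_congr rfl fun I _ => ?_)
    exact hsmul _ _
  rw [h1, const_eq_sum b e, map_sum]
  refine Finset.sum_congr rfl fun I _ => ?_
  rw [map_smul, ← constBasis_apply, extendR, Module.Basis.constr_basis]

end

end Insert

/-! #### Evaluation of braces -/

section Insert

variable {R₀ V : Type*} [CommRing R₀] [AddCommGroup V] [Module R₀ V] {n : ℕ}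
  (b : Module.Basis (Fin n) R₀ V) {f φ ψ χ : List (ExtAlg R₀ V) → ExtAlg R₀ V}

/-- The operation `∑ f(v, …, v, e₃, v, …, v, e₂, v, …, v, e₁, v, …, v)`, for elements of `E`. -/
def wordInsert₃ (f : List (ExtAlg R₀ V) → ExtAlg R₀ V) (e₃ e₂ e₁ : ExtAlg R₀ V) :
    ExtSeries R₀ V n :=
  wordSum fun x => wordSum fun y => wordSum fun z => wordSum fun u =>
    const n (f (basisWord b x ++ e₃ :: (basisWord b y ++ e₂ :: (basisWord b z ++
      e₁ :: basisWord b u))))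

/-- The `R`-trilinear operation `∑ f(v, …, v, a₃, v, …, v, a₂, v, …, v, a₁, v, …, v)`. -/
def insert₃ (f : List (ExtAlg R₀ V) → ExtAlg R₀ V) :
    ExtSeries R₀ V n →ₗ[MvPowerSeries (Fin n) R₀] ExtSeries R₀ V n
      →ₗ[MvPowerSeries (Fin n) R₀] ExtSeries R₀ V n
        →ₗ[MvPowerSeries (Fin n) R₀] ExtSeries R₀ V n :=
  extendR b fun e₃ => extendR b fun e₂ => extendR b fun e₁ => wordInsert₃ b f e₃ e₂ e₁

theorem wordSum_congr {F G : List (Fin n) → ExtSeries R₀ V n} (h : ∀ w, F w = G w) :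
    wordSum F = wordSum G := congrArg wordSum (funext h)

theorem insert₃_const (hf : IsMultilinear f) (e₃ e₂ e₁ : ExtAlg R₀ V) :
    insert₃ b f (const n e₃) (const n e₂) (const n e₁) = wordInsert₃ b f e₃ e₂ e₁ := by
  have hs : ∀ x : List (ExtAlg R₀ V), ∀ e : ExtAlg R₀ V, IsMultilinear fun l => f (x ++ e :: l) :=
    fun x e => (hf.append_left x).cons e
  have hss : ∀ (x y : List (ExtAlg R₀ V)) (e e' : ExtAlg R₀ V),
      IsMultilinear fun l => f (x ++ e :: (y ++ e' :: l)) :=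
    fun x y e e' => ((hs x e).append_left y).cons e'
  have h1 : ∀ e₃ e₂ e₁, extendR b (wordInsert₃ b f e₃ e₂) (const n e₁) =
      wordInsert₃ b f e₃ e₂ e₁ := by
    intro e₃ e₂ e₁
    refine extendR_const b (fun e e' => ?_) (fun r e => ?_) e₁
    · simp only [wordInsert₃, (hss _ _ _ _).map_add, const_add, wordSum_add]
    · simp only [wordInsert₃, (hss _ _ _ _).map_smul, const_smul, wordSum_smul]
  have h2 : ∀ e₃ e₂ e₁, extendR b (fun e₂ => extendR b (wordInsert₃ b f e₃ e₂)) (const n e₂)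
      (const n e₁) = wordInsert₃ b f e₃ e₂ e₁ := by
    intro e₃ e₂ e₁
    rw [← h1]
    refine congrArg (· (const n e₁)) (extendR_const b (T := fun e₂ => extendR b
      (wordInsert₃ b f e₃ e₂)) (fun e e' => ?_) (fun r e => ?_) e₂)
    · refine extSeries_hom_ext b fun e'' => ?_
      rw [LinearMap.add_apply, h1, h1, h1]
      simp only [wordInsert₃, (hs _ _).map_add, const_add, wordSum_add]
    · refine extSeries_hom_ext b fun e'' => ?_
      rw [LinearMap.smul_apply, h1, h1]
      simp only [wordInsert₃, (hs _ _).map_smul, const_smul, wordSum_smul]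
  rw [← h2]
  refine congrArg (fun T : ExtSeries R₀ V n →ₗ[MvPowerSeries (Fin n) R₀] ExtSeries R₀ V n
    →ₗ[MvPowerSeries (Fin n) R₀] ExtSeries R₀ V n => T (const n e₂) (const n e₁))
      (extendR_const b (T := fun e₃ => extendR b fun e₂ => extendR b (wordInsert₃ b f e₃ e₂))
        (fun e e' => ?_) (fun r e => ?_) e₃)
  · refine extSeries_hom_ext b fun e'' => extSeries_hom_ext b fun e''' => ?_
    rw [LinearMap.add_apply, LinearMap.add_apply, h2, h2, h2]
    simp only [wordInsert₃, hf.map_add, const_add, wordSum_add]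
  · refine extSeries_hom_ext b fun e'' => extSeries_hom_ext b fun e''' => ?_
    rw [LinearMap.smul_apply, LinearMap.smul_apply, h2, h2]
    simp only [wordInsert₃, hf.map_smul, const_smul, wordSum_smul]

theorem insert₁Lin_apply (hf : IsMultilinear f) (a : ExtSeries R₀ V n) :
    insert₁Lin b hf a = insert₁ b f a := rfl

theorem insert₂Lin_apply (hf : IsMultilinear f) (a c : ExtSeries R₀ V n) :
    insert₂Lin b hf a c = insert₂ b f a c := rfl

theorem const_splitSum (G : List (ExtAlg R₀ V) → List (ExtAlg R₀ V) → ExtAlg R₀ V)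
    (w : List (Fin n)) : const n (splitSum G (basisWord b w)) =
      splitSum (fun x y => const n (G (basisWord b x) (basisWord b y))) w := by
  rw [basisWord, splitSum_map]
  exact map_splitSum (constHom R₀ V n) _ _

theorem wordSum_const_splitSum (G : List (ExtAlg R₀ V) → List (ExtAlg R₀ V) → ExtAlg R₀ V) :
    (wordSum fun w => const n (splitSum G (basisWord b w))) =
      wordSum fun x => wordSum fun y => const n (G (basisWord b x) (basisWord b y)) := by
  simp only [const_splitSum, wordSum_splitSum]

/-- Evaluating a brace on the tautological element inserts the values of its arguments. -/
theorem evalTaut_brace_one (hf : IsMultilinear f) (hφ : IsMultilinear φ) (p : ZMod 2) :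
    evalTaut b (brace [(p, φ)] f) = insert₁ b f (evalTaut b φ) := by
  rw [evalTaut_eq b (hf.brace (by simpa using hφ)), evalTaut_eq b hφ, ← insert₁Lin_apply b hf,
    wordSum_map]
  simp only [brace_cons, brace_nil, wordSum_const_splitSum, basisWord_map_tw, insert₁Lin_apply,
    insert₁_const b hf]
  rw [wordSum_swap]

theorem evalTaut_brace_two (hf : IsMultilinear f) (hφ : IsMultilinear φ) (hψ : IsMultilinear ψ)
    (p q : ZMod 2) : evalTaut b (brace [(p, φ), (q, ψ)] f) =
      insert₂ b f (evalTaut b φ) (mapE (tw p) (evalTaut b ψ)) := by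
  rw [evalTaut_eq b (hf.brace (by simpa using ⟨hφ, hψ⟩)), mapE_evalTaut b _ hψ, evalTaut_eq b hφ,
    evalTaut_eq b (hψ.comp_linear _), ← insert₂Lin_apply b hf]
  have h1 : ∀ F G : List (Fin n) → ExtSeries R₀ V n, insert₂Lin b hf (wordSum F) (wordSum G) =
      wordSum fun x => wordSum fun y => insert₂Lin b hf (F x) (G y) := by
    intro F G
    rw [← LinearMap.flip_apply, wordSum_map]
    simp only [LinearMap.flip_apply, wordSum_map]
  rw [h1]
  simp only [brace_cons, brace_nil, wordSum_const_splitSum, List.map_append, List.map_cons,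
    basisWord_map_tw, insert₂Lin_apply, insert₂_const b hf]
  rw [wordSum_swap]
  refine congrArg wordSum (funext fun y => ?_)
  exact (wordSum_congr fun x => wordSum_swap _).trans (wordSum_swap _)

theorem evalTaut_brace_three (hf : IsMultilinear f) (hφ : IsMultilinear φ) (hψ : IsMultilinear ψ)
    (hχ : IsMultilinear χ) (p q r : ZMod 2) : evalTaut b (brace [(p, φ), (q, ψ), (r, χ)] f) =
      insert₃ b f (evalTaut b φ) (mapE (tw p) (evalTaut b ψ))
        (mapE (tw p) (mapE (tw q) (evalTaut b χ))) := by
  rw [evalTaut_eq b (hf.brace (by simpa using ⟨hφ, hψ, hχ⟩)), mapE_evalTaut b _ hψ,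
    mapE_evalTaut b _ hχ, mapE_evalTaut b _ (hχ.comp_linear _), evalTaut_eq b hφ,
    evalTaut_eq b (hψ.comp_linear _), evalTaut_eq b ((hχ.comp_linear _).comp_linear _)]
  have h1 : ∀ F G H : List (Fin n) → ExtSeries R₀ V n,
      insert₃ b f (wordSum F) (wordSum G) (wordSum H) =
      wordSum fun x => wordSum fun y => wordSum fun z => insert₃ b f (F x) (G y) (H z) := by
    intro F G H
    have h2 := wordSum_map ((insert₃ b f).flip (wordSum G)|>.flip (wordSum H)) F
    simp only [LinearMap.flip_apply] at h2
    rw [h2]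
    refine congrArg wordSum (funext fun x => ?_)
    rw [← LinearMap.flip_apply, wordSum_map]
    simp only [LinearMap.flip_apply, wordSum_map]
  rw [h1]
  simp only [brace_cons, brace_nil, wordSum_const_splitSum, List.map_append, List.map_cons,
    basisWord_map_tw, insert₃_const b hf, wordInsert₃]
  rw [wordSum_swap]
  refine congrArg wordSum (funext fun y => ?_)
  refine (wordSum_congr fun x => wordSum_congr fun z => wordSum_congr fun w =>
    wordSum_swap _).trans ?_
  refine (wordSum_congr fun x => wordSum_swap _).trans ?_
  refine (wordSum_swap _).trans (wordSum_congr fun w => ?_)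
  exact (wordSum_congr fun x => wordSum_swap _).trans (wordSum_swap _)

/-! ### Derivatives -/

/-- The derivative in the direction of the `i`-th coordinate. -/
def pderivE (i : Fin n) : ExtSeries R₀ V n →+ ExtSeries R₀ V n :=
  AddMonoidHom.mk' (fun a => series fun m => ((m i + 1 : ℕ) : R₀) •
      coeffE (m + Finsupp.single i 1) a)
    fun a c => coeffE_ext fun m => by
      simp only [coeffE_add, coeffE_series, smul_add]

/-- The operator `½ ∂_i²`. -/
def halfPderivSqE (i : Fin n) : ExtSeries R₀ V n →+ ExtSeries R₀ V n :=
  AddMonoidHom.mk' (fun a => series fun m => ((m i + 2).choose 2 : R₀) •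
      coeffE (m + Finsupp.single i 2) a)
    fun a c => coeffE_ext fun m => by
      simp only [coeffE_add, coeffE_series, smul_add]

theorem coeffE_pderivE (i : Fin n) (a : ExtSeries R₀ V n) (m : Fin n →₀ ℕ) :
    coeffE m (pderivE i a) = ((m i + 1 : ℕ) : R₀) • coeffE (m + Finsupp.single i 1) a := rfl

theorem coeffE_halfPderivSqE (i : Fin n) (a : ExtSeries R₀ V n) (m : Fin n →₀ ℕ) :
    coeffE m (halfPderivSqE i a) =
      ((m i + 2).choose 2 : R₀) • coeffE (m + Finsupp.single i 2) a := rfl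

theorem pderivE_smul_one (i : Fin n) (r : MvPowerSeries (Fin n) R₀) (e : ExtAlg R₀ V) :
    pderivE i (r • const n e) = MvPowerSeries.pderiv R₀ i r • const n e := by
  refine coeffE_ext fun m => ?_
  rw [coeffE_pderivE, coeffE_smul_const, coeffE_smul_const, MvPowerSeries.coeff_pderiv, smul_smul,
    mul_comm, Nat.cast_add_one]

theorem halfPderivSqE_smul_one (i : Fin n) (r : MvPowerSeries (Fin n) R₀) (e : ExtAlg R₀ V) :
    halfPderivSqE i (r • const n e) = halfPderivSq i r • const n e := by
  refine coeffE_ext fun m => ?_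
  rw [coeffE_halfPderivSqE, coeffE_smul_const, coeffE_smul_const, smul_smul]
  rfl

theorem pderivE_const (i : Fin n) (e : ExtAlg R₀ V) : pderivE i (const n e) = 0 := by
  refine coeffE_ext fun m => ?_
  rw [coeffE_pderivE, coeffE_const, if_neg, smul_zero, coeffE_zero]
  intro h
  simpa using DFunLike.congr_fun h i

theorem halfPderivSqE_const (i : Fin n) (e : ExtAlg R₀ V) : halfPderivSqE i (const n e) = 0 := by
  refine coeffE_ext fun m => ?_
  rw [coeffE_halfPderivSqE, coeffE_const, if_neg, smul_zero, coeffE_zero]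
  intro h
  simpa using DFunLike.congr_fun h i

theorem pderivE_X_smul (i j : Fin n) (a : ExtSeries R₀ V n) :
    pderivE i ((MvPowerSeries.X j : MvPowerSeries (Fin n) R₀) • a) =
      (if i = j then a else 0) + (MvPowerSeries.X j : MvPowerSeries (Fin n) R₀) • pderivE i a := by
  refine coeffE_ext fun m => ?_
  rw [coeffE_pderivE, coeffE_add, coeffE_X_smul, coeffE_X_smul, coeffE_pderivE]
  rcases eq_or_ne i j with rfl | hij
  · rw [if_pos rfl, if_pos le_add_self, add_tsub_cancel_right]
    split_ifs with h
    · rw [tsub_add_cancel_of_le h]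
      have h1 : 1 ≤ m i := by simpa using h i
      have h2 : (m - Finsupp.single i 1 : Fin n →₀ ℕ) i + 1 = m i := by
        simp only [Finsupp.coe_tsub, Pi.sub_apply, Finsupp.single_eq_same]; omega
      rw [h2, Nat.cast_add, Nat.cast_one, add_smul, one_smul, add_comm]
    · have h1 : m i = 0 := by
        by_contra h0
        exact h (Finsupp.single_le_iff.2 (Nat.one_le_iff_ne_zero.2 h0))
      rw [h1]
      simp
  · rw [if_neg hij, coeffE_zero, zero_add]
    have h0 : Finsupp.single j 1 ≤ m + Finsupp.single i 1 ↔ Finsupp.single j 1 ≤ m := by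
      rw [Finsupp.single_le_iff, Finsupp.single_le_iff]
      simp [hij]
    by_cases h : Finsupp.single j 1 ≤ m
    · rw [if_pos (h0.2 h), if_pos h, tsub_add_eq_add_tsub h]
      simp [hij]
    · rw [if_neg (mt h0.1 h), if_neg h, smul_zero]

theorem halfPderivSqE_X_smul (i j : Fin n) (a : ExtSeries R₀ V n) :
    halfPderivSqE i ((MvPowerSeries.X j : MvPowerSeries (Fin n) R₀) • a) =
      (if i = j then pderivE i a else 0) +
        (MvPowerSeries.X j : MvPowerSeries (Fin n) R₀) • halfPderivSqE i a := by
  refine coeffE_ext fun m => ?_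
  rw [coeffE_halfPderivSqE, coeffE_add, coeffE_X_smul, coeffE_X_smul, coeffE_halfPderivSqE]
  rcases eq_or_ne i j with rfl | hij
  · have h2 : Finsupp.single i 2 = Finsupp.single i 1 + Finsupp.single i 1 := by
      rw [← Finsupp.single_add]
    rw [if_pos rfl, h2, ← add_assoc, if_pos le_add_self, add_tsub_cancel_right, coeffE_pderivE]
    split_ifs with h
    · rw [← add_assoc, tsub_add_cancel_of_le h]
      have h1 : 1 ≤ m i := by simpa using h i
      have h2 : (m - Finsupp.single i 1 : Fin n →₀ ℕ) i + 2 = m i + 1 := by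
        simp only [Finsupp.coe_tsub, Pi.sub_apply, Finsupp.single_eq_same]; omega
      rw [h2, ← add_smul, ← Nat.cast_add, Nat.choose_succ_succ' (m i + 1) 1, Nat.choose_one_right]
    · have h1 : m i = 0 := by
        by_contra h0
        exact h (Finsupp.single_le_iff.2 (Nat.one_le_iff_ne_zero.2 h0))
      rw [h1]
      simp
  · rw [if_neg hij, coeffE_zero, zero_add]
    have h0 : Finsupp.single j 1 ≤ m + Finsupp.single i 2 ↔ Finsupp.single j 1 ≤ m := by
      rw [Finsupp.single_le_iff, Finsupp.single_le_iff]
      simp [hij]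
    by_cases h : Finsupp.single j 1 ≤ m
    · rw [if_pos (h0.2 h), if_pos h, tsub_add_eq_add_tsub h]
      simp [hij]
    · rw [if_neg (mt h0.1 h), if_neg h, smul_zero]

section Derivative

variable (F : List (Fin n) → ExtAlg R₀ V)

theorem wordSum_const_eq : (wordSum fun w => const n (F w)) = const n (F []) +
    ∑ j, (MvPowerSeries.X j : MvPowerSeries (Fin n) R₀) • wordSum fun w => const n (F (j :: w)) :=
  wordSum_eq _

theorem pderivE_wordSum_eq (i : Fin n) :
    pderivE i (wordSum fun w => const n (F w)) = (wordSum fun w => const n (F (i :: w))) +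
      ∑ j, (MvPowerSeries.X j : MvPowerSeries (Fin n) R₀) •
        pderivE i (wordSum fun w => const n (F (j :: w))) := by
  rw [wordSum_const_eq, map_add, pderivE_const, zero_add, map_sum]
  simp only [pderivE_X_smul, Finset.sum_add_distrib]
  rw [Finset.sum_ite_eq, if_pos (Finset.mem_univ i)]

/-- Differentiating with respect to `x i` inserts the letter `i` into words at every position. -/
theorem pderivE_wordSum (i : Fin n) : pderivE i (wordSum fun w => const n (F w)) =
    wordSum fun x => wordSum fun z => const n (F (x ++ i :: z)) :=
  eq_of_recursion (T := fun F : List (Fin n) → ExtAlg R₀ V =>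
      pderivE i (wordSum fun w => const n (F w)))
    (T' := fun F => wordSum fun x => wordSum fun z => const n (F (x ++ i :: z)))
    (fun F => wordSum fun w => const n (F (i :: w))) (fun j F w => F (j :: w))
    (fun F => pderivE_wordSum_eq F i)
    (fun F => wordSum_eq fun x => wordSum fun z => const n (F (x ++ i :: z))) F

/-- The divided second derivative inserts the letter `i` at every unordered pair of positions, so
no division by two is needed. -/
theorem halfPderivSqE_wordSum (i : Fin n) : halfPderivSqE i (wordSum fun w => const n (F w)) =
    wordSum fun x => wordSum fun y => wordSum fun z => const n (F (x ++ i :: (y ++ i :: z))) := by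
  refine eq_of_recursion (T := fun F : List (Fin n) → ExtAlg R₀ V =>
      halfPderivSqE i (wordSum fun w => const n (F w)))
    (T' := fun F => wordSum fun x => wordSum fun y => wordSum fun z =>
      const n (F (x ++ i :: (y ++ i :: z))))
    (fun F => pderivE i (wordSum fun w => const n (F (i :: w)))) (fun j F w => F (j :: w))
    (fun F => ?_) (fun F => ?_) F
  · rw [wordSum_const_eq F, map_add, halfPderivSqE_const, zero_add, map_sum]
    simp only [halfPderivSqE_X_smul, Finset.sum_add_distrib]
    rw [Finset.sum_ite_eq, if_pos (Finset.mem_univ i)]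
  · rw [pderivE_wordSum]
    exact wordSum_eq fun x => wordSum fun y => wordSum fun z =>
      const n (F (x ++ i :: (y ++ i :: z)))

theorem pderivE_pderivE_wordSum (i j : Fin n) :
    pderivE i (pderivE j (wordSum fun w => const n (F w))) =
    (wordSum fun x => wordSum fun y => wordSum fun z => const n (F (x ++ i :: (y ++ j :: z)))) +
      wordSum fun x => wordSum fun y => wordSum fun z => const n (F (x ++ j :: (y ++ i :: z))) := by
  refine eq_of_recursion (T := fun F : List (Fin n) → ExtAlg R₀ V =>
      pderivE i (pderivE j (wordSum fun w => const n (F w))))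
    (T' := fun F => (wordSum fun x => wordSum fun y => wordSum fun z =>
      const n (F (x ++ i :: (y ++ j :: z)))) + wordSum fun x => wordSum fun y => wordSum fun z =>
      const n (F (x ++ j :: (y ++ i :: z))))
    (fun F => pderivE j (wordSum fun w => const n (F (i :: w))) +
      pderivE i (wordSum fun w => const n (F (j :: w)))) (fun k F w => F (k :: w))
    (fun F => ?_) (fun F => ?_) F
  · rw [pderivE_wordSum_eq F j, map_add, map_sum]
    simp only [pderivE_X_smul, Finset.sum_add_distrib]
    rw [Finset.sum_ite_eq, if_pos (Finset.mem_univ i)]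
    abel
  · have h1 := wordSum_eq fun x => wordSum fun y => wordSum fun z =>
      const n (F (x ++ i :: (y ++ j :: z)))
    have h2 := wordSum_eq fun x => wordSum fun y => wordSum fun z =>
      const n (F (x ++ j :: (y ++ i :: z)))
    rw [h1, h2, pderivE_wordSum, pderivE_wordSum]
    simp only [List.nil_append, List.cons_append, smul_add, Finset.sum_add_distrib]
    abel

end Derivative

end Insert

/-! ### The algebra `A_v` -/

section Taut

variable {R₀ V : Type*} [CommRing R₀] [AddCommGroup V] [Module R₀ V] {n : ℕ}
  (A : SuperfilteredDeformation R₀ V) (b : Module.Basis (Fin n) R₀ V)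
  {f φ ψ χ : List (ExtAlg R₀ V) → ExtAlg R₀ V}

theorem map_sgn (t : ZMod 2) :
    (MvPowerSeries.C (sgn R₀ t) : MvPowerSeries (Fin n) R₀) = sgn (MvPowerSeries (Fin n) R₀) t := by
  rcases zmod_two_cases t with rfl | rfl <;> simp [sgn_zero, sgn_one]

theorem const_sgn_smul (t : ZMod 2) (e : ExtAlg R₀ V) :
    const n (sgn R₀ t • e) = sgn (MvPowerSeries (Fin n) R₀) t • const n e := by
  rw [const_smul, map_sgn]

/-- Induction over `E_R`, which is generated over `R` by the homogeneous elements of `E`. -/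
theorem extSeries_induction (b : Module.Basis (Fin n) R₀ V) {P : ExtSeries R₀ V n → Prop}
    (hadd : ∀ a c, P a → P c → P (a + c))
    (hsmul : ∀ (r : MvPowerSeries (Fin n) R₀) a, P a → P (r • a))
    (hconst : ∀ (t : ZMod 2), ∀ e ∈ parityPart R₀ V t, P (const n e)) (a : ExtSeries R₀ V n) :
    P a := by
  have h0 : P 0 := by simpa using hsmul 0 _ (hconst 0 0 (zero_mem _))
  have h1 : ∀ e : ExtAlg R₀ V, P (const n e) := by
    intro e
    have he : e ∈ Submodule.span R₀ (homog R₀ V) := by rw [span_homog]; trivial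
    induction he using Submodule.span_induction with
    | mem e he => exact hconst he.choose e he.choose_spec
    | zero => rw [const_zero]; exact h0
    | add e e' _ _ h h' => rw [const_add]; exact hadd _ _ h h'
    | smul r e _ h => rw [const_smul]; exact hsmul _ _ h
  rw [← (constBasis b).sum_repr a]
  refine Finset.sum_induction _ P hadd h0 fun I _ => hsmul _ _ ?_
  rw [constBasis_apply]
  exact h1 _

theorem dTaut_apply (a : ExtSeries R₀ V n) :
    dTaut A b a = insert₁ b A.μ (epsR a) := rfl

theorem mulTaut_apply (a c : ExtSeries R₀ V n) :
    mulTaut A b a c = insert₂ b A.μ a (epsR c) := rfl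

theorem epsR_epsR (a : ExtSeries R₀ V n) : epsR (epsR a) = a :=
  coeffE_ext fun m => eps_eps (coeffE m a)

theorem epsR_const (e : ExtAlg R₀ V) : epsR (const n e) = const n (eps e) := mapE_const eps e

theorem epsR_const_of_mem {t : ZMod 2} {e : ExtAlg R₀ V} (he : e ∈ parityPart R₀ V t) :
    epsR (const n e) = sgn (MvPowerSeries (Fin n) R₀) t • const n e := by
  rw [epsR_const, eps_of_mem he, const_sgn_smul]

theorem mapE_tw_of_epsR {a : ExtSeries R₀ V n} {t : ZMod 2}
    (h : epsR a = sgn (MvPowerSeries (Fin n) R₀) t • a) (p : ZMod 2) :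
    mapE (tw p) a = sgn (MvPowerSeries (Fin n) R₀) ((p - 1) * (t - 1)) • a := by
  rcases zmod_two_cases p with rfl | rfl
  · have h1 : mapE (tw 0) a = -epsR a := coeffE_ext fun m => by
      have h2 := coeffE_sub m 0 (epsR a)
      rw [zero_sub, coeffE_zero, zero_sub] at h2
      rw [h2, tw_zero]
      rfl
    rw [h1, h]
    rcases zmod_two_cases t with rfl | rfl <;> simp [sgn]
  · have h1 : mapE (tw 1) a = a := coeffE_ext fun m => by
      rw [tw_one]
      rfl
    rw [h1, sub_self, zero_mul, sgn_zero, one_smul]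

theorem list_sum_parity (w : List (Fin n)) :
    ∃ k : List (ZMod 2 × ExtAlg R₀ V), (∀ a ∈ k, a.2 ∈ parityPart R₀ V a.1) ∧
      k.map Prod.snd = basisWord b w ∧ (k.map Prod.fst).sum = k.length := by
  refine ⟨w.map fun i => (1, ExteriorAlgebra.ι R₀ (b i)), ?_, ?_, ?_⟩
  · simp only [List.mem_map]
    rintro a ⟨i, _, rfl⟩
    exact CliffordAlgebra.ι_mem_evenOdd_one _ _
  · simp [basisWord, Function.comp_def]
  · simp [Function.comp_def]

theorem mem_parityPart_basisWord {t : ZMod 2} (hp : HasParity t φ) (w : List (Fin n)) :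
    φ (basisWord b w) ∈ parityPart R₀ V t := by
  obtain ⟨k, hk, h1, h2⟩ := list_sum_parity b w
  have := hp k hk
  rwa [h1, h2, sub_add_cancel] at this

theorem epsR_evalTaut {t : ZMod 2} (hφ : IsCochain (t, φ)) :
    epsR (evalTaut b φ) = sgn (MvPowerSeries (Fin n) R₀) t • evalTaut b φ := by
  have hm : IsMultilinear φ := hφ.multilinear
  rw [evalTaut_eq b hm, wordSum_map, ← wordSum_smul]
  exact wordSum_congr fun w => epsR_const_of_mem (mem_parityPart_basisWord b hφ.parity w)

theorem evalTaut_add (hφ : IsMultilinear φ) (hψ : IsMultilinear ψ) :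
    evalTaut b (fun l => φ l + ψ l) = evalTaut b φ + evalTaut b ψ := by
  rw [evalTaut_eq b (hφ.add hψ), evalTaut_eq b hφ, evalTaut_eq b hψ]
  simp only [const_add, wordSum_add]

theorem evalTaut_smul (hφ : IsMultilinear φ) (r : R₀) :
    evalTaut b (fun l => r • φ l) =
      (MvPowerSeries.C r : MvPowerSeries (Fin n) R₀) • evalTaut b φ := by
  rw [evalTaut_eq b (hφ.smul r), evalTaut_eq b hφ]
  simp only [const_smul, wordSum_smul]

theorem evalTaut_zero : evalTaut (n := n) b (fun _ => (0 : ExtAlg R₀ V)) = 0 := by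
  rw [evalTaut_eq b ⟨by simp, by simp⟩]
  simp only [const_zero, wordSum_zero]

/-! #### The value of the operations on the tautological element is the potential -/

theorem ι_mem_filt (v : V) : ExteriorAlgebra.ι R₀ v ∈ filt R₀ V 1 := by
  refine Submodule.mem_iSup_of_mem 1 (Submodule.mem_iSup_of_mem le_rfl ?_)
  simp

theorem filt_mono {p q : ℤ} (h : p ≤ q) : filt R₀ V p ≤ filt R₀ V q :=
  iSup₂_le fun i hi => le_iSup₂_of_le i (hi.trans h) le_rfl

/-- An even element of filtration level one is a scalar. This is why the potential, a priori an
element of `E_R`, lies in `R`. -/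
theorem mem_bot_of_filt_one_even {x : ExtAlg R₀ V} (h1 : x ∈ filt R₀ V 1)
    (h2 : x ∈ parityPart R₀ V 0) : algebraMap R₀ _ (ExteriorAlgebra.algebraMapInv x) = x := by
  have h3 : filt R₀ V 1 ≤
      (1 : Submodule R₀ (ExtAlg R₀ V)) ⊔ LinearMap.range (ExteriorAlgebra.ι R₀) := by
    refine iSup₂_le fun i hi => ?_
    have hi' : i ≤ 1 := by exact_mod_cast hi
    interval_cases i
    · exact (pow_zero _).le.trans le_sup_left
    · exact (pow_one _).le.trans le_sup_right
  obtain ⟨y, hy, z, hz, rfl⟩ := Submodule.mem_sup.1 (h3 h1)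
  obtain ⟨r, rfl⟩ := Submodule.mem_one.1 hy
  obtain ⟨v, rfl⟩ := hz
  have hr : algebraMap R₀ (ExtAlg R₀ V) r ∈ parityPart R₀ V 0 := by
    rw [Algebra.algebraMap_eq_smul_one]
    exact Submodule.smul_mem _ _ one_mem_parityPart
  have hv : ExteriorAlgebra.ι R₀ v ∈ parityPart R₀ V 0 := by
    simpa using sub_mem h2 hr
  have hv0 : ExteriorAlgebra.ι R₀ v = 0 := by
    have h4 := (DirectSum.Decomposition.isInternal (parityPart R₀ V)).submodule_iSupIndep
    have h5 := (h4.pairwiseDisjoint (show (0 : ZMod 2) ≠ 1 by decide))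
    exact Submodule.disjoint_def.1 h5 _ hv (CliffordAlgebra.ι_mem_evenOdd_one _ _)
  rw [hv0, add_zero]
  congr 1
  exact ExteriorAlgebra.algebraMap_leftInverse V r

theorem coeffE_wordSum_mem {S : Submodule R₀ (ExtAlg R₀ V)} {F : List (Fin n) → ExtAlg R₀ V}
    (hF : ∀ w, F w ∈ S) (m : Fin n →₀ ℕ) : coeffE m (wordSum fun w => const n (F w)) ∈ S := by
  have h : ∀ k (F : List (Fin n) → ExtAlg R₀ V), (∀ w, F w ∈ S) → ∀ m,
      coeffE m (wordSumDeg k fun w => const n (F w)) ∈ S := by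
    intro k
    induction k with
    | zero =>
      intro F hF m
      rw [wordSumDeg, coeffE_const]
      split_ifs
      exacts [hF _, zero_mem _]
    | succ k ih =>
      intro F hF m
      rw [wordSumDeg, coeffE_sum]
      refine sum_mem fun j _ => ?_
      rw [coeffE_X_smul]
      split_ifs
      exacts [ih _ (fun w => hF _) _, zero_mem _]
  rw [wordSum, coeffE_series]
  exact sum_mem fun k _ => h k F hF m

theorem basisWord_filt (w : List (Fin n)) :
    ∃ k : List (ℤ × ExtAlg R₀ V), (∀ a ∈ k, a.2 ∈ filt R₀ V a.1) ∧
      k.map Prod.snd = basisWord b w ∧ (k.map Prod.fst).sum = k.length := by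
  refine ⟨w.map fun i => (1, ExteriorAlgebra.ι R₀ (b i)), ?_, ?_, ?_⟩
  · simp only [List.mem_map]
    rintro a ⟨i, _, rfl⟩
    exact ι_mem_filt _
  · simp [basisWord, Function.comp_def]
  · simp [Function.comp_def]

theorem sum_antisymm {N ι : Type*} [AddCommGroup N] (s : Finset ι) (G : ι → ι → N)
    (h0 : ∀ i, G i i = 0) (h1 : ∀ i j, G i j + G j i = 0) : ∑ i ∈ s, ∑ j ∈ s, G i j = 0 := by
  rw [← Finset.sum_product']
  refine Finset.sum_involution (fun p _ => p.swap) (fun p _ => h1 p.1 p.2) ?_ ?_ ?_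
  · rintro ⟨i, j⟩ _ hne h
    have : i = j := congrArg Prod.snd h
    subst this
    exact hne (h0 i)
  · rintro ⟨i, j⟩ hp
    simpa [and_comm] using hp
  · simp

/-- The square of the tautological element in the exterior algebra vanishes. -/
theorem wordSum_wedge : (wordSum fun w : List (Fin n) => const n (if w.length = 2 then
    (basisWord b w).prod else 0)) = 0 := by
  have h3 : ∀ (i j k : Fin n) w, ¬ (i :: j :: k :: w).length = 2 := fun i j k w => by simp
  rw [wordSum_eq]
  simp only [List.length_nil, OfNat.zero_ne_ofNat, if_false, const_zero, zero_add]
  have h1 : ∀ j : Fin n, (wordSum fun w => const n (if (j :: w).length = 2 then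
      (basisWord b (j :: w)).prod else 0)) = ∑ i, (MvPowerSeries.X i : MvPowerSeries (Fin n) R₀) •
      const n (ExteriorAlgebra.ι R₀ (b j) * ExteriorAlgebra.ι R₀ (b i)) := by
    intro j
    rw [wordSum_eq]
    simp only [List.length_cons, List.length_nil, zero_add, OfNat.one_ne_ofNat, if_false,
      const_zero]
    refine Finset.sum_congr rfl fun i _ => congrArg _ ?_
    rw [wordSum_eq]
    simp [basisWord, const_zero, wordSum_zero]
  simp only [h1, Finset.smul_sum]
  refine sum_antisymm _ _ (fun i => ?_) fun i j => ?_
  · rw [ExteriorAlgebra.ι_sq_zero, const_zero, smul_zero, smul_zero]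
  · rw [smul_comm (MvPowerSeries.X j), ← smul_add, ← smul_add, ← const_add,
      ExteriorAlgebra.ι_add_mul_swap, const_zero, smul_zero, smul_zero]

/-- The operations of `A`, evaluated on the tautological element, sum up to the disc potential:
the sum has values in the part of filtration at most one, since the leading terms
`-∑ x_i x_j v_i ∧ v_j` cancel, and is even. -/
theorem evalTaut_μ : evalTaut b A.μ = discPotential A b • const n 1 := by
  have h1 : evalTaut b A.μ = wordSum fun w => const n (A.μ (basisWord b w) +
      if w.length = 2 then (basisWord b w).prod else 0) := by
    simp only [const_add, wordSum_add, wordSum_wedge, add_zero]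
    exact evalTaut_eq b A.multilinear
  have h2 : ∀ w, A.μ (basisWord b w) + (if w.length = 2 then (basisWord b w).prod else 0) ∈
      filt R₀ V 1 := by
    intro w
    obtain ⟨k, hk, hk1, hk2⟩ := basisWord_filt b w
    have hl : k.length = w.length := by
      have := congrArg List.length hk1
      simpa [basisWord] using this
    rcases w with _ | ⟨i, _ | ⟨j, _ | ⟨s, w⟩⟩⟩
    · simp [basisWord, A.zero]
    · simp [basisWord, A.one]
    · have := A.leading_two 1 1 _ (ι_mem_filt (b i)) _ (ι_mem_filt (b j))
      simpa [basisWord, eps_ι] using this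
    · have := A.leading_higher k (by rw [hl]; simp) hk
      rw [hk1, hk2] at this
      rw [if_neg (by simp), add_zero]
      refine filt_mono ?_ this
      omega
  have h3 : ∀ w, A.μ (basisWord b w) ∈ parityPart R₀ V 0 := mem_parityPart_basisWord b A.parity
  refine coeffE_ext fun m => ?_
  have h4 : coeffE m (evalTaut b A.μ) ∈ filt R₀ V 1 := by
    rw [h1]; exact coeffE_wordSum_mem h2 m
  have h5 : coeffE m (evalTaut b A.μ) ∈ parityPart R₀ V 0 := by
    rw [evalTaut_eq b A.multilinear]; exact coeffE_wordSum_mem h3 m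
  rw [coeffE_smul_const, ← Algebra.algebraMap_eq_smul_one]
  exact (mem_bot_of_filt_one_even h4 h5).symm

end Taut

/-! #### The differential and the Leibniz rule -/

section Taut

variable {R₀ V : Type*} [CommRing R₀] [AddCommGroup V] [Module R₀ V] {n : ℕ}
  (A : SuperfilteredDeformation R₀ V) (b : Module.Basis (Fin n) R₀ V)
  {φ ψ χ : List (ExtAlg R₀ V) → ExtAlg R₀ V} {p q r t : ZMod 2} {e e' e'' : ExtAlg R₀ V}

/-- The cochain with a single component `φ^0 = e`. -/
def constOp (e : ExtAlg R₀ V) (l : List (ExtAlg R₀ V)) : ExtAlg R₀ V := if l = [] then e else 0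

theorem isCochain_constOp (he : e ∈ parityPart R₀ V t) : IsCochain (t, constOp e) := by
  refine ⟨⟨by simp [constOp], by simp [constOp]⟩, fun l hl => ?_⟩
  rcases l with _ | ⟨a, l⟩
  · simpa [constOp] using he
  · simp [constOp]

theorem isReduced_constOp (e : ExtAlg R₀ V) : IsReduced (constOp e) := fun x z => by
  simp [constOp]

theorem isMultilinear_constOp (e : ExtAlg R₀ V) : IsMultilinear (constOp e) :=
  ⟨by simp [constOp], by simp [constOp]⟩

theorem evalTaut_constOp (e : ExtAlg R₀ V) : evalTaut b (constOp e) = const n e := by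
  rw [evalTaut_eq b (isMultilinear_constOp e), wordSum_eq]
  simp [constOp, basisWord, const_zero, wordSum_zero]

theorem insert₁_of_isReduced (hφ : IsMultilinear φ) (hr : IsReduced φ) :
    insert₁ b φ (const n 1) = 0 := by
  have h : ∀ x z, φ (x ++ 1 :: z) = 0 := hr
  rw [insert₁_const b hφ]
  simp only [h, const_zero, wordSum_zero]

/-- Evaluation on the tautological element intertwines the differentials. -/
theorem evalTaut_hochAux (hφ : IsCochain (t, φ)) (hr : IsReduced φ) :
    evalTaut b (hochAux A t φ) = dTaut A b (epsR (evalTaut b φ)) := by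
  have hm : IsMultilinear φ := hφ.multilinear
  have h1 : IsMultilinear (brace [(t, φ)] A.μ) := A.multilinear.brace (by simpa using hm)
  have h2 : IsMultilinear (barD A φ) := hm.brace (by simpa using A.multilinear)
  rw [hochAux_eq, evalTaut_add b h1 (h2.smul _), evalTaut_smul b h2,
    evalTaut_brace_one b A.multilinear hm, barD, evalTaut_brace_one b hm A.multilinear,
    evalTaut_μ, insert₁_smul b hm, insert₁_of_isReduced b hm hr, smul_zero, smul_zero, add_zero,
    dTaut_apply, epsR_epsR]

theorem sgn_smul_sgn_smul {M S : Type*} [CommRing S] [AddCommGroup M] [Module S M] (t : ZMod 2)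
    (a : M) : sgn S t • sgn S t • a = a := by rw [smul_smul, sgn_mul_self, one_smul]

theorem evalTaut_hochAux_constOp (he : e ∈ parityPart R₀ V t) :
    evalTaut b (hochAux A t (constOp e)) =
      sgn (MvPowerSeries (Fin n) R₀) t • dTaut A b (const n e) := by
  rw [evalTaut_hochAux A b (isCochain_constOp he) (isReduced_constOp e), evalTaut_constOp,
    epsR_const_of_mem he, map_smul]

theorem dTaut_const_parity (he : e ∈ parityPart R₀ V t) :
    epsR (dTaut A b (const n e)) =
      sgn (MvPowerSeries (Fin n) R₀) (t + 1) • dTaut A b (const n e) := by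
  have h := epsR_evalTaut b (isCochain_hochAux A (isCochain_constOp he))
  rw [evalTaut_hochAux_constOp A b he, map_smul, smul_comm] at h
  have h2 := congrArg (sgn (MvPowerSeries (Fin n) R₀) t • ·) h
  simpa only [sgn_smul_sgn_smul] using h2

theorem epsR_dTaut (a : ExtSeries R₀ V n) : epsR (dTaut A b a) = -dTaut A b (epsR a) := by
  induction a using extSeries_induction b with
  | hadd a c ha hc => simp only [map_add, ha, hc, neg_add]
  | hsmul r a ha => simp only [map_smul, ha, smul_neg]
  | hconst t e he =>
    rw [dTaut_const_parity A b he, epsR_const_of_mem he, map_smul, sgn_add_one, neg_smul]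

theorem dTaut_dTaut (a : ExtSeries R₀ V n) : dTaut A b (dTaut A b a) = 0 := by
  induction a using extSeries_induction b with
  | hadd a c ha hc => simp only [map_add, ha, hc, add_zero]
  | hsmul r a ha => simp only [map_smul, ha, smul_zero]
  | hconst t e he =>
    have hc := isCochain_constOp he
    have h1 := evalTaut_hochAux A b (isCochain_hochAux A hc)
      (isReduced_hochAux A hc (isReduced_constOp e))
    rw [evalTaut_hochAux_constOp A b he, funext (hochAux_hochAux A hc), evalTaut_zero, map_smul,
      dTaut_const_parity A b he, map_smul, map_smul, smul_smul, ← sgn_add] at h1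
    rcases sgn_eq (MvPowerSeries (Fin n) R₀) (t + (t + 1)) with h2 | h2 <;> rw [h2] at h1
    · rw [one_smul] at h1; exact h1.symm
    · rw [neg_smul, one_smul] at h1; exact neg_eq_zero.1 h1.symm

theorem insert₂_const_right (he : e' ∈ parityPart R₀ V q) (a : ExtSeries R₀ V n) :
    insert₂ b A.μ a (const n e') =
      sgn (MvPowerSeries (Fin n) R₀) q • mulTaut A b a (const n e') := by
  rw [mulTaut_apply, epsR_const_of_mem he, insert₂_smul_right b A.multilinear, sgn_smul_sgn_smul]

theorem insert₂_eq (a c : ExtSeries R₀ V n) : insert₂ b A.μ a c = mulTaut A b a (epsR c) := by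
  rw [mulTaut_apply, epsR_epsR]

theorem evalTaut_brace_constOp (he' : e' ∈ parityPart R₀ V q) :
    evalTaut b (brace [(p, constOp e), (q, constOp e')] A.μ) =
      sgn (MvPowerSeries (Fin n) R₀) ((p - 1) * (q - 1) + q) •
        mulTaut A b (const n e) (const n e') := by
  rw [evalTaut_brace_two b A.multilinear (isMultilinear_constOp e) (isMultilinear_constOp e'),
    evalTaut_constOp, evalTaut_constOp, mapE_tw_of_epsR (epsR_const_of_mem he'),
    insert₂_smul_right b A.multilinear, insert₂_const_right A b he', smul_smul, sgn_add]

theorem mulTaut_const_parity (he : e ∈ parityPart R₀ V p) (he' : e' ∈ parityPart R₀ V q) :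
    epsR (mulTaut A b (const n e) (const n e')) =
      sgn (MvPowerSeries (Fin n) R₀) (p + q) • mulTaut A b (const n e) (const n e') := by
  have h := epsR_evalTaut b (isCochain_brace_two A (isCochain_constOp he) (isCochain_constOp he'))
  rw [evalTaut_brace_constOp A b he', map_smul, smul_comm] at h
  have h2 := congrArg (sgn (MvPowerSeries (Fin n) R₀) ((p - 1) * (q - 1) + q) • ·) h
  simpa only [sgn_smul_sgn_smul] using h2

theorem epsR_mulTaut (a c : ExtSeries R₀ V n) :
    epsR (mulTaut A b a c) = mulTaut A b (epsR a) (epsR c) := by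
  induction a using extSeries_induction b with
  | hadd a c ha hc => simp only [map_add, LinearMap.add_apply, ha, hc]
  | hsmul r a ha => simp only [map_smul, LinearMap.smul_apply, ha]
  | hconst p e he =>
    induction c using extSeries_induction b with
    | hadd a c ha hc => simp only [map_add, ha, hc]
    | hsmul r a ha => simp only [map_smul, ha]
    | hconst q e' he' =>
      rw [mulTaut_const_parity A b he he', epsR_const_of_mem he, epsR_const_of_mem he', map_smul,
        map_smul, LinearMap.smul_apply, smul_smul, ← sgn_add, add_comm]

theorem dTaut_mulTaut_const (he : e ∈ parityPart R₀ V p) (he' : e' ∈ parityPart R₀ V q) :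
    dTaut A b (mulTaut A b (const n e) (const n e')) =
      mulTaut A b (dTaut A b (const n e)) (const n e') +
        mulTaut A b (epsR (const n e)) (dTaut A b (const n e')) := by
  have hc := isCochain_constOp he
  have hc' := isCochain_constOp he'
  have hd := isCochain_hochAux A hc
  have hd' := isCochain_hochAux A hc'
  have h0 := evalTaut_hochAux A b (isCochain_brace_two A hc hc')
    (isReduced_brace_two A (isReduced_constOp e) (isReduced_constOp e'))
  have h1 : IsMultilinear (brace [(p + 1, hochAux A p (constOp e)), (q, constOp e')] A.μ) :=
    (isCochain_brace_two A hd hc').multilinear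
  have h2 : IsMultilinear (brace [(p, constOp e), (q + 1, hochAux A q (constOp e'))] A.μ) :=
    (isCochain_brace_two A hc hd').multilinear
  have h3 : hochAux A (p + q) (brace [(p, constOp e), (q, constOp e')] A.μ) = fun l =>
      (-1 : R₀) • brace [(p + 1, hochAux A p (constOp e)), (q, constOp e')] A.μ l +
        sgn R₀ p • brace [(p, constOp e), (q + 1, hochAux A q (constOp e'))] A.μ l := by
    funext l
    rw [hochAux_brace_two A hc hc', neg_one_smul]
  rw [h3, evalTaut_add b (h1.smul _) (h2.smul _), evalTaut_smul b h1, evalTaut_smul b h2,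
    evalTaut_brace_two b A.multilinear hd.multilinear hc'.multilinear,
    evalTaut_brace_two b A.multilinear hc.multilinear hd'.multilinear,
    mapE_tw_of_epsR (epsR_evalTaut b hc'), mapE_tw_of_epsR (epsR_evalTaut b hd'),
    evalTaut_hochAux_constOp A b he, evalTaut_hochAux_constOp A b he', evalTaut_constOp,
    evalTaut_constOp, epsR_evalTaut b (isCochain_brace_two A hc hc'),
    evalTaut_brace_constOp A b he', insert₂_eq, insert₂_eq] at h0
  simp only [map_smul, LinearMap.smul_apply, epsR_const_of_mem he', dTaut_const_parity A b he',
    smul_smul, ← sgn_add, map_neg, map_one, map_sgn] at h0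
  rw [epsR_const_of_mem he, map_smul, LinearMap.smul_apply]
  rcases zmod_two_cases p with rfl | rfl <;> rcases zmod_two_cases q with rfl | rfl <;>
  · simp [sgn, show (1 + 1 : ZMod 2) = 0 from by decide] at h0 ⊢
    first
    | linear_combination (norm := module) h0
    | linear_combination (norm := module) -h0

/-- The Leibniz rule. By bilinearity it reduces to constants, where it is the compatibility of
evaluation with differential and braces, applied to constant cochains. -/
theorem dTaut_mulTaut (a c : ExtSeries R₀ V n) : dTaut A b (mulTaut A b a c) =
    mulTaut A b (dTaut A b a) c + mulTaut A b (epsR a) (dTaut A b c) := by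
  induction a using extSeries_induction b with
  | hadd a c ha hc => simp only [map_add, LinearMap.add_apply, ha, hc]; abel
  | hsmul r a ha => simp only [map_smul, LinearMap.smul_apply, ha, smul_add]
  | hconst p e he =>
    induction c using extSeries_induction b with
    | hadd a c ha hc => simp only [map_add, ha, hc]; abel
    | hsmul r a ha => simp only [map_smul, ha, smul_add]
    | hconst q e' he' => exact dTaut_mulTaut_const A b he he'

end Taut

/-! #### Associativity up to homotopy -/

section Taut

variable {R₀ V : Type*} [CommRing R₀] [AddCommGroup V] [Module R₀ V] {n : ℕ}
  (A : SuperfilteredDeformation R₀ V) (b : Module.Basis (Fin n) R₀ V)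
  {φ ψ χ : List (ExtAlg R₀ V) → ExtAlg R₀ V} {p q r t : ZMod 2} {e e' e'' : ExtAlg R₀ V}

theorem insert₃_parity (he : e ∈ parityPart R₀ V p) (he' : e' ∈ parityPart R₀ V q)
    (he'' : e'' ∈ parityPart R₀ V r) :
    epsR (insert₃ b A.μ (const n e) (const n e') (const n e'')) =
      sgn (MvPowerSeries (Fin n) R₀) (p + q + r + 1) •
        insert₃ b A.μ (const n e) (const n e') (const n e'') := by
  rw [insert₃_const b A.multilinear, wordInsert₃]
  simp only [wordSum_map, ← wordSum_smul]
  refine wordSum_congr fun x => wordSum_congr fun y => wordSum_congr fun z => wordSum_congr fun u =>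
    epsR_const_of_mem ?_
  obtain ⟨x', hx, hx1, hx2⟩ := list_sum_parity b x
  obtain ⟨y', hy, hy1, hy2⟩ := list_sum_parity b y
  obtain ⟨z', hz, hz1, hz2⟩ := list_sum_parity b z
  obtain ⟨u', hu, hu1, hu2⟩ := list_sum_parity b u
  have := A.parity (x' ++ (p, e) :: (y' ++ (q, e') :: (z' ++ (r, e'') :: u'))) (by
    simp only [List.mem_append, List.mem_cons]
    rintro a (h | rfl | h | rfl | h | rfl | h)
    exacts [hx a h, he, hy a h, he', hz a h, he'', hu a h])
  simp only [List.map_append, List.map_cons, hx1, hy1, hz1, hu1, List.sum_append, List.sum_cons,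
    hx2, hy2, hz2, hu2, List.length_append, List.length_cons] at this
  convert this using 1
  refine congrArg (parityPart R₀ V) ?_
  push_cast
  have h2 : (2 : ZMod 2) = 0 := by decide
  linear_combination h2

theorem epsR_insert₃ (a c d : ExtSeries R₀ V n) : epsR (insert₃ b A.μ a c d) =
    -insert₃ b A.μ (epsR a) (epsR c) (epsR d) := by
  induction a using extSeries_induction b with
  | hadd a c ha hc => simp only [map_add, LinearMap.add_apply, ha, hc, neg_add]
  | hsmul r a ha => simp only [map_smul, LinearMap.smul_apply, ha, smul_neg]
  | hconst p e he =>
    induction c using extSeries_induction b with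
    | hadd a c ha hc => simp only [map_add, LinearMap.add_apply, ha, hc, neg_add]
    | hsmul r a ha => simp only [map_smul, LinearMap.smul_apply, ha, smul_neg]
    | hconst q e' he' =>
      induction d using extSeries_induction b with
      | hadd a c ha hc => simp only [map_add, ha, hc, neg_add]
      | hsmul r a ha => simp only [map_smul, ha, smul_neg]
      | hconst r e'' he'' =>
        rw [insert₃_parity A b he he' he'', epsR_const_of_mem he, epsR_const_of_mem he',
          epsR_const_of_mem he'']
        simp only [map_smul, LinearMap.smul_apply, smul_smul]
        rw [sgn_add_one, neg_smul, sgn_add, sgn_add, mul_comm, mul_comm (sgn _ p)]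

/-- The homotopy for the associativity of the product of `A_v`, on homogeneous elements. -/
theorem mulTaut_assoc_const (he : e ∈ parityPart R₀ V p) (he' : e' ∈ parityPart R₀ V q)
    (he'' : e'' ∈ parityPart R₀ V r) :
    mulTaut A b (const n e) (mulTaut A b (const n e') (const n e'')) -
      mulTaut A b (mulTaut A b (const n e) (const n e')) (const n e'') =
    dTaut A b (insert₃ b A.μ (epsR (const n e)) (const n e') (epsR (const n e''))) +
      insert₃ b A.μ (epsR (dTaut A b (const n e))) (const n e') (epsR (const n e'')) +
      insert₃ b A.μ (const n e) (dTaut A b (const n e')) (epsR (const n e'')) +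
      insert₃ b A.μ (const n e) (epsR (const n e')) (epsR (dTaut A b (const n e''))) := by
  have hc := isCochain_constOp he
  have hc' := isCochain_constOp he'
  have hc'' := isCochain_constOp he''
  have hd := isCochain_hochAux A hc
  have hd' := isCochain_hochAux A hc'
  have hd'' := isCochain_hochAux A hc''
  have hb := isCochain_brace_two A hc hc'
  have hb' := isCochain_brace_two A hc' hc''
  have h3 : ∀ {p q r : ZMod 2} {φ ψ χ : List (ExtAlg R₀ V) → ExtAlg R₀ V}, IsCochain (p, φ) →
      IsCochain (q, ψ) → IsCochain (r, χ) →
      IsCochain (p + q + r + 1, brace [(p, φ), (q, ψ), (r, χ)] A.μ) := by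
    intro p q r φ ψ χ h1 h2 h3
    have h := IsCochain.brace (Φ := [(p, φ), (q, ψ), (r, χ)]) A.multilinear A.parity
      (by simpa using ⟨h1, h2, h3⟩)
    have h1 : (2 : ZMod 2) + (p - 1 + (q - 1 + (r - 1 + 0))) = p + q + r + 1 :=
      (by decide : ∀ p q r : ZMod 2,
        (2 : ZMod 2) + (p - 1 + (q - 1 + (r - 1 + 0))) = p + q + r + 1) p q r
    rwa [braceDeg_cons, braceDeg_cons, braceDeg_cons, braceDeg_nil, h1] at h
  have m1 := (isCochain_hochAux A (h3 hc hc' hc'')).multilinear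
  have m2 := (h3 hd hc' hc'').multilinear
  have m3 := (h3 hc hd' hc'').multilinear
  have m4 := (h3 hc hc' hd'').multilinear
  have m5 := (isCochain_brace_two A hb hc'').multilinear
  have m6 := (isCochain_brace_two A hc hb').multilinear
  have key := funext (hochAux_brace_three A hc hc' hc'')
  have h0 := (congrArg (evalTaut b) key).trans (evalTaut_zero b)
  have hE : evalTaut b (hochAux A (p + q + r + 1)
      (brace [(p, constOp e), (q, constOp e'), (r, constOp e'')] A.μ)) +
      evalTaut b (brace [(p + 1, hochAux A p (constOp e)), (q, constOp e'), (r, constOp e'')] A.μ) -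
      sgn (MvPowerSeries (Fin n) R₀) p • evalTaut b
        (brace [(p, constOp e), (q + 1, hochAux A q (constOp e')), (r, constOp e'')] A.μ) +
      (sgn (MvPowerSeries (Fin n) R₀) p * sgn (MvPowerSeries (Fin n) R₀) q) • evalTaut b
        (brace [(p, constOp e), (q, constOp e'), (r + 1, hochAux A r (constOp e''))] A.μ) +
      evalTaut b (brace [(p + q, brace [(p, constOp e), (q, constOp e')] A.μ),
        (r, constOp e'')] A.μ) -
      sgn (MvPowerSeries (Fin n) R₀) p • evalTaut b (brace [(p, constOp e),
        (q + r, brace [(q, constOp e'), (r, constOp e'')] A.μ)] A.μ) = 0 := by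
    simp only [sub_eq_add_neg, ← neg_smul] at h0
    rw [evalTaut_add b ((((m1.add m2).add (m3.smul _)).add (m4.smul _)).add m5) (m6.smul _),
      evalTaut_add b (((m1.add m2).add (m3.smul _)).add (m4.smul _)) m5,
      evalTaut_add b ((m1.add m2).add (m3.smul _)) (m4.smul _),
      evalTaut_add b (m1.add m2) (m3.smul _), evalTaut_add b m1 m2, evalTaut_smul b m3,
      evalTaut_smul b m4, evalTaut_smul b m6] at h0
    simp only [map_neg, map_mul, map_sgn, neg_smul, ← sub_eq_add_neg] at h0
    exact h0
  rw [evalTaut_hochAux A b (h3 hc hc' hc'') (isReduced_brace_three A (isReduced_constOp e)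
      (isReduced_constOp e') (isReduced_constOp e'')),
    evalTaut_brace_three b A.multilinear hc.multilinear hc'.multilinear hc''.multilinear,
    evalTaut_brace_three b A.multilinear hd.multilinear hc'.multilinear hc''.multilinear,
    evalTaut_brace_three b A.multilinear hc.multilinear hd'.multilinear hc''.multilinear,
    evalTaut_brace_three b A.multilinear hc.multilinear hc'.multilinear hd''.multilinear,
    evalTaut_brace_two b A.multilinear hb.multilinear hc''.multilinear,
    evalTaut_brace_two b A.multilinear hc.multilinear hb'.multilinear,
    mapE_tw_of_epsR (epsR_evalTaut b hb'), evalTaut_brace_constOp A b he',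
    evalTaut_brace_constOp A b he'',
    evalTaut_hochAux_constOp A b he, evalTaut_hochAux_constOp A b he',
    evalTaut_hochAux_constOp A b he'', evalTaut_constOp, evalTaut_constOp, evalTaut_constOp,
    insert₂_eq, insert₂_eq] at hE
  simp only [map_smul, LinearMap.smul_apply, mapE_tw_of_epsR (epsR_const_of_mem he'),
    mapE_tw_of_epsR (epsR_const_of_mem he''), mapE_tw_of_epsR (dTaut_const_parity A b he'),
    mapE_tw_of_epsR (dTaut_const_parity A b he''), insert₃_parity A b he he' he'',
    mulTaut_const_parity A b he' he'', epsR_const_of_mem he''] at hE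
  simp only [epsR_const_of_mem he, epsR_const_of_mem he', epsR_const_of_mem he'',
    dTaut_const_parity A b he, dTaut_const_parity A b he'', map_smul, LinearMap.smul_apply]
  rcases zmod_two_cases p with rfl | rfl <;> rcases zmod_two_cases q with rfl | rfl <;>
    rcases zmod_two_cases r with rfl | rfl <;>
  · simp [sgn, show (1 + 1 : ZMod 2) = 0 from by decide] at hE ⊢
    first
    | linear_combination (norm := module) hE
    | linear_combination (norm := module) -hE

/-- The product of `A_v` is associative up to the homotopy that inserts the three arguments into
`μ`. -/
theorem mulTaut_assoc (a c d : ExtSeries R₀ V n) :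
    mulTaut A b a (mulTaut A b c d) - mulTaut A b (mulTaut A b a c) d =
    dTaut A b (insert₃ b A.μ (epsR a) c (epsR d)) +
      insert₃ b A.μ (epsR (dTaut A b a)) c (epsR d) +
      insert₃ b A.μ a (dTaut A b c) (epsR d) + insert₃ b A.μ a (epsR c) (epsR (dTaut A b d)) := by
  induction a using extSeries_induction b with
  | hadd a c ha hc =>
    simp only [map_add, LinearMap.add_apply]
    linear_combination (norm := module) ha + hc
  | hsmul r a ha =>
    simp only [map_smul, LinearMap.smul_apply]
    simp only [← smul_add, ← smul_sub, ha]
  | hconst p e he =>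
    induction c using extSeries_induction b with
    | hadd a c ha hc =>
      simp only [map_add, LinearMap.add_apply]
      linear_combination (norm := module) ha + hc
    | hsmul r a ha =>
      simp only [map_smul, LinearMap.smul_apply]
      simp only [← smul_add, ← smul_sub, ha]
    | hconst q e' he' =>
      induction d using extSeries_induction b with
      | hadd a c ha hc =>
        simp only [map_add]
        linear_combination (norm := module) ha + hc
      | hsmul r a ha =>
        simp only [map_smul]
        simp only [← smul_add, ← smul_sub, ha]
      | hconst r e'' he'' => exact mulTaut_assoc_const A b he he' he''

end Taut

/-! #### Units -/

section Taut

variable {R₀ V : Type*} [CommRing R₀] [AddCommGroup V] [Module R₀ V] {n : ℕ}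
  (A : SuperfilteredDeformation R₀ V) (b : Module.Basis (Fin n) R₀ V)
  {φ ψ χ : List (ExtAlg R₀ V) → ExtAlg R₀ V} {p q r t : ZMod 2} {e e' e'' : ExtAlg R₀ V}

theorem wordSum_eq_nil {F : List (Fin n) → ExtSeries R₀ V n} (h : ∀ w, w ≠ [] → F w = 0) :
    wordSum F = F [] := by
  rw [wordSum_eq, Finset.sum_eq_zero, add_zero]
  intro j _
  have h1 : (fun w => F (j :: w)) = fun _ => 0 := funext fun w => h _ (by simp)
  rw [h1, wordSum_zero, smul_zero]

theorem mulTaut_one (a : ExtSeries R₀ V n) : mulTaut A b a (const n 1) = a := by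
  induction a using extSeries_induction b with
  | hadd a c ha hc => rw [map_add, LinearMap.add_apply, ha, hc]
  | hsmul r a ha => rw [map_smul, LinearMap.smul_apply, ha]
  | hconst t e he =>
    rw [mulTaut_apply, epsR_const, eps_one, insert₂_const b A.multilinear]
    have h : ∀ x y z : List (Fin n), 1 ≤ x.length + y.length + z.length →
        A.μ (basisWord b x ++ e :: (basisWord b y ++ 1 :: basisWord b z)) = 0 := by
      intro x y z h
      have := A.unit_higher (basisWord b x ++ e :: basisWord b y) (basisWord b z) (by
        simp only [List.length_append, List.length_cons, basisWord, List.length_map]; omega)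
      simpa using this
    rw [wordSum_eq_nil, wordSum_eq_nil, wordSum_eq_nil]
    · simp [basisWord, A.unit_right]
    · intro z hz
      have := List.length_pos_of_ne_nil hz
      rw [h _ _ _ (by omega), const_zero]
    · intro y hy
      have := List.length_pos_of_ne_nil hy
      exact (wordSum_congr fun z => by rw [h _ y _ (by omega), const_zero]).trans wordSum_zero
    · intro x hx
      have := List.length_pos_of_ne_nil hx
      refine (wordSum_congr fun y => ?_).trans wordSum_zero
      exact (wordSum_congr fun z => by rw [h x _ _ (by omega), const_zero]).trans wordSum_zero

theorem one_mulTaut (a : ExtSeries R₀ V n) : mulTaut A b (const n 1) a = a := by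
  induction a using extSeries_induction b with
  | hadd a c ha hc => rw [map_add, ha, hc]
  | hsmul r a ha => rw [map_smul, ha]
  | hconst t e he =>
    rw [mulTaut_apply, epsR_const, insert₂_const b A.multilinear]
    have h : ∀ x y z : List (Fin n), 1 ≤ x.length + y.length + z.length →
        A.μ (basisWord b x ++ 1 :: (basisWord b y ++ eps e :: basisWord b z)) = 0 := by
      intro x y z h
      refine A.unit_higher _ _ ?_
      simp only [List.length_append, List.length_cons, basisWord, List.length_map]; omega
    rw [wordSum_eq_nil, wordSum_eq_nil, wordSum_eq_nil]
    · simp [basisWord, A.unit_left, eps_eps]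
    · intro z hz
      have := List.length_pos_of_ne_nil hz
      rw [h _ _ _ (by omega), const_zero]
    · intro y hy
      have := List.length_pos_of_ne_nil hy
      exact (wordSum_congr fun z => by rw [h _ y _ (by omega), const_zero]).trans wordSum_zero
    · intro x hx
      have := List.length_pos_of_ne_nil hx
      refine (wordSum_congr fun y => ?_).trans wordSum_zero
      exact (wordSum_congr fun z => by rw [h x _ _ (by omega), const_zero]).trans wordSum_zero

theorem dTaut_one : dTaut A b (const n 1) = 0 := by
  have h := dTaut_mulTaut A b (const n 1) (const n 1)
  rw [epsR_const, eps_one, mulTaut_one, mulTaut_one, one_mulTaut] at h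
  simpa using h

theorem insert₃_one (a d : ExtSeries R₀ V n) : insert₃ b A.μ a (const n 1) d = 0 := by
  induction a using extSeries_induction b with
  | hadd a c ha hc => simp only [map_add, LinearMap.add_apply, ha, hc, add_zero]
  | hsmul r a ha => simp only [map_smul, LinearMap.smul_apply, ha, smul_zero]
  | hconst p e he =>
    induction d using extSeries_induction b with
    | hadd a c ha hc => simp only [map_add, ha, hc, add_zero]
    | hsmul r a ha => simp only [map_smul, ha, smul_zero]
    | hconst q e' he' =>
      have h : ∀ x y z u : List (Fin n), A.μ (basisWord b x ++ e :: (basisWord b y ++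
          1 :: (basisWord b z ++ e' :: basisWord b u))) = 0 := by
        intro x y z u
        have := A.unit_higher (basisWord b x ++ e :: basisWord b y)
          (basisWord b z ++ e' :: basisWord b u) (by
            simp only [List.length_append, List.length_cons]; omega)
        simpa using this
      rw [insert₃_const b A.multilinear, wordInsert₃]
      simp only [h, const_zero, wordSum_zero]

theorem insert₃_one_right (a d : ExtSeries R₀ V n) : insert₃ b A.μ a d (const n 1) = 0 := by
  induction a using extSeries_induction b with
  | hadd a c ha hc => simp only [map_add, LinearMap.add_apply, ha, hc, add_zero]
  | hsmul r a ha => simp only [map_smul, LinearMap.smul_apply, ha, smul_zero]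
  | hconst p e he =>
    induction d using extSeries_induction b with
    | hadd a c ha hc => simp only [map_add, LinearMap.add_apply, ha, hc, add_zero]
    | hsmul r a ha => simp only [map_smul, LinearMap.smul_apply, ha, smul_zero]
    | hconst q e' he' =>
      have h : ∀ x y z u : List (Fin n), A.μ (basisWord b x ++ e :: (basisWord b y ++
          e' :: (basisWord b z ++ 1 :: basisWord b u))) = 0 := by
        intro x y z u
        have := A.unit_higher (basisWord b x ++ e :: (basisWord b y ++
          e' :: basisWord b z)) (basisWord b u) (by
            simp only [List.length_append, List.length_cons]; omega)
        simpa using this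
      rw [insert₃_const b A.multilinear, wordInsert₃]
      simp only [h, const_zero, wordSum_zero]

theorem mem_cocycles_top {S M : Type*} [CommRing S] [AddCommGroup M] [Module S M]
    {d : M →ₗ[S] M} {x : M} : x ∈ cocycles ⊤ d ↔ d x = 0 := by
  simp [cocycles]

theorem mem_coboundaries_top {S M : Type*} [CommRing S] [AddCommGroup M] [Module S M]
    {d : M →ₗ[S] M} {x : M} : x ∈ coboundaries ⊤ d ↔ ∃ y, d y = x := by
  simp [coboundaries]

/-- The cohomology of `A_v` is a unital algebra. -/
theorem isCohomologyAlgebra_dTaut :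
    IsCohomologyAlgebra ⊤ (dTaut A b) (mulTaut A b) (const n 1) where
  d_mem _ _ := trivial
  d_d x _ := dTaut_dTaut A b x
  mul_mem _ _ _ _ := trivial
  one_cocycle := mem_cocycles_top.2 (dTaut_one A b)
  mul_cocycle x hx y hy := by
    rw [mem_cocycles_top] at hx hy ⊢
    rw [dTaut_mulTaut, hx, hy, map_zero, map_zero, LinearMap.zero_apply, add_zero]
  coboundary_mul x hx y hy := by
    rw [mem_coboundaries_top] at hx ⊢
    rw [mem_cocycles_top] at hy
    obtain ⟨z, rfl⟩ := hx
    exact ⟨mulTaut A b z y, by rw [dTaut_mulTaut, hy, map_zero, add_zero]⟩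
  mul_coboundary x hx y hy := by
    rw [mem_coboundaries_top] at hy ⊢
    rw [mem_cocycles_top] at hx
    obtain ⟨z, rfl⟩ := hy
    have h : dTaut A b (epsR x) = 0 := by
      have := epsR_dTaut A b x
      rw [hx, map_zero] at this
      exact neg_eq_zero.1 this.symm
    exact ⟨mulTaut A b (epsR x) z, by
      rw [dTaut_mulTaut, h, map_zero, LinearMap.zero_apply, zero_add, epsR_epsR]⟩
  one_mul x _ := by rw [one_mulTaut, sub_self]; exact zero_mem _
  mul_one x _ := by rw [mulTaut_one, sub_self]; exact zero_mem _
  mul_assoc x hx y hy z hz := by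
    rw [mem_cocycles_top] at hx hy hz
    have h := mulTaut_assoc A b x y z
    simp only [hx, hy, hz, map_zero, LinearMap.zero_apply, add_zero] at h
    rw [← neg_sub, h]
    exact neg_mem (mem_coboundaries_top.2 ⟨_, rfl⟩)

/-! #### The relations of the Clifford algebra hold in `A_v` -/

theorem pderivE_evalTaut_μ (i : Fin n) : insert₁ b A.μ (const n (ExteriorAlgebra.ι R₀ (b i))) =
    MvPowerSeries.pderiv R₀ i (discPotential A b) • const n 1 := by
  have h := pderivE_wordSum (fun w => A.μ (basisWord b w)) i
  rw [← evalTaut_eq b A.multilinear, evalTaut_μ, pderivE_smul_one] at h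
  rw [h, insert₁_const b A.multilinear]
  simp [basisWord]

/-- Differentiating the identity `evalTaut_μ` once with respect to `x i` computes the differential
of `v i`. -/
theorem dTaut_ι (i : Fin n) : dTaut A b (const n (ExteriorAlgebra.ι R₀ (b i))) =
    -(MvPowerSeries.pderiv R₀ i (discPotential A b) • const n 1) := by
  rw [dTaut_apply, epsR_const, eps_ι, const_neg, ← insert₁Lin_apply b A.multilinear, map_neg,
    insert₁Lin_apply, pderivE_evalTaut_μ]

/-- The divided second derivative of the identity `evalTaut_μ` computes the square of `v i`. -/
theorem mulTaut_ι_self (i : Fin n) :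
    mulTaut A b (const n (ExteriorAlgebra.ι R₀ (b i))) (const n (ExteriorAlgebra.ι R₀ (b i))) =
      -(halfPderivSq i (discPotential A b) • const n 1) := by
  have h := halfPderivSqE_wordSum (fun w => A.μ (basisWord b w)) i
  rw [← evalTaut_eq b A.multilinear, evalTaut_μ, halfPderivSqE_smul_one] at h
  rw [h, mulTaut_apply, epsR_const, eps_ι, const_neg, ← insert₂Lin_apply b A.multilinear, map_neg,
    insert₂Lin_apply, insert₂_const b A.multilinear]
  simp [basisWord]

/-- The mixed second derivative of the identity `evalTaut_μ` computes the anticommutator of `v i`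
and `v j`. -/
theorem mulTaut_ι_add_swap (i j : Fin n) :
    mulTaut A b (const n (ExteriorAlgebra.ι R₀ (b i))) (const n (ExteriorAlgebra.ι R₀ (b j))) +
      mulTaut A b (const n (ExteriorAlgebra.ι R₀ (b j))) (const n (ExteriorAlgebra.ι R₀ (b i))) =
      -(MvPowerSeries.pderiv R₀ i (MvPowerSeries.pderiv R₀ j (discPotential A b)) • const n 1) := by
  have h := pderivE_pderivE_wordSum (fun w => A.μ (basisWord b w)) i j
  rw [← evalTaut_eq b A.multilinear, evalTaut_μ, pderivE_smul_one, pderivE_smul_one] at h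
  rw [h, mulTaut_apply, mulTaut_apply, epsR_const, epsR_const, eps_ι, eps_ι, const_neg, const_neg,
    ← insert₂Lin_apply b A.multilinear, ← insert₂Lin_apply b A.multilinear, map_neg, map_neg,
    insert₂Lin_apply, insert₂Lin_apply, insert₂_const b A.multilinear,
    insert₂_const b A.multilinear, neg_add]
  simp [basisWord]

/-! #### The map from Hochschild cochains to `A_v` -/

theorem evalTaut_sum {ι : Type*} (s : Finset ι) {F : ι → List (ExtAlg R₀ V) → ExtAlg R₀ V}
    (hF : ∀ i, IsMultilinear (F i)) :
    evalTaut b (fun l => ∑ i ∈ s, F i l) = ∑ i ∈ s, evalTaut b (F i) := by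
  classical
  have : IsMultilinear (fun l => ∑ i ∈ s, F i l) ∧
      evalTaut b (fun l => ∑ i ∈ s, F i l) = ∑ i ∈ s, evalTaut b (F i) := by
    induction s using Finset.induction_on with
    | empty => exact ⟨⟨by simp, by simp⟩, by simp [evalTaut_zero]⟩
    | insert i s hi ih =>
      simp only [Finset.sum_insert hi]
      exact ⟨(hF i).add ih.1, by rw [evalTaut_add b (hF i) ih.1, ih.2]⟩
  exact this.2

theorem hochToTaut_hochD {φ : Ops R₀ V} (hφ : φ ∈ redCochains R₀ V) :
    hochToTaut b (hochD A φ) = dTaut A b (epsR (hochToTaut b φ)) := by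
  rw [mem_redCochains] at hφ
  rw [hochToTaut, hochToTaut, map_sum, map_sum,
    ← Equiv.sum_comp (Equiv.addRight (1 : ZMod 2)) fun t => evalTaut b (hochD A φ t)]
  refine Finset.sum_congr rfl fun t _ => ?_
  rw [Equiv.coe_addRight, hochD_apply_add_one, evalTaut_hochAux A b (hφ t).1 (hφ t).2]

theorem evalTaut_cupAux (hφ : IsCochain (p, φ)) (hψ : IsCochain (q, ψ)) :
    evalTaut b (cupAux A p q φ ψ) = mulTaut A b (evalTaut b φ) (evalTaut b ψ) := by
  rw [cupAux_eq A hψ, evalTaut_smul b (isCochain_brace_two A hφ hψ).multilinear,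
    evalTaut_brace_two b A.multilinear hφ.multilinear hψ.multilinear,
    mapE_tw_of_epsR (epsR_evalTaut b hψ), insert₂_smul_right b A.multilinear, insert₂_eq,
    epsR_evalTaut b hψ, map_smul, map_mul, map_sgn, map_sgn, smul_smul, smul_smul]
  rw [show ∀ x y : MvPowerSeries (Fin n) R₀, x * y * y * x = (x * x) * (y * y) from
    fun x y => by ring, sgn_mul_self, sgn_mul_self, one_mul, one_smul]

/-- Evaluation is multiplicative on the level of cochains, not only in cohomology. -/
theorem hochToTaut_cup {φ ψ : Ops R₀ V} (hφ : φ ∈ redCochains R₀ V) (hψ : ψ ∈ redCochains R₀ V) :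
    hochToTaut b (cup A φ ψ) = mulTaut A b (hochToTaut b φ) (hochToTaut b ψ) := by
  rw [mem_redCochains] at hφ hψ
  have h1 : ∀ t, evalTaut b (cup A φ ψ t) =
      ∑ p, mulTaut A b (evalTaut b (φ p)) (evalTaut b (ψ (t - p))) := by
    intro t
    have h2 : cup A φ ψ t = fun l => ∑ p, cupAux A p (t - p) (φ p) (ψ (t - p)) l := by
      funext l
      rw [cup_apply, Finset.sum_apply]
    rw [h2, evalTaut_sum b]
    · exact Finset.sum_congr rfl fun p _ => evalTaut_cupAux A b (hφ p).1 (hψ (t - p)).1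
    · intro p
      rw [cupAux_eq A (hψ _).1]
      exact (isCochain_brace_two A (hφ p).1 (hψ (t - p)).1).multilinear.smul _
  simp only [hochToTaut, h1, map_sum, LinearMap.sum_apply]
  rw [Finset.sum_comm]
  conv_rhs => rw [Finset.sum_comm]
  refine Finset.sum_congr rfl fun p _ => ?_
  exact Equiv.sum_comp (Equiv.subRight p) fun q => mulTaut A b (evalTaut b (φ p)) (evalTaut b (ψ q))

theorem hochToTaut_hochOne : hochToTaut b (hochOne R₀ V) = const n 1 := by
  rw [hochToTaut, Fintype.sum_eq_single 0]
  · rw [hochOne_zero]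
    exact evalTaut_constOp b 1
  · intro t ht
    rcases zmod_two_cases t with rfl | rfl
    · exact absurd rfl ht
    · rw [hochOne_one, evalTaut_zero]

theorem hochToTaut_add {φ ψ : Ops R₀ V} (hφ : φ ∈ redCochains R₀ V) (hψ : ψ ∈ redCochains R₀ V) :
    hochToTaut b (φ + ψ) = hochToTaut b φ + hochToTaut b ψ := by
  rw [hochToTaut, hochToTaut, hochToTaut, ← Finset.sum_add_distrib]
  exact Finset.sum_congr rfl fun t _ => evalTaut_add b (hφ t).1 (hψ t).1

theorem hochToTaut_smul (r : R₀) {φ : Ops R₀ V} (hφ : φ ∈ redCochains R₀ V) :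
    hochToTaut b (r • φ) = (MvPowerSeries.C r : MvPowerSeries (Fin n) R₀) • hochToTaut b φ := by
  rw [hochToTaut, hochToTaut, Finset.smul_sum]
  exact Finset.sum_congr rfl fun t _ => evalTaut_smul b (hφ t).1 r

end Taut

/-! ### Operations defined on words in a basis -/

section Basis

variable {R₀ V : Type*} [CommRing R₀] [AddCommGroup V] [Module R₀ V] {n : ℕ}
  (b : Module.Basis (Fin n) R₀ V)

theorem basis_empty : b.ExteriorAlgebra ∅ = 1 := by
  rw [ExteriorAlgebra.basis_apply_ofCard b (n := 0) rfl]
  simp [ExteriorAlgebra.ιMulti_family]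

theorem basis_singleton (i : Fin n) : b.ExteriorAlgebra {i} = ExteriorAlgebra.ι R₀ (b i) := by
  rw [ExteriorAlgebra.basis_apply_ofCard b (n := 1) (Finset.card_singleton i)]
  rw [ExteriorAlgebra.ιMulti_family, ExteriorAlgebra.ιMulti_apply]
  have h := (Set.powersetCard.mem_range_ofFinEmbEquiv_symm_iff_mem
    (Set.powersetCard.ofCard (Finset.card_singleton i)) _).1 ⟨0, rfl⟩
  have h2 := Finset.mem_singleton.1 h
  simp only [Function.comp_apply, List.ofFn_succ, List.ofFn_zero, List.prod_cons, List.prod_nil,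
    mul_one]
  rw [h2]

theorem basis_mul_of_not_disjoint {I J : Finset (Fin n)} (h : ¬Disjoint I J) :
    b.ExteriorAlgebra I * b.ExteriorAlgebra J = 0 :=
  ExteriorAlgebra.basis_mul_of_not_disjoint b (⟨I, rfl⟩ : Set.powersetCard (Fin n) I.card)
    (⟨J, rfl⟩ : Set.powersetCard (Fin n) J.card) h

theorem basis_mul_of_disjoint {I J : Finset (Fin n)} (h : Disjoint I J) :
    ∃ s : R₀, s * s = 1 ∧
      b.ExteriorAlgebra I * b.ExteriorAlgebra J = s • b.ExteriorAlgebra (I ∪ J) := by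
  have h1 := ExteriorAlgebra.basis_mul_of_disjoint b
    (s := (⟨I, rfl⟩ : Set.powersetCard (Fin n) I.card))
    (t := (⟨J, rfl⟩ : Set.powersetCard (Fin n) J.card)) h
  refine ⟨((Set.powersetCard.permOfDisjoint (s := (⟨I, rfl⟩ : Set.powersetCard (Fin n) I.card))
    (t := (⟨J, rfl⟩ : Set.powersetCard (Fin n) J.card)) h).sign : ℤ), ?_, ?_⟩
  · rw [← Int.cast_mul, ← Units.val_mul, Int.units_mul_self, Units.val_one, Int.cast_one]
  · rw [Int.cast_smul_eq_zsmul, ← Units.smul_def]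
    rw [Set.powersetCard.coe_disjUnion, Finset.disjUnion_eq_union] at h1
    exact h1

theorem basis_mem_exteriorPower (I : Finset (Fin n)) : b.ExteriorAlgebra I ∈ ⋀[R₀]^I.card V := by
  rw [ExteriorAlgebra.basis_eq_coe_basis b (⟨I, rfl⟩ : Set.powersetCard (Fin n) I.card)]
  exact Subtype.coe_prop _

theorem basis_mem_filt (I : Finset (Fin n)) : b.ExteriorAlgebra I ∈ filt R₀ V I.card :=
  Submodule.mem_iSup_of_mem I.card (Submodule.mem_iSup_of_mem le_rfl (basis_mem_exteriorPower b I))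

theorem filt_le_span (p : ℤ) : filt R₀ V p ≤
    Submodule.span R₀ {x | ∃ I : Finset (Fin n), (I.card : ℤ) ≤ p ∧ b.ExteriorAlgebra I = x} := by
  refine iSup₂_le fun i hi x hx => ?_
  have h := (b.exteriorPower i).sum_repr ⟨x, hx⟩
  have h2 := congrArg Subtype.val h
  simp only [AddSubmonoidClass.coe_finsetSum, SetLike.val_smul] at h2
  rw [← h2]
  refine sum_mem fun s _ => Submodule.smul_mem _ _ (Submodule.subset_span ⟨s.1, ?_, ?_⟩)
  · rw [show s.1.card = i from s.2]; exact hi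
  · exact ExteriorAlgebra.basis_eq_coe_basis b s

theorem basis_mem_parityPart (I : Finset (Fin n)) :
    b.ExteriorAlgebra I ∈ parityPart R₀ V (I.card : ZMod 2) := by
  exact Submodule.mem_iSup_of_mem (⟨I.card, rfl⟩ : {j : ℕ // (j : ZMod 2) = (I.card : ZMod 2)})
    (basis_mem_exteriorPower b I)

theorem repr_eq_zero_of_parity {t : ZMod 2} {x : ExtAlg R₀ V} (hx : x ∈ parityPart R₀ V t)
    {I : Finset (Fin n)} (hI : (I.card : ZMod 2) ≠ t) : b.ExteriorAlgebra.repr x I = 0 := by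
  classical
  have hs : ∀ {s : ZMod 2} (P : Finset (Fin n) → Prop) [DecidablePred P],
      (∀ J, P J → (J.card : ZMod 2) = s) →
      b.ExteriorAlgebra.repr.symm ((b.ExteriorAlgebra.repr x).filter P) ∈ parityPart R₀ V s := by
    intro s P _ hP
    rw [Module.Basis.repr_symm_apply, Finsupp.linearCombination_apply]
    refine Submodule.sum_mem _ fun J hJ => Submodule.smul_mem _ _ ?_
    have := hP J (by
      by_contra h
      simp [h] at hJ)
    exact this ▸ basis_mem_parityPart b J
  have h1 := hs (s := t) (fun J => (J.card : ZMod 2) = t) fun J h => h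
  have h2 := hs (s := t + 1) (fun J => ¬(J.card : ZMod 2) = t) fun J h =>
    (by decide : ∀ c t : ZMod 2, ¬c = t → c = t + 1) _ _ h
  have h3 : b.ExteriorAlgebra.repr.symm ((b.ExteriorAlgebra.repr x).filter
      fun J => (J.card : ZMod 2) = t) + b.ExteriorAlgebra.repr.symm
        ((b.ExteriorAlgebra.repr x).filter fun J => ¬(J.card : ZMod 2) = t) = x := by
    rw [← map_add, Finsupp.filter_add_filter_not, LinearEquiv.symm_apply_apply]
  have h4 : b.ExteriorAlgebra.repr.symm
      ((b.ExteriorAlgebra.repr x).filter fun J => ¬(J.card : ZMod 2) = t) ∈ parityPart R₀ V t := by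
    rw [← sub_eq_of_eq_add' h3.symm]
    exact sub_mem hx h1
  have h5 := (DirectSum.Decomposition.isInternal (parityPart R₀ V)).submodule_iSupIndep
  have h6 := Submodule.disjoint_def.1 (h5.pairwiseDisjoint
    ((by decide : ∀ t : ZMod 2, t ≠ t + 1) t)) _ h4 h2
  have h7 := DFunLike.congr_fun ((LinearEquiv.map_eq_zero_iff _).1 h6) I
  rwa [Finsupp.filter_apply, if_pos hI] at h7

/-- The multilinear operations with prescribed values on words in the monomial basis. -/
def ofWords : (List (Finset (Fin n)) → ExtAlg R₀ V) → List (ExtAlg R₀ V) → ExtAlg R₀ V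
  | F, [] => F []
  | F, a :: l => ∑ I, b.ExteriorAlgebra.repr a I • ofWords (fun w => F (I :: w)) l

/-- The list of basis elements of `E` spelled by a word. -/
def extWord (w : List (Finset (Fin n))) : List (ExtAlg R₀ V) := w.map b.ExteriorAlgebra

theorem ofWords_extWord (F : List (Finset (Fin n)) → ExtAlg R₀ V) (w : List (Finset (Fin n))) :
    ofWords b F (extWord b w) = F w := by
  induction w generalizing F with
  | nil => rfl
  | cons I w ih =>
    change ∑ J, b.ExteriorAlgebra.repr (b.ExteriorAlgebra I) J • ofWords b _ (extWord b w) = _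
    rw [Finset.sum_eq_single I]
    · rw [Module.Basis.repr_self, Finsupp.single_eq_same, one_smul, ih]
    · intro J _ hJ
      rw [Module.Basis.repr_self, Finsupp.single_eq_of_ne hJ, zero_smul]
    · simp

theorem isMultilinear_ofWords (F : List (Finset (Fin n)) → ExtAlg R₀ V) :
    IsMultilinear (ofWords b F) := by
  have h : ∀ (x z : List (ExtAlg R₀ V)) (F : List (Finset (Fin n)) → ExtAlg R₀ V),
      (∀ a a', ofWords b F (x ++ (a + a') :: z) =
        ofWords b F (x ++ a :: z) + ofWords b F (x ++ a' :: z)) ∧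
      ∀ (c : R₀) a, ofWords b F (x ++ (c • a) :: z) = c • ofWords b F (x ++ a :: z) := by
    intro x z
    induction x with
    | nil =>
      intro F
      simp only [List.nil_append, ofWords, map_add, map_smul, Finsupp.add_apply,
        Finsupp.smul_apply, add_smul, Finset.sum_add_distrib, Finset.smul_sum, smul_assoc]
      exact ⟨fun _ _ => trivial, fun _ _ => trivial⟩
    | cons y x ih =>
      intro F
      simp only [List.cons_append, ofWords, (ih _).1, (ih _).2, smul_add,
        Finset.sum_add_distrib, Finset.smul_sum]
      exact ⟨fun _ _ => trivial, fun c a => Finset.sum_congr rfl fun I _ => smul_comm _ _ _⟩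
  exact ⟨fun x z => (h x z F).1, fun x z => (h x z F).2⟩

theorem ofWords_add (F G : List (Finset (Fin n)) → ExtAlg R₀ V) :
    ofWords b (fun w => F w + G w) = fun l => ofWords b F l + ofWords b G l := by
  funext l
  induction l generalizing F G with
  | nil => rfl
  | cons a l ih => simp only [ofWords, ih, smul_add, Finset.sum_add_distrib]

/-- Multilinear operations are determined by their values on words in the monomial basis. -/
theorem IsMultilinear.ext_extWord {f g : List (ExtAlg R₀ V) → ExtAlg R₀ V} (hf : IsMultilinear f)
    (hg : IsMultilinear g) (h : ∀ w, f (extWord b w) = g (extWord b w)) : f = g := by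
  refine IsMultilinear.ext_span b.ExteriorAlgebra.span_eq hf hg fun l hl => ?_
  have h1 : ∃ w, l = extWord b w := by
    induction l with
    | nil => exact ⟨[], rfl⟩
    | cons a l ih =>
      obtain ⟨I, hI⟩ := hl a (by simp)
      obtain ⟨w, rfl⟩ := ih fun a ha => hl a (by simp [ha])
      exact ⟨I :: w, by rw [← hI]; rfl⟩
  obtain ⟨w, rfl⟩ := h1
  exact h w

/-- The degree of the value of operations of degree `t` on a word. -/
def wordDeg (t : ZMod 2) (w : List (Finset (Fin n))) : ZMod 2 :=
  t - w.length + (w.map fun I => (I.card : ZMod 2)).sum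

theorem HasParity.extWord {t : ZMod 2} {f : List (ExtAlg R₀ V) → ExtAlg R₀ V} (hf : HasParity t f)
    (w : List (Finset (Fin n))) : f (extWord b w) ∈ parityPart R₀ V (wordDeg t w) := by
  have h := hf (w.map fun I => ((I.card : ZMod 2), b.ExteriorAlgebra I)) (by
    simp only [List.mem_map]
    rintro _ ⟨I, _, rfl⟩
    exact basis_mem_parityPart b I)
  simp only [List.map_map, Function.comp_def, List.length_map] at h
  exact h

theorem hasParity_ofWords {t : ZMod 2} {F : List (Finset (Fin n)) → ExtAlg R₀ V}
    (hF : ∀ w, F w ∈ parityPart R₀ V (wordDeg t w)) : HasParity t (ofWords b F) := by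
  intro l hl
  induction l generalizing F t with
  | nil => simpa [wordDeg, ofWords] using hF []
  | cons a l ih =>
    simp only [List.map_cons, ofWords]
    refine sum_mem fun I _ => ?_
    by_cases hI : (I.card : ZMod 2) = a.1
    · refine Submodule.smul_mem _ _ ?_
      have h := ih (t := t - 1 + a.1) (F := fun w => F (I :: w)) (fun w => ?_)
        fun a ha => hl a (by simp [ha])
      · convert h using 2
        simp only [List.length_cons, List.sum_cons, Nat.cast_add, Nat.cast_one]
        ring
      · convert hF (I :: w) using 2
        simp only [wordDeg, List.length_cons, List.map_cons, List.sum_cons, Nat.cast_add,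
          Nat.cast_one, hI]
        ring
    · rw [repr_eq_zero_of_parity b (hl a (by simp)) hI, zero_smul]
      exact zero_mem _

theorem isReduced_ofWords {F : List (Finset (Fin n)) → ExtAlg R₀ V}
    (hF : ∀ w, ∅ ∈ w → F w = 0) : IsReduced (ofWords b F) := by
  intro x z
  rw [← basis_empty b]
  induction x generalizing F with
  | nil =>
    have h0 : ∀ G : List (Finset (Fin n)) → ExtAlg R₀ V, (∀ w, G w = 0) → ofWords b G z = 0 := by
      intro G hG
      rw [funext hG]
      induction z with
      | nil => rfl
      | cons a z ih => simp [ofWords, ih]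
    simp only [List.nil_append, ofWords]
    rw [Finset.sum_eq_single ∅]
    · rw [h0 _ fun w => hF _ (by simp), smul_zero]
    · intro J _ hJ
      rw [Module.Basis.repr_self, Finsupp.single_eq_of_ne hJ, zero_smul]
    · simp
  | cons a x ih =>
    simp only [List.cons_append, ofWords]
    refine Finset.sum_eq_zero fun I _ => ?_
    rw [ih fun w hw => hF _ (by simp [hw]), smul_zero]

/-- A linear map that vanishes on the monomials of degree at most `p` vanishes on `F^p`. -/
theorem map_filt_eq_zero {N : Type*} [AddCommGroup N] [Module R₀ N] (T : ExtAlg R₀ V →ₗ[R₀] N)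
    {p : ℤ} (h : ∀ I : Finset (Fin n), (I.card : ℤ) ≤ p → T (b.ExteriorAlgebra I) = 0)
    {x : ExtAlg R₀ V} (hx : x ∈ filt R₀ V p) : T x = 0 := by
  have h1 : filt R₀ V p ≤ LinearMap.ker T := by
    refine (filt_le_span b p).trans (Submodule.span_le.2 ?_)
    rintro _ ⟨I, hI, rfl⟩
    exact h I hI
  exact h1 hx

end Basis

/-! ### A matching on words of monomials -/

section Matching

variable {n : ℕ}

/-- The three types of words in the nonempty subsets of `{1, …, n}`. -/
inductive WordType
  /-- weakly decreasing words of singletons -/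
  | critical
  /-- words which begin with weakly decreasing singletons, the last of which is smaller than all
  elements of the following letter -/
  | split
  /-- words which begin with weakly decreasing singletons, followed by a letter with more than one
  element, the smallest of which continues the weakly decreasing sequence -/
  | merged

/-- The type of a word which is preceded by a singleton `p` (by nothing if `p = ⊤`). -/
def wordType : WithTop (Fin n) → List (Finset (Fin n)) → WordType
  | _, [] => .critical
  | p, I :: w => open Classical in
    if ∀ i ∈ I, p < i then .split else if 2 ≤ I.card then .merged else wordType I.min w

/-- Splits off the smallest element of the first letter with more than one element. This defines a
bijection from the words of type `merged` to those of type `split`. -/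
def splitLetter : List (Finset (Fin n)) → List (Finset (Fin n))
  | [] => []
  | I :: w => open Classical in
    if h : I.Nonempty ∧ 2 ≤ I.card then {I.min' h.1} :: I.erase (I.min' h.1) :: w
    else I :: splitLetter w

/-- The number of pairs in `I × J` in the wrong order. -/
def cross (I J : Finset (Fin n)) : ℕ := ((I ×ˢ J).filter fun q => q.2 < q.1).card

/-- The number of inversions of a word. -/
def inversions : List (Finset (Fin n)) → ℕ
  | [] => 0
  | I :: w => (w.map (cross I)).sum + inversions w

/-- The total degree of the letters of a word minus their number. -/
def excess (w : List (Finset (Fin n))) : ℕ := (w.map fun I => I.card - 1).sum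

theorem excess_append (x z : List (Finset (Fin n))) : excess (x ++ z) = excess x + excess z := by
  simp [excess]

theorem excess_cons (I : Finset (Fin n)) (z : List (Finset (Fin n))) :
    excess (I :: z) = I.card - 1 + excess z := by
  simp [excess]

theorem cross_union_left {I I' J : Finset (Fin n)} (h : Disjoint I I') :
    cross (I ∪ I') J = cross I J + cross I' J := by
  rw [cross, cross, cross, Finset.union_product, Finset.filter_union, Finset.card_union_of_disjoint]
  exact Finset.disjoint_filter_filter (Finset.disjoint_product.2 (Or.inl h))

theorem cross_union_right {I J J' : Finset (Fin n)} (h : Disjoint J J') :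
    cross I (J ∪ J') = cross I J + cross I J' := by
  rw [cross, cross, cross, Finset.product_union, Finset.filter_union, Finset.card_union_of_disjoint]
  exact Finset.disjoint_filter_filter (Finset.disjoint_product.2 (Or.inr h))

theorem cross_pos {I J : Finset (Fin n)} {i j : Fin n} (hi : i ∈ I) (hj : j ∈ J) (h : j < i) :
    0 < cross I J :=
  Finset.card_pos.2 ⟨(i, j), by simp [hi, hj, h]⟩

theorem cross_eq_zero {I J : Finset (Fin n)} (h : ∀ i ∈ I, ∀ j ∈ J, i < j) : cross I J = 0 := by
  refine Finset.card_eq_zero.2 (Finset.filter_eq_empty_iff.2 ?_)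
  rintro ⟨i, j⟩ hq
  rw [Finset.mem_product] at hq
  exact not_lt.2 (h i hq.1 j hq.2).le

/-- Merging two letters removes the inversions between them. -/
theorem inversions_merge (x : List (Finset (Fin n))) {B C : Finset (Fin n)} (h : Disjoint B C)
    (z : List (Finset (Fin n))) :
    inversions (x ++ B :: C :: z) = inversions (x ++ (B ∪ C) :: z) + cross B C := by
  induction x with
  | nil =>
    have h1 : (z.map (cross (B ∪ C))).sum = (z.map (cross B)).sum + (z.map (cross C)).sum := by
      induction z with
      | nil => rfl
      | cons J z ih =>
        simp only [List.map_cons, List.sum_cons, cross_union_left h, ih]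
        omega
    simp only [List.nil_append, inversions, List.map_cons, List.sum_cons, h1]
    omega
  | cons I x ih =>
    simp only [List.cons_append, inversions, ih, List.map_append, List.map_cons, List.sum_append,
      List.sum_cons, cross_union_right h]
    omega

theorem wordType_singleton_cons {p : WithTop (Fin n)} {i : Fin n} (h : ¬p < i)
    (w : List (Finset (Fin n))) : wordType p ({i} :: w) = wordType i w := by
  rw [wordType, if_neg (by simpa using h), if_neg (by simp), Finset.min_singleton]

theorem splitLetter_singleton_cons (i : Fin n) (w : List (Finset (Fin n))) :
    splitLetter ({i} :: w) = {i} :: splitLetter w := by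
  rw [splitLetter, dif_neg (by simp)]

theorem wordType_merged_cases {p : WithTop (Fin n)} {I : Finset (Fin n)}
    {w : List (Finset (Fin n))} (hI : I.Nonempty) (h : wordType p (I :: w) = .merged) :
    (¬(∀ i ∈ I, p < i) ∧ 2 ≤ I.card) ∨
      ∃ i, I = {i} ∧ ¬p < i ∧ wordType i w = .merged := by
  rw [wordType] at h
  split_ifs at h with h1 h2
  · exact Or.inl ⟨h1, h2⟩
  · have h3 : I.card = 1 := by have := hI.card_pos; omega
    obtain ⟨i, rfl⟩ := Finset.card_eq_one.1 h3
    exact Or.inr ⟨i, rfl, by simpa using h1, by simpa using h⟩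

/-- If `w` has type `merged`, then the word obtained from `splitLetter w` by merging two
adjacent letters is `w`, or has type `split`, or has fewer inversions. -/
theorem exists_splitLetter {p : WithTop (Fin n)} {w : List (Finset (Fin n))} (hw : ∅ ∉ w)
    (h : wordType p w = .merged) : ∃ x₀ m J z₀, w = x₀ ++ ({m} ∪ J) :: z₀ ∧
      splitLetter w = x₀ ++ {m} :: J :: z₀ ∧ J.Nonempty ∧ (∀ j ∈ J, m < j) ∧
      ∀ x B C z, splitLetter w = x ++ B :: C :: z → x ≠ x₀ → Disjoint B C →
        wordType p (x ++ (B ∪ C) :: z) = .split ∨ 0 < cross B C := by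
  induction w generalizing p with
  | nil => simp [wordType] at h
  | cons I w ih =>
    have hI : I.Nonempty := Finset.nonempty_iff_ne_empty.2 fun h => hw (by simp [h])
    have hw' : ∅ ∉ w := fun h => hw (by simp [h])
    rcases wordType_merged_cases hI h with ⟨h1, h2⟩ | ⟨i, rfl, h1, h2⟩
    · have hs : splitLetter (I :: w) = {I.min' hI} :: I.erase (I.min' hI) :: w := by
        rw [splitLetter, dif_pos ⟨hI, h2⟩]
      have hJ : (I.erase (I.min' hI)).Nonempty := by
        rw [← Finset.card_pos, Finset.card_erase_of_mem (Finset.min'_mem I hI)]; omega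
      have hlt : ∀ j ∈ I.erase (I.min' hI), I.min' hI < j := fun j hj =>
        Finset.min'_lt_of_mem_erase_min' I hI hj
      have hm : ¬p < (I.min' hI : Fin n) := fun hp => h1 fun i hi =>
        hp.trans_le (WithTop.coe_le_coe.2 (Finset.min'_le I i hi))
      refine ⟨[], I.min' hI, I.erase (I.min' hI), w, ?_, hs, hJ, hlt, ?_⟩
      · rw [List.nil_append, ← Finset.insert_eq, Finset.insert_erase (Finset.min'_mem I hI)]
      · intro x B C z hx hne _
        rw [hs] at hx
        rcases x with _ | ⟨X, x⟩
        · exact absurd rfl hne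
        rw [List.cons_append, List.cons.injEq] at hx
        obtain ⟨rfl, hx⟩ := hx
        rw [List.cons_append, wordType_singleton_cons hm]
        rcases x with _ | ⟨X, x⟩
        · rw [List.nil_append, List.cons.injEq] at hx
          obtain ⟨rfl, rfl⟩ := hx
          by_cases hC : ∀ k ∈ C, I.min' hI < k
          · left
            rw [List.nil_append, wordType, if_pos]
            intro k hk
            rw [WithTop.coe_lt_coe]
            exact (Finset.mem_union.1 hk).elim (hlt k) (hC k)
          · right
            push Not at hC
            obtain ⟨k, hk, hk'⟩ := hC
            obtain ⟨j, hj⟩ := hJ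
            exact cross_pos hj hk (hk'.trans_lt (hlt j hj))
        · rw [List.cons_append, List.cons.injEq] at hx
          obtain ⟨rfl, rfl⟩ := hx
          left
          rw [List.cons_append, wordType, if_pos]
          exact fun k hk => WithTop.coe_lt_coe.2 (hlt k hk)
    · obtain ⟨x₀, m, J, z₀, hw1, hw2, hJ, hlt, hcl⟩ := ih hw' h2
      rw [splitLetter_singleton_cons]
      refine ⟨{i} :: x₀, m, J, z₀, by rw [hw1]; rfl, by rw [hw2]; rfl, hJ, hlt, ?_⟩
      intro x B C z hx hne hd
      rcases x with _ | ⟨X, x⟩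
      · rw [List.nil_append, List.cons.injEq] at hx
        obtain ⟨rfl, hx⟩ := hx
        right
        rcases w with _ | ⟨I', w⟩
        · simp [wordType] at h2
        have hI' : I'.Nonempty := Finset.nonempty_iff_ne_empty.2 fun h => hw' (by simp [h])
        have key : ∃ j ∈ C, j ≤ i := by
          rcases wordType_merged_cases hI' h2 with ⟨h3, h4⟩ | ⟨i', rfl, h3, h4⟩
          · rw [splitLetter, dif_pos ⟨hI', h4⟩, List.cons.injEq] at hx
            push Not at h3
            obtain ⟨k, hk, hk'⟩ := h3
            refine ⟨I'.min' hI', by rw [← hx.1]; simp, ?_⟩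
            exact (Finset.min'_le I' k hk).trans (WithTop.coe_le_coe.1 hk')
          · rw [splitLetter_singleton_cons, List.cons.injEq] at hx
            exact ⟨i', by rw [← hx.1]; simp, WithTop.coe_le_coe.1 (not_lt.1 h3)⟩
        obtain ⟨j, hj, hji⟩ := key
        refine cross_pos (Finset.mem_singleton_self i) hj (lt_of_le_of_ne hji ?_)
        rintro rfl
        exact Finset.disjoint_left.1 hd (Finset.mem_singleton_self j) hj
      · rw [List.cons_append, List.cons.injEq] at hx
        obtain ⟨rfl, hx⟩ := hx
        rw [List.cons_append, wordType_singleton_cons h1]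
        exact hcl x B C z hx (fun h => hne (by rw [h])) hd

theorem exists_merged_aux {p : WithTop (Fin n)} {u : List (Finset (Fin n))} (hu : ∅ ∉ u)
    (h : wordType p u = .split) : (∃ I u', u = I :: u' ∧ ∀ i ∈ I, p < i) ∨
      ∃ w, ∅ ∉ w ∧ wordType p w = .merged ∧ splitLetter w = u := by
  induction u generalizing p with
  | nil => simp [wordType] at h
  | cons I u ih =>
    have hI : I.Nonempty := Finset.nonempty_iff_ne_empty.2 fun h => hu (by simp [h])
    have hu' : ∅ ∉ u := fun h => hu (by simp [h])
    rw [wordType] at h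
    split_ifs at h with h1 h2
    · exact Or.inl ⟨I, u, rfl, h1⟩
    · right
      have h3 : I.card = 1 := by have := hI.card_pos; omega
      obtain ⟨i, rfl⟩ := Finset.card_eq_one.1 h3
      have h1 : ¬p < i := by simpa using h1
      rw [Finset.min_singleton] at h
      rcases ih hu' h with ⟨J, u, rfl, hJ⟩ | ⟨w, hw1, hw2, rfl⟩
      · have hJn : J.Nonempty := Finset.nonempty_iff_ne_empty.2 fun h => hu' (by simp [h])
        have hiJ : i ∉ J := fun hi => lt_irrefl _ (hJ i hi)
        have hcard : 2 ≤ (insert i J).card := by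
          rw [Finset.card_insert_of_notMem hiJ]
          have := hJn.card_pos
          omega
        refine ⟨insert i J :: u, ?_, ?_, ?_⟩
        · simp only [List.mem_cons, not_or] at hu' ⊢
          exact ⟨(Finset.insert_ne_empty i J).symm, hu'.2⟩
        · rw [wordType, if_neg, if_pos hcard]
          exact fun h => h1 (h i (Finset.mem_insert_self i J))
        · have hne : (insert i J).Nonempty := Finset.insert_nonempty i J
          have hmin : (insert i J).min' hne = i := by
            refine le_antisymm (Finset.min'_le _ _ (Finset.mem_insert_self i J)) ?_
            refine Finset.le_min' _ _ _ fun j hj => ?_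
            rcases Finset.mem_insert.1 hj with rfl | hj
            · exact le_rfl
            · exact (WithTop.coe_lt_coe.1 (hJ j hj)).le
          rw [splitLetter, dif_pos ⟨hne, hcard⟩, hmin, Finset.erase_insert hiJ]
      · refine ⟨{i} :: w, by simpa using hw1, ?_, splitLetter_singleton_cons i w⟩
        rw [wordType_singleton_cons h1, hw2]

/-- Splitting letters maps the words of type `merged` onto those of type `split`. -/
theorem exists_merged {u : List (Finset (Fin n))} (hu : ∅ ∉ u) (h : wordType ⊤ u = .split) :
    ∃ w, ∅ ∉ w ∧ wordType ⊤ w = .merged ∧ splitLetter w = u := by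
  rcases exists_merged_aux hu h with ⟨I, u', rfl, hI⟩ | h
  · have hn : I.Nonempty := Finset.nonempty_iff_ne_empty.2 fun h => hu (by simp [h])
    obtain ⟨i, hi⟩ := hn
    exact absurd (hI i hi) not_top_lt
  · exact h

/-- The critical words are the weakly decreasing words of single letters; under evaluation they
correspond to the monomials in `R`. -/
theorem exists_of_critical {p : WithTop (Fin n)} {w : List (Finset (Fin n))} (hw : ∅ ∉ w)
    (h : wordType p w = .critical) : ∃ c : List (Fin n), w = c.map (fun i => {i}) ∧
      c.Pairwise (· ≥ ·) ∧ ∀ i ∈ c, (i : WithTop (Fin n)) ≤ p := by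
  induction w generalizing p with
  | nil => exact ⟨[], rfl, List.Pairwise.nil, by simp⟩
  | cons I w ih =>
    have hI : I.Nonempty := Finset.nonempty_iff_ne_empty.2 fun h => hw (by simp [h])
    rw [wordType] at h
    split_ifs at h with h1 h2
    have h3 : I.card = 1 := by have := hI.card_pos; omega
    obtain ⟨i, rfl⟩ := Finset.card_eq_one.1 h3
    rw [Finset.min_singleton] at h
    obtain ⟨c, rfl, hc1, hc2⟩ := ih (fun h => hw (by simp [h])) h
    have h4 : (i : WithTop (Fin n)) ≤ p := not_lt.1 (by simpa using h1)
    refine ⟨i :: c, rfl,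
      List.pairwise_cons.2 ⟨fun j hj => WithTop.coe_le_coe.1 (hc2 j hj), hc1⟩, ?_⟩
    simp only [List.mem_cons]
    rintro j (rfl | hj)
    exacts [h4, (hc2 j hj).trans h4]

theorem wordType_singletons_ne_merged (p : WithTop (Fin n)) (c : List (Fin n)) :
    wordType p (c.map fun i => {i}) ≠ .merged := by
  induction c generalizing p with
  | nil => simp [wordType]
  | cons i c ih =>
    rw [List.map_cons, wordType]
    split_ifs with h1 h2
    · simp
    · simp at h2
    · exact ih _

/-- The order on words used to invert the differential. -/
def wordRank (w : List (Finset (Fin n))) : ℕ ×ₗ ℕ := toLex (excess w, inversions w)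

end Matching

/-! ### The leading term of the Hochschild differential -/

section SplitSum

variable {α N : Type*} [AddCommMonoid N]

/-- Only one term of a sum over deconcatenations is nonzero. -/
theorem splitSum_eq_single (x₀ y₀ : List α) {G : List α → List α → N}
    (h : ∀ x y, x ++ y = x₀ ++ y₀ → x ≠ x₀ → G x y = 0) :
    splitSum G (x₀ ++ y₀) = G x₀ y₀ := by
  induction x₀ generalizing G with
  | nil => exact splitSum_eq_left fun x y hx hxy => h x y hxy hx
  | cons a x₀ ih =>
    rw [List.cons_append, splitSum_cons, h [] (a :: (x₀ ++ y₀)) rfl (by simp), zero_add]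
    exact ih fun x y hxy hx => h (a :: x) y (by simp [hxy]) (by simpa using hx)

end SplitSum

section Leading

variable {R₀ V : Type*} [CommRing R₀] [AddCommGroup V] [Module R₀ V] {n : ℕ}
  (A : SuperfilteredDeformation R₀ V) (b : Module.Basis (Fin n) R₀ V)

theorem extWord_append (x z : List (Finset (Fin n))) :
    extWord b (x ++ z) = extWord b x ++ extWord b z := List.map_append

theorem exists_map_tw_extWord (p : ZMod 2) (z : List (Finset (Fin n))) :
    ∃ s : R₀, s * s = 1 ∧ ∀ f : List (ExtAlg R₀ V) → ExtAlg R₀ V, IsMultilinear f →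
      f ((extWord b z).map (tw p)) = s • f (extWord b z) := by
  refine ⟨sgn R₀ ((p - 1) * ((z.map fun I => (I.card : ZMod 2)).sum - z.length)), sgn_mul_self _,
    fun f hf => ?_⟩
  have h := map_tw_homog f hf p (z.map fun I => ((I.card : ZMod 2), b.ExteriorAlgebra I)) (by
    simp only [List.mem_map]
    rintro _ ⟨I, _, rfl⟩
    exact basis_mem_parityPart b I)
  simp only [List.map_map, Function.comp_def, List.length_map] at h
  rw [extWord, List.map_map]
  exact h

theorem IsReduced.extWord {κ : List (ExtAlg R₀ V) → ExtAlg R₀ V} (hκ : IsReduced κ)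
    {w : List (Finset (Fin n))} (hw : ∅ ∈ w) : κ (extWord b w) = 0 := by
  obtain ⟨x, z, rfl⟩ := List.append_of_mem hw
  rw [extWord_append, SuperDef.extWord, SuperDef.extWord, List.map_cons, basis_empty]
  exact hκ _ _

theorem wordRank_lt_of_excess {u w : List (Finset (Fin n))} (h : excess u < excess w) :
    wordRank u < wordRank w := Prod.Lex.toLex_lt_toLex.2 (Or.inl h)

theorem sum_card_eq {y : List (Finset (Fin n))} (hy : ∅ ∉ y) :
    (y.map Finset.card).sum = excess y + y.length := by
  induction y with
  | nil => rfl
  | cons I y ih =>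
    have hI : 0 < I.card :=
      Finset.card_pos.2 (Finset.nonempty_iff_ne_empty.2 fun h => hy (by simp [h]))
    rw [List.map_cons, List.sum_cons, ih fun h => hy (by simp [h]), excess_cons, List.length_cons]
    omega

variable {κ : List (ExtAlg R₀ V) → ExtAlg R₀ V} {N : ℕ}

/-- Operations of more than two entries contribute words of lower excess. -/
theorem slot_μ_higher_eq_zero (hm : IsMultilinear κ)
    (hlow : ∀ u : List (Finset (Fin n)), excess u < N → κ (extWord b u) = 0)
    {x y z : List (Finset (Fin n))} (hy : ∅ ∉ y) (h3 : 3 ≤ y.length)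
    (hN : excess (x ++ y ++ z) < N) :
    κ (extWord b x ++ A.μ (extWord b y) :: extWord b z) = 0 := by
  have h1 := A.leading_higher (y.map fun I => ((I.card : ℤ), b.ExteriorAlgebra I))
    (by simpa using h3) (by
      simp only [List.mem_map]
      rintro _ ⟨I, _, rfl⟩
      exact basis_mem_filt b I)
  simp only [List.map_map, Function.comp_def, List.length_map] at h1
  have h2 : ((y.map fun I => (I.card : ℤ)).sum) = ((excess y + y.length : ℕ) : ℤ) := by
    rw [← sum_card_eq hy, Nat.cast_list_sum, List.map_map]
    rfl
  rw [h2] at h1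
  refine map_filt_eq_zero b (hm.slot (extWord b x) (extWord b z)) (fun I hI => ?_) h1
  have h4 : extWord b x ++ b.ExteriorAlgebra I :: extWord b z = extWord b (x ++ I :: z) :=
    (extWord_append b x (I :: z)).symm
  change κ (extWord b x ++ b.ExteriorAlgebra I :: extWord b z) = 0
  rw [h4]
  refine hlow _ ?_
  rw [excess_append, excess_append] at hN
  rw [excess_append, excess_cons]
  push_cast at hI
  omega

/-- Up to words of lower excess, the product is the exterior one. -/
theorem slot_μ_two (hm : IsMultilinear κ)
    (hlow : ∀ u : List (Finset (Fin n)), excess u < N → κ (extWord b u) = 0)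
    {x z : List (Finset (Fin n))} {B C : Finset (Fin n)} (hB : B ≠ ∅) (hC : C ≠ ∅)
    (hN : excess (x ++ [B, C] ++ z) < N) :
    κ (extWord b x ++ A.μ (extWord b [B, C]) :: extWord b z) = sgn R₀ (C.card : ZMod 2) •
      κ (extWord b x ++ (b.ExteriorAlgebra B * b.ExteriorAlgebra C) :: extWord b z) := by
  have h1 := A.leading_two B.card C.card _ (basis_mem_filt b B) _ (basis_mem_filt b C)
  have hB' := Finset.card_pos.2 (Finset.nonempty_iff_ne_empty.2 hB)
  have hC' := Finset.card_pos.2 (Finset.nonempty_iff_ne_empty.2 hC)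
  have h2 := map_filt_eq_zero b (hm.slot (extWord b x) (extWord b z)) (fun I hI => ?_) h1
  · rw [map_sub, sub_eq_zero, eps_of_mem (basis_mem_parityPart b C), mul_smul_comm, map_smul] at h2
    exact h2
  have h4 : extWord b x ++ b.ExteriorAlgebra I :: extWord b z = extWord b (x ++ I :: z) :=
    (extWord_append b x (I :: z)).symm
  change κ (extWord b x ++ b.ExteriorAlgebra I :: extWord b z) = 0
  rw [h4]
  refine hlow _ ?_
  rw [excess_append, excess_append, excess_cons, excess_cons] at hN
  rw [excess_append, excess_cons]
  have : excess ([] : List (Finset (Fin n))) = 0 := rfl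
  omega

/-- On the word `splitLetter w`, the differential of `κ` is up to sign the value of `κ` on `w`, if
`κ` vanishes on the words of type `split` and on those of lower rank. -/
theorem exists_hochAux_splitLetter (t : ZMod 2) {w : List (Finset (Fin n))} (hw : ∅ ∉ w)
    (h : wordType ⊤ w = .merged) : ∃ s : R₀, s * s = 1 ∧
      ∀ κ : List (ExtAlg R₀ V) → ExtAlg R₀ V, IsMultilinear κ → IsReduced κ →
        (∀ u, ∅ ∉ u → wordRank u < wordRank w → κ (extWord b u) = 0) →
        (∀ u, wordType ⊤ u = .split → κ (extWord b u) = 0) →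
        hochAux A t κ (extWord b (splitLetter w)) = s • κ (extWord b w) := by
  obtain ⟨x₀, m, J, z₀, hw1, hw2, hJ, hlt, hcl⟩ := exists_splitLetter hw h
  have hmJ : m ∉ J := fun h => lt_irrefl _ (hlt m h)
  have hdis : Disjoint {m} J := Finset.disjoint_singleton_left.2 hmJ
  obtain ⟨s₁, hs₁, h₁⟩ := exists_map_tw_extWord b (0 : ZMod 2) z₀
  obtain ⟨s₂, hs₂, h₂⟩ := basis_mul_of_disjoint b hdis
  have hJ' := hJ.card_pos
  have hex : excess (splitLetter w) + 1 = excess w := by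
    rw [hw2, hw1, excess_append, excess_append, excess_cons, excess_cons, excess_cons,
      Finset.card_union_of_disjoint hdis, Finset.card_singleton]
    omega
  have hinv : inversions (splitLetter w) = inversions w := by
    rw [hw2, hw1, inversions_merge _ hdis, cross_eq_zero, add_zero]
    intro i hi j hj
    rw [Finset.mem_singleton.1 hi]
    exact hlt j hj
  have hu : ∅ ∉ splitLetter w := by
    rw [hw1] at hw
    rw [hw2]
    simp only [List.mem_append, List.mem_cons, not_or] at hw ⊢
    exact ⟨hw.1, (Finset.singleton_ne_empty m).symm, hJ.ne_empty.symm, hw.2.2⟩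
  refine ⟨-(sgn R₀ (t - 1) * (s₁ * (sgn R₀ (J.card : ZMod 2) * s₂))), ?_, ?_⟩
  · linear_combination (s₁ * s₁ * (s₂ * s₂) * (sgn R₀ (J.card : ZMod 2)) ^ 2) *
      sgn_mul_self (R₀ := R₀) (t - 1) + (s₂ * s₂ * (sgn R₀ (J.card : ZMod 2)) ^ 2) * hs₁ +
      ((sgn R₀ (J.card : ZMod 2)) ^ 2) * hs₂ + sgn_mul_self (R₀ := R₀) (J.card : ZMod 2)
  intro κ hm hr hlow hsp
  have hlow' : ∀ u, wordRank u < wordRank w → κ (extWord b u) = 0 := fun u hu => by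
    by_cases h : ∅ ∈ u
    · exact hr.extWord b h
    · exact hlow u h hu
  have hlow'' : ∀ u, excess u < excess w → κ (extWord b u) = 0 := fun u hu =>
    hlow' u (wordRank_lt_of_excess hu)
  have hE1 : sumSplit (fun x y z => A.μ (x ++ κ y :: z.map (tw t)))
      (extWord b (splitLetter w)) = 0 := by
    rw [sumSplit_eq_splitSum, extWord, splitSum_map]
    refine splitSum_eq_zero fun x r hx => ?_
    rw [splitSum_map]
    refine splitSum_eq_zero fun y z hy => ?_
    have : κ (List.map b.ExteriorAlgebra y) = 0 := by
      refine hlow'' y ?_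
      rw [← hex, ← hx, ← hy, excess_append, excess_append]
      omega
    rw [this, A.multilinear.map_zero]
  have hlen : ∀ x y z, x ++ (y ++ z) = splitLetter w → y.length ≠ 2 →
      κ (extWord b x ++ A.μ (extWord b y) :: extWord b z) = 0 := by
    intro x y z hxyz hy
    rcases Nat.lt_or_ge y.length 3 with h3 | h3
    · have : A.μ (extWord b y) = 0 := by
        rcases y with _ | ⟨I, _ | ⟨J, y⟩⟩
        · exact A.zero
        · exact A.one _
        · simp only [List.length_cons] at h3 hy
          omega
      rw [this, hm.map_zero]
    · refine slot_μ_higher_eq_zero A b hm hlow'' (fun h => hu ?_) h3 ?_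
      · rw [← hxyz]; simp [h]
      · rw [List.append_assoc, hxyz]; omega
  have htw : ∀ x y z, κ (extWord b x ++ A.μ (extWord b y) :: extWord b z) = 0 →
      κ (extWord b x ++ A.μ (extWord b y) :: (extWord b z).map (tw 0)) = 0 := by
    intro x y z h0
    obtain ⟨s, _, hs⟩ := exists_map_tw_extWord b (0 : ZMod 2) z
    rw [hs _ ((hm.append_left (extWord b x)).cons _), h0, smul_zero]
  have hne : ∀ x r, x ++ r = splitLetter w → x ≠ x₀ →
      splitSum (fun y z => κ (extWord b x ++ A.μ (extWord b y) :: (extWord b z).map (tw 0))) r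
        = 0 := by
    intro x r hx hne
    refine splitSum_eq_zero fun y z hyz => htw x y z ?_
    subst hyz
    by_cases hy : y.length = 2
    swap
    · exact hlen x y z hx hy
    obtain ⟨B, C, rfl⟩ := List.length_eq_two.1 hy
    have hB : B ≠ ∅ := fun h => hu (by rw [← hx]; simp [h])
    have hC : C ≠ ∅ := fun h => hu (by rw [← hx]; simp [h])
    rw [slot_μ_two A b hm hlow'' hB hC (by rw [List.append_assoc, hx]; omega)]
    by_cases hd : Disjoint B C
    · obtain ⟨s, _, hs⟩ := basis_mul_of_disjoint b hd
      rw [hs, hm.map_smul]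
      have h4 : extWord b x ++ b.ExteriorAlgebra (B ∪ C) :: extWord b z =
        extWord b (x ++ (B ∪ C) :: z) := (extWord_append b x ((B ∪ C) :: z)).symm
      rw [h4]
      rcases hcl x B C z hx.symm hne hd with h5 | h5
      · rw [hsp _ h5, smul_zero, smul_zero]
      · rw [hlow' _ ?_, smul_zero, smul_zero]
        have h6 := inversions_merge x hd z
        have h7 : x ++ B :: C :: z = splitLetter w := hx
        have hB' := Finset.card_pos.2 (Finset.nonempty_iff_ne_empty.2 hB)
        have hC' := Finset.card_pos.2 (Finset.nonempty_iff_ne_empty.2 hC)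
        rw [h7, hinv] at h6
        refine Prod.Lex.toLex_lt_toLex.2 (Or.inr ⟨?_, by omega⟩)
        rw [← hex, ← h7, excess_append, excess_append, excess_cons, excess_cons, excess_cons,
          Finset.card_union_of_disjoint hd]
        omega
    · rw [basis_mul_of_not_disjoint b hd, hm.map_zero, smul_zero]
  have hE2 : sumSplit (fun x y z => κ (x ++ A.μ y :: z.map (tw 0))) (extWord b (splitLetter w)) =
      (s₁ * (sgn R₀ (J.card : ZMod 2) * s₂)) • κ (extWord b w) := by
    rw [sumSplit_eq_splitSum, extWord, splitSum_map]
    simp only [splitSum_map]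
    rw [hw2] at hne hlen ⊢
    refine (splitSum_eq_single x₀ ({m} :: J :: z₀) hne).trans ?_
    refine (splitSum_eq_single (N := ExtAlg R₀ V) [{m}, J] z₀ fun y z hyz hy => ?_).trans ?_
    · refine htw x₀ y z (hlen x₀ y z (by rw [hyz]; rfl) fun h => hy ?_)
      obtain ⟨B, C, rfl⟩ := List.length_eq_two.1 h
      simp only [List.cons_append, List.nil_append, List.cons.injEq] at hyz
      simp [hyz]
    · rw [h₁ _ ((hm.append_left (extWord b x₀)).cons _)]
      rw [slot_μ_two A b hm hlow'' (Finset.singleton_ne_empty m) hJ.ne_empty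
        (by rw [List.append_assoc]; change excess (x₀ ++ {m} :: J :: z₀) < _; rw [← hw2]; omega),
        h₂, hm.map_smul]
      have h4 : extWord b x₀ ++ b.ExteriorAlgebra ({m} ∪ J) :: extWord b z₀ =
        extWord b (x₀ ++ ({m} ∪ J) :: z₀) := (extWord_append b x₀ (({m} ∪ J) :: z₀)).symm
      rw [h4, ← hw1, smul_smul, smul_smul, mul_assoc]
  rw [hochAux, hE1, hE2, zero_sub, smul_smul, neg_smul]

end Leading

/-! ### Acyclicity of the kernel of evaluation -/

section Content

variable {R₀ V : Type*} [CommRing R₀] [AddCommGroup V] [Module R₀ V] {n : ℕ}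

/-- The exponent of the monomial spelled by a word in the coordinates. -/
def content (c : List (Fin n)) : Fin n →₀ ℕ := (c.map fun i => Finsupp.single i 1).sum

theorem content_cons (i : Fin n) (c : List (Fin n)) :
    content (i :: c) = Finsupp.single i 1 + content c := by
  simp [content]

theorem content_apply (c : List (Fin n)) (i : Fin n) : content c i = c.count i := by
  induction c with
  | nil => rfl
  | cons j c ih =>
    rw [content_cons, Finsupp.add_apply, ih, List.count_cons, Finsupp.single_apply, add_comm]
    simp only [beq_iff_eq]

theorem eq_of_content_eq {c c' : List (Fin n)} (hc : c.Pairwise (· ≥ ·)) (hc' : c'.Pairwise (· ≥ ·))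
    (h : content c = content c') : c = c' := by
  refine List.Perm.eq_of_pairwise (le := (· ≥ ·)) (fun a b _ _ h h' => le_antisymm h' h) hc hc' ?_
  refine List.perm_iff_count.2 fun i => ?_
  rw [← content_apply, ← content_apply, h]

theorem exists_content (m : Fin n →₀ ℕ) :
    ∃ c : List (Fin n), c.Pairwise (· ≥ ·) ∧ content c = m := by
  refine ⟨(Finsupp.toMultiset m).sort (· ≥ ·), Multiset.pairwise_sort _ _, ?_⟩
  ext i
  rw [content_apply, ← Multiset.coe_count, Multiset.sort_eq, Finsupp.count_toMultiset]

theorem coeffE_wordSum_const (m : Fin n →₀ ℕ) (F : List (Fin n) → ExtAlg R₀ V) :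
    coeffE m (wordSum fun c => const n (F c)) = (if m = 0 then F [] else 0) +
      ∑ j, if Finsupp.single j 1 ≤ m then
        coeffE (m - Finsupp.single j 1) (wordSum fun c => const n (F (j :: c))) else 0 := by
  rw [wordSum_eq, coeffE_add, coeffE_const, coeffE_sum]
  simp only [coeffE_X_smul]

theorem coeffE_wordSum_eq_zero {m : Fin n →₀ ℕ} {F : List (Fin n) → ExtAlg R₀ V}
    (h : ∀ c, content c = m → F c = 0) : coeffE m (wordSum fun c => const n (F c)) = 0 := by
  induction hd : m.degree generalizing m F with
  | zero =>
    rw [Finsupp.degree_eq_zero_iff] at hd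
    subst hd
    rw [coeffE_wordSum_const, if_pos rfl, h [] rfl, zero_add]
    refine Finset.sum_eq_zero fun j _ => ?_
    rw [if_neg]
    simp
  | succ k ih =>
    rw [coeffE_wordSum_const, if_neg, zero_add]
    swap
    · rintro rfl; simp at hd
    refine Finset.sum_eq_zero fun j _ => ?_
    split_ifs with hj
    · refine ih (fun c hc => h _ ?_) ?_
      · rw [content_cons, hc, add_tsub_cancel_of_le hj]
      · have h1 := congrArg Finsupp.degree (add_tsub_cancel_of_le hj)
        rw [map_add, Finsupp.degree_single, hd] at h1
        omega
    · rfl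

/-- The coefficient of a monomial in a sum over all words, if only one word with this content
contributes. -/
theorem coeffE_wordSum_eq_single (c₀ : List (Fin n)) {F : List (Fin n) → ExtAlg R₀ V}
    (h : ∀ c, content c = content c₀ → c ≠ c₀ → F c = 0) :
    coeffE (content c₀) (wordSum fun c => const n (F c)) = F c₀ := by
  induction c₀ generalizing F with
  | nil =>
    rw [coeffE_wordSum_const, if_pos (show content ([] : List (Fin n)) = 0 from rfl),
      Finset.sum_eq_zero, add_zero]
    intro j _
    rw [if_neg]
    simp [content]
  | cons i c₀ ih =>
    rw [coeffE_wordSum_const, if_neg, zero_add, Finset.sum_eq_single i]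
    · rw [content_cons, if_pos le_self_add, add_tsub_cancel_left]
      exact ih fun c hc hne => h _ (by rw [content_cons, content_cons, hc]) (by simpa using hne)
    · intro j _ hj
      split_ifs with hle
      · refine coeffE_wordSum_eq_zero fun c hc => h _ ?_ ?_
        · rw [content_cons, hc, add_tsub_cancel_of_le hle]
        · simp [hj]
      · rfl
    · simp
    · intro h0
      have := DFunLike.congr_fun h0 i
      simp [content_cons] at this

end Content

section Acyclic

variable {R₀ V : Type*} [CommRing R₀] [AddCommGroup V] [Module R₀ V] {n : ℕ}
  (A : SuperfilteredDeformation R₀ V) (b : Module.Basis (Fin n) R₀ V)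

theorem basisWord_eq_extWord (c : List (Fin n)) :
    basisWord b c = extWord b (c.map fun i => {i}) := by
  rw [basisWord, extWord, List.map_map]
  exact List.map_congr_left fun i _ => (basis_singleton b i).symm

/-- A reduced cocycle is determined by its values on words of types `split` and `critical`. -/
theorem eq_zero_of_split_of_critical {t : ZMod 2} {ψ : List (ExtAlg R₀ V) → ExtAlg R₀ V}
    (hm : IsMultilinear ψ) (hr : IsReduced ψ) (hd : hochAux A t ψ = fun _ => 0)
    (hs : ∀ u : List (Finset (Fin n)), ∅ ∉ u → wordType ⊤ u = .split → ψ (extWord b u) = 0)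
    (hc : ∀ u : List (Finset (Fin n)), ∅ ∉ u → wordType ⊤ u = .critical → ψ (extWord b u) = 0) :
    ψ = fun _ => 0 := by
  have hs' : ∀ u : List (Finset (Fin n)), wordType ⊤ u = .split → ψ (extWord b u) = 0 :=
    fun u hu => by
      by_cases h : ∅ ∈ u
      · exact hr.extWord b h
      · exact hs u h hu
  have key : ∀ w : List (Finset (Fin n)), ∅ ∉ w → ψ (extWord b w) = 0 := by
    intro w
    induction w using (InvImage.wf wordRank (wellFounded_lt (α := ℕ ×ₗ ℕ))).induction with
    | _ w ih =>
      intro hw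
      cases h : wordType ⊤ w with
      | split => exact hs w hw h
      | critical => exact hc w hw h
      | merged =>
        obtain ⟨s, hs1, hs2⟩ := exists_hochAux_splitLetter A b t hw h
        have h1 := hs2 ψ hm hr (fun u hu hlt => ih u hlt hu) hs'
        rw [hd] at h1
        rw [← one_smul R₀ (ψ (extWord b w)), ← hs1, mul_smul, ← h1, smul_zero]
  refine IsMultilinear.ext_extWord b hm ⟨by simp, by simp⟩ fun w => ?_
  by_cases h : ∅ ∈ w
  · exact hr.extWord b h
  · exact key w h

theorem wordDeg_splitLetter (t : ZMod 2) {w : List (Finset (Fin n))} (hw : ∅ ∉ w)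
    (h : wordType ⊤ w = .merged) : wordDeg (t + 1) (splitLetter w) = wordDeg t w := by
  obtain ⟨x₀, m, J, z₀, hw1, hw2, hJ, hlt, -⟩ := exists_splitLetter hw h
  have hdis : Disjoint {m} J := Finset.disjoint_singleton_left.2 fun h => lt_irrefl _ (hlt m h)
  rw [hw2, hw1]
  simp only [wordDeg, List.length_append, List.length_cons, List.map_append, List.map_cons,
    List.sum_append, List.sum_cons, Finset.card_union_of_disjoint hdis]
  push_cast
  ring

open Classical in
/-- Every reduced cochain agrees on the words of type `split` with the differential of a reduced
cochain which is supported on the words of type `merged`. -/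
theorem exists_hochAux_eq_on_split {t : ZMod 2} {φ : List (ExtAlg R₀ V) → ExtAlg R₀ V}
    (hφ : IsCochain (t + 1, φ)) : ∃ F : List (Finset (Fin n)) → ExtAlg R₀ V,
      (∀ w, ¬(∅ ∉ w ∧ wordType ⊤ w = .merged) → F w = 0) ∧ IsCochain (t, ofWords b F) ∧
      ∀ u, ∅ ∉ u → wordType ⊤ u = .split →
        hochAux A t (ofWords b F) (extWord b u) = φ (extWord b u) := by
  have hex : ∀ w : List (Finset (Fin n)), ∃ s : R₀, s * s = 1 ∧
      (∅ ∉ w ∧ wordType ⊤ w = .merged → ∀ κ : List (ExtAlg R₀ V) → ExtAlg R₀ V,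
        IsMultilinear κ → IsReduced κ →
        (∀ u, ∅ ∉ u → wordRank u < wordRank w → κ (extWord b u) = 0) →
        (∀ u, wordType ⊤ u = .split → κ (extWord b u) = 0) →
        hochAux A t κ (extWord b (splitLetter w)) = s • κ (extWord b w)) := by
    intro w
    by_cases h : ∅ ∉ w ∧ wordType ⊤ w = .merged
    · obtain ⟨s, hs, hs'⟩ := exists_hochAux_splitLetter A b t h.1 h.2
      exact ⟨s, hs, fun _ => hs'⟩
    · exact ⟨1, one_mul 1, fun h' => absurd h' h⟩
  choose s hs hkey using hex
  have hwf := InvImage.wf (wordRank (n := n)) (wellFounded_lt (α := ℕ ×ₗ ℕ))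
  -- the values on words of type `merged` are found by recursion over the rank, since the
  -- contribution of the words of lower rank is known
  let F : List (Finset (Fin n)) → ExtAlg R₀ V := hwf.fix fun w rec =>
    if ∅ ∉ w ∧ wordType ⊤ w = .merged then
      s w • (φ (extWord b (splitLetter w)) - hochAux A t
        (ofWords b fun u => if h : wordRank u < wordRank w then rec u h else 0)
        (extWord b (splitLetter w))) else 0
  let low : List (Finset (Fin n)) → List (Finset (Fin n)) → ExtAlg R₀ V := fun w u =>
    if wordRank u < wordRank w then F u else 0
  have hF : ∀ w, F w = if ∅ ∉ w ∧ wordType ⊤ w = .merged then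
      s w • (φ (extWord b (splitLetter w)) - hochAux A t (ofWords b (low w))
        (extWord b (splitLetter w))) else 0 := by
    intro w
    simp only [F]
    rw [hwf.fix_eq]
    rfl
  have hF0 : ∀ w, ¬(∅ ∉ w ∧ wordType ⊤ w = .merged) → F w = 0 := fun w hw => by
    rw [hF, if_neg hw]
  have hpar : ∀ w, F w ∈ parityPart R₀ V (wordDeg t w) := by
    intro w
    induction w using hwf.induction with
    | _ w ih =>
      by_cases h : ∅ ∉ w ∧ wordType ⊤ w = .merged
      · have hlow : IsCochain (t, ofWords b (low w)) := by
          refine ⟨isMultilinear_ofWords b _, hasParity_ofWords b fun u => ?_⟩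
          by_cases hu : wordRank u < wordRank w
          · simp only [low, if_pos hu]
            exact ih u hu
          · simp only [low, if_neg hu]
            exact zero_mem _
        rw [hF, if_pos h, ← wordDeg_splitLetter t h.1 h.2]
        exact Submodule.smul_mem _ _ (sub_mem (hφ.parity.extWord b _)
          ((isCochain_hochAux A hlow).parity.extWord b _))
      · rw [hF0 w h]
        exact zero_mem _
  refine ⟨F, hF0, ⟨isMultilinear_ofWords b F, hasParity_ofWords b hpar⟩, fun u hu hsp => ?_⟩
  obtain ⟨w, hw, hmerged, rfl⟩ := exists_merged hu hsp
  have hsplit : ofWords b F = fun l => ofWords b (low w) l +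
      (1 : R₀) • ofWords b (fun u => if wordRank u < wordRank w then 0 else F u) l := by
    simp only [one_smul]
    rw [← ofWords_add]
    congr 1
    funext u
    by_cases h : wordRank u < wordRank w <;> simp [low, h]
  have h1 := hkey w ⟨hw, hmerged⟩
    (ofWords b fun u => if wordRank u < wordRank w then 0 else F u) (isMultilinear_ofWords b _)
    (isReduced_ofWords b fun u hu => by rw [hF0 u fun h => h.1 hu, ite_self])
    (fun u _ hlt => by rw [ofWords_extWord, if_pos hlt])
    (fun u hu => by rw [ofWords_extWord, hF0 u (fun h => by rw [hu] at h; simp at h), ite_self])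
  rw [ofWords_extWord, if_neg (lt_irrefl _), hF, if_pos ⟨hw, hmerged⟩, smul_smul, hs,
    one_smul] at h1
  rw [hsplit, hochAux_add_smul]
  simp only [h1, one_smul]
  abel

theorem evalTaut_ofWords (F : List (Finset (Fin n)) → ExtAlg R₀ V) :
    evalTaut b (ofWords b F) = wordSum fun c => const n (F (c.map fun i => {i})) := by
  rw [evalTaut_eq b (isMultilinear_ofWords b F)]
  simp only [basisWord_eq_extWord, ofWords_extWord]

/-- A reduced cocycle in the kernel of the evaluation on the tautological element is the
differential of a reduced cochain in this kernel. -/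
theorem exists_hochAux_eq {t : ZMod 2} {φ : List (ExtAlg R₀ V) → ExtAlg R₀ V}
    (hφ : IsCochain (t + 1, φ)) (hr : IsReduced φ) (hd : hochAux A (t + 1) φ = fun _ => 0)
    (he : evalTaut b φ = 0) :
    ∃ κ, IsCochain (t, κ) ∧ IsReduced κ ∧ hochAux A t κ = φ ∧ evalTaut b κ = 0 := by
  obtain ⟨F, hF, hκ, hsp⟩ := exists_hochAux_eq_on_split A b hφ
  have hκr : IsReduced (ofWords b F) := isReduced_ofWords b fun w hw => hF w fun h => h.1 hw
  have hdκ := isCochain_hochAux A hκ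
  have hφm : IsMultilinear φ := hφ.multilinear
  have hdκm : IsMultilinear (hochAux A t (ofWords b F)) := hdκ.multilinear
  have heκ : evalTaut b (ofWords b F) = 0 := by
    rw [evalTaut_ofWords, ← wordSum_zero (R₀ := R₀) (V := V) (n := n)]
    refine wordSum_congr fun c => ?_
    rw [hF _ fun h => wordType_singletons_ne_merged _ _ h.2, const_zero]
  set ψ : List (ExtAlg R₀ V) → ExtAlg R₀ V :=
    fun l => φ l + (-1 : R₀) • hochAux A t (ofWords b F) l with hψ
  have hψm : IsMultilinear ψ := hφm.add (hdκm.smul _)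
  have hψr : IsReduced ψ := fun x z => by
    rw [hψ]
    simp only [hr x z, isReduced_hochAux A hκ hκr x z, smul_zero, add_zero]
  have hψd : hochAux A (t + 1) ψ = fun _ => 0 := by
    rw [hψ, hochAux_add_smul, hd]
    funext l
    simp only [hochAux_hochAux A hκ l, smul_zero, add_zero]
  have hψe : evalTaut b ψ = 0 := by
    rw [hψ, evalTaut_add b hφm (hdκm.smul _), evalTaut_smul b hdκm, he,
      evalTaut_hochAux A b hκ hκr, heκ, map_zero, map_zero, smul_zero, add_zero]
  have hψs : ∀ u : List (Finset (Fin n)), ∅ ∉ u → wordType ⊤ u = .split → ψ (extWord b u) = 0 :=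
    fun u hu h => by
      simp only [hψ, hsp u hu h]
      simp
  have hψ0 : ψ = fun _ => 0 := by
    refine eq_zero_of_split_of_critical A b hψm hψr hψd hψs fun u hu hcrit => ?_
    obtain ⟨c₀, rfl, hc₀, -⟩ := exists_of_critical hu hcrit
    rw [evalTaut_eq b hψm] at hψe
    have h1 := congrArg (coeffE (content c₀)) hψe
    rw [coeffE_wordSum_eq_single c₀] at h1
    · rw [basisWord_eq_extWord] at h1
      exact h1
    -- a word of singletons which is not weakly decreasing has type `split`
    intro c hc hne
    rw [basisWord_eq_extWord]
    have hcn : (∅ : Finset (Fin n)) ∉ c.map fun i => ({i} : Finset (Fin n)) := by simp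
    cases h : wordType ⊤ (c.map fun i => ({i} : Finset (Fin n))) with
    | split => exact hψs _ hcn h
    | merged => exact absurd h (wordType_singletons_ne_merged _ _)
    | critical =>
      obtain ⟨c', hc', hdec, -⟩ := exists_of_critical hcn h
      have : c = c' := (List.map_injective_iff.2 Finset.singleton_injective) hc'
      rw [← this] at hdec
      exact absurd (eq_of_content_eq hdec hc₀ hc) hne
  refine ⟨ofWords b F, hκ, hκr, funext fun l => ?_, heκ⟩
  have h2 := congrFun hψ0 l
  simp only [hψ] at h2
  rw [neg_smul, one_smul, ← sub_eq_add_neg, sub_eq_zero] at h2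
  exact h2.symm

theorem coeffE_evalTaut_mem {t : ZMod 2} {φ : List (ExtAlg R₀ V) → ExtAlg R₀ V}
    (hφ : IsCochain (t, φ)) (m : Fin n →₀ ℕ) : coeffE m (evalTaut b φ) ∈ parityPart R₀ V t := by
  rw [evalTaut_eq b hφ.multilinear]
  exact coeffE_wordSum_mem (fun w => mem_parityPart_basisWord b hφ.parity w) m

theorem disjoint_parityPart : Disjoint (parityPart R₀ V 0) (parityPart R₀ V 1) :=
  (DirectSum.Decomposition.isInternal (parityPart R₀ V)).submodule_iSupIndep.pairwiseDisjoint
    (by decide)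

theorem exists_add_parityPart (x : ExtAlg R₀ V) :
    ∃ y : ZMod 2 → ExtAlg R₀ V, (∀ t, y t ∈ parityPart R₀ V t) ∧ ∑ t, y t = x := by
  have h : x ∈ parityPart R₀ V 0 ⊔ parityPart R₀ V 1 := by
    rw [(CliffordAlgebra.evenOdd_isCompl (0 : QuadraticForm R₀ V)).sup_eq_top]
    trivial
  obtain ⟨y, hy, z, hz, rfl⟩ := Submodule.mem_sup.1 h
  refine ⟨fun t => if t = 0 then y else z, fun t => ?_, ?_⟩
  · rcases zmod_two_cases t with rfl | rfl
    · simpa using hy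
    · simpa using hz
  · refine (Fin.sum_univ_two (fun t : ZMod 2 => if t = 0 then y else z)).trans ?_
    change (if (0 : ZMod 2) = 0 then y else z) + (if (1 : ZMod 2) = 0 then y else z) = y + z
    rw [if_pos rfl, if_neg (by decide)]

theorem evalTaut_eq_zero_of_hochToTaut {φ : Ops R₀ V} (hφ : φ ∈ redCochains R₀ V)
    (h : hochToTaut b φ = 0) (t : ZMod 2) : evalTaut b (φ t) = 0 := by
  rw [mem_redCochains] at hφ
  have h1 : evalTaut b (φ 0) + evalTaut b (φ 1) = 0 :=
    (Fin.sum_univ_two (fun t : ZMod 2 => evalTaut b (φ t))).symm.trans h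
  have h2 : ∀ m, coeffE m (evalTaut b (φ 0)) + coeffE m (evalTaut b (φ 1)) = 0 := fun m => by
    rw [← coeffE_add, h1, coeffE_zero]
  have h3 : ∀ m, coeffE m (evalTaut b (φ 0)) = 0 := fun m =>
    Submodule.disjoint_def.1 disjoint_parityPart _ (coeffE_evalTaut_mem b (hφ 0).1 m) (by
      rw [eq_neg_of_add_eq_zero_left (h2 m)]
      exact neg_mem (coeffE_evalTaut_mem b (hφ 1).1 m))
  rcases zmod_two_cases t with rfl | rfl
  · exact coeffE_ext fun m => by rw [h3, coeffE_zero]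
  · refine coeffE_ext fun m => ?_
    have := h2 m
    rw [h3, zero_add] at this
    rw [this, coeffE_zero]

/-- The kernel of the evaluation on the tautological element is acyclic. -/
theorem exists_hochD_eq {φ : Ops R₀ V} (hφ : φ ∈ cocycles (redCochains R₀ V) (hochD A))
    (h : hochToTaut b φ = 0) :
    ∃ κ ∈ redCochains R₀ V, hochD A κ = φ ∧ hochToTaut b κ = 0 := by
  rw [mem_hochCocycles] at hφ
  have h1 := mem_redCochains.1 hφ.1
  have h2 : ∀ t, ∃ κ, IsCochain (t, κ) ∧ IsReduced κ ∧ hochAux A t κ = φ (t + 1) ∧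
      evalTaut b κ = 0 := fun t =>
    exists_hochAux_eq A b (h1 (t + 1)).1 (h1 (t + 1)).2 (hφ.2 (t + 1))
      (evalTaut_eq_zero_of_hochToTaut b hφ.1 h (t + 1))
  choose κ hκ using h2
  refine ⟨κ, mem_redCochains.2 fun t => ⟨(hκ t).1, (hκ t).2.1⟩, funext fun t => ?_,
    Finset.sum_eq_zero fun t _ => (hκ t).2.2.2⟩
  have h3 := hochD_apply_add_one A κ (t - 1)
  rw [(hκ (t - 1)).2.2.1, sub_add_cancel] at h3
  exact h3

open Classical in
/-- Evaluation on the tautological element is surjective. -/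
theorem exists_hochToTaut_eq (y : ExtSeries R₀ V n) :
    ∃ φ ∈ redCochains R₀ V, hochToTaut b φ = y := by
  choose p hp hp' using exists_add_parityPart (R₀ := R₀) (V := V)
  let F : ZMod 2 → List (Finset (Fin n)) → ExtAlg R₀ V := fun t w =>
    if h : ∃ c : List (Fin n), w = c.map (fun i => {i}) ∧ c.Pairwise (· ≥ ·) then
      p (coeffE (content h.choose) y) t else 0
  have hF : ∀ t (c : List (Fin n)), c.Pairwise (· ≥ ·) →
      F t (c.map fun i => {i}) = p (coeffE (content c) y) t := by
    intro t c hc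
    have h : ∃ c' : List (Fin n), c.map (fun i => ({i} : Finset (Fin n))) =
      c'.map (fun i => {i}) ∧ c'.Pairwise (· ≥ ·) := ⟨c, rfl, hc⟩
    have h1 : c = h.choose :=
      (List.map_injective_iff.2 Finset.singleton_injective) h.choose_spec.1
    simp only [F]
    rw [dif_pos h, ← h1]
  have hF0 : ∀ t (c : List (Fin n)), ¬c.Pairwise (· ≥ ·) → F t (c.map fun i => {i}) = 0 := by
    intro t c hc
    refine dif_neg ?_
    rintro ⟨c', h1, h2⟩
    rw [(List.map_injective_iff.2 Finset.singleton_injective) h1] at hc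
    exact hc h2
  have hpar : ∀ t w, F t w ∈ parityPart R₀ V (wordDeg t w) := by
    intro t w
    by_cases h : ∃ c : List (Fin n), w = c.map (fun i => {i}) ∧ c.Pairwise (· ≥ ·)
    · obtain ⟨c, rfl, hc⟩ := h
      rw [hF t c hc]
      have : wordDeg t (c.map fun i => ({i} : Finset (Fin n))) = t := by
        simp [wordDeg, Function.comp_def]
      rw [this]
      exact hp _ t
    · simp only [F]
      rw [dif_neg h]
      exact zero_mem _
  refine ⟨fun t => ofWords b (F t), mem_redCochains.2 fun t => ⟨⟨isMultilinear_ofWords b _,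
    hasParity_ofWords b (hpar t)⟩, isReduced_ofWords b fun w hw => dif_neg ?_⟩, ?_⟩
  · rintro ⟨c, rfl, -⟩
    simp at hw
  · refine coeffE_ext fun m => ?_
    obtain ⟨c₀, hc₀, rfl⟩ := exists_content m
    rw [hochToTaut, coeffE_sum]
    have h1 : ∀ t, coeffE (content c₀) (evalTaut b (ofWords b (F t))) =
        p (coeffE (content c₀) y) t := by
      intro t
      rw [evalTaut_ofWords, coeffE_wordSum_eq_single c₀, hF t c₀ hc₀]
      intro c hc hne
      exact hF0 t c fun h => hne (eq_of_content_eq h hc₀ hc)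
    simp only [h1, hp']

end Acyclic

/-! ### Hochschild cohomology and `H^*(A_v)` -/

section RingEquiv

variable {S S' M M' : Type*} [CommRing S] [AddCommGroup M] [Module S M] [CommRing S']
  [AddCommGroup M'] [Module S' M'] {C : Submodule S M} {d : M →ₗ[S] M} {m : M →ₗ[S] M →ₗ[S] M}
  {e : M} {C' : Submodule S' M'} {d' : M' →ₗ[S'] M'} {m' : M' →ₗ[S'] M' →ₗ[S'] M'} {e' : M'}

theorem cls_eq_iff (h : IsCohomologyAlgebra C d m e) {x y : M} (hx : x ∈ cocycles C d)
    (hy : y ∈ cocycles C d) : CohomologyAlgebra.cls h x hx = CohomologyAlgebra.cls h y hy ↔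
      x - y ∈ coboundaries C d :=
  Submodule.Quotient.eq _

/-- A map which is multiplicative up to coboundaries, and which detects and exhausts cohomology
classes, induces an isomorphism of cohomology rings. -/
theorem exists_cohomology_ringEquiv (h : IsCohomologyAlgebra C d m e)
    (h' : IsCohomologyAlgebra C' d' m' e') (P : M → M')
    (hadd : ∀ x ∈ cocycles C d, ∀ y ∈ cocycles C d, P (x + y) = P x + P y)
    (hP : ∀ x ∈ cocycles C d, P x ∈ cocycles C' d')
    (hmul : ∀ x ∈ cocycles C d, ∀ y ∈ cocycles C d, P (m x y) - m' (P x) (P y) ∈ coboundaries C' d')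
    (hcob : ∀ x ∈ cocycles C d, P x ∈ coboundaries C' d' ↔ x ∈ coboundaries C d)
    (hsurj : ∀ y ∈ cocycles C' d', ∃ x ∈ cocycles C d, P x - y ∈ coboundaries C' d') :
    ∃ Φ : CohomologyAlgebra h ≃+* CohomologyAlgebra h', ∀ x (hx : x ∈ cocycles C d),
      ∃ hx' : P x ∈ cocycles C' d',
        Φ (CohomologyAlgebra.cls h x hx) = CohomologyAlgebra.cls h' (P x) hx' := by
  have hsub : ∀ x ∈ cocycles C d, ∀ y ∈ cocycles C d, P (x - y) = P x - P y := by
    intro x hx y hy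
    have := hadd (x - y) (sub_mem hx hy) y hy
    rw [sub_add_cancel] at this
    rw [this, add_sub_cancel_right]
  let f : CohomologyAlgebra h → CohomologyAlgebra h' := fun a =>
    Quotient.liftOn a (fun x => CohomologyAlgebra.cls h' (P x.1) (hP x.1 x.2)) (fun x y hxy => by
      have hxy' : x.1 - y.1 ∈ coboundaries C d := (Submodule.quotientRel_def
        ((coboundaries C d).comap (cocycles C d).subtype)).1 hxy
      rw [cls_eq_iff, ← hsub _ x.2 _ y.2]
      exact (hcob _ (sub_mem x.2 y.2)).2 hxy')
  have hf : ∀ x (hx : x ∈ cocycles C d), f (CohomologyAlgebra.cls h x hx) =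
    CohomologyAlgebra.cls h' (P x) (hP x hx) := fun x hx => rfl
  have hfadd : ∀ a c, f (a + c) = f a + f c := by
    intro a c
    induction a using CohomologyAlgebra.ind with | hp x hx =>
    induction c using CohomologyAlgebra.ind with | hp y hy =>
    rw [CohomologyAlgebra.cls_add, hf, hf, hf, CohomologyAlgebra.cls_add]
    exact CohomologyAlgebra.cls_eq _ _ _ (by rw [hadd x hx y hy, sub_self]; exact zero_mem _)
  have hfmul : ∀ a c, f (a * c) = f a * f c := by
    intro a c
    induction a using CohomologyAlgebra.ind with | hp x hx =>
    induction c using CohomologyAlgebra.ind with | hp y hy =>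
    rw [CohomologyAlgebra.cls_mul, hf, hf, hf, CohomologyAlgebra.cls_mul]
    exact CohomologyAlgebra.cls_eq _ _ _ (hmul x hx y hy)
  have hbij : Function.Bijective f := by
    constructor
    · intro a c hac
      induction a using CohomologyAlgebra.ind with | hp x hx =>
      induction c using CohomologyAlgebra.ind with | hp y hy =>
      rw [hf, hf, cls_eq_iff, ← hsub x hx y hy] at hac
      exact CohomologyAlgebra.cls_eq _ _ _ ((hcob _ (sub_mem hx hy)).1 hac)
    · intro c
      induction c using CohomologyAlgebra.ind with | hp y hy =>
      obtain ⟨x, hx, hxy⟩ := hsurj y hy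
      exact ⟨CohomologyAlgebra.cls h x hx, CohomologyAlgebra.cls_eq _ _ _ hxy⟩
  exact ⟨{ Equiv.ofBijective f hbij with map_mul' := hfmul, map_add' := hfadd },
    fun x hx => ⟨hP x hx, hf x hx⟩⟩

end RingEquiv

section Hochschild

variable {R₀ V : Type*} [CommRing R₀] [AddCommGroup V] [Module R₀ V] {n : ℕ}
  (A : SuperfilteredDeformation R₀ V) (b : Module.Basis (Fin n) R₀ V)

theorem hochToTaut_mem_cocycles {φ : Ops R₀ V}
    (hφ : φ ∈ cocycles (redCochains R₀ V) (hochD A)) :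
    hochToTaut b φ ∈ cocycles ⊤ (dTaut A b) := by
  have h0 : hochD A φ = 0 := hφ.2
  have h1 := hochToTaut_hochD A b hφ.1
  rw [h0] at h1
  have h2 : hochToTaut b (0 : Ops R₀ V) = 0 :=
    Finset.sum_eq_zero fun t _ => evalTaut_zero b
  rw [h2] at h1
  rw [mem_cocycles_top, ← epsR_epsR (hochToTaut b φ), ← neg_eq_zero, ← neg_eq_iff_eq_neg.2
    (epsR_dTaut A b (epsR (hochToTaut b φ))), neg_neg, ← h1, map_zero]

theorem coboundary_mem_cocycles {φ : Ops R₀ V}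
    (hφ : φ ∈ coboundaries (redCochains R₀ V) (hochD A)) :
    φ ∈ cocycles (redCochains R₀ V) (hochD A) := by
  obtain ⟨κ, hκ, rfl⟩ := hφ
  exact ⟨hochD_mem A hκ, hochD_hochD A hκ⟩

/-- Evaluation on the tautological element detects coboundaries. -/
theorem hochToTaut_mem_coboundaries {φ : Ops R₀ V}
    (hφ : φ ∈ cocycles (redCochains R₀ V) (hochD A)) :
    hochToTaut b φ ∈ coboundaries ⊤ (dTaut A b) ↔
      φ ∈ coboundaries (redCochains R₀ V) (hochD A) := by
  constructor
  · intro h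
    obtain ⟨y, hy⟩ := mem_coboundaries_top.1 h
    obtain ⟨κ, hκ, hκy⟩ := exists_hochToTaut_eq b (epsR y)
    have h1 : hochD A κ ∈ coboundaries (redCochains R₀ V) (hochD A) := ⟨κ, hκ, rfl⟩
    have h2 := coboundary_mem_cocycles A h1
    have h3 : hochToTaut b (hochD A κ) = hochToTaut b φ := by
      rw [hochToTaut_hochD A b hκ, hκy, epsR_epsR, hy]
    have h4 : hochToTaut b (φ + (-1 : R₀) • hochD A κ) = 0 := by
      rw [hochToTaut_add b hφ.1 (Submodule.smul_mem _ _ h2.1), hochToTaut_smul b _ h2.1, h3,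
        map_neg, map_one, neg_smul, one_smul, add_neg_cancel]
    obtain ⟨κ', hκ', h5, -⟩ := exists_hochD_eq A b (add_mem hφ (Submodule.smul_mem _ _ h2)) h4
    have h6 := add_mem (Submodule.mem_map_of_mem hκ') h1
    rw [h5] at h6
    rwa [neg_smul, one_smul, neg_add_cancel_right] at h6
  · rintro ⟨κ, hκ, rfl⟩
    rw [hochToTaut_hochD A b hκ]
    exact mem_coboundaries_top.2 ⟨_, rfl⟩

/-- The cohomology of the reduced Hochschild complex is a unital algebra. -/
theorem isCohomologyAlgebra_hochD (b : Module.Basis (Fin n) R₀ V) :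
    IsCohomologyAlgebra (redCochains R₀ V) (hochD A) (cup A) (hochOne R₀ V) := by
  have hv := isCohomologyAlgebra_dTaut A b
  have hone : hochOne R₀ V ∈ cocycles (redCochains R₀ V) (hochD A) :=
    ⟨hochOne_mem, hochD_hochOne A⟩
  have hsub : ∀ φ ∈ cocycles (redCochains R₀ V) (hochD A),
      ∀ ψ ∈ cocycles (redCochains R₀ V) (hochD A),
      hochToTaut b (φ - ψ) = hochToTaut b φ - hochToTaut b ψ := by
    intro φ hφ ψ hψ
    have := hochToTaut_add b (sub_mem hφ hψ).1 hψ.1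
    rw [sub_add_cancel] at this
    rw [this, add_sub_cancel_right]
  have hP := fun φ hφ => hochToTaut_mem_cocycles A b (φ := φ) hφ
  have hB := fun φ hφ => hochToTaut_mem_coboundaries A b (φ := φ) hφ
  have hm := fun φ hφ ψ hψ => cup_mem_cocycles A (φ := φ) (ψ := ψ) hφ hψ
  refine
  { d_mem := fun x hx => hochD_mem A hx
    d_d := fun x hx => hochD_hochD A hx
    mul_mem := fun x hx y hy => cup_mem A hx hy
    one_cocycle := hone
    mul_cocycle := fun x hx y hy => cup_mem_cocycles A hx hy
    coboundary_mul := fun x hx y hy => ?_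
    mul_coboundary := fun x hx y hy => ?_
    one_mul := fun x hx => ?_
    mul_one := fun x hx => ?_
    mul_assoc := fun x hx y hy z hz => ?_ }
  · have hx' := coboundary_mem_cocycles A hx
    rw [← hB _ (hm x hx' y hy), hochToTaut_cup A b hx'.1 hy.1]
    exact hv.coboundary_mul _ ((hB x hx').2 hx) _ (hP y hy)
  · have hy' := coboundary_mem_cocycles A hy
    rw [← hB _ (hm x hx y hy'), hochToTaut_cup A b hx.1 hy'.1]
    exact hv.mul_coboundary _ (hP x hx) _ ((hB y hy').2 hy)
  · rw [← hB _ (sub_mem (hm _ hone x hx) hx), hsub _ (hm _ hone x hx) x hx,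
      hochToTaut_cup A b hone.1 hx.1, hochToTaut_hochOne]
    exact hv.one_mul _ (hP x hx)
  · rw [← hB _ (sub_mem (hm x hx _ hone) hx), hsub _ (hm x hx _ hone) x hx,
      hochToTaut_cup A b hx.1 hone.1, hochToTaut_hochOne]
    exact hv.mul_one _ (hP x hx)
  · have h1 := hm _ (hm x hx y hy) z hz
    have h2 := hm x hx _ (hm y hy z hz)
    rw [← hB _ (sub_mem h1 h2), hsub _ h1 _ h2, hochToTaut_cup A b (hm x hx y hy).1 hz.1,
      hochToTaut_cup A b hx.1 hy.1, hochToTaut_cup A b hx.1 (hm y hy z hz).1,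
      hochToTaut_cup A b hy.1 hz.1]
    exact hv.mul_assoc _ (hP x hx) _ (hP y hy) _ (hP z hz)

/-- The isomorphism `HH^*(A) ≅ H^*(A_v)` induced by evaluation on the tautological element. -/
theorem exists_hochToTaut_algEquiv
    (hHH : IsCohomologyAlgebra (redCochains R₀ V) (hochD A) (cup A) (hochOne R₀ V))
    (hv : IsCohomologyAlgebra ⊤ (dTaut A b) (mulTaut A b) (const n 1)) :
    ∃ Φ : CohomologyAlgebra hHH ≃ₐ[R₀] CohomologyAlgebra hv,
      ∀ φ (hφ : φ ∈ cocycles (redCochains R₀ V) (hochD A)),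
        ∃ h : hochToTaut b φ ∈ cocycles ⊤ (dTaut A b),
          Φ (CohomologyAlgebra.cls hHH φ hφ) =
            CohomologyAlgebra.cls hv (hochToTaut b φ) h := by
  obtain ⟨Φ, hΦ⟩ := exists_cohomology_ringEquiv hHH hv (hochToTaut b)
    (fun x hx y hy => hochToTaut_add b hx.1 hy.1)
    (fun x hx => hochToTaut_mem_cocycles A b hx)
    (fun x hx y hy => by rw [hochToTaut_cup A b hx.1 hy.1, sub_self]; exact zero_mem _)
    (fun x hx => hochToTaut_mem_coboundaries A b hx)
    (fun y hy => by
      obtain ⟨φ, hφ, hφy⟩ := exists_hochToTaut_eq b y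
      -- the differential of `φ` evaluates to zero, so it is the differential of a cochain that
      -- evaluates to zero
      obtain ⟨κ, hκ, hd, hκ0⟩ := exists_hochD_eq A b ⟨hochD_mem A hφ, hochD_hochD A hφ⟩ (by
        rw [hochToTaut_hochD A b hφ, hφy, ← neg_eq_zero, ← epsR_dTaut, mem_cocycles_top.1 hy,
          map_zero])
      refine ⟨φ + (-1 : R₀) • κ, ⟨add_mem hφ (Submodule.smul_mem _ _ hκ), ?_⟩, ?_⟩
      · change hochD A (φ + (-1 : R₀) • κ) = 0
        rw [map_add, map_smul, hd]
        simp
      · rw [hochToTaut_add b hφ (Submodule.smul_mem _ _ hκ), hochToTaut_smul b _ hκ, hκ0,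
          smul_zero, add_zero, hφy, sub_self]
        exact zero_mem _)
  refine ⟨AlgEquiv.ofRingEquiv (f := Φ) fun r => ?_, hΦ⟩
  have h1 : algebraMap R₀ (CohomologyAlgebra hHH) r =
      CohomologyAlgebra.cls hHH (r • hochOne R₀ V) (Submodule.smul_mem _ r hHH.one_cocycle) := by
    rw [Algebra.algebraMap_eq_smul_one]; rfl
  have h2 : algebraMap R₀ (CohomologyAlgebra hv) r =
      CohomologyAlgebra.cls hv ((MvPowerSeries.C r : MvPowerSeries (Fin n) R₀) • const n 1)
        (Submodule.smul_mem _ _ hv.one_cocycle) := by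
    rw [Algebra.algebraMap_eq_smul_one]; rfl
  obtain ⟨h3, h4⟩ := hΦ _ (Submodule.smul_mem _ r hHH.one_cocycle)
  rw [h1, h2, h4]
  refine CohomologyAlgebra.cls_eq _ _ _ ?_
  rw [hochToTaut_smul b r hochOne_mem, hochToTaut_hochOne, sub_self]
  exact zero_mem _

end Hochschild

/-! ### Monomials in Clifford algebras -/

theorem sort_insert_of_lt {n : ℕ} {i : Fin n} {I : Finset (Fin n)} (h : ∀ j ∈ I, j < i) :
    (insert i I).sort (· ≤ ·) = I.sort (· ≤ ·) ++ [i] := by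
  have hi : i ∉ I := fun hi => lt_irrefl _ (h i hi)
  refine List.Perm.eq_of_pairwise (le := (· ≤ ·)) (fun a b _ _ h h' => le_antisymm h h')
    (Finset.pairwise_sort _ _) ?_ ?_
  · refine List.pairwise_append.2 ⟨Finset.pairwise_sort _ _, List.pairwise_singleton _ _, ?_⟩
    intro a ha c hc
    rw [List.mem_singleton.1 hc]
    exact (h a ((Finset.mem_sort _).1 ha)).le
  · refine (List.perm_ext_iff_of_nodup (Finset.sort_nodup _ _) ?_).2 fun a => ?_
    · refine List.nodup_append.2 ⟨Finset.sort_nodup _ _, List.nodup_singleton i, ?_⟩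
      intro a ha c hc
      rw [List.mem_singleton.1 hc]
      rintro rfl
      exact hi ((Finset.mem_sort _).1 ha)
    · simp [or_comm]

/-- A surjection onto a free module of the same finite rank is bijective: a family which spans and
has the cardinality of a basis is linearly independent. -/
theorem linearIndependent_of_span_eq_top {ι R M : Type*} [Finite ι] [CommRing R] [AddCommGroup M]
    [Module R M] (β : Module.Basis ι R M) {v : ι → M} (h : ⊤ ≤ Submodule.span R (Set.range v)) :
    LinearIndependent R v := by
  have hs : Function.Surjective (β.repr.toLinearMap ∘ₗ Finsupp.linearCombination R v) := by
    refine β.repr.surjective.comp (LinearMap.range_eq_top.1 ?_)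
    rw [Finsupp.range_linearCombination]
    exact top_le_iff.1 h
  have hi := OrzechProperty.injective_of_surjective_endomorphism _ hs
  exact fun x y hxy => hi (by simpa using hxy)

section Monomials

variable {R M : Type*} [CommRing R] [AddCommGroup M] [Module R M] (Q : QuadraticForm R M) {n : ℕ}
  (v : Fin n → M)

/-- The subalgebra generated by the first `k` vectors of a family. -/
def below (k : ℕ) : Subalgebra R (CliffordAlgebra Q) :=
  Algebra.adjoin R {x | ∃ j : Fin n, (j : ℕ) < k ∧ CliffordAlgebra.ι Q (v j) = x}

/-- The product `v_{i_1} ⋯ v_{i_r}` for `I = {i_1 < ⋯ < i_r}`. -/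
def cliffordMonomial (I : Finset (Fin n)) : CliffordAlgebra Q :=
  ((I.sort (· ≤ ·)).map fun i => CliffordAlgebra.ι Q (v i)).prod

theorem cliffordMonomial_empty : cliffordMonomial Q v ∅ = 1 := by simp [cliffordMonomial]

theorem cliffordMonomial_insert {i : Fin n} {I : Finset (Fin n)} (h : ∀ j ∈ I, j < i) :
    cliffordMonomial Q v (insert i I) = cliffordMonomial Q v I * CliffordAlgebra.ι Q (v i) := by
  simp [cliffordMonomial, sort_insert_of_lt h]

variable {Q v}

theorem ι_mem_below {j : Fin n} {k : ℕ} (h : (j : ℕ) < k) :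
    CliffordAlgebra.ι Q (v j) ∈ below Q v k :=
  Algebra.subset_adjoin ⟨j, h, rfl⟩

theorem below_mono {k l : ℕ} (h : k ≤ l) : below Q v k ≤ below Q v l :=
  Algebra.adjoin_mono fun _ ⟨j, hj, hx⟩ => ⟨j, hj.trans_le h, hx⟩

/-- A submodule which contains `1` and is stable under right multiplication with the generators
contains the subalgebra. -/
theorem below_le {k : ℕ} {S : Submodule R (CliffordAlgebra Q)} (h1 : 1 ∈ S)
    (h : ∀ j : Fin n, (j : ℕ) < k → ∀ x ∈ S, x * CliffordAlgebra.ι Q (v j) ∈ S)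
    {x : CliffordAlgebra Q} (hx : x ∈ below Q v k) : x ∈ S := by
  have key : ∀ y ∈ S, y * x ∈ S := by
    induction hx using Algebra.adjoin_induction with
    | mem x hx =>
      obtain ⟨j, hj, rfl⟩ := hx
      exact h j hj
    | algebraMap r =>
      intro y hy
      rw [← Algebra.commutes, ← Algebra.smul_def]
      exact S.smul_mem r hy
    | add x z _ _ hx hz =>
      intro y hy
      rw [mul_add]
      exact add_mem (hx y hy) (hz y hy)
    | mul x z _ _ hx hz =>
      intro y hy
      rw [← mul_assoc]
      exact hz _ (hx y hy)
  rw [← one_mul x]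
  exact key 1 h1

theorem ι_mul_ι_swap (a c : M) : CliffordAlgebra.ι Q a * CliffordAlgebra.ι Q c =
    algebraMap R _ (QuadraticMap.polar Q a c) - CliffordAlgebra.ι Q c * CliffordAlgebra.ι Q a :=
  eq_sub_of_add_eq (CliffordAlgebra.ι_mul_ι_add_swap a c)

theorem exists_of_mem_below_succ {i : Fin n} {x : CliffordAlgebra Q}
    (hx : x ∈ below Q v ((i : ℕ) + 1)) : ∃ y ∈ below Q v i, ∃ z ∈ below Q v i,
      x = y + z * CliffordAlgebra.ι Q (v i) := by
  let S : Submodule R (CliffordAlgebra Q) := (below Q v i).toSubmodule ⊔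
    (below Q v i).toSubmodule.map (LinearMap.mulRight R (CliffordAlgebra.ι Q (v i)))
  have hS : ∀ x, x ∈ S ↔ ∃ y ∈ below Q v i, ∃ z ∈ below Q v i,
      x = y + z * CliffordAlgebra.ι Q (v i) := by
    intro x
    rw [Submodule.mem_sup]
    constructor
    · rintro ⟨y, hy, _, ⟨z, hz, rfl⟩, rfl⟩
      exact ⟨y, hy, z, hz, rfl⟩
    · rintro ⟨y, hy, z, hz, rfl⟩
      exact ⟨y, hy, _, ⟨z, hz, rfl⟩, rfl⟩
  refine (hS x).1 (below_le ((hS 1).2 ⟨1, one_mem _, 0, zero_mem _, by simp⟩) ?_ hx)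
  intro j hj x hx
  obtain ⟨y, hy, z, hz, rfl⟩ := (hS _).1 hx
  refine (hS _).2 ?_
  rcases Nat.lt_succ_iff_lt_or_eq.1 hj with hj | hj
  · refine ⟨y * CliffordAlgebra.ι Q (v j) + z * algebraMap R _ (QuadraticMap.polar Q (v i) (v j)),
      add_mem (mul_mem hy (ι_mem_below hj)) (mul_mem hz (Subalgebra.algebraMap_mem _ _)),
      -(z * CliffordAlgebra.ι Q (v j)), neg_mem (mul_mem hz (ι_mem_below hj)), ?_⟩
    rw [add_mul, mul_assoc, ι_mul_ι_swap (v i) (v j)]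
    noncomm_ring
  · obtain rfl := Fin.ext hj
    refine ⟨z * algebraMap R _ (Q (v j)), mul_mem hz (Subalgebra.algebraMap_mem _ _), y, hy, ?_⟩
    rw [add_mul, mul_assoc, CliffordAlgebra.ι_sq_scalar]
    exact add_comm _ _

theorem below_eq_of_le {k : ℕ} (h : n ≤ k) : below Q v k = below Q v n := by
  refine congrArg (Algebra.adjoin R) (Set.ext fun x => ?_)
  exact ⟨fun ⟨j, _, hx⟩ => ⟨j, j.2, hx⟩, fun ⟨j, _, hx⟩ => ⟨j, j.2.trans_le h, hx⟩⟩

/-- Induction over the Clifford algebra of a free module by right multiplication with basis vectors,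
in increasing order. -/
theorem clifford_induction (hv : Submodule.span R (Set.range v) = ⊤)
    {S : Submodule R (CliffordAlgebra Q)}
    (h1 : 1 ∈ S) (h : ∀ i : Fin n, ∀ x ∈ below Q v i, x ∈ S → x * CliffordAlgebra.ι Q (v i) ∈ S)
    (x : CliffordAlgebra Q) : x ∈ S := by
  have key : ∀ k x, x ∈ below Q v k → x ∈ S := by
    intro k
    induction k with
    | zero =>
      exact fun x hx => below_le h1 (fun j hj => absurd hj (Nat.not_lt_zero _)) hx
    | succ k ih =>
      intro x hx
      rcases Nat.lt_or_ge k n with hk | hk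
      · obtain ⟨y, hy, z, hz, rfl⟩ := exists_of_mem_below_succ (i := ⟨k, hk⟩) hx
        exact add_mem (ih y hy) (h ⟨k, hk⟩ z hz (ih z hz))
      · rw [below_eq_of_le (hk.trans (Nat.le_succ k)), ← below_eq_of_le hk] at hx
        exact ih x hx
  refine key n x ?_
  have h2 : ∀ m : M, CliffordAlgebra.ι Q m ∈ below Q v n := by
    intro m
    have hm : m ∈ Submodule.span R (Set.range v) := by rw [hv]; trivial
    induction hm using Submodule.span_induction with
    | mem m hm =>
      obtain ⟨j, rfl⟩ := hm
      exact ι_mem_below j.2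
    | zero => rw [map_zero]; exact zero_mem _
    | add a c _ _ ha hc => rw [map_add]; exact add_mem ha hc
    | smul r a _ ha => rw [map_smul]; exact Subalgebra.smul_mem _ ha r
  induction x using CliffordAlgebra.induction with
  | algebraMap r => exact Subalgebra.algebraMap_mem _ r
  | ι m => exact h2 m
  | mul a c ha hc => exact mul_mem ha hc
  | add a c ha hc => exact add_mem ha hc

/-- The subalgebra generated by the first `k` vectors is spanned by their monomials. -/
theorem mem_of_mem_below {k : ℕ} {S : Submodule R (CliffordAlgebra Q)}
    (h : ∀ I : Finset (Fin n), (∀ j ∈ I, (j : ℕ) < k) → cliffordMonomial Q v I ∈ S)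
    {x : CliffordAlgebra Q} (hx : x ∈ below Q v k) : x ∈ S := by
  induction k generalizing S x with
  | zero =>
    refine below_le ?_ (fun j hj => absurd hj (Nat.not_lt_zero _)) hx
    rw [← cliffordMonomial_empty Q v]
    exact h ∅ (by simp)
  | succ k ih =>
    rcases Nat.lt_or_ge k n with hk | hk
    · obtain ⟨y, hy, z, hz, rfl⟩ := exists_of_mem_below_succ (i := ⟨k, hk⟩) hx
      refine add_mem (ih (fun I hI => h I fun j hj => (hI j hj).trans (Nat.lt_succ_self k)) hy) ?_
      have := ih (S := S.comap (LinearMap.mulRight R (CliffordAlgebra.ι Q (v ⟨k, hk⟩))))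
        (fun I hI => ?_) hz
      · exact this
      · change cliffordMonomial Q v I * CliffordAlgebra.ι Q (v ⟨k, hk⟩) ∈ S
        rw [← cliffordMonomial_insert Q v (i := ⟨k, hk⟩) fun j hj => hI j hj]
        refine h _ fun j hj => ?_
        rcases Finset.mem_insert.1 hj with rfl | hj
        · exact Nat.lt_succ_self k
        · exact (hI j hj).trans (Nat.lt_succ_self k)
    · rw [below_eq_of_le (hk.trans (Nat.le_succ k)), ← below_eq_of_le hk] at hx
      exact ih (fun I hI => h I fun j hj => (hI j hj).trans (Nat.lt_succ_self k)) hx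

theorem span_cliffordMonomial (hv : Submodule.span R (Set.range v) = ⊤) :
    ⊤ ≤ Submodule.span R (Set.range (cliffordMonomial Q v)) := by
  intro x _
  refine clifford_induction hv
    (Submodule.subset_span (Set.mem_range.2 ⟨∅, cliffordMonomial_empty Q v⟩))
    ?_ x
  intro i x hx _
  refine mem_of_mem_below (S := (Submodule.span R (Set.range (cliffordMonomial Q v))).comap
    (LinearMap.mulRight R (CliffordAlgebra.ι Q (v i)))) (fun I hI => ?_) hx
  refine Submodule.subset_span ⟨insert i I, ?_⟩
  rw [cliffordMonomial_insert Q v fun j hj => hI j hj]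
  rfl

variable (Q) in
/-- The monomials in a basis of a free module form a basis of each of its Clifford algebras, which
is isomorphic as a module to the exterior algebra. -/
def cliffordBasis (β : Module.Basis (Fin n) R M) :
    Module.Basis (Finset (Fin n)) R (CliffordAlgebra Q) :=
  have : Module.Free R M := Module.Free.of_basis β
  let B := (LinearMap.BilinMap.toQuadraticMap_surjective (0 - Q)).choose
  have hB : B.toQuadraticMap = 0 - Q :=
    (LinearMap.BilinMap.toQuadraticMap_surjective (0 - Q)).choose_spec
  Module.Basis.mk (v := cliffordMonomial Q β)
    (linearIndependent_of_span_eq_top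
      (β.ExteriorAlgebra.map (CliffordAlgebra.changeFormEquiv hB).symm)
      (span_cliffordMonomial β.span_eq))
    (span_cliffordMonomial β.span_eq)

theorem cliffordBasis_apply (β : Module.Basis (Fin n) R M) (I : Finset (Fin n)) :
    cliffordBasis Q β I = cliffordMonomial Q β I :=
  Module.Basis.mk_apply _ (span_cliffordMonomial β.span_eq) I

end Monomials

/-! ### Monomials in `A_v` -/

section Filtration

variable {R₀ V : Type*} [CommRing R₀] [AddCommGroup V] [Module R₀ V] {n : ℕ}
  (A : SuperfilteredDeformation R₀ V) (b w : Module.Basis (Fin n) R₀ V)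

variable (n) in
/-- The submodule of `E_R` of the power series with coefficients in a submodule of `E`. -/
def seriesIn (S : Submodule R₀ (ExtAlg R₀ V)) :
    Submodule (MvPowerSeries (Fin n) R₀) (ExtSeries R₀ V n) where
  carrier := {a | ∀ m, coeffE m a ∈ S}
  add_mem' ha hc m := add_mem (ha m) (hc m)
  zero_mem' m := zero_mem S
  smul_mem' r a ha m := by
    rw [coeffE_smul]
    exact sum_mem fun q _ => Submodule.smul_mem _ _ (ha q.2)

variable (R₀ V n) in
/-- The filtration of `E_R` by the power series with coefficients in `F^p E`. -/
abbrev filtR (p : ℤ) : Submodule (MvPowerSeries (Fin n) R₀) (ExtSeries R₀ V n) :=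
  seriesIn n (filt R₀ V p)

theorem filtR_mono {p q : ℤ} (h : p ≤ q) : filtR R₀ V n p ≤ filtR R₀ V n q :=
  fun _ ha m => filt_mono h (ha m)

variable {S : Submodule R₀ (ExtAlg R₀ V)}

theorem const_mem_seriesIn {e : ExtAlg R₀ V} (he : e ∈ S) : const n e ∈ seriesIn n S := by
  intro m
  rw [coeffE_const]
  split_ifs
  exacts [he, zero_mem _]

theorem wordSum_mem_seriesIn {F : List (Fin n) → ExtSeries R₀ V n}
    (hF : ∀ c, F c ∈ seriesIn n S) : wordSum F ∈ seriesIn n S := by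
  have h : ∀ k (F : List (Fin n) → ExtSeries R₀ V n), (∀ c, F c ∈ seriesIn n S) →
      wordSumDeg k F ∈ seriesIn n S := by
    intro k
    induction k with
    | zero => exact fun F hF => hF []
    | succ k ih =>
      exact fun F hF => sum_mem fun j _ => Submodule.smul_mem _ _ (ih _ fun c => hF _)
  intro m
  rw [wordSum, coeffE_series]
  exact sum_mem fun k _ => h k F hF m

theorem wordSum_sub_mem_filtR {p : ℤ} {F : List (Fin n) → ExtSeries R₀ V n}
    (hF : ∀ c, c ≠ [] → F c ∈ filtR R₀ V n p) : wordSum F - F [] ∈ filtR R₀ V n p := by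
  rw [wordSum_eq, add_sub_cancel_left]
  exact sum_mem fun j _ => Submodule.smul_mem _ _ (wordSum_mem_seriesIn fun c => hF _ (by simp))

theorem eps_mem_filt (w : Module.Basis (Fin n) R₀ V) {p : ℤ} {e : ExtAlg R₀ V}
    (he : e ∈ filt R₀ V p) : eps e ∈ filt R₀ V p := by
  have h : filt R₀ V p ≤ (filt R₀ V p).comap eps := by
    refine (filt_le_span w p).trans (Submodule.span_le.2 ?_)
    rintro _ ⟨I, hI, rfl⟩
    change eps _ ∈ filt R₀ V p
    rw [eps_of_mem (basis_mem_parityPart w I)]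
    exact Submodule.smul_mem _ _ (filt_mono hI (basis_mem_filt w I))
  exact h he

theorem mul_eps_mem_filt (A : SuperfilteredDeformation R₀ V) {p q : ℤ} {e e' : ExtAlg R₀ V}
    (he : e ∈ filt R₀ V p) (he' : e' ∈ filt R₀ V q) : e * eps e' ∈ filt R₀ V (p + q) := by
  have h1 := A.leading_two p q e he e' he'
  have h2 := A.filtered [(p, e), (q, e')] (by simp [he, he'])
  have h3 := sub_mem (filt_mono (p := _) (q := p + q) (by simp) h2)
    (filt_mono (by omega : p + q - 1 ≤ p + q) h1)
  simpa using h3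

/-- The product of `A_v` is the exterior product up to terms of lower filtration. -/
theorem mulTaut_const_sub_mem {p q : ℤ} {e e' : ExtAlg R₀ V} (he : e ∈ filt R₀ V p)
    (he' : e' ∈ filt R₀ V q) :
    mulTaut A b (const n e) (const n e') - const n (e * e') ∈ filtR R₀ V n (p + q - 1) := by
  have he'' : eps e' ∈ filt R₀ V q := eps_mem_filt b he'
  rw [mulTaut_apply, epsR_const, insert₂_const b A.multilinear]
  set G : List (Fin n) → List (Fin n) → List (Fin n) → ExtSeries R₀ V n := fun x y z =>
    const n (A.μ (basisWord b x ++ e :: (basisWord b y ++ eps e' :: basisWord b z))) with hG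
  have hlow : ∀ x y z, x ≠ [] ∨ y ≠ [] ∨ z ≠ [] → G x y z ∈ filtR R₀ V n (p + q - 1) := by
    intro x y z hne
    have hlen : 1 ≤ x.length + y.length + z.length := by
      rcases hne with h | h | h <;> have := List.length_pos_of_ne_nil h <;> omega
    obtain ⟨k₁, hk₁, h₁, h₁'⟩ := basisWord_filt b x
    obtain ⟨k₂, hk₂, h₂, h₂'⟩ := basisWord_filt b y
    obtain ⟨k₃, hk₃, h₃, h₃'⟩ := basisWord_filt b z
    have l₁ : k₁.length = x.length := by simpa [basisWord] using congrArg List.length h₁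
    have l₂ : k₂.length = y.length := by simpa [basisWord] using congrArg List.length h₂
    have l₃ : k₃.length = z.length := by simpa [basisWord] using congrArg List.length h₃
    have h := A.leading_higher (k₁ ++ (p, e) :: (k₂ ++ (q, eps e') :: k₃)) (by
      simp only [List.length_append, List.length_cons]
      omega) (by
      simp only [List.mem_append, List.mem_cons]
      rintro a (h | rfl | h | rfl | h)
      exacts [hk₁ a h, he, hk₂ a h, he'', hk₃ a h])
    simp only [List.map_append, List.map_cons, h₁, h₂, h₃, List.sum_append, List.sum_cons, h₁', h₂',
      h₃', List.length_append, List.length_cons] at h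
    refine const_mem_seriesIn (filt_mono ?_ h)
    push_cast
    omega
  have h0 : G [] [] [] - const n (e * e') ∈ filtR R₀ V n (p + q - 1) := by
    have h := A.leading_two p q e he _ he''
    rw [eps_eps] at h
    have h' := const_mem_seriesIn (n := n) h
    rw [sub_eq_add_neg (A.μ [e, eps e']), const_add, const_neg, ← sub_eq_add_neg] at h'
    exact h'
  have h1 : (wordSum fun x => wordSum fun y => wordSum fun z => G x y z) -
      (wordSum fun y => wordSum fun z => G [] y z) ∈ filtR R₀ V n (p + q - 1) :=
    wordSum_sub_mem_filtR (F := fun x => wordSum fun y => wordSum fun z => G x y z) fun x hx =>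
      wordSum_mem_seriesIn fun y => wordSum_mem_seriesIn fun z => hlow x y z (Or.inl hx)
  have h2 : (wordSum fun y => wordSum fun z => G [] y z) - (wordSum fun z => G [] [] z) ∈
      filtR R₀ V n (p + q - 1) :=
    wordSum_sub_mem_filtR (F := fun y => wordSum fun z => G [] y z) fun y hy =>
      wordSum_mem_seriesIn fun z => hlow [] y z (Or.inr (Or.inl hy))
  have h3 : (wordSum fun z => G [] [] z) - G [] [] [] ∈ filtR R₀ V n (p + q - 1) :=
    wordSum_sub_mem_filtR (F := fun z => G [] [] z) fun z hz => hlow [] [] z (Or.inr (Or.inr hz))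
  have h4 := add_mem (add_mem h1 h2) (add_mem h3 h0)
  convert h4 using 1
  abel

theorem coordE_eq_zero {p : ℤ} {a : ExtSeries R₀ V n} (ha : a ∈ filtR R₀ V n p)
    {I : Finset (Fin n)} (hI : p < I.card) : coordE w I a = 0 := by
  refine MvPowerSeries.ext fun m => ?_
  rw [coeff_coordE, map_zero]
  refine map_filt_eq_zero w (w.ExteriorAlgebra.coord I) (fun J hJ => ?_) (ha m)
  rw [Module.Basis.coord_apply, Module.Basis.repr_self, Finsupp.single_eq_of_ne]
  rintro rfl
  omega

theorem eq_sum_coordE (a : ExtSeries R₀ V n) :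
    a = ∑ I, coordE w I a • const n (w.ExteriorAlgebra I) := by
  conv_lhs => rw [← (constBasis w).sum_repr a]
  refine Finset.sum_congr rfl fun I _ => ?_
  rw [constBasis_apply]
  rfl

/-- A submodule contains `R ⊗ F^p E` if it contains the monomials of degree at most `p`. -/
theorem filtR_le {p : ℤ} {S : Submodule (MvPowerSeries (Fin n) R₀) (ExtSeries R₀ V n)}
    (h : ∀ I : Finset (Fin n), (I.card : ℤ) ≤ p → const n (w.ExteriorAlgebra I) ∈ S) :
    filtR R₀ V n p ≤ S := by
  intro a ha
  rw [eq_sum_coordE w a]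
  refine sum_mem fun I _ => ?_
  rcases le_or_gt (I.card : ℤ) p with hI | hI
  · exact S.smul_mem _ (h I hI)
  · rw [coordE_eq_zero w ha hI, zero_smul]
    exact zero_mem _

variable (n) in
/-- An element of `V`, regarded as an element of `E_R`. -/
def vec (v : V) : ExtSeries R₀ V n := const n (ExteriorAlgebra.ι R₀ v)

theorem mulTaut_vec_mem {p : ℤ} {a : ExtSeries R₀ V n} (ha : a ∈ filtR R₀ V n p) (v : V) :
    mulTaut A b a (vec n v) ∈ filtR R₀ V n (p + 1) := by
  refine filtR_le b (S := (filtR R₀ V n (p + 1)).comap ((mulTaut A b).flip (vec n v)))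
    (fun I hI => ?_) ha
  change mulTaut A b (const n (b.ExteriorAlgebra I)) (vec n v) ∈ filtR R₀ V n (p + 1)
  have h1 := mulTaut_const_sub_mem A b (basis_mem_filt b I) (ι_mem_filt (R₀ := R₀) v)
  have h2 := mul_eps_mem_filt A (basis_mem_filt b I) (ι_mem_filt (R₀ := R₀) (-v))
  rw [eps_ι, map_neg, neg_neg] at h2
  have h3 := add_mem (filtR_mono (by omega : _ ≤ p + 1) h1)
    (filtR_mono (by omega : _ ≤ p + 1) (const_mem_seriesIn (n := n) h2))
  rwa [sub_add_cancel] at h3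

theorem tautMonomial_empty (v : Fin n → V) : tautMonomial A b v ∅ = const n 1 := by
  simp [tautMonomial]

theorem tautMonomial_insert (v : Fin n → V) {i : Fin n} {I : Finset (Fin n)} (h : ∀ j ∈ I, j < i) :
    tautMonomial A b v (insert i I) = mulTaut A b (tautMonomial A b v I) (vec n (v i)) := by
  simp [tautMonomial, sort_insert_of_lt h, vec]

/-- Up to a sign, the leading term of an iterated product of basis vectors in `A_v` is the
corresponding exterior monomial; hence these products form a basis of `E_R`. -/
theorem exists_tautMonomial_sub_mem (I : Finset (Fin n)) : ∃ s : R₀, s * s = 1 ∧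
    tautMonomial A b w I - (MvPowerSeries.C s : MvPowerSeries (Fin n) R₀) •
      const n (w.ExteriorAlgebra I) ∈ filtR R₀ V n (I.card - 1) := by
  induction I using Finset.induction_on_max with
  | empty =>
    refine ⟨1, one_mul 1, ?_⟩
    rw [tautMonomial_empty, basis_empty, map_one, one_smul, sub_self]
    exact zero_mem _
  | insert i I hi ih =>
    obtain ⟨s, hs, h⟩ := ih
    have hiI : i ∉ I := fun h => lt_irrefl _ (hi i h)
    obtain ⟨s', hs', h'⟩ := basis_mul_of_disjoint w (Finset.disjoint_singleton_right.2 hiI)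
    refine ⟨s * s', by linear_combination (s' * s') * hs + hs', ?_⟩
    have h1 := mulTaut_vec_mem A b h (w i)
    have h2 := mulTaut_const_sub_mem A b (basis_mem_filt w I) (ι_mem_filt (R₀ := R₀) (w i))
    rw [← basis_singleton w i, h', const_smul, basis_singleton] at h2
    rw [tautMonomial_insert A b w hi, Finset.card_insert_of_notMem hiI, Finset.insert_eq,
      Finset.union_comm]
    have h3 := add_mem (filtR_mono (by omega : _ ≤ ((I.card + 1 : ℕ) : ℤ) - 1) h1)
      (Submodule.smul_mem _ (MvPowerSeries.C s)
        (filtR_mono (by omega : _ ≤ ((I.card + 1 : ℕ) : ℤ) - 1) h2))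
    convert h3 using 1
    rw [map_sub, map_smul, LinearMap.sub_apply, LinearMap.smul_apply, smul_sub, smul_smul,
      ← map_mul]
    simp only [vec]
    abel

theorem filtR_le_span_tautMonomial (p : ℕ) : filtR R₀ V n ((p : ℤ) - 1) ≤
    Submodule.span (MvPowerSeries (Fin n) R₀) (Set.range (tautMonomial A b w)) := by
  induction p with
  | zero => exact filtR_le w fun I hI => by omega
  | succ p ih =>
    refine filtR_le w fun I hI => ?_
    obtain ⟨s, hs, h⟩ := exists_tautMonomial_sub_mem A b w I
    have h1 := ih (filtR_mono (by omega) h)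
    have h2 := Submodule.smul_mem _ (MvPowerSeries.C s)
      (sub_mem (Submodule.subset_span (Set.mem_range_self I)) h1)
    rwa [sub_sub_cancel, smul_smul, ← map_mul, hs, map_one, one_smul] at h2

theorem span_tautMonomial :
    ⊤ ≤ Submodule.span (MvPowerSeries (Fin n) R₀) (Set.range (tautMonomial A b w)) := by
  refine le_trans ?_ (filtR_le_span_tautMonomial A b w (n + 1))
  intro a _
  rw [eq_sum_coordE w a]
  refine sum_mem fun I _ => Submodule.smul_mem _ _ (const_mem_seriesIn ?_)
  refine filt_mono ?_ (basis_mem_filt w I)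
  have := card_finset_fin_le I
  omega

/-- The monomials in a basis of `V` form a basis of `A_v`. -/
def tautBasis : Module.Basis (Finset (Fin n)) (MvPowerSeries (Fin n) R₀) (ExtSeries R₀ V n) :=
  Module.Basis.mk (linearIndependent_of_span_eq_top (constBasis w) (span_tautMonomial A b w))
    (span_tautMonomial A b w)

theorem tautBasis_apply (I : Finset (Fin n)) : tautBasis A b w I = tautMonomial A b w I :=
  Module.Basis.mk_apply _ (span_tautMonomial A b w) I

end Filtration

/-! ### The comparison of the Clifford algebra with `A_v` -/

section Comparison

variable {R₀ V : Type*} [CommRing R₀] [AddCommGroup V] [Module R₀ V] {n : ℕ}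
  (A : SuperfilteredDeformation R₀ V) (b : Module.Basis (Fin n) R₀ V)

/-! #### Right multiplication with vectors -/

/-- The homotopy for the associativity of products with `v ∈ V`. -/
def vecHtpy (v : V) : ExtSeries R₀ V n →ₗ[MvPowerSeries (Fin n) R₀] ExtSeries R₀ V n
      →ₗ[MvPowerSeries (Fin n) R₀] ExtSeries R₀ V n :=
  (insert₃ b A.μ ∘ₗ epsR).compr₂ (LinearMap.applyₗ (vec n v))

theorem vecHtpy_apply (v : V) (a c : ExtSeries R₀ V n) :
    vecHtpy A b v a c = insert₃ b A.μ (epsR a) c (vec n v) := rfl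

theorem vecHtpy_one (v : V) (a : ExtSeries R₀ V n) : vecHtpy A b v a (const n 1) = 0 := by
  rw [vecHtpy_apply, insert₃_one]

theorem epsR_vec (v : V) : epsR (vec n v : ExtSeries R₀ V n) = -vec n v := by
  rw [vec, epsR_const, eps_ι, const_neg]

theorem epsR_vecHtpy (v : V) (a c : ExtSeries R₀ V n) :
    epsR (vecHtpy A b v a c) = vecHtpy A b v (epsR a) (epsR c) := by
  rw [vecHtpy_apply, vecHtpy_apply, epsR_insert₃, epsR_vec, map_neg, neg_neg]

theorem vec_eq_sum (v : V) : (vec n v : ExtSeries R₀ V n) =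
    ∑ i, (MvPowerSeries.C (b.repr v i) : MvPowerSeries (Fin n) R₀) • vec n (b i) := by
  have h : vec n v = constHom R₀ V n (ExteriorAlgebra.ι R₀ v) := rfl
  rw [h]
  conv_lhs => rw [← b.sum_repr v]
  rw [map_sum, map_sum]
  refine Finset.sum_congr rfl fun i _ => ?_
  rw [map_smul]
  exact const_smul _ _

theorem one_tmul_eq_sum (v : V) : (1 : MvPowerSeries (Fin n) R₀) ⊗ₜ[R₀] v =
    ∑ i, (MvPowerSeries.C (b.repr v i) : MvPowerSeries (Fin n) R₀) •
      ((1 : MvPowerSeries (Fin n) R₀) ⊗ₜ[R₀] b i) := by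
  conv_lhs => rw [← b.sum_repr v]
  rw [TensorProduct.tmul_sum]
  refine Finset.sum_congr rfl fun i _ => ?_
  rw [TensorProduct.tmul_smul, ← algebraMap_smul (MvPowerSeries (Fin n) R₀) (b.repr v i)]
  rfl

theorem coord_tmul (i j : Fin n) : coord b i ((1 : MvPowerSeries (Fin n) R₀) ⊗ₜ[R₀] b j) =
    if i = j then 1 else 0 := by
  rw [coord, ← Algebra.TensorProduct.basis_apply, Module.Basis.coord_apply, Module.Basis.repr_self,
    Finsupp.single_apply]
  simp only [eq_comm]

variable (P : MvPowerSeries (Fin n) R₀)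

theorem dForm_tmul (i : Fin n) :
    dForm b P (1 ⊗ₜ[R₀] b i) = MvPowerSeries.pderiv R₀ i P := by
  simp [dForm, coord_tmul]

theorem halfHess_tmul (i : Fin n) : halfHess b P (1 ⊗ₜ[R₀] b i) = halfPderivSq i P := by
  simp only [halfHess, add_apply, sum_apply, smul_apply,
    QuadraticMap.linMulLin_apply, coord_tmul]
  rw [Finset.sum_eq_single i, Finset.sum_eq_zero, add_zero]
  · simp
  · intro j _
    refine Finset.sum_eq_zero fun k hk => ?_
    have := (Finset.mem_Ioi.1 hk).ne
    by_cases hj : j = i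
    · subst hj
      simp [this.symm]
    · simp [hj]
  · intro j _ hj
    simp [hj]
  · simp

theorem polar_halfHess_tmul {i j : Fin n} (h : i < j) :
    QuadraticMap.polar (halfHess b P) (1 ⊗ₜ[R₀] b i) (1 ⊗ₜ[R₀] b j) =
      MvPowerSeries.pderiv R₀ i (MvPowerSeries.pderiv R₀ j P) := by
  rw [QuadraticMap.polar, halfHess_tmul, halfHess_tmul]
  simp only [halfHess, add_apply, sum_apply, smul_apply,
    QuadraticMap.linMulLin_apply, coord_tmul, map_add]
  have h1 : ∀ k : Fin n, ((if k = i then (1 : MvPowerSeries (Fin n) R₀) else 0) +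
      if k = j then 1 else 0) * ((if k = i then 1 else 0) + if k = j then 1 else 0) =
      (if k = i then 1 else 0) + if k = j then 1 else 0 := by
    intro k
    by_cases hki : k = i
    · subst hki; simp [h.ne]
    · by_cases hkj : k = j
      · subst hkj; simp [hki]
      · simp [hki, hkj]
  have h2 : ∀ k l : Fin n, l ∈ Finset.Ioi k →
      ((if k = i then (1 : MvPowerSeries (Fin n) R₀) else 0) +
      if k = j then 1 else 0) * ((if l = i then 1 else 0) + if l = j then 1 else 0) =
      if k = i ∧ l = j then 1 else 0 := by
    intro k l hkl
    have hkl := Finset.mem_Ioi.1 hkl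
    by_cases hki : k = i
    · subst hki; simp [h.ne, hkl.ne']
    · by_cases hkj : k = j
      · subst hkj; simp [h.ne', hkl.ne', (h.trans hkl).ne']
      · simp [hki, hkj]
  have h3 : ∑ k, ∑ l ∈ Finset.Ioi k, MvPowerSeries.pderiv R₀ k (MvPowerSeries.pderiv R₀ l P) *
      (if k = i ∧ l = j then 1 else 0) =
        MvPowerSeries.pderiv R₀ i (MvPowerSeries.pderiv R₀ j P) := by
    rw [Finset.sum_eq_single i, Finset.sum_eq_single j]
    · simp
    · intro l _ hl
      simp [hl]
    · simp [h]
    · intro k _ hk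
      simp [hk]
    · simp
  simp only [smul_eq_mul, h1]
  rw [Finset.sum_congr rfl fun k _ => Finset.sum_congr rfl fun l hl => by rw [h2 k l hl], h3]
  simp only [mul_add, Finset.sum_add_distrib, mul_ite, mul_one, mul_zero, Finset.sum_ite_eq',
    Finset.mem_univ, if_true]
  ring

/-- The vector `v ∈ V` in the Clifford algebra. -/
def clVec (v : V) : Cl b P := CliffordAlgebra.ι (-halfHess b P) (1 ⊗ₜ[R₀] v)

theorem clVec_mul_self (i : Fin n) :
    clVec b P (b i) * clVec b P (b i) = -(halfPderivSq i P • 1) := by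
  rw [clVec, CliffordAlgebra.ι_sq_scalar, neg_apply, halfHess_tmul,
    Algebra.algebraMap_eq_smul_one, neg_smul]

theorem clVec_mul_clVec {i j : Fin n} (h : j < i) : clVec b P (b i) * clVec b P (b j) =
    -(MvPowerSeries.pderiv R₀ j (MvPowerSeries.pderiv R₀ i P) • 1) -
      clVec b P (b j) * clVec b P (b i) := by
  rw [clVec, clVec, ι_mul_ι_swap, QuadraticMap.polar_comm, FunLike.coe_neg,
    QuadraticMap.polar_neg, polar_halfHess_tmul b P h, Algebra.algebraMap_eq_smul_one, neg_smul]

theorem clVec_eq_sum (v : V) : clVec b P v =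
    ∑ i, (MvPowerSeries.C (b.repr v i) : MvPowerSeries (Fin n) R₀) • clVec b P (b i) := by
  rw [clVec, one_tmul_eq_sum b, map_sum]
  exact Finset.sum_congr rfl fun i _ => map_smul _ _ _

/-- The grading involution of the Clifford algebra. -/
def clEps : Cl b P →ₗ[MvPowerSeries (Fin n) R₀] Cl b P :=
  (CliffordAlgebra.involute (Q := -halfHess b P)).toLinearMap

theorem clEps_mul_clVec (x : Cl b P) (v : V) :
    clEps b P (x * clVec b P v) = -(clEps b P x * clVec b P v) := by
  simp [clEps, clVec]

theorem clEps_one : clEps b P 1 = 1 := map_one (CliffordAlgebra.involute (Q := -halfHess b P))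

theorem dCl_one : dCl b P 1 = 0 :=
  CliffordAlgebra.contractLeft_one (Q := -halfHess b P) (-dForm b P)

theorem dCl_mul_clVec (x : Cl b P) (v : V) : dCl b P (x * clVec b P v) =
    dCl b P x * clVec b P v - dForm b P (1 ⊗ₜ[R₀] v) • clEps b P x := by
  have h : dCl b P (clVec b P v) = -(dForm b P (1 ⊗ₜ[R₀] v) • 1) := by
    rw [dCl, clVec, CliffordAlgebra.contractLeft_ι, LinearMap.neg_apply, map_neg,
      Algebra.algebraMap_eq_smul_one]
  rw [dCl, contractLeft_mul, ← dCl, h, mul_neg, mul_smul_comm, mul_one, ← sub_eq_add_neg]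
  rfl

theorem dTaut_vec (v : V) : dTaut A b (vec n v) =
    -(dForm b (discPotential A b) (1 ⊗ₜ[R₀] v) • const n 1) := by
  rw [vec_eq_sum b, one_tmul_eq_sum b, map_sum, map_sum, Finset.sum_smul, ← Finset.sum_neg_distrib]
  refine Finset.sum_congr rfl fun i _ => ?_
  rw [map_smul, map_smul, dForm_tmul, vec, dTaut_ι, smul_neg, smul_assoc]

theorem dTaut_mul_vec (a : ExtSeries R₀ V n) (v : V) : dTaut A b (mulTaut A b a (vec n v)) =
    mulTaut A b (dTaut A b a) (vec n v) -
      dForm b (discPotential A b) (1 ⊗ₜ[R₀] v) • epsR a := by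
  rw [dTaut_mulTaut, dTaut_vec, map_neg, map_smul, mulTaut_one, sub_eq_add_neg]

theorem epsR_mul_vec (a : ExtSeries R₀ V n) (v : V) :
    epsR (mulTaut A b a (vec n v)) = -mulTaut A b (epsR a) (vec n v) := by
  rw [epsR_mulTaut, epsR_vec, map_neg]

/-- Right multiplication with a vector is associative up to the homotopy `vecHtpy`: the term of
`mulTaut_assoc` with the differential of the vector, a multiple of the unit, vanishes. -/
theorem mul_mul_vec (v : V) (a c : ExtSeries R₀ V n) :
    mulTaut A b (mulTaut A b a c) (vec n v) = mulTaut A b a (mulTaut A b c (vec n v)) +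
      (dTaut A b (vecHtpy A b v a c) + vecHtpy A b v (dTaut A b a) c +
        vecHtpy A b v (epsR a) (dTaut A b c)) := by
  have h := mulTaut_assoc A b a c (vec n v)
  rw [dTaut_vec, map_neg, map_smul, epsR_const, eps_one, map_neg (insert₃ b A.μ a (epsR c)),
    map_smul (insert₃ b A.μ a (epsR c)), insert₃_one_right, epsR_vec, smul_zero, neg_zero,
    add_zero] at h
  simp only [map_neg] at h
  simp only [vecHtpy_apply, epsR_epsR]
  rw [← sub_eq_iff_eq_add', ← neg_sub, h]
  abel

theorem mul_vec_mul_vec (a : ExtSeries R₀ V n) (v v' : V) :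
    mulTaut A b (mulTaut A b a (vec n v)) (vec n v') =
      mulTaut A b a (mulTaut A b (vec n v) (vec n v')) +
        (dTaut A b (vecHtpy A b v' a (vec n v)) + vecHtpy A b v' (dTaut A b a) (vec n v)) := by
  rw [mul_mul_vec, dTaut_vec, map_neg, map_smul, vecHtpy_one, smul_zero, neg_zero, add_zero]

end Comparison

section Comparison

variable {R₀ V : Type*} [CommRing R₀] [AddCommGroup V] [Module R₀ V] {n : ℕ}
  (A : SuperfilteredDeformation R₀ V) (b : Module.Basis (Fin n) R₀ V)

/-! #### The comparison map and its compatibility with right multiplication -/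

/-- The vectors of a basis of `V` in `R ⊗ V`. -/
def tmulVec (v : Fin n → V) (i : Fin n) : MvPowerSeries (Fin n) R₀ ⊗[R₀] V := 1 ⊗ₜ[R₀] v i

theorem coe_tensorBasis :
    ⇑(Algebra.TensorProduct.basis (MvPowerSeries (Fin n) R₀) b) = tmulVec b :=
  funext fun i => Algebra.TensorProduct.basis_apply b i

/-- The monomials in a basis of `V` form a basis of the Clifford algebra. -/
def clBasis (P : MvPowerSeries (Fin n) R₀) (w : Module.Basis (Fin n) R₀ V) :
    Module.Basis (Finset (Fin n)) (MvPowerSeries (Fin n) R₀) (Cl b P) :=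
  cliffordBasis (-halfHess b P) (Algebra.TensorProduct.basis (MvPowerSeries (Fin n) R₀) w)

theorem clBasis_apply (P : MvPowerSeries (Fin n) R₀) (w : Module.Basis (Fin n) R₀ V)
    (I : Finset (Fin n)) : clBasis b P w I = clMonomial b P w I := by
  rw [clBasis, cliffordBasis_apply, coe_tensorBasis]
  rfl

variable (i j : Fin n)

/-- The subalgebra of the Clifford algebra generated by the basis vectors before `v_i`. -/
abbrev clBelow (P : MvPowerSeries (Fin n) R₀) (i : Fin n) :
    Subalgebra (MvPowerSeries (Fin n) R₀) (Cl b P) :=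
  below (-halfHess b P) (tmulVec b) i

variable {i j}

theorem clVec_mem_clBelow {P : MvPowerSeries (Fin n) R₀} (h : j < i) :
    clVec b P (b j) ∈ clBelow b P i := ι_mem_below (v := tmulVec b) h

theorem clMonomial_insert (P : MvPowerSeries (Fin n) R₀) (v : Fin n → V) {I : Finset (Fin n)}
    (h : ∀ j ∈ I, j < i) : clMonomial b P v (insert i I) = clMonomial b P v I * clVec b P (v i) :=
  cliffordMonomial_insert (-halfHess b P) (tmulVec v) h

theorem clMonomial_empty (P : MvPowerSeries (Fin n) R₀) (v : Fin n → V) :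
    clMonomial b P v ∅ = 1 := cliffordMonomial_empty (-halfHess b P) (tmulVec v)

theorem cl_induction {P : MvPowerSeries (Fin n) R₀} {p : Cl b P → Prop}
    (hadd : ∀ x y, p x → p y → p (x + y))
    (hsmul : ∀ (r : MvPowerSeries (Fin n) R₀) x, p x → p (r • x))
    (h1 : p 1) (h : ∀ i : Fin n, ∀ x ∈ clBelow b P i, p x → p (x * clVec b P (b i))) (x : Cl b P) :
    p x := by
  let S : Submodule (MvPowerSeries (Fin n) R₀) (Cl b P) :=
    { carrier := {x | p x}
      add_mem' := fun {x y} => hadd x y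
      zero_mem' := by simpa using hsmul 0 1 h1
      smul_mem' := hsmul }
  have hs : Submodule.span (MvPowerSeries (Fin n) R₀) (Set.range (tmulVec (R₀ := R₀) b)) = ⊤ := by
    rw [← coe_tensorBasis, Module.Basis.span_eq]
  exact clifford_induction (v := tmulVec b) (S := S) hs h1 h x

/-- Linear conditions on the subalgebra generated by the basis vectors before `v_i` can be checked
on monomials. -/
theorem clBelow_induction {P : MvPowerSeries (Fin n) R₀} {p : Cl b P → Prop}
    (hadd : ∀ x y, p x → p y → p (x + y))
    (hsmul : ∀ (r : MvPowerSeries (Fin n) R₀) x, p x → p (r • x))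
    (h : ∀ I : Finset (Fin n), (∀ j ∈ I, j < i) → p (clMonomial b P b I)) {x : Cl b P}
    (hx : x ∈ clBelow b P i) : p x := by
  let S : Submodule (MvPowerSeries (Fin n) R₀) (Cl b P) :=
    { carrier := {x | p x}
      add_mem' := fun {x y} => hadd x y
      zero_mem' := by simpa using hsmul 0 _ (h ∅ (by simp))
      smul_mem' := hsmul }
  exact mem_of_mem_below (S := S) (fun I hI => h I hI) hx

theorem clEps_mem_clBelow {P : MvPowerSeries (Fin n) R₀} {x : Cl b P} (hx : x ∈ clBelow b P i) :
    clEps b P x ∈ clBelow b P i := by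
  refine below_le (S := (clBelow b P i).toSubmodule.comap (clEps b P)) ?_ ?_ hx
  · change clEps b P 1 ∈ clBelow b P i
    rw [clEps_one]
    exact one_mem _
  · intro j hj x hx
    change clEps b P (x * clVec b P (b j)) ∈ clBelow b P i
    rw [clEps_mul_clVec]
    exact neg_mem (mul_mem hx (clVec_mem_clBelow b hj))

theorem dCl_mem_clBelow {P : MvPowerSeries (Fin n) R₀} {x : Cl b P} (hx : x ∈ clBelow b P i) :
    dCl b P x ∈ clBelow b P i := by
  let S : Submodule (MvPowerSeries (Fin n) R₀) (Cl b P) :=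
    (clBelow b P i).toSubmodule ⊓ (clBelow b P i).toSubmodule.comap (dCl b P)
  have hS : ∀ x, x ∈ S ↔ x ∈ clBelow b P i ∧ dCl b P x ∈ clBelow b P i := fun x => Iff.rfl
  have h1 : (1 : Cl b P) ∈ S := by
    rw [hS, dCl_one]
    exact ⟨one_mem _, zero_mem _⟩
  refine ((hS x).1 (below_le h1 (fun j hj x hx => ?_) hx)).2
  obtain ⟨hx, hx'⟩ := (hS x).1 hx
  refine (hS _).2 ⟨mul_mem hx (clVec_mem_clBelow b hj), ?_⟩
  have h := dCl_mul_clVec b P x (b j)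
  rw [clVec] at h
  rw [tmulVec, h]
  exact sub_mem (mul_mem hx' (clVec_mem_clBelow b hj))
    (Subalgebra.smul_mem _ (clEps_mem_clBelow b hx) _)

/-- The `R`-linear isomorphism from the Clifford algebra to `A_v` which identifies the monomials in
the given basis of `V`. -/
def clToTaut : Cl b (discPotential A b) ≃ₗ[MvPowerSeries (Fin n) R₀] ExtSeries R₀ V n :=
  (clBasis b (discPotential A b) b).equiv (tautBasis A b b) (Equiv.refl _)

theorem clToTaut_clMonomial (I : Finset (Fin n)) :
    clToTaut A b (clMonomial b (discPotential A b) b I) = tautMonomial A b b I := by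
  rw [← clBasis_apply, clToTaut, Module.Basis.equiv_apply, tautBasis_apply]
  rfl

theorem clToTaut_one : clToTaut A b 1 = const n 1 := by
  rw [← clMonomial_empty b (discPotential A b) b, clToTaut_clMonomial, tautMonomial_empty]

theorem clToTaut_mul {x : Cl b (discPotential A b)} (hx : x ∈ clBelow b (discPotential A b) i) :
    clToTaut A b (x * clVec b (discPotential A b) (b i)) =
      mulTaut A b (clToTaut A b x) (vec n (b i)) := by
  refine clBelow_induction b (p := fun x => clToTaut A b (x * clVec b (discPotential A b) (b i)) =
    mulTaut A b (clToTaut A b x) (vec n (b i)))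
    ?_ ?_ ?_ hx
  · intro x y hx hy
    beta_reduce at hx hy ⊢
    rw [add_mul, map_add, map_add, map_add, LinearMap.add_apply, hx, hy]
  · intro r x hx
    beta_reduce at hx ⊢
    rw [smul_mul_assoc, map_smul, map_smul, map_smul, LinearMap.smul_apply, hx]
  · intro I hI
    rw [← clMonomial_insert b _ b hI, clToTaut_clMonomial, clToTaut_clMonomial,
      tautMonomial_insert A b b hI]

theorem clToTaut_clEps (x : Cl b (discPotential A b)) :
    clToTaut A b (clEps b _ x) = epsR (clToTaut A b x) := by
  induction x using cl_induction b with
  | hadd x y hx hy => simp only [map_add, hx, hy]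
  | hsmul r x hx => simp only [map_smul, hx]
  | h1 => rw [clEps_one, clToTaut_one, epsR_const, eps_one]
  | h i x hx ih =>
    rw [clEps_mul_clVec, map_neg, clToTaut_mul A b (clEps_mem_clBelow b hx), clToTaut_mul A b hx,
      epsR_mul_vec, ih]

/-- The comparison map is a chain map. -/
theorem clToTaut_dCl (x : Cl b (discPotential A b)) :
    clToTaut A b (dCl b _ x) = dTaut A b (clToTaut A b x) := by
  induction x using cl_induction b with
  | hadd x y hx hy => simp only [map_add, hx, hy]
  | hsmul r x hx => simp only [map_smul, hx]
  | h1 => rw [dCl_one, clToTaut_one, dTaut_one, map_zero]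
  | h i x hx ih =>
    rw [dCl_mul_clVec, map_sub, map_smul, clToTaut_mul A b (dCl_mem_clBelow b hx),
      clToTaut_mul A b hx, dTaut_mul_vec, ih, clToTaut_clEps]

/-- The recursion for the homotopy `mulHtpy` on words, read from right to left, in the basis. -/
def mulHtpyWord (j : Fin n) : List (Fin n) → ExtSeries R₀ V n
  | [] => 0
  | i :: l =>
    let g := l.foldr (fun k x => mulTaut A b x (vec n (b k))) (const n 1)
    if i < j then 0 else if i = j then -vecHtpy A b (b i) g (vec n (b i))
    else -mulTaut A b (mulHtpyWord j l) (vec n (b i)) - vecHtpy A b (b j) g (vec n (b i)) -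
      vecHtpy A b (b i) g (vec n (b j))

/-- The homotopy for the compatibility of the comparison map with right multiplication by `v_j`. -/
def mulHtpy (j : Fin n) :
    Cl b (discPotential A b) →ₗ[MvPowerSeries (Fin n) R₀] ExtSeries R₀ V n :=
  (clBasis b (discPotential A b) b).constr (MvPowerSeries (Fin n) R₀) fun I =>
    mulHtpyWord A b j (I.sort (· ≤ ·)).reverse

theorem mulHtpy_clMonomial (I : Finset (Fin n)) :
    mulHtpy A b j (clMonomial b (discPotential A b) b I) =
      mulHtpyWord A b j (I.sort (· ≤ ·)).reverse := by
  rw [← clBasis_apply, mulHtpy, Module.Basis.constr_basis]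

theorem tautMonomial_eq_foldr (v : Fin n → V) (I : Finset (Fin n)) : tautMonomial A b v I =
    (I.sort (· ≤ ·)).reverse.foldr (fun k x => mulTaut A b x (vec n (v k))) (const n 1) := by
  rw [tautMonomial, List.foldl_map, List.foldr_reverse]
  rfl

theorem mulHtpy_clMonomial_insert {I : Finset (Fin n)} (h : ∀ j ∈ I, j < i) :
    mulHtpy A b j (clMonomial b (discPotential A b) b (insert i I)) =
      if i < j then 0 else if i = j then -vecHtpy A b (b i) (tautMonomial A b b I) (vec n (b i))
      else -mulTaut A b (mulHtpy A b j (clMonomial b (discPotential A b) b I)) (vec n (b i)) -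
        vecHtpy A b (b j) (tautMonomial A b b I) (vec n (b i)) -
        vecHtpy A b (b i) (tautMonomial A b b I) (vec n (b j)) := by
  rw [mulHtpy_clMonomial, mulHtpy_clMonomial, tautMonomial_eq_foldr, sort_insert_of_lt h,
    List.reverse_append, List.reverse_singleton, List.singleton_append, mulHtpyWord]

theorem mulHtpy_of_mem {x : Cl b (discPotential A b)}
    (hx : x ∈ clBelow b (discPotential A b) j) : mulHtpy A b j x = 0 := by
  refine clBelow_induction b (p := fun x => mulHtpy A b j x = 0) ?_ ?_ ?_ hx
  · intro x y hx hy
    beta_reduce at hx hy ⊢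
    rw [map_add, hx, hy, add_zero]
  · intro r x hx
    beta_reduce at hx ⊢
    rw [map_smul, hx, smul_zero]
  · intro I hI
    induction I using Finset.induction_on_max with
    | empty => rw [mulHtpy_clMonomial]; simp [mulHtpyWord]
    | insert i I h _ =>
      rw [mulHtpy_clMonomial_insert A b h, if_pos (hI i (Finset.mem_insert_self i I))]

theorem mulHtpy_mul_self {x : Cl b (discPotential A b)}
    (hx : x ∈ clBelow b (discPotential A b) i) :
    mulHtpy A b i (x * clVec b _ (b i)) =
      -vecHtpy A b (b i) (clToTaut A b x) (vec n (b i)) := by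
  refine clBelow_induction b (p := fun x => mulHtpy A b i (x * clVec b _ (b i)) =
    -vecHtpy A b (b i) (clToTaut A b x) (vec n (b i)))
    ?_ ?_ ?_ hx
  · intro x y hx hy
    beta_reduce at hx hy ⊢
    rw [add_mul, map_add, map_add, map_add, LinearMap.add_apply, hx, hy, neg_add]
  · intro r x hx
    beta_reduce at hx ⊢
    rw [smul_mul_assoc, map_smul, map_smul, map_smul, LinearMap.smul_apply, hx, smul_neg]
  · intro I hI
    rw [← clMonomial_insert b _ b hI, mulHtpy_clMonomial_insert A b hI, clToTaut_clMonomial,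
      if_neg (lt_irrefl i), if_pos rfl]

theorem mulHtpy_mul (h : j < i) {x : Cl b (discPotential A b)}
    (hx : x ∈ clBelow b (discPotential A b) i) :
    mulHtpy A b j (x * clVec b _ (b i)) = -mulTaut A b (mulHtpy A b j x) (vec n (b i)) -
      vecHtpy A b (b j) (clToTaut A b x) (vec n (b i)) -
      vecHtpy A b (b i) (clToTaut A b x) (vec n (b j)) := by
  refine clBelow_induction b (p := fun x => mulHtpy A b j (x * clVec b _ (b i)) =
    -mulTaut A b (mulHtpy A b j x) (vec n (b i)) -
      vecHtpy A b (b j) (clToTaut A b x) (vec n (b i)) -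
      vecHtpy A b (b i) (clToTaut A b x) (vec n (b j)))
    ?_ ?_ ?_ hx
  · intro x y hx hy
    beta_reduce at hx hy ⊢
    rw [add_mul, map_add, hx, hy]
    simp only [map_add, LinearMap.add_apply]
    abel
  · intro r x hx
    beta_reduce at hx ⊢
    rw [smul_mul_assoc, map_smul, hx]
    simp only [map_smul, LinearMap.smul_apply, smul_sub, smul_neg]
  · intro I hI
    rw [← clMonomial_insert b _ b hI, mulHtpy_clMonomial_insert A b hI, clToTaut_clMonomial,
      if_neg h.not_gt, if_neg h.ne']

theorem clBelow_mono {P : MvPowerSeries (Fin n) R₀} (h : i ≤ j) : clBelow b P i ≤ clBelow b P j :=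
  below_mono h

theorem mul_clVec_mem_clBelow {P : MvPowerSeries (Fin n) R₀} (h : i < j) {x : Cl b P}
    (hx : x ∈ clBelow b P i) : x * clVec b P (b i) ∈ clBelow b P j :=
  mul_mem (clBelow_mono b h.le hx) (clVec_mem_clBelow b h)

theorem epsR_mulHtpy (x : Cl b (discPotential A b)) :
    epsR (mulHtpy A b j x) = mulHtpy A b j (clEps b _ x) := by
  induction x using cl_induction b with
  | hadd x y hx hy => simp only [map_add, hx, hy]
  | hsmul r x hx => simp only [map_smul, hx]
  | h1 => rw [clEps_one, mulHtpy_of_mem A b (one_mem _), map_zero]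
  | h i x hx ih =>
    have hx' := clEps_mem_clBelow b hx
    rw [clEps_mul_clVec, map_neg]
    rcases lt_trichotomy i j with h | rfl | h
    · rw [mulHtpy_of_mem A b (mul_clVec_mem_clBelow b h hx),
        mulHtpy_of_mem A b (mul_clVec_mem_clBelow b h hx'), map_zero, neg_zero]
    · rw [mulHtpy_mul_self A b hx, mulHtpy_mul_self A b hx', map_neg, epsR_vecHtpy, epsR_vec,
        clToTaut_clEps, map_neg]
    · rw [mulHtpy_mul A b h hx, mulHtpy_mul A b h hx', map_sub, map_sub, map_neg, epsR_mul_vec,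
        epsR_vecHtpy, epsR_vecHtpy, epsR_vec, epsR_vec, clToTaut_clEps, ih, map_neg, map_neg]
      abel

/-- The comparison map is compatible with right multiplication by basis vectors up to homotopy. -/
theorem clToTaut_mul_clVec_basis (x : Cl b (discPotential A b)) :
    clToTaut A b (x * clVec b _ (b j)) = mulTaut A b (clToTaut A b x) (vec n (b j)) +
      (dTaut A b (mulHtpy A b j x) + mulHtpy A b j (dCl b _ x)) := by
  induction x using cl_induction b with
  | hadd x y hx hy =>
    rw [add_mul, map_add, hx, hy]
    simp only [map_add, LinearMap.add_apply]
    abel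
  | hsmul r x hx =>
    rw [smul_mul_assoc, map_smul, hx]
    simp only [map_smul, LinearMap.smul_apply, smul_add]
  | h1 =>
    rw [clToTaut_mul A b (one_mem _), mulHtpy_of_mem A b (one_mem _), dCl_one, map_zero, map_zero,
      add_zero, add_zero]
  | h i x hx ih =>
    have hd := dCl_mem_clBelow b hx
    have he := clEps_mem_clBelow b hx
    rcases lt_trichotomy i j with h | rfl | h
    · have hxi := mul_clVec_mem_clBelow b h hx
      rw [clToTaut_mul A b hxi, mulHtpy_of_mem A b hxi, mulHtpy_of_mem A b (dCl_mem_clBelow b hxi),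
        map_zero, add_zero, add_zero]
    · rw [mul_assoc, clVec_mul_self, mul_neg, mul_smul_comm, mul_one, map_neg, map_smul,
        clToTaut_mul A b hx, mul_vec_mul_vec, vec, mulTaut_ι_self, ← vec, map_neg, map_smul,
        mulTaut_one, dCl_mul_clVec, map_sub, map_smul, mulHtpy_of_mem A b he,
        mulHtpy_mul_self A b hx, mulHtpy_mul_self A b hd, clToTaut_dCl, map_neg, smul_zero,
        sub_zero]
      abel
    · have h1 := mulTaut_ι_add_swap A b j i
      rw [← vec, ← vec] at h1
      have h2 := mul_vec_mul_vec A b (clToTaut A b x) (b i) (b j)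
      have h3 := mul_vec_mul_vec A b (clToTaut A b x) (b j) (b i)
      have h4 : mulTaut A b (clToTaut A b x) (mulTaut A b (vec n (b j)) (vec n (b i))) =
          -(MvPowerSeries.pderiv R₀ j (MvPowerSeries.pderiv R₀ i (discPotential A b)) •
            clToTaut A b x) -
          mulTaut A b (clToTaut A b x) (mulTaut A b (vec n (b i)) (vec n (b j))) := by
        rw [eq_sub_of_add_eq h1, map_sub, map_neg, map_smul, mulTaut_one]
      have hxj : x * clVec b _ (b j) ∈ clBelow b (discPotential A b) i :=
        mul_mem hx (clVec_mem_clBelow b h)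
      rw [mul_assoc, clVec_mul_clVec b _ h, mul_sub, mul_neg, mul_smul_comm, mul_one, ← mul_assoc,
        map_sub, map_neg, map_smul, clToTaut_mul A b hxj, ih, clToTaut_mul A b hx, h2,
        mulHtpy_mul A b h hx, dCl_mul_clVec, map_sub (mulHtpy A b j), map_smul (mulHtpy A b j),
        mulHtpy_mul A b h hd, ← epsR_mulHtpy, map_sub (dTaut A b), map_sub (dTaut A b),
        map_neg (dTaut A b), dTaut_mul_vec, clToTaut_dCl, map_add (mulTaut A b),
        map_add (mulTaut A b), LinearMap.add_apply, LinearMap.add_apply, h3, h4]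
      abel

/-- The homotopy for the compatibility of the comparison map with right multiplication by `v`. -/
def vecMulHtpy (v : V) :
    Cl b (discPotential A b) →ₗ[MvPowerSeries (Fin n) R₀] ExtSeries R₀ V n :=
  ∑ j, (MvPowerSeries.C (b.repr v j) : MvPowerSeries (Fin n) R₀) • mulHtpy A b j

theorem epsR_vecMulHtpy (v : V) (x : Cl b (discPotential A b)) :
    epsR (vecMulHtpy A b v x) = vecMulHtpy A b v (clEps b _ x) := by
  simp only [vecMulHtpy, LinearMap.sum_apply, LinearMap.smul_apply, map_sum, map_smul, epsR_mulHtpy]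

theorem clToTaut_mul_clVec (v : V) (x : Cl b (discPotential A b)) :
    clToTaut A b (x * clVec b _ v) = mulTaut A b (clToTaut A b x) (vec n v) +
      (dTaut A b (vecMulHtpy A b v x) + vecMulHtpy A b v (dCl b _ x)) := by
  rw [clVec_eq_sum b _ v, vec_eq_sum b v]
  simp only [vecMulHtpy, LinearMap.sum_apply, LinearMap.smul_apply, map_sum, map_smul,
    Finset.mul_sum, mul_smul_comm, clToTaut_mul_clVec_basis, smul_add, Finset.sum_add_distrib]

end Comparison

section Words

variable {R₀ V : Type*} [CommRing R₀] [AddCommGroup V] [Module R₀ V] {n : ℕ}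
  (A : SuperfilteredDeformation R₀ V) (b : Module.Basis (Fin n) R₀ V)

/-! #### Linear combinations of words in `V` -/

variable (R₀ V n) in
/-- The `R`-linear combinations of words in `V`. A word `v_r, …, v_1` stands for the product
`((v_1 · v_2) ⋯) · v_r` of its letters from right to left. -/
abbrev WordModule : Type _ := List V →₀ MvPowerSeries (Fin n) R₀

/-- The left-bracketed product of a word in `A_v`, its last letter being the first factor. -/
def wordTaut (l : List V) : ExtSeries R₀ V n :=
  l.foldr (fun v x => mulTaut A b x (vec n v)) (const n 1)

/-- The product of a word in the Clifford algebra, its last letter being the first factor. -/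
def wordCl (P : MvPowerSeries (Fin n) R₀) (l : List V) : Cl b P :=
  l.foldr (fun v x => x * clVec b P v) 1

/-- Multiplication of words with a letter. -/
def consW (v : V) : WordModule R₀ V n →ₗ[MvPowerSeries (Fin n) R₀] WordModule R₀ V n :=
  Finsupp.lmapDomain _ _ (v :: ·)

theorem consW_single {V : Type*} (v : V) (l : List V) (r : MvPowerSeries (Fin n) R₀) :
    consW v (Finsupp.single l r) = Finsupp.single (v :: l) r := Finsupp.mapDomain_single

/-- The contraction of a word with `-dP`. -/
def dWord (P : MvPowerSeries (Fin n) R₀) : List V → WordModule R₀ V n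
  | [] => 0
  | v :: l => consW v (dWord P l) -
      dForm b P (1 ⊗ₜ[R₀] v) • Finsupp.single l ((-1) ^ l.length)

/-- The linear extension of a function on words. -/
abbrev linW {M : Type*} [AddCommGroup M] [Module (MvPowerSeries (Fin n) R₀) M] (F : List V → M) :
    WordModule R₀ V n →ₗ[MvPowerSeries (Fin n) R₀] M :=
  Finsupp.linearCombination (MvPowerSeries (Fin n) R₀) F

theorem linW_single {V M : Type*} [AddCommGroup M] [Module (MvPowerSeries (Fin n) R₀) M]
    (F : List V → M) (l : List V) (r : MvPowerSeries (Fin n) R₀) :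
    linW F (Finsupp.single l r) = r • F l := Finsupp.linearCombination_single _ _ _

/-- Linear conditions on linear combinations of words can be checked on words. -/
theorem wordModule_induction {V : Type*} {p : WordModule R₀ V n → Prop} (h0 : p 0)
    (hadd : ∀ s t, p s → p t → p (s + t))
    (hsmul : ∀ (r : MvPowerSeries (Fin n) R₀) t, p t → p (r • t))
    (h : ∀ l, p (Finsupp.single l 1)) (t : WordModule R₀ V n) : p t := by
  induction t using Finsupp.induction_linear with
  | zero => exact h0
  | add s t hs ht => exact hadd s t hs ht
  | single l r => simpa using hsmul r _ (h l)

theorem linW_wordTaut_consW (v : V) (t : WordModule R₀ V n) :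
    linW (wordTaut A b) (consW v t) = mulTaut A b (linW (wordTaut A b) t) (vec n v) := by
  induction t using wordModule_induction with
  | h0 => simp only [map_zero, LinearMap.zero_apply]
  | hadd s t hs ht => simp only [map_add, LinearMap.add_apply, hs, ht]
  | hsmul r t ht => simp only [map_smul, LinearMap.smul_apply, ht]
  | h l => rw [consW_single, linW_single, linW_single, one_smul, one_smul]; rfl

theorem linW_wordCl_consW (P : MvPowerSeries (Fin n) R₀) (v : V) (t : WordModule R₀ V n) :
    linW (wordCl b P) (consW v t) = linW (wordCl b P) t * clVec b P v := by
  induction t using wordModule_induction with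
  | h0 => simp only [map_zero, zero_mul]
  | hadd s t hs ht => simp only [map_add, add_mul, hs, ht]
  | hsmul r t ht => simp only [map_smul, smul_mul_assoc, ht]
  | h l => rw [consW_single, linW_single, linW_single, one_smul, one_smul]; rfl

theorem epsR_wordTaut (l : List V) : epsR (wordTaut A b l) =
    ((-1 : MvPowerSeries (Fin n) R₀) ^ l.length) • wordTaut A b l := by
  induction l with
  | nil => simp [wordTaut, epsR_const, eps_one]
  | cons v l ih =>
    change epsR (mulTaut A b (wordTaut A b l) (vec n v)) =
      _ • mulTaut A b (wordTaut A b l) (vec n v)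
    rw [epsR_mul_vec, ih, map_smul, LinearMap.smul_apply, List.length_cons, pow_succ, mul_neg_one,
      neg_smul]

theorem clEps_wordCl (P : MvPowerSeries (Fin n) R₀) (l : List V) : clEps b P (wordCl b P l) =
    ((-1 : MvPowerSeries (Fin n) R₀) ^ l.length) • wordCl b P l := by
  induction l with
  | nil => simp [wordCl, clEps_one]
  | cons v l ih =>
    change clEps b P (wordCl b P l * clVec b P v) = _ • (wordCl b P l * clVec b P v)
    rw [clEps_mul_clVec, ih, smul_mul_assoc, List.length_cons, pow_succ, mul_neg_one, neg_smul]

theorem dTaut_wordTaut (l : List V) :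
    dTaut A b (wordTaut A b l) = linW (wordTaut A b) (dWord b (discPotential A b) l) := by
  induction l with
  | nil =>
    rw [dWord, map_zero]
    exact dTaut_one A b
  | cons v l ih =>
    change dTaut A b (mulTaut A b (wordTaut A b l) (vec n v)) = _
    rw [dWord, map_sub, map_smul, linW_single, ← epsR_wordTaut, linW_wordTaut_consW, ← ih,
      dTaut_mul_vec]

theorem dCl_wordCl (P : MvPowerSeries (Fin n) R₀) (l : List V) :
    dCl b P (wordCl b P l) = linW (wordCl b P) (dWord b P l) := by
  induction l with
  | nil =>
    rw [dWord, map_zero]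
    exact dCl_one b P
  | cons v l ih =>
    change dCl b P (wordCl b P l * clVec b P v) = _
    rw [dWord, map_sub, map_smul, linW_single, ← clEps_wordCl, linW_wordCl_consW, ← ih,
      dCl_mul_clVec]

theorem dTaut_linW (t : WordModule R₀ V n) : dTaut A b (linW (wordTaut A b) t) =
    linW (wordTaut A b) (linW (dWord b (discPotential A b)) t) := by
  induction t using wordModule_induction with
  | h0 => simp only [map_zero]
  | hadd s t hs ht => simp only [map_add, hs, ht]
  | hsmul r t ht => simp only [map_smul, ht]
  | h l => simp only [linW_single, one_smul, dTaut_wordTaut]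

theorem dCl_linW (P : MvPowerSeries (Fin n) R₀) (t : WordModule R₀ V n) :
    dCl b P (linW (wordCl b P) t) = linW (wordCl b P) (linW (dWord b P) t) := by
  induction t using wordModule_induction with
  | h0 => simp only [map_zero]
  | hadd s t hs ht => simp only [map_add, hs, ht]
  | hsmul r t ht => simp only [map_smul, ht]
  | h l => simp only [linW_single, one_smul, dCl_wordCl]

/-- The homotopy between `(x, l) ↦ f(x l)` and `(x, l) ↦ f(x) · l`, for the comparison map `f`,
elements `x` of the Clifford algebra and words `l`. -/
def wordHtpy : List V → Cl b (discPotential A b) →ₗ[MvPowerSeries (Fin n) R₀] ExtSeries R₀ V n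
  | [] => 0
  | v :: l => (mulTaut A b).flip (vec n v) ∘ₗ wordHtpy l +
      vecMulHtpy A b v ∘ₗ LinearMap.mulRight _ (wordCl b (discPotential A b) l) +
      (vecHtpy A b v).flip (wordTaut A b l) ∘ₗ (clToTaut A b).toLinearMap

theorem wordHtpy_cons (v : V) (l : List V) (x : Cl b (discPotential A b)) :
    wordHtpy A b (v :: l) x = mulTaut A b (wordHtpy A b l x) (vec n v) +
      vecMulHtpy A b v (x * wordCl b (discPotential A b) l) +
      vecHtpy A b v (clToTaut A b x) (wordTaut A b l) := by
  simp only [wordHtpy, LinearMap.add_apply, LinearMap.comp_apply, LinearMap.flip_apply,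
    LinearMap.mulRight_apply, LinearEquiv.coe_coe]

theorem linW_wordHtpy_consW (v : V) (t : WordModule R₀ V n) (x : Cl b (discPotential A b)) :
    linW (wordHtpy A b) (consW v t) x = mulTaut A b (linW (wordHtpy A b) t x) (vec n v) +
      vecMulHtpy A b v (x * linW (wordCl b (discPotential A b)) t) +
      vecHtpy A b v (clToTaut A b x) (linW (wordTaut A b) t) := by
  induction t using wordModule_induction with
  | h0 => simp only [map_zero, LinearMap.zero_apply, mul_zero, add_zero]
  | hadd s t hs ht =>
    simp only [map_add, LinearMap.add_apply, hs, ht, mul_add]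
    abel
  | hsmul r t ht => simp only [map_smul, LinearMap.smul_apply, ht, mul_smul_comm, smul_add]
  | h l => simp only [consW_single, linW_single, one_smul, wordHtpy_cons]

theorem clEps_mul (P : MvPowerSeries (Fin n) R₀) (x y : Cl b P) :
    clEps b P (x * y) = clEps b P x * clEps b P y :=
  map_mul (CliffordAlgebra.involute (Q := -halfHess b P)) x y

theorem epsR_wordHtpy (l : List V) (x : Cl b (discPotential A b)) :
    epsR (wordHtpy A b l x) =
      -(((-1 : MvPowerSeries (Fin n) R₀) ^ l.length) • wordHtpy A b l (clEps b _ x)) := by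
  induction l generalizing x with
  | nil => simp [wordHtpy]
  | cons v l ih =>
    rw [wordHtpy_cons, wordHtpy_cons, map_add, map_add, epsR_mul_vec, ih, epsR_vecMulHtpy,
      epsR_vecHtpy, clEps_mul, clEps_wordCl, epsR_wordTaut, clToTaut_clEps, mul_smul_comm,
      map_smul, map_smul, map_neg, map_smul, LinearMap.neg_apply, LinearMap.smul_apply,
      List.length_cons, pow_succ, mul_neg_one, neg_smul, smul_add, smul_add]
    abel

theorem dCl_mul (P : MvPowerSeries (Fin n) R₀) (x y : Cl b P) :
    dCl b P (x * y) = dCl b P x * y + clEps b P x * dCl b P y := contractLeft_mul _ x y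

/-- The comparison map is compatible with right multiplication by words up to homotopy. -/
theorem clToTaut_mul_wordCl (l : List V) (x : Cl b (discPotential A b)) :
    clToTaut A b (x * wordCl b _ l) = mulTaut A b (clToTaut A b x) (wordTaut A b l) +
      (dTaut A b (wordHtpy A b l x) + wordHtpy A b l (dCl b _ x) +
        linW (wordHtpy A b) (dWord b (discPotential A b) l) (clEps b _ x)) := by
  induction l generalizing x with
  | nil =>
    have h1 : wordCl b (discPotential A b) ([] : List V) = 1 := rfl
    have h2 : wordTaut A b ([] : List V) = const n 1 := rfl
    have h3 : wordHtpy A b ([] : List V) = 0 := rfl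
    rw [h1, h2, h3, dWord, mul_one, mulTaut_one]
    simp only [map_zero, LinearMap.zero_apply, add_zero]
  | cons v l ih =>
    have h1 : wordCl b (discPotential A b) (v :: l) = wordCl b _ l * clVec b _ v := rfl
    have h2 : wordTaut A b (v :: l) = mulTaut A b (wordTaut A b l) (vec n v) := rfl
    have h3 := mul_mul_vec A b v (clToTaut A b x) (wordTaut A b l)
    have h4 : epsR (wordHtpy A b l x) = -(linW (wordHtpy A b)
        (Finsupp.single l ((-1 : MvPowerSeries (Fin n) R₀) ^ l.length)) (clEps b _ x)) := by
      rw [epsR_wordHtpy, linW_single, LinearMap.smul_apply]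
    rw [h1, h2, ← mul_assoc, clToTaut_mul_clVec, ih, wordHtpy_cons, wordHtpy_cons, dWord,
      map_sub, map_smul, LinearMap.sub_apply, LinearMap.smul_apply, linW_wordHtpy_consW,
      ← dCl_wordCl, ← dTaut_wordTaut, map_add (dTaut A b), map_add (dTaut A b), dTaut_mul_vec, h4,
      dCl_mul, map_add (vecMulHtpy A b v), clToTaut_dCl, clToTaut_clEps, smul_neg]
    simp only [map_add, LinearMap.add_apply]
    rw [h3]
    abel

theorem clToTaut_mul_linW (t : WordModule R₀ V n) (x : Cl b (discPotential A b)) :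
    clToTaut A b (x * linW (wordCl b _) t) = mulTaut A b (clToTaut A b x) (linW (wordTaut A b) t) +
      (dTaut A b (linW (wordHtpy A b) t x) + linW (wordHtpy A b) t (dCl b _ x) +
        linW (wordHtpy A b) (linW (dWord b (discPotential A b)) t) (clEps b _ x)) := by
  induction t using wordModule_induction with
  | h0 => simp only [map_zero, LinearMap.zero_apply, mul_zero, add_zero]
  | hadd s t hs ht =>
    simp only [map_add, LinearMap.add_apply, hs, ht, mul_add]
    abel
  | hsmul r t ht => simp only [map_smul, LinearMap.smul_apply, ht, mul_smul_comm, smul_add]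
  | h l => simp only [linW_single, one_smul, clToTaut_mul_wordCl]

/-- On cocycles, right multiplication by closed linear combinations of words is preserved up to
coboundaries. -/
theorem clToTaut_mul_linW_sub_mem {t : WordModule R₀ V n}
    (ht : linW (dWord b (discPotential A b)) t = 0) {x : Cl b (discPotential A b)}
    (hx : dCl b _ x = 0) :
    clToTaut A b (x * linW (wordCl b _) t) - mulTaut A b (clToTaut A b x) (linW (wordTaut A b) t) ∈
      coboundaries ⊤ (dTaut A b) := by
  rw [clToTaut_mul_linW, hx, ht, add_sub_cancel_left]
  simp only [map_zero, LinearMap.zero_apply, add_zero]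
  exact mem_coboundaries_top.2 ⟨_, rfl⟩

/-! #### Increasing words in a basis -/

/-- The word of the monomial `v_{i_1} ⋯ v_{i_r}`, for `I = {i_1 < ⋯ < i_r}`. -/
def monoWord (v : Fin n → V) (I : Finset (Fin n)) : List V := ((I.sort (· ≤ ·)).reverse).map v

theorem wordTaut_monoWord (v : Fin n → V) (I : Finset (Fin n)) :
    wordTaut A b (monoWord v I) = tautMonomial A b v I := by
  rw [tautMonomial_eq_foldr, wordTaut, monoWord, List.foldr_map]

theorem wordCl_monoWord (P : MvPowerSeries (Fin n) R₀) (v : Fin n → V) (I : Finset (Fin n)) :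
    wordCl b P (monoWord v I) = clMonomial b P v I := by
  induction I using Finset.induction_on_max with
  | empty => rw [clMonomial_empty]; simp [monoWord, wordCl]
  | insert i I hi ih =>
    rw [clMonomial_insert b P v hi, ← ih, monoWord, sort_insert_of_lt hi, List.reverse_append,
      List.reverse_singleton, List.singleton_append, List.map_cons]
    rfl

/-- The linear combination of increasing words with given coefficients. -/
def combW (v : Fin n → V) :
    (Finset (Fin n) → MvPowerSeries (Fin n) R₀) →ₗ[MvPowerSeries (Fin n) R₀] WordModule R₀ V n :=
  Fintype.linearCombination _ fun I => Finsupp.single (monoWord v I) 1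

theorem combW_apply {V : Type*} (v : Fin n → V) (c : Finset (Fin n) → MvPowerSeries (Fin n) R₀) :
    combW v c = ∑ I, c I • Finsupp.single (monoWord v I) 1 := Fintype.linearCombination_apply _ _ _

theorem linW_wordTaut_combW (v : Fin n → V) (c : Finset (Fin n) → MvPowerSeries (Fin n) R₀) :
    linW (wordTaut A b) (combW v c) = ∑ I, c I • tautMonomial A b v I := by
  simp only [combW_apply, map_sum, map_smul, linW_single, one_smul, wordTaut_monoWord]

theorem linW_wordCl_combW (P : MvPowerSeries (Fin n) R₀) (v : Fin n → V)
    (c : Finset (Fin n) → MvPowerSeries (Fin n) R₀) :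
    linW (wordCl b P) (combW v c) = ∑ I, c I • clMonomial b P v I := by
  simp only [combW_apply, map_sum, map_smul, linW_single, one_smul, wordCl_monoWord]

theorem dWord_monoWord_mem (P : MvPowerSeries (Fin n) R₀) (v : Fin n → V) (I : Finset (Fin n)) :
    dWord b P (monoWord v I) ∈ Submodule.span (MvPowerSeries (Fin n) R₀)
      {x | ∃ J ⊆ I, x = Finsupp.single (monoWord v J) 1} := by
  induction I using Finset.induction_on_max with
  | empty => simp [monoWord, dWord]
  | insert i I hi ih =>
    have hcons : ∀ J ⊆ I, monoWord v (insert i J) = v i :: monoWord v J := fun J hJ => by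
      rw [monoWord, sort_insert_of_lt fun j hj => hi j (hJ hj), List.reverse_append,
        List.reverse_singleton, List.singleton_append, List.map_cons, monoWord]
    rw [hcons I subset_rfl, dWord]
    refine sub_mem ?_ (Submodule.smul_mem _ _ ?_)
    · have h := Submodule.mem_map_of_mem (f := consW (v i)) ih
      rw [Submodule.map_span] at h
      refine Submodule.span_mono ?_ h
      rintro _ ⟨_, ⟨J, hJ, rfl⟩, rfl⟩
      exact ⟨insert i J, Finset.insert_subset_insert i hJ, by rw [consW_single, hcons J hJ]⟩
    · have h : (Finsupp.single (monoWord v I) ((-1) ^ (monoWord v I).length) : WordModule R₀ V n) =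
          ((-1 : MvPowerSeries (Fin n) R₀) ^ (monoWord v I).length) •
            Finsupp.single (monoWord v I) 1 := by simp
      rw [h]
      exact Submodule.smul_mem _ _ (Submodule.subset_span ⟨I, Finset.subset_insert i I, rfl⟩)

theorem exists_combW (P : MvPowerSeries (Fin n) R₀) (v : Fin n → V)
    (c : Finset (Fin n) → MvPowerSeries (Fin n) R₀) :
    ∃ c', linW (dWord b P) (combW v c) = combW v c' := by
  have h : linW (dWord b P) (combW v c) ∈ LinearMap.range (combW (R₀ := R₀) v) := by
    rw [combW_apply, map_sum]
    refine sum_mem fun I _ => ?_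
    rw [map_smul, linW_single, one_smul]
    refine Submodule.smul_mem _ _ (Submodule.span_le.2 ?_ (dWord_monoWord_mem b P v I))
    rintro _ ⟨J, _, rfl⟩
    exact ⟨Pi.single J 1, by rw [combW, Fintype.linearCombination_apply_single, one_smul]⟩
  obtain ⟨c', hc'⟩ := h
  exact ⟨c', hc'.symm⟩

variable (w : Module.Basis (Fin n) R₀ V)

theorem eq_zero_of_sum_clMonomial (P : MvPowerSeries (Fin n) R₀)
    {c : Finset (Fin n) → MvPowerSeries (Fin n) R₀} (h : ∑ I, c I • clMonomial b P w I = 0) :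
    c = 0 := by
  have h1 := (clBasis b P w).linearIndependent
  rw [Fintype.linearIndependent_iff] at h1
  exact funext (h1 c (by simpa only [clBasis_apply] using h))

theorem eq_zero_of_sum_tautMonomial {c : Finset (Fin n) → MvPowerSeries (Fin n) R₀}
    (h : ∑ I, c I • tautMonomial A b w I = 0) : c = 0 := by
  have h1 := (tautBasis A b w).linearIndependent
  rw [Fintype.linearIndependent_iff] at h1
  exact funext (h1 c (by simpa only [tautBasis_apply] using h))

/-- A linear combination of increasing words in a basis is closed if its product in `A_v` is. -/
theorem dWord_combW_of_taut {c : Finset (Fin n) → MvPowerSeries (Fin n) R₀}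
    (h : dTaut A b (linW (wordTaut A b) (combW w c)) = 0) :
    linW (dWord b (discPotential A b)) (combW w c) = 0 := by
  obtain ⟨c', hc'⟩ := exists_combW b (discPotential A b) w c
  rw [dTaut_linW, hc', linW_wordTaut_combW] at h
  rw [hc', eq_zero_of_sum_tautMonomial A b w h, map_zero]

/-- A linear combination of increasing words in a basis is closed if its product in the Clifford
algebra is. -/
theorem dWord_combW_of_cl {P : MvPowerSeries (Fin n) R₀}
    {c : Finset (Fin n) → MvPowerSeries (Fin n) R₀}
    (h : dCl b P (linW (wordCl b P) (combW w c)) = 0) :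
    linW (dWord b P) (combW w c) = 0 := by
  obtain ⟨c', hc'⟩ := exists_combW b P w c
  rw [dCl_linW, hc', linW_wordCl_combW] at h
  rw [hc', eq_zero_of_sum_clMonomial b w P h, map_zero]

end Words

/-! ### The isomorphisms in cohomology -/

section Final

variable {R₀ V : Type*} [CommRing R₀] [AddCommGroup V] [Module R₀ V] {n : ℕ}
  (A : SuperfilteredDeformation R₀ V) (b : Module.Basis (Fin n) R₀ V)

theorem clToTaut_sum_clMonomial (c : Finset (Fin n) → MvPowerSeries (Fin n) R₀) :
    clToTaut A b (∑ I, c I • clMonomial b (discPotential A b) b I) =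
      ∑ I, c I • tautMonomial A b b I := by
  simp only [map_sum, map_smul, clToTaut_clMonomial]

theorem eq_sum_clMonomial (P : MvPowerSeries (Fin n) R₀) (x : Cl b P) :
    ∃ c : Finset (Fin n) → MvPowerSeries (Fin n) R₀, x = ∑ I, c I • clMonomial b P b I := by
  refine ⟨fun I => (clBasis b P b).repr x I, ?_⟩
  conv_lhs => rw [← (clBasis b P b).sum_repr x]
  simp only [clBasis_apply]

/-- The comparison map is multiplicative on cocycles, up to coboundaries. -/
theorem clToTaut_mul_sub_mem {x y : Cl b (discPotential A b)} (hx : dCl b _ x = 0)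
    (hy : dCl b _ y = 0) :
    clToTaut A b (x * y) - mulTaut A b (clToTaut A b x) (clToTaut A b y) ∈
      coboundaries ⊤ (dTaut A b) := by
  obtain ⟨c, hc⟩ := eq_sum_clMonomial b _ y
  have h1 : linW (wordCl b (discPotential A b)) (combW b c) = y := by
    rw [linW_wordCl_combW, hc]
  have h2 : linW (wordTaut A b) (combW b c) = clToTaut A b y := by
    rw [linW_wordTaut_combW, hc, clToTaut_sum_clMonomial]
  have h := clToTaut_mul_linW_sub_mem A b (dWord_combW_of_cl b b (by rw [h1, hy])) hx
  rwa [h1, h2] at h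

theorem dCl_symm_clToTaut (a : ExtSeries R₀ V n) :
    dCl b _ ((clToTaut A b).symm a) = (clToTaut A b).symm (dTaut A b a) := by
  rw [LinearEquiv.eq_symm_apply, clToTaut_dCl, LinearEquiv.apply_symm_apply]

theorem symm_clToTaut_mem_coboundaries (a : ExtSeries R₀ V n) :
    (clToTaut A b).symm a ∈ coboundaries ⊤ (dCl b (discPotential A b)) ↔
      a ∈ coboundaries ⊤ (dTaut A b) := by
  rw [mem_coboundaries_top, mem_coboundaries_top]
  constructor
  · rintro ⟨y, hy⟩
    exact ⟨clToTaut A b y, by rw [← clToTaut_dCl, hy, LinearEquiv.apply_symm_apply]⟩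
  · rintro ⟨y, rfl⟩
    exact ⟨(clToTaut A b).symm y, dCl_symm_clToTaut A b y⟩

/-- The inverse of the comparison map induces an isomorphism of algebras in cohomology. -/
theorem exists_symm_clToTaut_algEquiv
    (hv : IsCohomologyAlgebra ⊤ (dTaut A b) (mulTaut A b) (const n 1)) :
    ∃ Ψ : CohomologyAlgebra hv ≃ₐ[MvPowerSeries (Fin n) R₀]
        CohomologyAlgebra (isCohomologyAlgebra_dCl b (discPotential A b)),
      ∀ a (ha : a ∈ cocycles ⊤ (dTaut A b)),
        ∃ h : (clToTaut A b).symm a ∈ cocycles ⊤ (dCl b (discPotential A b)),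
          Ψ (CohomologyAlgebra.cls hv a ha) =
            CohomologyAlgebra.cls (isCohomologyAlgebra_dCl b (discPotential A b)) _ h := by
  have hcoc : ∀ a ∈ cocycles ⊤ (dTaut A b),
      (clToTaut A b).symm a ∈ cocycles ⊤ (dCl b (discPotential A b)) := by
    intro a ha
    rw [mem_cocycles_top] at ha ⊢
    rw [dCl_symm_clToTaut, ha, map_zero]
  obtain ⟨Ψ, hΨ⟩ := exists_cohomology_ringEquiv hv
    (isCohomologyAlgebra_dCl b (discPotential A b)) (clToTaut A b).symm
    (fun x _ y _ => map_add _ x y) hcoc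
    (fun x hx y hy => by
      have h := clToTaut_mul_sub_mem A b (mem_cocycles_top.1 (hcoc x hx))
        (mem_cocycles_top.1 (hcoc y hy))
      rw [LinearEquiv.apply_symm_apply, LinearEquiv.apply_symm_apply,
        ← symm_clToTaut_mem_coboundaries, map_sub, LinearEquiv.symm_apply_apply] at h
      rw [← neg_sub]
      exact neg_mem h)
    (fun x _ => symm_clToTaut_mem_coboundaries A b x)
    (fun y hy => ⟨clToTaut A b y, by
      rw [mem_cocycles_top] at hy ⊢
      rw [← clToTaut_dCl, hy, map_zero], by
      rw [LinearEquiv.symm_apply_apply, sub_self]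
      exact zero_mem _⟩)
  refine ⟨AlgEquiv.ofRingEquiv (f := Ψ) fun r => ?_, hΨ⟩
  have h1 : algebraMap (MvPowerSeries (Fin n) R₀) (CohomologyAlgebra hv) r =
      CohomologyAlgebra.cls hv (r • const n 1) (Submodule.smul_mem _ r hv.one_cocycle) := by
    rw [Algebra.algebraMap_eq_smul_one]; rfl
  have h2 : algebraMap (MvPowerSeries (Fin n) R₀)
      (CohomologyAlgebra (isCohomologyAlgebra_dCl b (discPotential A b))) r =
      CohomologyAlgebra.cls (isCohomologyAlgebra_dCl b (discPotential A b)) (r • 1)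
        (Submodule.smul_mem _ r (isCohomologyAlgebra_dCl b (discPotential A b)).one_cocycle) := by
    rw [Algebra.algebraMap_eq_smul_one]; rfl
  obtain ⟨h3, h4⟩ := hΨ _ (Submodule.smul_mem _ r hv.one_cocycle)
  rw [h1, h2, h4]
  refine CohomologyAlgebra.cls_eq _ _ _ ?_
  rw [map_smul, ← clToTaut_one A b, LinearEquiv.symm_apply_apply, sub_self]
  exact zero_mem _

/-- A combination of monomials in another basis is compared with the combination of monomials in the
Clifford algebra with the same coefficients. -/
theorem symm_clToTaut_sum_tautMonomial_sub_mem (w : Module.Basis (Fin n) R₀ V)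
    {c : Finset (Fin n) → MvPowerSeries (Fin n) R₀}
    (h : dTaut A b (∑ I, c I • tautMonomial A b w I) = 0) :
    dCl b (discPotential A b) (∑ I, c I • clMonomial b (discPotential A b) w I) = 0 ∧
      (clToTaut A b).symm (∑ I, c I • tautMonomial A b w I) -
        ∑ I, c I • clMonomial b (discPotential A b) w I ∈
          coboundaries ⊤ (dCl b (discPotential A b)) := by
  rw [← linW_wordTaut_combW] at h ⊢
  rw [← linW_wordCl_combW]
  have ht := dWord_combW_of_taut A b w h
  refine ⟨by rw [dCl_linW, ht, map_zero], ?_⟩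
  have h1 := clToTaut_mul_linW_sub_mem A b ht (dCl_one b _)
  rw [one_mul, clToTaut_one, one_mulTaut, ← symm_clToTaut_mem_coboundaries, map_sub,
    LinearEquiv.symm_apply_apply] at h1
  rw [← neg_sub]
  exact neg_mem h1

/-! #### The comparison map preserves the grading -/

theorem mulTaut_const_mem_parity {p q : ZMod 2} {e e' : ExtAlg R₀ V} (he : e ∈ parityPart R₀ V p)
    (he' : e' ∈ parityPart R₀ V q) :
    mulTaut A b (const n e) (const n e') ∈ seriesIn n (parityPart R₀ V (p + q)) := by
  have h : evalTaut b (brace [(p, constOp e), (q, constOp e')] A.μ) ∈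
      seriesIn n (parityPart R₀ V (p + q)) := fun m =>
    coeffE_evalTaut_mem b (isCochain_brace_two A (isCochain_constOp he) (isCochain_constOp he')) m
  rw [evalTaut_brace_constOp A b he'] at h
  have h2 := Submodule.smul_mem _ (sgn (MvPowerSeries (Fin n) R₀) ((p - 1) * (q - 1) + q)) h
  rwa [sgn_smul_sgn_smul] at h2

theorem mulTaut_vec_mem_parity {t : ZMod 2} {a : ExtSeries R₀ V n}
    (ha : a ∈ seriesIn n (parityPart R₀ V t)) (v : V) :
    mulTaut A b a (vec n v) ∈ seriesIn n (parityPart R₀ V (t + 1)) := by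
  rw [eq_sum_coordE b a, map_sum, LinearMap.sum_apply]
  refine sum_mem fun I _ => ?_
  rw [map_smul, LinearMap.smul_apply]
  by_cases hI : (I.card : ZMod 2) = t
  · refine Submodule.smul_mem _ _ ?_
    rw [← hI]
    exact mulTaut_const_mem_parity A b (basis_mem_parityPart b I)
      (CliffordAlgebra.ι_mem_evenOdd_one _ v)
  · have h : coordE b I a = 0 := MvPowerSeries.ext fun m => by
      rw [coeff_coordE, map_zero, repr_eq_zero_of_parity b (ha m) hI]
    rw [h, zero_smul]
    exact zero_mem _

theorem tautMonomial_mem_parity (v : Fin n → V) (I : Finset (Fin n)) :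
    tautMonomial A b v I ∈ seriesIn n (parityPart R₀ V (I.card : ZMod 2)) := by
  induction I using Finset.induction_on_max with
  | empty =>
    rw [tautMonomial_empty]
    exact const_mem_seriesIn (by simpa using one_mem_parityPart)
  | insert i I hi ih =>
    rw [tautMonomial_insert A b v hi, Finset.card_insert_of_notMem fun h => lt_irrefl _ (hi i h),
      Nat.cast_add_one]
    exact mulTaut_vec_mem_parity A b ih (v i)

theorem clMonomial_mem_evenOdd (P : MvPowerSeries (Fin n) R₀) (v : Fin n → V)
    (I : Finset (Fin n)) :
    clMonomial b P v I ∈ CliffordAlgebra.evenOdd (-halfHess b P) (I.card : ZMod 2) := by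
  induction I using Finset.induction_on_max with
  | empty =>
    rw [clMonomial_empty]
    simpa using SetLike.one_mem_graded (CliffordAlgebra.evenOdd (-halfHess b P))
  | insert i I hi ih =>
    rw [clMonomial_insert b P v hi, Finset.card_insert_of_notMem fun h => lt_irrefl _ (hi i h),
      Nat.cast_add_one]
    exact SetLike.mul_mem_graded ih (CliffordAlgebra.ι_mem_evenOdd_one _ _)

theorem eq_of_sub_mem_parity {t : ZMod 2} {a c : ExtSeries R₀ V n}
    (h1 : a - c ∈ seriesIn n (parityPart R₀ V (t + 1)))
    (h2 : a - c ∈ seriesIn n (parityPart R₀ V t)) : a = c := by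
  rw [← sub_eq_zero]
  refine coeffE_ext fun m => ?_
  rw [coeffE_zero]
  have h := disjoint_parityPart (R₀ := R₀) (V := V)
  rcases zmod_two_cases t with rfl | rfl
  · exact Submodule.disjoint_def.1 h _ (h2 m) (h1 m)
  · exact Submodule.disjoint_def.1 h _ (h1 m) (h2 m)

/-- The comparison map takes monomials to the monomials of the same parity, so its inverse
preserves the grading as well. -/
theorem symm_clToTaut_mem_evenOdd {t : ZMod 2} {a : ExtSeries R₀ V n}
    (ha : a ∈ seriesIn n (parityPart R₀ V t)) :
    (clToTaut A b).symm a ∈ CliffordAlgebra.evenOdd (-halfHess b (discPotential A b)) t := by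
  obtain ⟨c, hc⟩ := eq_sum_clMonomial b _ ((clToTaut A b).symm a)
  set y : Cl b (discPotential A b) := ∑ I with (I.card : ZMod 2) = t, c I • clMonomial b _ b I
    with hy
  have hy1 : y ∈ CliffordAlgebra.evenOdd (-halfHess b (discPotential A b)) t :=
    sum_mem fun I hI => Submodule.smul_mem _ _
      ((Finset.mem_filter.1 hI).2 ▸ clMonomial_mem_evenOdd b _ b I)
  have hmem : ∀ {s : ZMod 2} {F : Finset (Finset (Fin n))}, (∀ I ∈ F, (I.card : ZMod 2) = s) →
      clToTaut A b (∑ I ∈ F, c I • clMonomial b (discPotential A b) b I) ∈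
        seriesIn n (parityPart R₀ V s) := by
    intro s F hF
    simp only [map_sum, map_smul, clToTaut_clMonomial]
    exact sum_mem fun I hI => Submodule.smul_mem _ _ (hF I hI ▸ tautMonomial_mem_parity A b b I)
  have h1 : a = clToTaut A b y + clToTaut A b
      (∑ I with ¬(I.card : ZMod 2) = t, c I • clMonomial b (discPotential A b) b I) := by
    rw [← map_add, hy, Finset.sum_filter_add_sum_filter_not, ← hc, LinearEquiv.apply_symm_apply]
  have h2 : clToTaut A b y ∈ seriesIn n (parityPart R₀ V t) :=
    hmem fun I hI => (Finset.mem_filter.1 hI).2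
  have h3 : a = clToTaut A b y := by
    refine eq_of_sub_mem_parity (t := t) ?_ (sub_mem ha h2)
    rw [sub_eq_iff_eq_add'.2 h1]
    refine hmem fun I hI => ?_
    have h4 : ∀ s t : ZMod 2, s ≠ t → s = t + 1 := by decide
    exact h4 _ _ (Finset.mem_filter.1 hI).2
  rw [h3, LinearEquiv.symm_apply_apply]
  exact hy1

theorem hochToTaut_mem_parity {φ : Ops R₀ V} (hφ : φ ∈ redCochains R₀ V) {t : ZMod 2}
    (h : ∀ s, s ≠ t → φ s = 0) : hochToTaut b φ ∈ seriesIn n (parityPart R₀ V t) := by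
  rw [mem_redCochains] at hφ
  refine sum_mem fun s _ => ?_
  by_cases hs : s = t
  · subst hs
    exact coeffE_evalTaut_mem b (hφ s).1
  · have h0 : φ s = fun _ => 0 := h s hs
    rw [h0, evalTaut_zero]
    exact zero_mem _

end Final

end SuperDef

end

theorem mainTheorem4 {R₀ V : Type*} [CommRing R₀] [AddCommGroup V] [Module R₀ V] {n : ℕ}
    (b : Module.Basis (Fin n) R₀ V) (A : SuperDef.SuperfilteredDeformation R₀ V) :
    ∃ (hHH : SuperDef.IsCohomologyAlgebra (SuperDef.redCochains R₀ V) (SuperDef.hochD A)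
        (SuperDef.cup A) (SuperDef.hochOne R₀ V))
      (hv : SuperDef.IsCohomologyAlgebra ⊤ (SuperDef.dTaut A b) (SuperDef.mulTaut A b)
        (SuperDef.const n 1))
      (Φ : SuperDef.CohomologyAlgebra hHH ≃ₐ[R₀] SuperDef.CohomologyAlgebra hv)
      (Ψ : SuperDef.CohomologyAlgebra hv ≃ₐ[MvPowerSeries (Fin n) R₀]
        SuperDef.CohomologyAlgebra
          (SuperDef.isCohomologyAlgebra_dCl b (SuperDef.discPotential A b)))
      (Θ : SuperDef.CohomologyAlgebra hHH ≃ₐ[R₀]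
        SuperDef.CohomologyAlgebra
          (SuperDef.isCohomologyAlgebra_dCl b (SuperDef.discPotential A b))),
      -- `Θ` is the composite of `Φ` and `Ψ`
      (∀ x, Θ x = Ψ (Φ x)) ∧
      -- `Φ` is induced by `φ ↦ ∑ φ^k(v, …, v)`
      (∀ φ (hφ : φ ∈ SuperDef.cocycles (SuperDef.redCochains R₀ V) (SuperDef.hochD A)),
        ∃ h : SuperDef.hochToTaut b φ ∈ SuperDef.cocycles ⊤ (SuperDef.dTaut A b),
          Φ (SuperDef.CohomologyAlgebra.cls hHH φ hφ) =
            SuperDef.CohomologyAlgebra.cls hv (SuperDef.hochToTaut b φ) h) ∧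
      -- `Ψ` is induced by `∑ c_I v_I ↦ ∑ c_I v_I` for every basis of `V`
      (∀ (v : Module.Basis (Fin n) R₀ V) (c : Finset (Fin n) → MvPowerSeries (Fin n) R₀)
        (hc : ∑ I, c I • SuperDef.tautMonomial A b v I ∈
          SuperDef.cocycles ⊤ (SuperDef.dTaut A b)),
        ∃ h : ∑ I, c I • SuperDef.clMonomial b (SuperDef.discPotential A b) v I ∈
            SuperDef.cocycles ⊤ (SuperDef.dCl b (SuperDef.discPotential A b)),
          Ψ (SuperDef.CohomologyAlgebra.cls hv _ hc) =
            SuperDef.CohomologyAlgebra.cls _ _ h) ∧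
      -- `Θ` respects the `ℤ/2`-gradings
      (∀ (t : ZMod 2) (φ)
        (hφ : φ ∈ SuperDef.cocycles (SuperDef.redCochains R₀ V) (SuperDef.hochD A)),
        (∀ s, s ≠ t → φ s = 0) →
        ∃ (a : SuperDef.Cl b (SuperDef.discPotential A b))
          (ha : a ∈ SuperDef.cocycles ⊤ (SuperDef.dCl b (SuperDef.discPotential A b))),
          a ∈ CliffordAlgebra.evenOdd _ t ∧
          Θ (SuperDef.CohomologyAlgebra.cls hHH φ hφ) =
            SuperDef.CohomologyAlgebra.cls _ a ha) := by

  have hv := SuperDef.isCohomologyAlgebra_dTaut A b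
  have hHH := SuperDef.isCohomologyAlgebra_hochD A b
  obtain ⟨Φ, hΦ⟩ := SuperDef.exists_hochToTaut_algEquiv A b hHH hv
  obtain ⟨Ψ, hΨ⟩ := SuperDef.exists_symm_clToTaut_algEquiv A b hv
  refine ⟨hHH, hv, Φ, Ψ, Φ.trans (Ψ.restrictScalars R₀), fun x => rfl, hΦ, ?_, ?_⟩
  · intro v c hc
    obtain ⟨h1, h2⟩ := SuperDef.symm_clToTaut_sum_tautMonomial_sub_mem A b v
      (SuperDef.mem_cocycles_top.1 hc)
    obtain ⟨h3, h4⟩ := hΨ _ hc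
    exact ⟨SuperDef.mem_cocycles_top.2 h1, h4.trans (SuperDef.CohomologyAlgebra.cls_eq _ _ _ h2)⟩
  · intro t φ hφ ht
    obtain ⟨h1, h2⟩ := hΦ φ hφ
    obtain ⟨h3, h4⟩ := hΨ _ h1
    exact ⟨_, h3, SuperDef.symm_clToTaut_mem_evenOdd A b
      (SuperDef.hochToTaut_mem_parity b hφ.1 ht), (congrArg Ψ h2).trans h4⟩
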